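/- Let $G$ be a compact Lie group with Lie algebra $\mathfrak g$ carrying an $\mathrm{Ad}$-invariant inner product, and let $\mathbf V$ be a finite-dimensional real inner product space with a (smooth) orthogonal representation of $G$; write $h\phi$ for the derived action of $h\in\mathfrak g$ on $\phi\in\mathbf V$. Put $E=\mathfrak g^3\oplus\mathbf V$, $\mathbf T^3=\mathbf R^3/\mathbf Z^3$, and let $\mathbf B:\mathbf V\otimes\mathbf V\to\mathfrak g$ be the linear map with $\langle\mathbf B(u\otimes v),h\rangle_{\mathfrak g}=\langle u,hv\rangle_{\mathbf V}$. *Norms.* For $\alpha<0$, $|\xi|_{\mathcal C^\alpha}=\sup_{\lambda\in(0,1]}\sup_\psi\sup_x\lambda^{-\alpha}|\langle\xi,\lambda^{-3}\psi(\lambda^{-1}(\cdot-x))\rangle|$, where $\psi$ ranges over the smooth functions supported in $\{|z|\le\frac14\}$ with $|\psi|_{\mathcal C^r}\le1$, $r=-\lceil\alpha-1\rceil$; $\mathcal C^0=L^\infty$ with norm $|\cdot|_\infty$; $|\cdot|_{\mathcal C^1}$ is the sum of $|\cdot|_\infty$ and the Lipschitz seminorm. *Initial conditions.* For $X\in\mathcal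 D'(\mathbf T^3,E)$ and $t>0$ let $\mathcal P_tX=e^{t\Delta}X$ and $\mathcal N_t(X)=\mathcal P_tX\otimes\nabla\mathcal P_tX$. For $X,Y\in\mathcal D'(\mathbf T^3,E)$ put $$⦀X;Y⦀=\sup_{t\in(0,1]}t^\delta|\mathcal N_t(X)-\mathcal N_t(Y)|_{\mathcal C^\beta},\qquad \Theta(X,Y)=|X-Y|_{\mathcal C^\eta}+⦀X;Y⦀,$$ $⦀X⦀=⦀X;0⦀$, $\Theta(X)=\Theta(X,0)$, and let $\mathcal I$ be the closure of $\mathcal C^\infty(\mathbf T^3,E)$ in $\mathcal D'(\mathbf T^3,E)$ under the extended metric $\Theta$. *Parameters.* Suppose that $\eta\in(-\frac23,0]$, $\beta\in(-1,0]$, $\delta\in(0,1)$, $\hat\beta:=\beta+2(1-\delta)\in(-\frac12,0]$ and $\eta+\hat\beta>-1$. *The space $B$.* For $T>0$ let $B=B_T$ be the space of $R\in\mathcal C([0,T],\mathcal C^{\hat\beta}(\mathbf T^3,E))$ with $$|R|_B=\sup_{t\in(0,T)}\Big(|R_t|_{\mathcal C^{\hat\beta}}+t^{-\hat\beta/2}|R_t|_\infty+t^{\frac12-\frac{\hat\beta}2}|R_t|_{\mathcal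 C^1}\Big)<\infty .$$ *Claim.* There are constants $c,C>0$ and $q\in\mathbf R$ (depending only on $\eta,\beta,\delta$ and the fixed data $G$, $\mathfrak g$, $\mathbf V$) such that the following holds for every $T>0$. For each $X\in\mathcal I$ with $T<c(1+\Theta(X))^q$ there is a unique $\mathcal R(X)\in B_T$ such that 1. $(a,\phi):=\mathcal R(X)+\mathcal PX:(0,T]\to\mathcal C^\infty(\mathbf T^3,E)$ is jointly smooth on $(0,T]\times\mathbf T^3$ and solves the Yang–Mills–Higgs flow with DeTurck term $$\partial_ta=-\mathrm d_a^*F_a-\mathrm d_a\mathrm d^*a-\mathbf B(\mathrm d_a\phi\otimes\phi),\qquad \partial_t\phi=-\mathrm d_a^*\mathrm d_a\phi+(\mathrm d^*a)\phi,$$ where $(F_a)_{ij}=\partial_ia_j-\partial_ja_i+[a_i,a_j]$, $\mathrm d_a$ denotes the covariant derivative ($\partial_i+[a_i,\cdot]$ on $\mathfrak g$-valued and $\partial_i+a_i$ on $\mathbf V$-valued functions), $\mathrm d_a^*$ is its adjoint and $\mathrm d^*a=-\sum_j\partial_ja_j$; 2. the initial condition is $X$ in the sense that $\lim_{t\to0}|\mathcal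 R_t(X)|_{\mathcal C^{\hat\beta}}=0$. Moreover $|\mathcal R(X)|_B\le C(⦀X⦀+1)$ for all such $X$. Finally, $X\mapsto\mathcal R(X)\in B_T$ is locally Lipschitz continuous for $\Theta$: every $X_0\in\mathcal I$ with $T<c(1+\Theta(X_0))^q$ has a neighbourhood in $(\mathcal I,\Theta)$ on which $\mathcal R$ is defined and $|\mathcal R(X)-\mathcal R(Y)|_B\le L\,\Theta(X,Y)$ for some $L<\infty$. -/

import Mathlib

open MeasureTheory Filter Topology
open scoped ENNReal NNReal ContDiff Manifold TensorProduct

noncomputable section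

namespace YMH

/-! ### The torus, test functions and distributions -/

/-- Three-dimensional Euclidean space. Functions on the torus `ℝ³ / ℤ³` are treated as
`ℤ³`-periodic functions on this space. -/
abbrev R3 : Type := EuclideanSpace ℝ (Fin 3)

/-- The lattice vector with integer coordinates `k`. -/
def latticeVec (k : Fin 3 → ℤ) : R3 := WithLp.toLp 2 fun i => (k i : ℝ)

/-- `ℤ³`-periodicity, that is, being a function on the torus. -/
def Periodic {S : Type*} (f : R3 → S) : Prop :=
  ∀ (k : Fin 3 → ℤ) (x : R3), f (x + latticeVec k) = f x

/-- The fundamental domain `[-1/2, 1/2)³` of the torus. -/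
def cube : Set R3 := {x | ∀ i, x i ∈ Set.Ico (-(1 / 2) : ℝ) (1 / 2)}

/-- The space `C^∞(T³)` of real-valued smooth functions on the torus. -/
def Test : Submodule ℝ (R3 → ℝ) where
  carrier := {f | ContDiff ℝ ∞ f ∧ Periodic f}
  add_mem' := by
    rintro f g ⟨hf, hf'⟩ ⟨hg, hg'⟩
    exact ⟨hf.add hg, fun k x => by simp [hf' k x, hg' k x]⟩
  zero_mem' := ⟨contDiff_const, fun _ _ => rfl⟩
  smul_mem' := by
    rintro c f ⟨hf, hf'⟩
    exact ⟨hf.const_smul c, fun k x => by simp [hf' k x]⟩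

/-- The space `D'(T³, W)` of `W`-valued distributions on the torus: the linear maps
`C^∞(T³) → W` that are continuous for the Fréchet topology of `C^∞(T³)`. -/
def Dist (W : Type*) [NormedAddCommGroup W] [NormedSpace ℝ W] :
    Submodule ℝ (Test →ₗ[ℝ] W) where
  carrier := {X | ∃ (N : ℕ) (C : ℝ), ∀ (φ : Test) (M : ℝ),
    (∀ j ≤ N, ∀ x, ‖iteratedFDeriv ℝ j (φ : R3 → ℝ) x‖ ≤ M) → ‖X φ‖ ≤ C * M}
  add_mem' := by
    rintro X Y ⟨N, C, hX⟩ ⟨N', C', hY⟩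
    refine ⟨max N N', C + C', fun φ M h => ?_⟩
    have h1 := hX φ M fun j hj x => h j (hj.trans (le_max_left _ _)) x
    have h2 := hY φ M fun j hj x => h j (hj.trans (le_max_right _ _)) x
    calc ‖(X + Y) φ‖ ≤ ‖X φ‖ + ‖Y φ‖ := by
          rw [LinearMap.add_apply]; exact norm_add_le _ _
      _ ≤ (C + C') * M := by linarith
  zero_mem' := ⟨0, 0, fun φ M _ => by simp⟩
  smul_mem' := by
    rintro c X ⟨N, C, hX⟩
    refine ⟨N, ‖c‖ * C, fun φ M h => ?_⟩
    rw [LinearMap.smul_apply, norm_smul, mul_assoc]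
    exact mul_le_mul_of_nonneg_left (hX φ M h) (norm_nonneg _)

section Distributions

variable {W : Type*} [NormedAddCommGroup W] [NormedSpace ℝ W]

/-- Partial derivative of a function on the torus in the `j`-th coordinate direction. -/
def pd (j : Fin 3) (f : R3 → W) (x : R3) : W := fderiv ℝ f x (EuclideanSpace.single j 1)

theorem integrableOn_smul {f : R3 → W} (hf : IntegrableOn f cube) (φ : Test) :
    IntegrableOn (fun x => (φ : R3 → ℝ) x • f x) cube := by
  have hφ : Continuous (φ : R3 → ℝ) := φ.2.1.continuous
  have hb : ∃ C : ℝ, ∀ x ∈ cube, ‖(φ : R3 → ℝ) x‖ ≤ C := by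
    obtain ⟨C, hC⟩ := (isCompact_closedBall (0 : R3) 2).exists_bound_of_continuousOn
      hφ.continuousOn
    refine ⟨C, fun x hx => hC x ?_⟩
    rw [mem_closedBall_zero_iff, EuclideanSpace.norm_eq, Real.sqrt_le_left (by norm_num)]
    have h : ∀ i, ‖x i‖ ^ 2 ≤ 1 := fun i => by
      have := hx i
      rw [Real.norm_eq_abs, sq_abs]
      nlinarith [this.1, this.2]
    calc ∑ i, ‖x i‖ ^ 2 ≤ ∑ _i : Fin 3, (1 : ℝ) := Finset.sum_le_sum fun i _ => h i
      _ ≤ 2 ^ 2 := by norm_num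
  obtain ⟨C, hC⟩ := hb
  have hm : MeasurableSet cube := by
    have : cube = ⋂ i, (fun x : R3 => x i) ⁻¹' Set.Ico (-(1 / 2) : ℝ) (1 / 2) := by
      ext x; simp [cube]
    rw [this]
    exact MeasurableSet.iInter fun i =>
      (EuclideanSpace.proj i : R3 →L[ℝ] ℝ).continuous.measurable measurableSet_Ico
  refine Integrable.bdd_smul (C := C) hf hφ.aestronglyMeasurable ?_
  exact (ae_restrict_iff' hm).2 (Eventually.of_forall hC)

open Classical in
/-- The distribution `φ ↦ ∫_{T³} φ f` given by an integrable function `f` on the torus. -/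
def ofFun (f : R3 → W) : Dist W :=
  if hf : IntegrableOn f cube then
    ⟨{ toFun := fun φ => ∫ x in cube, (φ : R3 → ℝ) x • f x
       map_add' := fun φ ψ => by
        rw [← integral_add (integrableOn_smul hf φ) (integrableOn_smul hf ψ)]
        simp [add_smul]
       map_smul' := fun c φ => by
        rw [RingHom.id_apply, ← integral_smul]
        simp [mul_smul] },
      0, ∫ x in cube, ‖f x‖, fun φ M h => by
        have h0 : ∀ x, ‖(φ : R3 → ℝ) x‖ ≤ M := fun x => by
          simpa using h 0 le_rfl x
        calc ‖∫ x in cube, (φ : R3 → ℝ) x • f x‖ ≤ ∫ x in cube, M * ‖f x‖ := by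
              refine norm_integral_le_of_norm_le (hf.norm.const_mul M)
                (Eventually.of_forall fun x => ?_)
              rw [norm_smul]
              exact mul_le_mul_of_nonneg_right (h0 x) (norm_nonneg _)
          _ = (∫ x in cube, ‖f x‖) * M := by
              rw [integral_const_mul, mul_comm]⟩
  else 0

end Distributions

/-! ### Hölder–Besov norms -/

theorem locallyFinite_periodization {ψ : R3 → ℝ} (hs : tsupport ψ ⊆ Metric.closedBall 0 (1 / 4))
    {l : ℝ} (hl : 0 < l) (x : R3) : LocallyFinite fun k : Fin 3 → ℤ =>
      Function.support fun y : R3 => (l ^ 3)⁻¹ * ψ (l⁻¹ • (y - x + latticeVec k)) := by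
  intro y
  refine ⟨Metric.ball y 1, Metric.ball_mem_nhds _ one_pos, ?_⟩
  set M : ℤ := ⌈l + 1 + ‖y - x‖⌉
  refine Set.Finite.subset (Set.finite_Icc (fun _ => -M) (fun _ => M)) ?_
  rintro k ⟨z, hz, hzy⟩
  have h1 : l⁻¹ • (z - x + latticeVec k) ∈ Metric.closedBall (0 : R3) (1 / 4) := by
    apply hs
    apply subset_tsupport
    intro h
    apply hz
    exact mul_eq_zero_of_right _ h
  rw [mem_closedBall_zero_iff, norm_smul, norm_inv, Real.norm_of_nonneg hl.le,
    inv_mul_le_iff₀ hl] at h1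
  have h2 : ‖z - y‖ < 1 := by simpa [dist_eq_norm] using hzy
  have h3 : ‖latticeVec k‖ ≤ l + 1 + ‖y - x‖ := by
    have e : latticeVec k = (z - x + latticeVec k) - (z - y) - (y - x) := by abel
    rw [e]
    calc _ ≤ ‖z - x + latticeVec k‖ + ‖z - y‖ + ‖y - x‖ :=
          (norm_sub_le _ _).trans (add_le_add_left (norm_sub_le _ _) _)
      _ ≤ _ := by linarith
  have h4 : ∀ i, |k i| ≤ M := fun i => by
    have h5 : ‖(latticeVec k) i‖ ≤ ‖latticeVec k‖ := PiLp.norm_apply_le _ i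
    have h6 : ((|k i| : ℤ) : ℝ) ≤ l + 1 + ‖y - x‖ := by
      rw [Int.cast_abs]
      exact h5.trans h3
    exact_mod_cast h6.trans (Int.le_ceil _)
  exact ⟨fun i => (abs_le.1 (h4 i)).1, fun i => (abs_le.1 (h4 i)).2⟩

open Classical in
/-- The rescaled and recentred test function `ψ_x^l (y) = l⁻³ ψ (l⁻¹ (y - x))` on the torus, for a
smooth `ψ` with support in `{|z| ≤ 1/4}` and `0 < l ≤ 1`. The sum over the lattice makes it
periodic; at each point `y` it has at most one non-zero term. -/
def scaledTest (ψ : R3 → ℝ) (l : ℝ) (x : R3) : Test :=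
  if h : ContDiff ℝ ∞ ψ ∧ tsupport ψ ⊆ Metric.closedBall 0 (1 / 4) ∧ 0 < l then
    ⟨fun y => ∑ᶠ k : Fin 3 → ℤ, (l ^ 3)⁻¹ * ψ (l⁻¹ • (y - x + latticeVec k)), by
      constructor
      · rw [← contMDiff_iff_contDiff]
        refine contMDiff_finsum (fun k => ?_) (locallyFinite_periodization h.2.1 h.2.2 x)
        rw [contMDiff_iff_contDiff]
        exact contDiff_const.mul (h.1.comp (by fun_prop))
      · intro m y
        refine finsum_eq_of_bijective (fun k => k + m) (Equiv.addRight m).bijective fun k => ?_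
        have : latticeVec (k + m) = latticeVec m + latticeVec k := by
          ext i; simp [latticeVec, add_comm]
        rw [this, ← add_assoc]
        congr 4
        abel⟩
  else 0

/-- The set `𝓑^r` of smooth functions with support in `{|z| ≤ 1/4}` and `C^r`-norm at most `1`. -/
def bumps (r : ℕ) : Set (R3 → ℝ) :=
  {ψ | ContDiff ℝ ∞ ψ ∧ tsupport ψ ⊆ Metric.closedBall 0 (1 / 4) ∧
    ∑ j ∈ Finset.range (r + 1), ⨆ x, ‖iteratedFDeriv ℝ j ψ x‖ₑ ≤ 1}

section Norms

variable {W : Type*} [NormedAddCommGroup W] [NormedSpace ℝ W]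

/-- The `C^α`-norm of a distribution for `α < 0`. -/
def negHolderNorm (α : ℝ) (X : Dist W) : ℝ≥0∞ :=
  ⨆ l ∈ Set.Ioc (0 : ℝ) 1, ⨆ ψ ∈ bumps (-⌈α - 1⌉).toNat, ⨆ x : R3,
    ENNReal.ofReal (l ^ (-α)) * ‖X.1 (scaledTest ψ l x)‖ₑ

/-- The norm of `C⁰ = L^∞(T³, W)`, extended by `∞` to the distributions that are not given by a
bounded function. -/
def supNorm (X : Dist W) : ℝ≥0∞ :=
  ⨅ (f : R3 → W) (_ : MemLp f ∞ (volume.restrict cube)) (_ : ofFun f = X),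
    eLpNorm f ∞ (volume.restrict cube)

/-- The norm of `C^α(T³, W)` for `α ∈ (0, 1]`, the sum of the supremum norm and of the `α`-Hölder
seminorm, extended by `∞` to the distributions that are not given by a Hölder function. -/
def posHolderNorm (α : ℝ) (X : Dist W) : ℝ≥0∞ :=
  ⨅ (f : R3 → W) (_ : Periodic f) (_ : Continuous f) (_ : ofFun f = X),
    (⨆ x, ‖f x‖ₑ) + ⨆ (x : R3) (y : R3), ‖f x - f y‖ₑ / edist x y ^ α

/-- The norm of the Hölder–Besov space `C^α(T³, W)`, for `α ≤ 1`, as an extended norm on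
distributions: the space consists of the distributions for which it is finite. -/
def holderNorm (α : ℝ) (X : Dist W) : ℝ≥0∞ :=
  if α < 0 then negHolderNorm α X else if α = 0 then supNorm X else posHolderNorm α X

end Norms

/-! ### The heat semigroup and the space of initial conditions -/

/-- The test function `y ↦ cos (2π k · (x - y))`. -/
def cosTest (k : Fin 3 → ℤ) (x : R3) : Test :=
  ⟨fun y => Real.cos (2 * Real.pi * ∑ i, k i * (x i - y i)), by
    constructor
    · fun_prop
    · intro m y
      have : 2 * Real.pi * ∑ i, (k i : ℝ) * (x i - (y + latticeVec m) i) =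
          2 * Real.pi * ∑ i, (k i : ℝ) * (x i - y i) -
            ((∑ i, k i * m i : ℤ) : ℝ) * (2 * Real.pi) := by
        push_cast
        rw [Finset.mul_sum, Finset.mul_sum, Finset.sum_mul, ← Finset.sum_sub_distrib]
        refine Finset.sum_congr rfl fun i _ => ?_
        simp only [PiLp.add_apply, latticeVec]
        ring
      simp only [this]
      exact Real.cos_sub_int_mul_two_pi _ _⟩

section Heat

variable {W : Type*} [NormedAddCommGroup W] [NormedSpace ℝ W]

/-- The heat semigroup `P_t X = e^{tΔ} X` on distributions, for `t > 0`, as a function on the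
torus: the Fourier multiplier `exp (-4π² |k|² t)`, with the modes `k` and `-k` combined into
`cos (2π k · (x - y))`. -/
def heat (t : ℝ) (X : Dist W) (x : R3) : W :=
  ∑' k : Fin 3 → ℤ,
    Real.exp (-(4 * Real.pi ^ 2 * (∑ i, (k i : ℝ) ^ 2) * t)) • X.1 (cosTest k x)

end Heat

section InitialConditions

variable {W : Type*} [NormedAddCommGroup W] [InnerProductSpace ℝ W]

/-- The quadratic function `N_t(X) = P_t X ⊗ ∇ P_t X`. -/
def quad (t : ℝ) (X : Dist W) (x : R3) : W ⊗[ℝ] PiLp 2 (fun _ : Fin 3 => W) :=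
  heat t X x ⊗ₜ[ℝ] (WithLp.toLp 2 fun j => pd j (heat t X) x)

/-- The extended pseudometric `sup_{t ∈ (0, 1]} t^δ |N_t(X) - N_t(Y)|_{C^β}`. -/
def fancy (β δ : ℝ) (X Y : Dist W) : ℝ≥0∞ :=
  ⨆ t ∈ Set.Ioc (0 : ℝ) 1,
    ENNReal.ofReal (t ^ δ) * holderNorm β (ofFun fun x => quad t X x - quad t Y x)

/-- The extended metric `Θ`. -/
def theta (η β δ : ℝ) (X Y : Dist W) : ℝ≥0∞ := holderNorm η (X - Y) + fancy β δ X Y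

/-- The space `𝓘` of initial conditions: the closure of the smooth functions under `Θ`. -/
def initSpace (η β δ : ℝ) : Set (Dist W) :=
  {X | ∀ ε : ℝ≥0∞, 0 < ε → ∃ f : R3 → W, ContDiff ℝ ∞ f ∧ Periodic f ∧
    theta η β δ X (ofFun f) < ε}

end InitialConditions

/-- The exponent `β̂ = β + 2 (1 - δ)`. -/
def betaHat (β δ : ℝ) : ℝ := β + 2 * (1 - δ)

/-- The condition on the parameters `(η, β, δ)`. -/
structure Admissible (η β δ : ℝ) : Prop where
  eta_mem : η ∈ Set.Ioc (-2 / 3 : ℝ) 0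
  beta_mem : β ∈ Set.Ioc (-1 : ℝ) 0
  delta_mem : δ ∈ Set.Ioo (0 : ℝ) 1
  betaHat_mem : betaHat β δ ∈ Set.Ioc (-1 / 2 : ℝ) 0
  sum_gt : -1 < η + betaHat β δ

section Remainders

variable {W : Type*} [NormedAddCommGroup W] [NormedSpace ℝ W]

/-- The norm of the space `B`, where `b` stands for `β̂`. -/
def bNorm (b : ℝ) {T : ℝ} (R : Set.Icc (0 : ℝ) T → Dist W) : ℝ≥0∞ :=
  ⨆ (t : Set.Icc (0 : ℝ) T) (_ : (t : ℝ) ∈ Set.Ioo 0 T),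
    (holderNorm b (R t) + ENNReal.ofReal ((t : ℝ) ^ (-b / 2)) * holderNorm 0 (R t)
      + ENNReal.ofReal ((t : ℝ) ^ (1 / 2 - b / 2)) * holderNorm 1 (R t))

/-- The space `B` of continuous functions `[0, T] → C^b(T³, W)` with finite `bNorm`. -/
structure MemB (b : ℝ) {T : ℝ} (R : Set.Icc (0 : ℝ) T → Dist W) : Prop where
  mem_holder : ∀ t, holderNorm b (R t) < ⊤
  continuous : ∀ t, Tendsto (fun s => holderNorm b (R s - R t)) (𝓝 t) (𝓝 0)
  norm_lt_top : bNorm b R < ⊤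

end Remainders

/-! ### The Yang–Mills–Higgs flow with DeTurck term -/

section Flow

/- A Lie group `G` modelled on the inner product space `F`. The Lie algebra of `G` is the tangent
space at the identity, which is `F` as a vector space, and its metric is that of `F`. -/
variable {F : Type*} [NormedAddCommGroup F] [InnerProductSpace ℝ F] [FiniteDimensional ℝ F]
  (G : Type*) [Group G] [TopologicalSpace G] [ChartedSpace F G]
  {V : Type*} [NormedAddCommGroup V] [InnerProductSpace ℝ V] [FiniteDimensional ℝ V]

/-- The bracket of the Lie algebra of `G`. -/
def br (x y : F) : F :=
  Bracket.bracket (L := GroupLieAlgebra 𝓘(ℝ, F) G) (M := GroupLieAlgebra 𝓘(ℝ, F) G) x y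

variable {G}

/-- The adjoint action `Ad_g` of `G` on its Lie algebra, the derivative of `h ↦ g h g⁻¹` at the
identity. -/
def Ad (g : G) : F →L[ℝ] F := mfderiv 𝓘(ℝ, F) 𝓘(ℝ, F) (fun h : G => g * h * g⁻¹) 1

/-- The derivative representation, as a function of the Lie algebra element `h` for a fixed vector
`v`: it maps `h` to `h v`, the derivative of `g ↦ ρ(g) v` at the identity in the direction `h`. -/
def act (ρ : G →* (V ≃ₗᵢ[ℝ] V)) (v : V) : F →L[ℝ] V :=
  mfderiv 𝓘(ℝ, F) 𝓘(ℝ, V) (fun g : G => ρ g v) 1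

/-- The bilinear map `𝐁 : V × V → 𝔤` determined by `⟨𝐁(u ⊗ v), h⟩ = ⟨u, h v⟩`: for fixed `v` it is
the adjoint of `h ↦ h v`. -/
def bilB (ρ : G →* (V ≃ₗᵢ[ℝ] V)) (u v : V) : F :=
  ContinuousLinearMap.adjoint (act (F := F) ρ v) u

variable (G) in
/-- The curvature `F_a`, with components `∂_i a_j - ∂_j a_i + [a_i, a_j]`. -/
def curv (a : Fin 3 → R3 → F) (i j : Fin 3) (x : R3) : F :=
  pd i (a j) x - pd j (a i) x + br G (a i x) (a j x)

variable (G) in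
/-- The covariant derivative `d_a w` of a `𝔤`-valued function. -/
def covDeriv (a : Fin 3 → R3 → F) (w : R3 → F) (i : Fin 3) (x : R3) : F :=
  pd i w x + br G (a i x) (w x)

variable (G) in
/-- The adjoint `d_a^*` of the covariant derivative on `𝔤`-valued `2`-forms. -/
def covDivTwo (a : Fin 3 → R3 → F) (w : Fin 3 → Fin 3 → R3 → F) (i : Fin 3) (x : R3) : F :=
  -∑ j, (pd j (w j i) x + br G (a j x) (w j i x))

/-- The adjoint `d^*` of the exterior derivative on `𝔤`-valued `1`-forms. -/
def codiff (a : Fin 3 → R3 → F) (x : R3) : F := -∑ j, pd j (a j) x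

/-- The covariant derivative `d_a φ` of a `V`-valued function. -/
def covDerivV (ρ : G →* (V ≃ₗᵢ[ℝ] V)) (a : Fin 3 → R3 → F) (φ : R3 → V) (i : Fin 3) (x : R3) : V :=
  pd i φ x + act ρ (φ x) (a i x)

/-- The adjoint `d_a^*` of the covariant derivative on `V`-valued `1`-forms. -/
def covDivV (ρ : G →* (V ≃ₗᵢ[ℝ] V)) (a : Fin 3 → R3 → F) (ψ : Fin 3 → R3 → V) (x : R3) : V :=
  -∑ j, (pd j (ψ j) x + act ρ (ψ j x) (a j x))

/-- The space `E = 𝔤³ ⊕ V`. -/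
abbrev Fields (F V : Type*) : Type _ := WithLp 2 (PiLp 2 (fun _ : Fin 3 => F) × V)

/-- The component `a_i` of a function `(a, φ)` with values in `E`. -/
def gaugePart (X : R3 → Fields F V) (i : Fin 3) (x : R3) : F := (X x).fst i

/-- The component `φ` of a function `(a, φ)` with values in `E`. -/
def higgsPart (X : R3 → Fields F V) (x : R3) : V := (X x).snd

/-- The right-hand side of the YMH flow with DeTurck term,
`(-d_a^* F_a - d_a d^* a - 𝐁(d_a φ ⊗ φ), -d_a^* d_a φ + (d^* a) φ)`. -/
def flowRHS (ρ : G →* (V ≃ₗᵢ[ℝ] V)) (X : R3 → Fields F V) (x : R3) : Fields F V :=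
  let a := gaugePart X
  let φ := higgsPart X
  WithLp.toLp 2
    (WithLp.toLp 2 fun i =>
      -covDivTwo G a (curv G a) i x - covDeriv G a (codiff a) i x
        - bilB ρ (covDerivV ρ a φ i x) (φ x),
     -covDivV ρ a (covDerivV ρ a φ) x + act ρ (φ x) (codiff a x))

/-- `u : (0, T] → C^∞(T³, E)` is a solution of the YMH flow with DeTurck term. A differentiable
curve in `C^∞(T³, E)` that solves the equation is jointly smooth on `(0, T] × T³`. -/
structure IsFlow (ρ : G →* (V ≃ₗᵢ[ℝ] V)) (T : ℝ) (u : ℝ → R3 → Fields F V) : Prop where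
  smooth : ContDiffOn ℝ ∞ (fun p : ℝ × R3 => u p.1 p.2) (Set.Ioc 0 T ×ˢ Set.univ)
  periodic : ∀ t ∈ Set.Ioc 0 T, Periodic (u t)
  eqn : ∀ t ∈ Set.Ioc 0 T, ∀ x,
    HasDerivWithinAt (fun s => u s x) (flowRHS ρ (u t) x) (Set.Ioc 0 T) t

/-- `R` is in `B`, the function `R + P X : (0, T] → C^∞(T³, E)` solves the YMH flow with DeTurck
term, and the initial condition is `X` in the sense that `R_t → 0` in `C^b` as `t → 0`. -/
structure IsRemainder (ρ : G →* (V ≃ₗᵢ[ℝ] V)) (b : ℝ) {T : ℝ} (X : Dist (Fields F V))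
    (R : Set.Icc (0 : ℝ) T → Dist (Fields F V)) : Prop where
  memB : MemB b R
  flow : ∃ u : ℝ → R3 → Fields F V, IsFlow ρ T u ∧
    ∀ t : Set.Icc (0 : ℝ) T, 0 < (t : ℝ) → R t + ofFun (heat t X) = ofFun (u t)
  init : Tendsto (fun t : Set.Icc (0 : ℝ) T => holderNorm b (R t))
    (comap Subtype.val (𝓝[>] (0 : ℝ))) (𝓝 0)

end Flow

end YMH

end

/-! Write the solution as u = PX + R. The DeTurck term turns the flow into ∂ₜu = Δu + Q(u, ∇u) +
C(u), with Q bilinear and C cubic (`exists_semilinear_form`); beyond that form nothing about the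
group is used. Subtracting the heat flow, R has to be the Duhamel integral of Q(PX, ∇PX) plus the
terms Q(R, ∇R), Q(R, ∇PX), Q(PX, ∇R) and C(PX + R), collected in `restN`.

The first force cannot be estimated from the C^η norm of X, but it is a fixed linear image of
N_t(X), so it has size s^{-δ} in C^β by the definition of ⦀X⦀ (`exists_HB_heatQ`). Its Duhamel
integral is bounded by ⦀X⦀ in the norm of B with b = β + 2(1 - δ) (`wb_duhP_of_HB`, `HB.duh`). With
the weights t^{b/2} for R, t^{η/2} for PX and an extra t^{-1/2} for gradients, every other term is
bounded pointwise by s^{-γ} for some γ < 1, and this is what the conditions on the parameters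
provide (`exps_of_admissible`, `norm_restN_sub_le`). Integrating in time gains T^{1-γ}, so for T
below a negative power of 1 + Θ(X) the Picard iterates converge (`exists_fixed`), and the same
estimate gives Lipschitz dependence (`Fixed.lipschitz`). Since the rest contributes at most a
constant, the bound on R involves only ⦀X⦀ + 1.

Uniqueness must hold in all of B, without a smallness condition on the size of the solution; there
the contraction comes from an exponential weight in time (`Fixed.unique`). A classical solution with
the right initial condition is a fixed point: Duhamel's formula holds between times s < t, and as s
→ 0 the boundary term is smoothed away by the heat flow because R_s → 0 in C^b
(`Setup.fixed_of_classical`).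

Conversely a fixed point is a mild solution (`Fixed.mild`) and is smooth. Its gradient is Hölder
continuous of exponent 1/2, hence so is the nonlinearity, hence second derivatives exist
(`Mild.exists_second`); then the pair (u, ∇u) is again a mild solution of an equation of the same
type (`Mild.jet`), and induction gives all derivatives (`contDiffOn_mild`). The fixed point is built
on (0, 2T], so that T is an interior time.

That R_t → 0 in C^b is where the closure of the smooth functions matters: the leading term is merely
bounded for X of finite norm, but it is small after subtracting a smooth approximation, whose own
contribution is O(t) (`Setup.tendsto_holderNorm_fixed`).

The linear analysis is done with Gaussian averages on ℝ³. They agree with the Fourier definition of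
the heat flow by Poisson summation (`heat_ofFun`). Negative Hölder norms enter because an average
against a Schwartz function is a superposition of averages against bumps
(`norm_integral_schwartz_le`), so P_t maps C^α to L^∞ with norm of order t^{α/2}. -/

namespace YMH

/-! ### The Gaussian kernel -/

/-- The heat kernel at time one. -/
noncomputable def gk (z : R3) : ℝ := ((4 * Real.pi) ^ (3 / 2 : ℝ))⁻¹ * Real.exp (-(1 / 4) * ‖z‖ ^ 2)

theorem gk_nonneg (z : R3) : 0 ≤ gk z := by unfold gk; positivity

theorem contDiff_gk : ContDiff ℝ ∞ gk := by
  unfold gk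
  exact contDiff_const.mul (Real.contDiff_exp.comp (contDiff_const.mul (contDiff_norm_sq ℝ)))

theorem integral_gk : ∫ z, gk z = 1 := by
  unfold gk
  rw [integral_const_mul, GaussianFourier.integral_rexp_neg_mul_sq_norm (by norm_num)]
  have : Module.finrank ℝ R3 = 3 := by simp
  rw [this, show Real.pi / (1 / 4 : ℝ) = 4 * Real.pi by ring]
  push_cast
  exact inv_mul_cancel₀ (by positivity)

/-- A quadratic has a linear first derivative, a constant second one and no further ones. The form
`D ^ i` of the bound is what the estimate for iterated derivatives of a composition asks of the
inner function. -/
theorem norm_iteratedFDeriv_quadratic_le (i : ℕ) (hi : 1 ≤ i) (x : R3) :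
    ‖iteratedFDeriv ℝ i (fun z : R3 => -(1 / 4 : ℝ) * ‖z‖ ^ 2) x‖ ≤ (1 + ‖x‖) ^ i := by
  have h1 : fderiv ℝ (fun z : R3 => -(1 / 4 : ℝ) * ‖z‖ ^ 2) =
      fun z => (-(1 / 2 : ℝ)) • (innerSL ℝ z) := by
    ext z v
    rw [fderiv_const_mul ((contDiff_norm_sq ℝ (n := 1)).differentiable (by simp) z),
      fderiv_norm_sq]
    simp; ring
  obtain ⟨j, rfl⟩ : ∃ j, i = j + 1 := ⟨i - 1, by omega⟩
  rw [← norm_iteratedFDeriv_fderiv, h1]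
  have hl : (fun z : R3 => (-(1 / 2 : ℝ)) • (innerSL ℝ z)) =
      ⇑((-(1 / 2 : ℝ)) • (innerSL ℝ : R3 →L[ℝ] R3 →L[ℝ] ℝ)) := by ext; simp
  rw [hl]
  rcases j with _ | _ | j
  · rw [norm_iteratedFDeriv_zero]
    simp only [_root_.smul_apply, norm_smul, innerSL_apply_norm]
    norm_num
    linarith [norm_nonneg x]
  · rw [← norm_iteratedFDeriv_fderiv, norm_iteratedFDeriv_zero, ContinuousLinearMap.fderiv,
      norm_smul]
    have : ‖(innerSL ℝ : R3 →L[ℝ] R3 →L[ℝ] ℝ)‖ ≤ 1 :=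
      ContinuousLinearMap.opNorm_le_bound _ zero_le_one fun v => by
        rw [innerSL_apply_norm, one_mul]
    have h3 : (1 : ℝ) ≤ (1 + ‖x‖) ^ (0 + 1 + 1) := one_le_pow₀ (by linarith [norm_nonneg x])
    have h4 : ‖(-(1 / 2) : ℝ)‖ = 1 / 2 := by norm_num
    rw [h4]
    exact (mul_le_mul_of_nonneg_left this (by norm_num)).trans
      ((by norm_num : (1 / 2 : ℝ) * 1 ≤ 1).trans h3)
  · have : iteratedFDeriv ℝ (j + 1 + 1)
        (⇑((-(1 / 2 : ℝ)) • (innerSL ℝ : R3 →L[ℝ] R3 →L[ℝ] ℝ))) x = 0 := by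
      rw [← norm_eq_zero, ← norm_iteratedFDeriv_fderiv]
      have : fderiv ℝ (⇑((-(1 / 2 : ℝ)) • (innerSL ℝ : R3 →L[ℝ] R3 →L[ℝ] ℝ))) =
          fun _ => (-(1 / 2 : ℝ)) • (innerSL ℝ : R3 →L[ℝ] R3 →L[ℝ] ℝ) := by
        ext1 z; exact ContinuousLinearMap.fderiv _
      rw [this, iteratedFDeriv_const_of_ne (by omega)]
      simp
    rw [this, norm_zero]
    positivity

/-- The Gaussian kernel as a Schwartz function. -/
noncomputable def gkS : SchwartzMap R3 ℝ where
  toFun := gk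
  smooth' := contDiff_gk
  decay' := by
    intro k n
    have hb : ∃ C : ℝ, ∀ r : ℝ, 0 ≤ r → (1 + r) ^ (k + n) * Real.exp (-(1 / 4) * r ^ 2) ≤ C := by
      have hb : ∃ C, ∀ r : ℝ, 0 ≤ r → r ^ (k + n) * Real.exp (-r) ≤ C := by
        refine ⟨(k + n).factorial, fun r hr => ?_⟩
        rw [Real.exp_neg, ← div_eq_mul_inv, div_le_iff₀ (Real.exp_pos _)]
        have := Real.pow_div_factorial_le_exp r hr (k + n)
        rwa [div_le_iff₀' (by positivity)] at this
      obtain ⟨C, hC⟩ := hb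
      refine ⟨C * Real.exp 2, fun r hr => ?_⟩
      -- Since (r - 2)² ≥ 0, the exponent -r²/4 is at most 2 - (1 + r), so exponential decay
      -- suffices.
      have h2 : Real.exp (-(1 / 4) * r ^ 2) ≤ Real.exp (-(1 + r)) * Real.exp 2 := by
        rw [← Real.exp_add]
        apply Real.exp_le_exp.2
        nlinarith [sq_nonneg (r - 2)]
      calc _ ≤ (1 + r) ^ (k + n) * (Real.exp (-(1 + r)) * Real.exp 2) := by gcongr
        _ = ((1 + r) ^ (k + n) * Real.exp (-(1 + r))) * Real.exp 2 := by ring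
        _ ≤ _ := by gcongr; exact hC _ (by linarith)
    obtain ⟨C, hC⟩ := hb
    refine ⟨((4 * Real.pi) ^ (3 / 2 : ℝ))⁻¹ * (n.factorial * C), fun x => ?_⟩
    have h1 : ‖iteratedFDeriv ℝ n (Real.exp ∘ fun z : R3 => -(1 / 4 : ℝ) * ‖z‖ ^ 2) x‖ ≤
        n.factorial * Real.exp (-(1 / 4) * ‖x‖ ^ 2) * (1 + ‖x‖) ^ n := by
      refine norm_iteratedFDeriv_comp_le (N := ∞) Real.contDiff_exp
        (contDiff_const.mul (contDiff_norm_sq ℝ)) (by exact_mod_cast le_top) x (fun i _ => ?_)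
        (fun i hi _ => norm_iteratedFDeriv_quadratic_le i hi x)
      rw [norm_iteratedFDeriv_eq_norm_iteratedDeriv, iteratedDeriv_eq_iterate, Real.iter_deriv_exp,
        Real.norm_of_nonneg (Real.exp_pos _).le]
    have h2 : gk = ((4 * Real.pi) ^ (3 / 2 : ℝ))⁻¹ •
        (Real.exp ∘ fun z : R3 => -(1 / 4 : ℝ) * ‖z‖ ^ 2) := by
      ext z; simp [gk]
    have hsm : ContDiff ℝ ∞ (Real.exp ∘ fun z : R3 => -(1 / 4 : ℝ) * ‖z‖ ^ 2) :=
      Real.contDiff_exp.comp (contDiff_const.mul (contDiff_norm_sq ℝ))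
    rw [h2, iteratedFDeriv_const_smul_apply (hsm.contDiffAt.of_le (by exact_mod_cast le_top)),
      norm_smul, Real.norm_of_nonneg (by positivity)]
    have h3 := hC ‖x‖ (norm_nonneg x)
    calc _ ≤ ‖x‖ ^ k * (((4 * Real.pi) ^ (3 / 2 : ℝ))⁻¹ *
          (n.factorial * Real.exp (-(1 / 4) * ‖x‖ ^ 2) * (1 + ‖x‖) ^ n)) := by gcongr
      _ ≤ (1 + ‖x‖) ^ k * (((4 * Real.pi) ^ (3 / 2 : ℝ))⁻¹ *
          (n.factorial * Real.exp (-(1 / 4) * ‖x‖ ^ 2) * (1 + ‖x‖) ^ n)) := by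
            gcongr; linarith
      _ = ((4 * Real.pi) ^ (3 / 2 : ℝ))⁻¹ * (n.factorial *
          ((1 + ‖x‖) ^ (k + n) * Real.exp (-(1 / 4) * ‖x‖ ^ 2))) := by ring
      _ ≤ _ := by gcongr

@[simp] theorem coe_gkS : (gkS : R3 → ℝ) = gk := rfl

theorem integrable_gk : Integrable gk := gkS.integrable

theorem integrable_norm_mul_gk : Integrable fun z : R3 => ‖z‖ * gk z := by
  have := gkS.integrable_pow_mul volume 1
  simpa [abs_of_nonneg (gk_nonneg _)] using this

theorem integrable_fderiv_gk : Integrable (fderiv ℝ gk) :=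
  (SchwartzMap.fderivCLM ℝ R3 ℝ gkS).integrable

theorem continuous_gk : Continuous gk := contDiff_gk.continuous

theorem continuous_fderiv_gk : Continuous (fderiv ℝ gk) :=
  contDiff_gk.continuous_fderiv (by simp)

theorem fderiv_gk (z v : R3) : fderiv ℝ gk z v = -(1 / 2) * inner ℝ z v * gk z := by
  have h : HasFDerivAt gk (((4 * Real.pi) ^ (3 / 2 : ℝ))⁻¹ • (Real.exp (-(1 / 4) * ‖z‖ ^ 2) •
      ((-(1 / 4) : ℝ) • (2 • (innerSL ℝ z))))) z := by
    unfold gk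
    exact (((hasStrictFDerivAt_norm_sq z).hasFDerivAt.const_mul _).exp).const_mul _
  rw [h.fderiv]
  simp [gk]
  ring

end YMH

/-! ### Gaussian averages of bounded continuous functions. -/

namespace YMH

/-- The exponent 4 exceeds the dimension 3, so the bound is integrable. The constant is increased by
one only to be positive. -/
theorem schwartz_decay {E : Type*} [NormedAddCommGroup E] [NormedSpace ℝ E] (g : SchwartzMap R3 E)
    (n : ℕ) : ∃ C : ℝ, 0 < C ∧ ∀ w, ‖iteratedFDeriv ℝ n g w‖ ≤ C * (1 + ‖w‖) ^ (-4 : ℝ) := by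
  set C := 2 ^ 4 * ((Finset.Iic (4, n)).sup fun m => SchwartzMap.seminorm ℝ m.1 m.2) g
  have hC : 0 ≤ C := by positivity
  refine ⟨C + 1, by positivity, fun w => ?_⟩
  have h := SchwartzMap.one_add_le_sup_seminorm_apply (𝕜 := ℝ) (m := (4, n)) (k := 4) (n := n)
    le_rfl le_rfl g w
  have hp : 0 < 1 + ‖w‖ := by positivity
  rw [Real.rpow_neg hp.le, ← div_eq_mul_inv, le_div_iff₀ (by positivity)]
  have : (1 + ‖w‖) ^ (4 : ℝ) = (1 + ‖w‖) ^ 4 := by exact_mod_cast Real.rpow_natCast _ 4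
  rw [this, mul_comm]
  exact h.trans (le_add_of_nonneg_right zero_le_one)

theorem integrable_decay : Integrable fun w : R3 => (1 + ‖w‖) ^ (-4 : ℝ) :=
  integrable_one_add_norm (by simp; norm_num)

section

variable {W : Type*} [NormedAddCommGroup W] [NormedSpace ℝ W]
  {W' : Type*} [NormedAddCommGroup W'] [NormedSpace ℝ W']

/-- The heat semigroup on bounded continuous functions, as a Gaussian average. -/
noncomputable def hs (t : ℝ) (f : R3 → W) (x : R3) : W := ∫ w, gk w • f (x + √t • w)

/-- The gradient of `hs t f`. -/
noncomputable def dhs (t : ℝ) (f : R3 → W) (x : R3) : R3 →L[ℝ] W :=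
  -(√t)⁻¹ • ∫ w, (fderiv ℝ gk w).smulRight (f (x + √t • w))

/-- The `L¹`-norm of the gradient of the Gaussian kernel. -/
noncomputable def gradConst : ℝ := ∫ w, ‖fderiv ℝ gk w‖

theorem gradConst_nonneg : 0 ≤ gradConst := integral_nonneg fun _ => norm_nonneg _

theorem integrable_hs {f : R3 → W} (hf : Continuous f) {M : ℝ} (hM : ∀ x, ‖f x‖ ≤ M) (l : ℝ)
    (x : R3) : Integrable fun w => gk w • f (x + l • w) :=
  integrable_gk.smul_bdd M (by fun_prop) (Eventually.of_forall fun w => hM _)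

theorem integrable_dhs {f : R3 → W} (hf : Continuous f) {M : ℝ} (hM : ∀ x, ‖f x‖ ≤ M) (l : ℝ)
    (x : R3) : Integrable fun w => (fderiv ℝ gk w).smulRight (f (x + l • w)) := by
  have hc := continuous_fderiv_gk
  refine (integrable_fderiv_gk.norm.mul_const M).mono' ?_ (Eventually.of_forall fun w => ?_)
  · refine Continuous.aestronglyMeasurable ?_
    have : Continuous fun w => ContinuousLinearMap.smulRightL ℝ R3 W (fderiv ℝ gk w)
      (f (x + l • w)) := by fun_prop
    exact this
  · rw [ContinuousLinearMap.norm_smulRight_apply]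
    exact mul_le_mul_of_nonneg_left (hM _) (norm_nonneg _)

theorem norm_hs_le {f : R3 → W} {M : ℝ} (hM : ∀ x, ‖f x‖ ≤ M) (t : ℝ) (x : R3) :
    ‖hs t f x‖ ≤ M := by
  calc ‖hs t f x‖ ≤ ∫ w, gk w * M := by
        refine norm_integral_le_of_norm_le (integrable_gk.mul_const M)
          (Eventually.of_forall fun w => ?_)
        rw [norm_smul, Real.norm_of_nonneg (gk_nonneg w)]
        exact mul_le_mul_of_nonneg_left (hM _) (gk_nonneg w)
    _ = M := by rw [integral_mul_const, integral_gk, one_mul]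

theorem norm_dhs_le {f : R3 → W} {M : ℝ} (hM : ∀ x, ‖f x‖ ≤ M) (t : ℝ) (x : R3) :
    ‖dhs t f x‖ ≤ gradConst * (√t)⁻¹ * M := by
  rw [dhs, norm_smul, norm_neg, norm_inv, Real.norm_of_nonneg (Real.sqrt_nonneg t),
    mul_comm gradConst, mul_assoc]
  refine mul_le_mul_of_nonneg_left ?_ (by positivity)
  rw [gradConst, ← integral_mul_const]
  refine norm_integral_le_of_norm_le (integrable_fderiv_gk.norm.mul_const M)
    (Eventually.of_forall fun w => ?_)
  rw [ContinuousLinearMap.norm_smulRight_apply]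
  exact mul_le_mul_of_nonneg_left (hM _) (norm_nonneg _)

theorem hs_zero [CompleteSpace W] (f : R3 → W) (x : R3) : hs 0 f x = f x := by
  simp [hs, integral_smul_const, integral_gk]

theorem hs_add {f g : R3 → W} (hf : Continuous f) {M : ℝ} (hM : ∀ x, ‖f x‖ ≤ M)
    (hg : Continuous g) {M' : ℝ} (hM' : ∀ x, ‖g x‖ ≤ M') (t : ℝ) (x : R3) :
    hs t (fun y => f y + g y) x = hs t f x + hs t g x := by
  simp only [hs, smul_add]
  exact integral_add (integrable_hs hf hM _ _) (integrable_hs hg hM' _ _)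

theorem hs_sub {f g : R3 → W} (hf : Continuous f) {M : ℝ} (hM : ∀ x, ‖f x‖ ≤ M)
    (hg : Continuous g) {M' : ℝ} (hM' : ∀ x, ‖g x‖ ≤ M') (t : ℝ) (x : R3) :
    hs t (fun y => f y - g y) x = hs t f x - hs t g x := by
  simp only [hs, smul_sub]
  exact integral_sub (integrable_hs hf hM _ _) (integrable_hs hg hM' _ _)

theorem hs_smul (c : ℝ) (f : R3 → W) (t : ℝ) (x : R3) :
    hs t (fun y => c • f y) x = c • hs t f x := by
  simp only [hs, smul_comm _ c]
  exact integral_smul _ _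

theorem dhs_sub {f g : R3 → W} (hf : Continuous f) {M : ℝ} (hM : ∀ x, ‖f x‖ ≤ M)
    (hg : Continuous g) {M' : ℝ} (hM' : ∀ x, ‖g x‖ ≤ M') (t : ℝ) (x : R3) :
    dhs t (fun y => f y - g y) x = dhs t f x - dhs t g x := by
  simp only [dhs]
  rw [← smul_sub, ← integral_sub (integrable_dhs hf hM _ _) (integrable_dhs hg hM' _ _)]
  congr 2; ext w v; simp [smul_sub]

theorem hs_clm [CompleteSpace W] [CompleteSpace W'] (A : W →L[ℝ] W') {f : R3 → W}
    (hf : Continuous f) {M : ℝ} (hM : ∀ x, ‖f x‖ ≤ M) (t : ℝ) (x : R3) :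
    hs t (fun y => A (f y)) x = A (hs t f x) := by
  simp only [hs]
  rw [← A.integral_comp_comm (integrable_hs hf hM _ _)]
  simp

theorem hs_translate (f : R3 → W) (a : R3) (t : ℝ) (x : R3) :
    hs t (fun y => f (y + a)) x = hs t f (x + a) := by
  simp only [hs, add_right_comm]

/-- The base point is moved into the kernel, so that a derivative in `x` falls on the Gaussian and
`f` need only be continuous. -/
theorem hs_eq_integral_scaled {t : ℝ} (ht : 0 < t) (f : R3 → W) (x : R3) :
    hs t f x = (√t ^ 3)⁻¹ • ∫ y, gk ((√t)⁻¹ • (y - x)) • f y := by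
  have hl : 0 < √t := Real.sqrt_pos.2 ht
  have h := Measure.integral_comp_inv_smul (volume : Measure R3)
    (fun w => gk w • f (x + √t • w)) √t
  have h2 := integral_sub_right_eq_self (μ := (volume : Measure R3))
    (fun y => gk ((√t)⁻¹ • y) • f (x + √t • (√t)⁻¹ • y)) x
  have hfr : Module.finrank ℝ R3 = 3 := by simp
  rw [hfr, abs_of_pos (by positivity)] at h
  rw [h] at h2
  rw [hs, eq_inv_smul_iff₀ (by positivity), ← h2]
  refine integral_congr_ae (Eventually.of_forall fun y => ?_)
  simp [smul_smul, hl.ne']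

theorem dhs_eq_integral_scaled {t : ℝ} (ht : 0 < t) (f : R3 → W) (x : R3) :
    dhs t f x = (√t ^ 3)⁻¹ • ∫ y, (-(√t)⁻¹ • fderiv ℝ gk ((√t)⁻¹ • (y - x))).smulRight (f y) := by
  have hl : 0 < √t := Real.sqrt_pos.2 ht
  have h := Measure.integral_comp_inv_smul (volume : Measure R3)
    (fun w => (fderiv ℝ gk w).smulRight (f (x + √t • w))) √t
  have h2 := integral_sub_right_eq_self (μ := (volume : Measure R3))
    (fun y => (fderiv ℝ gk ((√t)⁻¹ • y)).smulRight (f (x + √t • (√t)⁻¹ • y))) x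
  have hfr : Module.finrank ℝ R3 = 3 := by simp
  rw [hfr, abs_of_pos (by positivity)] at h
  rw [h] at h2
  rw [dhs, eq_inv_smul_iff₀ (by positivity), smul_comm, ← h2, ← integral_smul]
  refine integral_congr_ae (Eventually.of_forall fun y => ?_)
  ext v
  simp [smul_smul, hl.ne']

/-- Differentiation under the integral with the derivative on the kernel. Base points are restricted
to a ball of radius `√t`, on which the decay of the rescaled kernel is comparable to that at `x`. -/
theorem hasFDerivAt_hs {t : ℝ} (ht : 0 < t) {f : R3 → W} (hf : Continuous f) {M : ℝ}
    (hM : ∀ x, ‖f x‖ ≤ M) (x : R3) : HasFDerivAt (hs t f) (dhs t f x) x := by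
  have hl : 0 < √t := Real.sqrt_pos.2 ht
  set l := √t with hl_def
  have hM0 : 0 ≤ M := (norm_nonneg _).trans (hM 0)
  have e : hs t f = fun x => (l ^ 3)⁻¹ • ∫ y, gk (l⁻¹ • (y - x)) • f y := by
    ext x; exact hs_eq_integral_scaled ht f x
  rw [e, dhs_eq_integral_scaled ht]
  refine HasFDerivAt.const_smul ?_ _
  obtain ⟨C, hC, hdec⟩ := schwartz_decay gkS 1
  have hdec' : ∀ w, ‖fderiv ℝ gk w‖ ≤ C * (1 + ‖w‖) ^ (-4 : ℝ) := fun w => by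
    have := hdec w
    rwa [← zero_add 1, ← norm_iteratedFDeriv_fderiv, norm_iteratedFDeriv_zero, coe_gkS] at this
  have hcont := continuous_fderiv_gk
  have : SecondCountableTopologyEither R3 (R3 →L[ℝ] W) := ⟨Or.inl inferInstance⟩
  refine hasFDerivAt_integral_of_dominated_of_fderiv_le (𝕜 := ℝ)
    (F := fun x y => gk (l⁻¹ • (y - x)) • f y)
    (F' := fun x y => (-l⁻¹ • fderiv ℝ gk (l⁻¹ • (y - x))).smulRight (f y))
    (bound := fun y => l⁻¹ * (C * (2 ^ 4 * (1 + ‖l⁻¹ • (y - x)‖) ^ (-4 : ℝ))) * M)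
    (Metric.ball_mem_nhds x hl) ?_ ?_ ?_ ?_ ?_ ?_
  · refine Eventually.of_forall fun z => Continuous.aestronglyMeasurable ?_
    have := continuous_gk
    fun_prop
  · have h1 : Integrable fun y => gk (l⁻¹ • (y - x)) :=
      (integrable_gk.comp_smul (inv_ne_zero hl.ne')).comp_sub_right x
    exact h1.smul_bdd M hf.aestronglyMeasurable (Eventually.of_forall hM)
  · refine Continuous.aestronglyMeasurable ?_
    have : Continuous fun y => ContinuousLinearMap.smulRightL ℝ R3 W
      (-l⁻¹ • fderiv ℝ gk (l⁻¹ • (y - x))) (f y) := by fun_prop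
    exact this
  · refine Eventually.of_forall fun y z hz => ?_
    rw [ContinuousLinearMap.norm_smulRight_apply, norm_smul, norm_neg, norm_inv,
      Real.norm_of_nonneg hl.le]
    -- In rescaled units the base point moves by at most one, which changes `1 + ‖·‖` by a factor of
    -- at most two.
    have h1 : (1 + ‖l⁻¹ • (y - z)‖) ^ (-4 : ℝ) ≤ 2 ^ 4 * (1 + ‖l⁻¹ • (y - x)‖) ^ (-4 : ℝ) := by
      have h2 : 1 + ‖l⁻¹ • (y - x)‖ ≤ 2 * (1 + ‖l⁻¹ • (y - z)‖) := by
        have h3 : l⁻¹ • (y - x) = l⁻¹ • (y - z) + l⁻¹ • (z - x) := by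
          rw [← smul_add]; congr 1; abel
        have h4 : ‖l⁻¹ • (z - x)‖ ≤ 1 := by
          rw [norm_smul, norm_inv, Real.norm_of_nonneg hl.le, inv_mul_le_iff₀ hl, mul_one]
          exact (mem_ball_iff_norm.1 hz).le
        have := norm_add_le (l⁻¹ • (y - z)) (l⁻¹ • (z - x))
        rw [h3]
        linarith [norm_nonneg (l⁻¹ • (y - z))]
      have h5 : (2 * (1 + ‖l⁻¹ • (y - z)‖)) ^ (-4 : ℝ) ≤ (1 + ‖l⁻¹ • (y - x)‖) ^ (-4 : ℝ) :=
        Real.rpow_le_rpow_of_nonpos (by positivity) h2 (by norm_num)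
      rw [Real.mul_rpow (by norm_num) (by positivity)] at h5
      have h6 : (2 : ℝ) ^ (-4 : ℝ) = (2 ^ 4)⁻¹ := by
        rw [Real.rpow_neg (by norm_num)]; norm_num
      rw [h6, inv_mul_le_iff₀ (by positivity)] at h5
      exact h5
    gcongr
    · exact (hdec' _).trans (by gcongr)
    · exact hM y
  · have h1 : Integrable fun y => (1 + ‖l⁻¹ • (y - x)‖) ^ (-4 : ℝ) :=
      (integrable_decay.comp_smul (inv_ne_zero hl.ne')).comp_sub_right x
    exact (((h1.const_mul _).const_mul _).const_mul _).mul_const M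
  · refine Eventually.of_forall fun y z _ => ?_
    have h1 : HasFDerivAt (fun z : R3 => l⁻¹ • (y - z)) (-l⁻¹ • ContinuousLinearMap.id ℝ R3) z := by
      have := ((hasFDerivAt_id (𝕜 := ℝ) z).const_sub y).const_smul l⁻¹
      refine this.congr_fderiv ?_
      ext v; simp
    have h2 := ((contDiff_gk.differentiable (by simp)) (l⁻¹ • (y - z))).hasFDerivAt.comp z h1
    refine (h2.smul_const (f y)).congr_fderiv ?_
    ext v; simp

theorem hasFDerivAt_hs_of_hasFDerivAt {f : R3 → W} {f' : R3 → R3 →L[ℝ] W}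
    (hf : ∀ x, HasFDerivAt f (f' x) x) (hf' : Continuous f') {M M' : ℝ} (hM : ∀ x, ‖f x‖ ≤ M)
    (hM' : ∀ x, ‖f' x‖ ≤ M') (t : ℝ) (x : R3) : HasFDerivAt (hs t f) (hs t f' x) x := by
  have hc : Continuous f := continuous_iff_continuousAt.2 fun x => (hf x).continuousAt
  refine hasFDerivAt_integral_of_dominated_of_fderiv_le (𝕜 := ℝ)
    (F := fun x w => gk w • f (x + √t • w)) (F' := fun x w => gk w • f' (x + √t • w))
    (bound := fun w => gk w * M')
    (univ_mem) ?_ ?_ ?_ ?_ ?_ ?_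
  · exact Eventually.of_forall fun z => (integrable_hs hc hM _ z).aestronglyMeasurable
  · exact integrable_hs hc hM _ x
  · exact (integrable_hs hf' hM' _ x).aestronglyMeasurable
  · refine Eventually.of_forall fun w z _ => ?_
    rw [norm_smul, Real.norm_of_nonneg (gk_nonneg w)]
    exact mul_le_mul_of_nonneg_left (hM' _) (gk_nonneg w)
  · exact integrable_gk.mul_const M'
  · refine Eventually.of_forall fun w z _ => ?_
    have := (hf (z + √t • w)).comp z ((hasFDerivAt_id (𝕜 := ℝ) z).add_const (√t • w))
    exact this.const_smul (gk w)

/-- Integration by parts, obtained without computing an integral: the derivative of `hs t f` can be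
placed on the kernel or on `f`, and it is unique. -/
theorem dhs_eq_hs {f : R3 → W} {f' : R3 → R3 →L[ℝ] W}
    (hf : ∀ x, HasFDerivAt f (f' x) x) (hf' : Continuous f') {M M' : ℝ} (hM : ∀ x, ‖f x‖ ≤ M)
    (hM' : ∀ x, ‖f' x‖ ≤ M') {t : ℝ} (ht : 0 < t) (x : R3) : dhs t f x = hs t f' x :=
  (hasFDerivAt_hs ht (continuous_iff_continuousAt.2 fun x => (hf x).continuousAt) hM x).unique
    (hasFDerivAt_hs_of_hasFDerivAt hf hf' hM hM' t x)

section Continuity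

variable {P : Type*} [TopologicalSpace P] [FirstCountableTopology P] {S : Set P} {p₀ : P}
  {τ : P → ℝ} {ξ : P → R3} {f : P → R3 → W}

theorem continuousWithinAt_comp_translate (hτ : ContinuousWithinAt τ S p₀)
    (hξ : ContinuousWithinAt ξ S p₀)
    (hf : ∀ y, ContinuousWithinAt (fun q : P × R3 => f q.1 q.2) (S ×ˢ Set.univ) (p₀, y)) (w : R3) :
    ContinuousWithinAt (fun p => f p (ξ p + √(τ p) • w)) S p₀ := by
  have h1 : ContinuousWithinAt (fun p => (p, ξ p + √(τ p) • w)) S p₀ :=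
    continuousWithinAt_id.prodMk (hξ.add ((Real.continuous_sqrt.continuousAt.comp_continuousWithinAt
      hτ).smul continuousWithinAt_const))
  exact ContinuousWithinAt.comp (g := fun q : P × R3 => f q.1 q.2) (f := fun p => (p, ξ p + √(τ p) • w)) (t := S ×ˢ Set.univ)
    (hf (ξ p₀ + √(τ p₀) • w)) h1 fun p hp => ⟨hp, Set.mem_univ _⟩

/-- Time, base point and function all depend on the parameter, as they do in the Duhamel kernels. A
bound that is uniform near `p₀` is enough for dominated convergence. -/
theorem continuousWithinAt_hs (hτ : ContinuousWithinAt τ S p₀)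
    (hξ : ContinuousWithinAt ξ S p₀)
    (hf : ∀ y, ContinuousWithinAt (fun q : P × R3 => f q.1 q.2) (S ×ˢ Set.univ) (p₀, y))
    (hc : ∀ᶠ p in 𝓝[S] p₀, Continuous (f p)) {M : ℝ} (hM : ∀ᶠ p in 𝓝[S] p₀, ∀ y, ‖f p y‖ ≤ M) :
    ContinuousWithinAt (fun p => hs (τ p) (f p) (ξ p)) S p₀ := by
  refine continuousWithinAt_of_dominated (bound := fun w => gk w * M) ?_ ?_
    (integrable_gk.mul_const M) ?_
  · filter_upwards [hc, hM] with p h1 h2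
    exact (integrable_hs h1 h2 _ _).aestronglyMeasurable
  · filter_upwards [hM] with p h2
    refine Eventually.of_forall fun w => ?_
    rw [norm_smul, Real.norm_of_nonneg (gk_nonneg w)]
    exact mul_le_mul_of_nonneg_left (h2 _) (gk_nonneg w)
  · exact Eventually.of_forall fun w =>
      (continuousWithinAt_comp_translate hτ hξ hf w).const_smul (gk w)

theorem continuousWithinAt_dhs (hτ : ContinuousWithinAt τ S p₀) (h0 : 0 < τ p₀)
    (hξ : ContinuousWithinAt ξ S p₀)
    (hf : ∀ y, ContinuousWithinAt (fun q : P × R3 => f q.1 q.2) (S ×ˢ Set.univ) (p₀, y))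
    (hc : ∀ᶠ p in 𝓝[S] p₀, Continuous (f p)) {M : ℝ} (hM : ∀ᶠ p in 𝓝[S] p₀, ∀ y, ‖f p y‖ ≤ M) :
    ContinuousWithinAt (fun p => dhs (τ p) (f p) (ξ p)) S p₀ := by
  have h1 : ContinuousWithinAt (fun p => -(√(τ p))⁻¹) S p₀ :=
    ((Real.continuous_sqrt.continuousAt.comp_continuousWithinAt hτ).inv₀
      (Real.sqrt_pos.2 h0).ne').neg
  refine h1.smul ?_
  refine continuousWithinAt_of_dominated (bound := fun w => ‖fderiv ℝ gk w‖ * M) ?_ ?_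
    (integrable_fderiv_gk.norm.mul_const M) ?_
  · filter_upwards [hc, hM] with p h1 h2
    exact (integrable_dhs h1 h2 _ _).aestronglyMeasurable
  · filter_upwards [hM] with p h2
    refine Eventually.of_forall fun w => ?_
    rw [ContinuousLinearMap.norm_smulRight_apply]
    exact mul_le_mul_of_nonneg_left (h2 _) (norm_nonneg _)
  · refine Eventually.of_forall fun w => ?_
    have := (ContinuousLinearMap.smulRightL ℝ R3 W (fderiv ℝ gk w)).continuous.continuousAt.comp_continuousWithinAt
      (continuousWithinAt_comp_translate hτ hξ hf w)
    exact this

end Continuity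

end

end YMH

/-! ### Fourier transform of the Gaussian and the heat equation for Gaussian averages. -/

namespace YMH

/-- The real part of the complex Gaussian integral at frequency `θ`, with the phase `a` carried by a
constant prefactor. -/
theorem integral_gk_mul_cos (a : ℝ) (θ : R3) :
    ∫ w, gk w * Real.cos (a + inner ℝ θ w) = Real.exp (-‖θ‖ ^ 2) * Real.cos a := by
  have h := GaussianFourier.integral_cexp_neg_mul_sq_norm_add (V := R3) (b := (1 / 4 : ℂ))
    (by norm_num) Complex.I θ
  have hi := GaussianFourier.integrable_cexp_neg_mul_sq_norm_add (V := R3) (b := (1 / 4 : ℂ))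
    (by norm_num) Complex.I θ
  set c : ℂ := (((4 * Real.pi) ^ (3 / 2 : ℝ))⁻¹ : ℝ) * Complex.exp (a * Complex.I) with hc
  have h1 : ∀ w : R3, gk w * Real.cos (a + inner ℝ θ w) =
      RCLike.re (c * Complex.exp (-(1 / 4) * (‖w‖ : ℂ) ^ 2 + Complex.I * (inner ℝ θ w : ℝ))) := by
    intro w
    have : c * Complex.exp (-(1 / 4) * (‖w‖ : ℂ) ^ 2 + Complex.I * (inner ℝ θ w : ℝ)) =
        ((gk w : ℝ) : ℂ) * Complex.exp ((a + inner ℝ θ w : ℝ) * Complex.I) := by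
      rw [hc, mul_assoc, ← Complex.exp_add, gk]
      push_cast
      rw [mul_assoc, ← Complex.exp_add]
      congr 2
      ring
    rw [this, RCLike.re_eq_complex_re, Complex.re_ofReal_mul, Complex.exp_ofReal_mul_I_re]
  simp_rw [h1]
  rw [integral_re (hi.const_mul c), integral_const_mul, h]
  have hfr : Module.finrank ℝ R3 = 3 := by simp
  rw [hfr]
  have h2 : ((Real.pi : ℂ) / (1 / 4)) ^ (((3 : ℕ) : ℂ) / 2) = (((4 * Real.pi) ^ (3 / 2 : ℝ) : ℝ) : ℂ) := by
    rw [Complex.ofReal_cpow (by positivity)]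
    push_cast
    congr 1
    ring
  rw [h2, hc]
  have h3 : (((((4 * Real.pi) ^ (3 / 2 : ℝ))⁻¹ : ℝ) : ℂ) * Complex.exp (a * Complex.I)) *
      ((((4 * Real.pi) ^ (3 / 2 : ℝ) : ℝ) : ℂ) *
        Complex.exp (Complex.I ^ 2 * (‖θ‖ : ℂ) ^ 2 / (4 * (1 / 4)))) =
      ((Real.exp (-‖θ‖ ^ 2) : ℝ) : ℂ) * Complex.exp ((a : ℝ) * Complex.I) := by
    have h0 : ((4 * Real.pi) ^ (3 / 2 : ℝ) : ℝ) ≠ 0 := by positivity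
    have h4 : (((((4 * Real.pi) ^ (3 / 2 : ℝ))⁻¹ : ℝ) : ℂ) *
      (((4 * Real.pi) ^ (3 / 2 : ℝ) : ℝ) : ℂ)) = 1 := by
      rw [← Complex.ofReal_mul, inv_mul_cancel₀ h0, Complex.ofReal_one]
    rw [mul_mul_mul_comm, h4, one_mul, mul_comm]
    congr 1
    push_cast
    congr 1
    rw [Complex.I_sq]
    ring
  rw [h3, RCLike.re_eq_complex_re, Complex.re_ofReal_mul, Complex.exp_ofReal_mul_I_re]

variable {W : Type*} [NormedAddCommGroup W] [NormedSpace ℝ W]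

/-- The Gaussian satisfies w·gk = -2∇gk, so each factor `w j` can be traded for a second derivative
of `f`. This is the term produced by differentiating `√t` in time, and it is where the Laplacian
comes from. -/
theorem integral_gk_smul_fderiv_apply [CompleteSpace W] {f : R3 → W} {f' : R3 → R3 →L[ℝ] W}
    {f'' : Fin 3 → R3 → R3 →L[ℝ] W} {K : ℝ}
    (hf : ∀ x, HasFDerivAt f (f' x) x) (hK : ∀ x, ‖f' x‖ ≤ K)
    (hd : ∀ j x, HasFDerivAt (pd j f) (f'' j x) x) (hd' : ∀ j, Continuous (f'' j)) {K' : ℝ}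
    (hK' : ∀ j x, ‖f'' j x‖ ≤ K') {t : ℝ} (ht : 0 < t) (x : R3) :
    ∫ w, gk w • f' (x + √t • w) w = (2 * √t) • hs t (fun y => ∑ j, pd j (pd j f) y) x := by
  have hl : 0 < √t := Real.sqrt_pos.2 ht
  have hpd : ∀ j y, f' y (EuclideanSpace.single j 1) = pd j f y := fun j y => by
    rw [pd, (hf y).fderiv]
  have hpdc : ∀ j, Continuous (pd j f) := fun j =>
    continuous_iff_continuousAt.2 fun y => (hd j y).continuousAt
  have hpdb : ∀ j y, ‖pd j f y‖ ≤ K := fun j y => by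
    rw [← hpd]
    refine ((f' y).le_opNorm _).trans ?_
    simpa using hK y
  have hpdd : ∀ j y, f'' j y (EuclideanSpace.single j 1) = pd j (pd j f) y := fun j y => by
    rw [pd, (hd j y).fderiv]
  have e1 : ∀ w, gk w • f' (x + √t • w) w =
      ∑ j, (-2 : ℝ) • (fderiv ℝ gk w).smulRight (pd j f (x + √t • w)) (EuclideanSpace.single j 1) := by
    intro w
    have hw : w = ∑ j, w j • EuclideanSpace.single j (1 : ℝ) := by
      have := (EuclideanSpace.basisFun (Fin 3) ℝ).sum_repr w
      simpa using this.symm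
    conv_lhs => rw [hw]
    rw [map_sum, Finset.smul_sum, ← hw]
    refine Finset.sum_congr rfl fun j _ => ?_
    rw [map_smul, hpd, ContinuousLinearMap.smulRight_apply, fderiv_gk, smul_smul, smul_smul]
    congr 1
    simp [EuclideanSpace.inner_single_right]
    ring
  simp_rw [e1]
  have hint : ∀ j ∈ Finset.univ, Integrable fun w => (-2 : ℝ) •
      (fderiv ℝ gk w).smulRight (pd j f (x + √t • w)) (EuclideanSpace.single j (1 : ℝ)) :=
    fun j _ => Integrable.smul _ ((integrable_dhs (hpdc j) (hpdb j) (√t)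
      x).apply_continuousLinearMap _)
  rw [integral_finsetSum _ hint]
  have e2 : ∀ j, ∫ w, (-2 : ℝ) • (fderiv ℝ gk w).smulRight (pd j f (x + √t • w))
      (EuclideanSpace.single j 1) = (2 * √t) • hs t (pd j (pd j f)) x := by
    intro j
    have h1 := dhs_eq_hs (hd j) (hd' j) (hpdb j) (hK' j) ht x
    have h2 : dhs t (pd j f) x (EuclideanSpace.single j 1) = hs t (pd j (pd j f)) x := by
      have h3 := hs_clm (ContinuousLinearMap.apply ℝ W (EuclideanSpace.single j (1 : ℝ))) (hd' j)
        (hK' j) t x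
      simp only [ContinuousLinearMap.apply_apply, hpdd] at h3
      rw [h1]
      exact h3.symm
    rw [← h2, dhs, integral_smul, _root_.smul_apply,
      ContinuousLinearMap.integral_apply (integrable_dhs (hpdc j) (hpdb j) (√t) x), smul_smul]
    congr 1
    field_simp
  rw [Finset.sum_congr rfl fun j _ => e2 j, ← Finset.smul_sum]
  congr 1
  simp only [hs, Finset.smul_sum]
  rw [integral_finsetSum]
  intro j _
  have : pd j (pd j f) = fun y => f'' j y (EuclideanSpace.single j 1) := by
    ext y; rw [hpdd]
  rw [this]
  have hc := hd' j
  refine integrable_hs (f := fun y => f'' j y (EuclideanSpace.single j 1)) (by fun_prop)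
    (M := K') (fun y => ?_) _ _
  refine ((f'' j y).le_opNorm _).trans ?_
  simpa using hK' j y

/-- The derivative of `s ↦ e^{(t-s)Δ} u_s` is `e^{(t-s)Δ} (∂_s u_s - Δ u_s)`. -/
theorem hasDerivAt_hs_sub [CompleteSpace W] {u : ℝ → R3 → W} {u' : ℝ → R3 → (ℝ × R3) →L[ℝ] W}
    {f'' : Fin 3 → R3 → R3 →L[ℝ] W} {t s : ℝ} (x : R3) {I : Set ℝ} (hI : I ∈ 𝓝 s) (hst : s < t)
    (hu : ∀ r ∈ I, ∀ y, HasFDerivAt (fun p : ℝ × R3 => u p.1 p.2) (u' r y) (r, y))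
    (hu' : Continuous (u' s)) {M K K' : ℝ} (hM : ∀ y, ‖u s y‖ ≤ M) (hK : ∀ r ∈ I, ∀ y, ‖u' r y‖ ≤ K)
    (hd : ∀ j y, HasFDerivAt (pd j (u s)) (f'' j y) y) (hd' : ∀ j, Continuous (f'' j))
    (hK' : ∀ j x, ‖f'' j x‖ ≤ K') :
    HasDerivAt (fun r => hs (t - r) (u r) x)
      (hs (t - s) (fun y => u' s y (1, 0) - ∑ j, pd j (pd j (u s)) y) x) s := by
  -- Staying to the left of the midpoint keeps `√(t - r)` away from zero, so its derivative is
  -- bounded.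
  set c := (s + t) / 2 with hc
  have hsc : s < c := by rw [hc]; linarith
  have hct : c < t := by rw [hc]; linarith
  have hK0 : 0 ≤ K := (norm_nonneg _).trans (hK s (mem_of_mem_nhds hI) 0)
  have hl : ∀ r < c, 0 < t - r := fun r hr => by linarith
  have hJ : I ∩ Set.Iio c ∈ 𝓝 s := inter_mem hI (Iio_mem_nhds hsc)
  have hux : ∀ r ∈ I, ∀ y, HasFDerivAt (u r) ((u' r y).comp (ContinuousLinearMap.inr ℝ ℝ R3)) y := by
    intro r hr y
    exact (hu r hr y).comp y (hasFDerivAt_prodMk_right r y)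
  have hs' := mem_of_mem_nhds hI
  have hcu : ∀ r ∈ I, Continuous (u r) := fun r hr =>
    continuous_iff_continuousAt.2 fun y => (hux r hr y).continuousAt
  have key := hasDerivAt_integral_of_dominated_loc_of_deriv_le (𝕜 := ℝ) (μ := (volume : Measure R3))
    (F := fun r w => gk w • u r (x + √(t - r) • w))
    (F' := fun r w => gk w • u' r (x + √(t - r) • w) (1, (-(2 * √(t - r))⁻¹) • w))
    (bound := fun w => K * (1 + (2 * √(t - c))⁻¹) * (gk w + ‖w‖ * gk w)) (x₀ := s) hJ ?_ ?_ ?_ ?_ ?_ ?_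
  · refine key.2.congr_deriv ?_
    have e1 : ∀ w, gk w • u' s (x + √(t - s) • w) (1, (-(2 * √(t - s))⁻¹) • w) =
        gk w • (fun y => u' s y (1, 0)) (x + √(t - s) • w) + (-(2 * √(t - s))⁻¹) • (gk w •
          ((u' s (x + √(t - s) • w)).comp (ContinuousLinearMap.inr ℝ ℝ R3)) w) := by
      intro w
      rw [smul_comm, ← smul_add]
      congr 1
      rw [← map_smul]
      simp only [ContinuousLinearMap.comp_apply, ContinuousLinearMap.inr_apply]
      rw [← map_add]
      simp
    have hb1 : ∀ y, ‖u' s y (1, 0)‖ ≤ K := fun y => by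
      refine ((u' s y).le_opNorm _).trans ?_
      simpa [Prod.norm_def] using hK s hs' y
    have hi1 := integrable_hs (f := fun y => u' s y (1, 0)) (by fun_prop) hb1 (√(t - s)) x
    have hb2 : ∀ y, ‖(u' s y).comp (ContinuousLinearMap.inr ℝ ℝ R3)‖ ≤ K := fun y => by
      refine ContinuousLinearMap.opNorm_le_bound _ hK0 fun v => ?_
      refine ((u' s y).le_opNorm _).trans ?_
      have : ‖((0 : ℝ), v)‖ = ‖v‖ := by simp [Prod.norm_def]
      change _ * ‖((0 : ℝ), v)‖ ≤ _
      rw [this]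
      exact mul_le_mul_of_nonneg_right (hK s hs' y) (norm_nonneg _)
    have hi2 : Integrable fun w => gk w •
        ((u' s (x + √(t - s) • w)).comp (ContinuousLinearMap.inr ℝ ℝ R3)) w := by
      refine (integrable_norm_mul_gk.const_mul K).mono' (Continuous.aestronglyMeasurable ?_)
        (Eventually.of_forall fun w => ?_)
      · have := continuous_gk
        fun_prop
      · rw [norm_smul, Real.norm_of_nonneg (gk_nonneg w)]
        calc _ ≤ gk w * (K * ‖w‖) := by
              gcongr
              · exact gk_nonneg w
              · exact (ContinuousLinearMap.le_opNorm _ _).trans (by gcongr; exact hb2 _)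
          _ = _ := by ring
    have hi3 : Integrable fun w => (-(2 * √(t - s))⁻¹) • (gk w •
        ((u' s (x + √(t - s) • w)).comp (ContinuousLinearMap.inr ℝ ℝ R3)) w) := hi2.smul _
    simp_rw [e1]
    rw [integral_add hi1 hi3, integral_smul,
      integral_gk_smul_fderiv_apply (hux s hs') hb2 hd hd' hK' (hl s hsc), smul_smul]
    have hne : √(t - s) ≠ 0 := (Real.sqrt_pos.2 (hl s hsc)).ne'
    -- The derivative of the square root cancels the factor `2 * √(t - s)` of the integration by
    -- parts, leaving exactly minus the Laplacian.
    have h5 : -(2 * √(t - s))⁻¹ * (2 * √(t - s)) = -1 := by field_simp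
    rw [h5, neg_one_smul, ← sub_eq_add_neg]
    have hpdd : ∀ j, pd j (pd j (u s)) = fun y => f'' j y (EuclideanSpace.single j 1) := fun j => by
      ext y; rw [pd, (hd j y).fderiv]
    rw [hs_sub (M := K) (M' := ∑ _j : Fin 3, K') (by fun_prop) hb1 ?_ ?_]
    · rfl
    · simp only [hpdd]
      fun_prop
    · intro y
      refine (norm_sum_le _ _).trans (Finset.sum_le_sum fun j _ => ?_)
      rw [hpdd]
      refine ((f'' j y).le_opNorm _).trans ?_
      simpa using hK' j y
  · filter_upwards [hI] with r hr
    have := hcu r hr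
    have := continuous_gk
    exact Continuous.aestronglyMeasurable (by fun_prop)
  · exact integrable_hs (hcu s hs') hM _ _
  · have := continuous_gk
    exact Continuous.aestronglyMeasurable (by fun_prop)
  · refine Eventually.of_forall fun w r hr => ?_
    rw [norm_smul, Real.norm_of_nonneg (gk_nonneg w)]
    have h1 : (2 * √(t - r))⁻¹ ≤ (2 * √(t - c))⁻¹ := by
      have : 0 < √(t - c) := Real.sqrt_pos.2 (by linarith)
      have : √(t - c) ≤ √(t - r) := Real.sqrt_le_sqrt (by linarith [Set.mem_Iio.1 hr.2])
      gcongr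
    have h2 : ‖((1 : ℝ), (-(2 * √(t - r))⁻¹) • w)‖ ≤ (1 + (2 * √(t - c))⁻¹) * (1 + ‖w‖) := by
      have h0 : 0 ≤ (2 * √(t - c))⁻¹ := by positivity
      rw [Prod.norm_def]
      refine max_le ?_ ?_
      · rw [norm_one]; nlinarith [norm_nonneg w]
      · rw [norm_smul, norm_neg, Real.norm_of_nonneg (by positivity)]
        have : (2 * √(t - r))⁻¹ * ‖w‖ ≤ (2 * √(t - c))⁻¹ * ‖w‖ := by gcongr
        nlinarith [norm_nonneg w]
    calc _ ≤ gk w * (K * ((1 + (2 * √(t - c))⁻¹) * (1 + ‖w‖))) := by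
          gcongr
          · exact gk_nonneg w
          · exact (ContinuousLinearMap.le_opNorm _ _).trans (by gcongr; exact hK r hr.1 _)
      _ = _ := by ring
  · exact (integrable_gk.add integrable_norm_mul_gk).const_mul _
  · refine Eventually.of_forall fun w r hr => ?_
    have h0 : 0 < t - r := hl r hr.2
    have h1 : HasDerivAt (fun r => √(t - r)) (-(2 * √(t - r))⁻¹) r := by
      have := ((hasDerivAt_id r).const_sub t).sqrt h0.ne'
      refine this.congr_deriv ?_
      simp [div_eq_mul_inv]
    have h2 : HasDerivAt (fun r => (r, x + √(t - r) • w)) (1, (-(2 * √(t - r))⁻¹) • w) r :=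
      (hasDerivAt_id r).prodMk ((h1.smul_const w).const_add x)
    have h3 := (hu r hr.1 (x + √(t - r) • w)).comp_hasDerivAt r h2
    exact h3.const_smul (gk w)

end YMH

namespace YMH

/-! ### Integration over the torus -/

theorem cube_eq : cube = (WithLp.ofLp : R3 → Fin 3 → ℝ) ⁻¹'
    (Set.univ.pi fun _ => Set.Ico (-(1 / 2) : ℝ) (1 / 2)) := by
  ext x; simp [cube]

theorem measurableSet_cube : MeasurableSet cube := by
  rw [cube_eq]
  exact (MeasurableSet.univ_pi fun _ => measurableSet_Ico).preimage
    (PiLp.volume_preserving_ofLp (Fin 3)).measurable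

theorem volume_cube : volume cube = 1 := by
  rw [cube_eq, (PiLp.volume_preserving_ofLp (Fin 3)).measure_preimage
    (MeasurableSet.univ_pi fun _ => measurableSet_Ico).nullMeasurableSet]
  rw [volume_pi_pi]
  simp
  norm_num

instance : IsProbabilityMeasure (volume.restrict cube) :=
  ⟨by rw [Measure.restrict_apply_univ, volume_cube]⟩

theorem cube_subset_closedBall : cube ⊆ Metric.closedBall 0 2 := by
  intro x hx
  rw [mem_closedBall_zero_iff, EuclideanSpace.norm_eq, Real.sqrt_le_left (by norm_num)]
  have h : ∀ i, ‖x i‖ ^ 2 ≤ 1 := fun i => by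
    have := hx i
    rw [Real.norm_eq_abs, sq_abs]
    nlinarith [this.1, this.2]
  calc ∑ i, ‖x i‖ ^ 2 ≤ ∑ _i : Fin 3, (1 : ℝ) := Finset.sum_le_sum fun i _ => h i
    _ ≤ 2 ^ 2 := by norm_num

theorem closedBall_subset_cube : Metric.closedBall (0 : R3) (1 / 4) ⊆ cube := by
  intro x hx i
  have h := (PiLp.norm_apply_le x i).trans (mem_closedBall_zero_iff.1 hx)
  rw [Real.norm_eq_abs, abs_le] at h
  exact ⟨by linarith [h.1], by linarith [h.2]⟩

/-- The lattice vector that moves a point into the cube. -/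
noncomputable def toCube (x : R3) : Fin 3 → ℤ := fun i => -⌊x i + 1 / 2⌋

theorem add_toCube_mem (x : R3) : x + latticeVec (toCube x) ∈ cube := by
  intro i
  have h1 := Int.floor_le (x i + 1 / 2)
  have h2 := Int.lt_floor_add_one (x i + 1 / 2)
  simp only [PiLp.add_apply, latticeVec, toCube]
  push_cast
  constructor <;> linarith

@[simp] theorem latticeVec_apply (k : Fin 3 → ℤ) (i : Fin 3) : latticeVec k i = k i := rfl

theorem latticeVec_add (k m : Fin 3 → ℤ) : latticeVec (k + m) = latticeVec k + latticeVec m := by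
  ext i; simp

theorem latticeVec_neg (k : Fin 3 → ℤ) : latticeVec (-k) = -latticeVec k := by
  ext i; simp

@[simp] theorem latticeVec_zero : latticeVec 0 = 0 := by
  ext i; simp

theorem eq_of_mem_cube {x : R3} (hx : x ∈ cube) {k : Fin 3 → ℤ} (hk : x + latticeVec k ∈ cube) :
    k = 0 := by
  ext i
  have h1 := hx i
  have h2 := hk i
  simp only [PiLp.add_apply, latticeVec_apply, Set.mem_Ico] at h1 h2
  have h3 : (-1 : ℝ) < k i := by linarith [h1.2, h2.1]
  have h4 : (k i : ℝ) < 1 := by linarith [h1.1, h2.2]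
  have h5 : -1 < k i := by exact_mod_cast h3
  have h6 : k i < 1 := by exact_mod_cast h4
  simp; omega

section

theorem Periodic.exists_mem_cube {S : Type*} {f : R3 → S} (hf : Periodic f) (x : R3) :
    ∃ y ∈ cube, f x = f y :=
  ⟨_, add_toCube_mem x, (hf _ x).symm⟩

variable {W : Type*} [NormedAddCommGroup W]

theorem Periodic.exists_bound {f : R3 → W} (hf : Periodic f) (hc : Continuous f) :
    ∃ M, 0 ≤ M ∧ ∀ x, ‖f x‖ ≤ M := by
  obtain ⟨C, hC⟩ := (isCompact_closedBall (0 : R3) 2).exists_bound_of_continuousOn hc.continuousOn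
  refine ⟨max C 0, le_max_right _ _, fun x => ?_⟩
  obtain ⟨y, hy, h⟩ := hf.exists_mem_cube x
  rw [h]
  exact (hC y (cube_subset_closedBall hy)).trans (le_max_left _ _)

theorem integrableOn_cube {f : R3 → W} (hc : Continuous f) : IntegrableOn f cube :=
  (hc.continuousOn.integrableOn_compact (isCompact_closedBall (0 : R3) 2)).mono_set
    cube_subset_closedBall

variable [NormedSpace ℝ W]

/-- The translates of the half-open cube by lattice vectors are a countable disjoint cover of space.
-/
theorem hasSum_integral_translates {F : R3 → W} (hF : Integrable F) :
    HasSum (fun k : Fin 3 → ℤ => ∫ x in cube, F (x + latticeVec k)) (∫ x, F x) := by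
  have hU : (⋃ k : Fin 3 → ℤ, (fun x => x - latticeVec k) ⁻¹' cube) = Set.univ := by
    refine Set.eq_univ_of_forall fun x => Set.mem_iUnion.2 ⟨-toCube x, ?_⟩
    simp only [Set.mem_preimage, latticeVec_neg, sub_neg_eq_add]
    exact add_toCube_mem x
  have h := hasSum_integral_iUnion (μ := (volume : Measure R3)) (f := F)
    (s := fun k : Fin 3 → ℤ => (fun x => x - latticeVec k) ⁻¹' cube)
    (fun k => measurableSet_cube.preimage (measurable_id.sub_const _)) ?_ (by
      rw [hU]; exact hF.integrableOn)
  · rw [hU, setIntegral_univ] at h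
    convert h using 2 with k
    have hmp := measurePreserving_sub_right (volume : Measure R3) (latticeVec k)
    have := hmp.setIntegral_preimage_emb (MeasurableEquiv.subRight (latticeVec k)).measurableEmbedding
      (fun x => F (x + latticeVec k)) cube
    rw [← this]
    simp
  · intro k m hkm
    rw [Function.onFun, Set.disjoint_left]
    intro x hx hy
    apply hkm
    have := eq_of_mem_cube (x := x - latticeVec k) hx (k := k - m) (by
      have : x - latticeVec k + latticeVec (k - m) = x - latticeVec m := by
        ext i; simp
      rw [this]; exact hy)
    exact sub_eq_zero.1 this

/-- Unfolding: integrating a periodisation over the torus is integrating over the whole space. -/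
theorem integral_cube_tsum {F : R3 → W} (hF : Integrable F) :
    ∫ x in cube, ∑' k : Fin 3 → ℤ, F (x + latticeVec k) = ∫ x, F x := by
  rw [← integral_tsum_of_summable_integral_norm, (hasSum_integral_translates hF).tsum_eq]
  · exact fun k => (hF.comp_add_right _).restrict
  · exact (hasSum_integral_translates hF.norm).summable

/-! ### Distributions given by functions -/

theorem ofFun_apply {f : R3 → W} (hf : IntegrableOn f cube) (φ : Test) :
    (ofFun f).1 φ = ∫ x in cube, (φ : R3 → ℝ) x • f x := by
  rw [ofFun, dif_pos hf]; rfl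

theorem ofFun_add {f g : R3 → W} (hf : IntegrableOn f cube) (hg : IntegrableOn g cube) :
    ofFun (fun x => f x + g x) = ofFun f + ofFun g := by
  ext φ
  have h : IntegrableOn (fun x => f x + g x) cube := hf.add hg
  change (ofFun _).1 φ = (ofFun f).1 φ + (ofFun g).1 φ
  rw [ofFun_apply h, ofFun_apply hf, ofFun_apply hg,
    ← integral_add (integrableOn_smul hf φ) (integrableOn_smul hg φ)]
  simp

theorem ofFun_sub {f g : R3 → W} (hf : IntegrableOn f cube) (hg : IntegrableOn g cube) :
    ofFun (fun x => f x - g x) = ofFun f - ofFun g := by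
  ext φ
  have h : IntegrableOn (fun x => f x - g x) cube := hf.sub hg
  change (ofFun _).1 φ = (ofFun f).1 φ - (ofFun g).1 φ
  rw [ofFun_apply h, ofFun_apply hf, ofFun_apply hg,
    ← integral_sub (integrableOn_smul hf φ) (integrableOn_smul hg φ)]
  simp [smul_sub]

theorem ofFun_zero : ofFun (fun _ => 0 : R3 → W) = 0 := by
  ext φ
  have h : IntegrableOn (fun _ => 0 : R3 → W) cube := integrableOn_zero
  change (ofFun _).1 φ = 0
  rw [ofFun_apply h]
  simp

theorem finite_latticeVec (R : ℝ) : {k : Fin 3 → ℤ | ‖latticeVec k‖ ≤ R}.Finite := by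
  refine Set.Finite.subset (Set.finite_Icc (fun _ => -⌈R⌉) (fun _ => ⌈R⌉)) fun k hk => ?_
  have h4 : ∀ i, |k i| ≤ ⌈R⌉ := fun i => by
    have h5 : ‖(latticeVec k) i‖ ≤ ‖latticeVec k‖ := PiLp.norm_apply_le _ i
    have h6 : ((|k i| : ℤ) : ℝ) ≤ R := by
      rw [Int.cast_abs]
      exact h5.trans hk
    exact_mod_cast h6.trans (Int.le_ceil _)
  exact ⟨fun i => (abs_le.1 (h4 i)).1, fun i => (abs_le.1 (h4 i)).2⟩

theorem scaledTest_apply {ψ : R3 → ℝ} (h1 : ContDiff ℝ ∞ ψ)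
    (h2 : tsupport ψ ⊆ Metric.closedBall 0 (1 / 4)) {l : ℝ} (hl : 0 < l) (x y : R3) :
    (scaledTest ψ l x : R3 → ℝ) y =
      ∑' k : Fin 3 → ℤ, (l ^ 3)⁻¹ * ψ (l⁻¹ • (y - x + latticeVec k)) := by
  rw [scaledTest, dif_pos ⟨h1, h2, hl⟩, tsum_eq_finsum]
  exact (locallyFinite_periodization h2 hl x).point_finite y

/-- Unfolding the periodised test function. From here on, tests of a function are ordinary integrals
over ℝ³ and the torus is present only through periodicity. -/
theorem ofFun_scaledTest' {f : R3 → W} (hf : LocallyIntegrable f) (hp : Periodic f) {ψ : R3 → ℝ}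
    (h1 : ContDiff ℝ ∞ ψ) (h2 : tsupport ψ ⊆ Metric.closedBall 0 (1 / 4)) {l : ℝ} (hl : 0 < l)
    (x : R3) : (ofFun f).1 (scaledTest ψ l x) = ∫ w, ψ w • f (x + l • w) := by
  have hcs : HasCompactSupport ψ := HasCompactSupport.of_support_subset_isCompact
    (isCompact_closedBall (0 : R3) (1 / 4)) ((subset_tsupport _).trans h2)
  set F : R3 → W := fun y => ((l ^ 3)⁻¹ * ψ (l⁻¹ • (y - x))) • f y with hFdef
  have hF0 : ∀ y, F y = (l ^ 3)⁻¹ • (fun w => ψ w • f (x + l • w)) (l⁻¹ • (y - x)) := by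
    intro y
    have e : x + l • l⁻¹ • (y - x) = y := by
      rw [smul_smul, mul_inv_cancel₀ hl.ne', one_smul, add_sub_cancel]
    simp only [hFdef]
    rw [e, mul_smul]
  have hF : Integrable F := by
    refine hf.integrable_smul_left_of_hasCompactSupport (by have := h1.continuous; fun_prop) ?_
    refine HasCompactSupport.mul_left (f := fun _ : R3 => (l ^ 3)⁻¹) ?_
    exact hcs.comp_homeomorph ((Homeomorph.subRight x).trans (Homeomorph.smulOfNeZero l⁻¹
      (inv_ne_zero hl.ne')))
  have hval : ∫ y, F y = ∫ w, ψ w • f (x + l • w) := by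
    simp_rw [hF0]
    rw [integral_smul, integral_sub_right_eq_self
      (fun y => (fun w => ψ w • f (x + l • w)) (l⁻¹ • y)) x,
      Measure.integral_comp_inv_smul volume (fun w => ψ w • f (x + l • w)) l]
    have hfr : Module.finrank ℝ R3 = 3 := by simp
    rw [hfr, abs_of_pos (by positivity), smul_smul, inv_mul_cancel₀ (by positivity), one_smul]
  have hfc : IntegrableOn f cube := (hf.integrableOn_isCompact
    (isCompact_closedBall (0 : R3) 2)).mono_set cube_subset_closedBall
  rw [ofFun_apply hfc, ← hval, ← integral_cube_tsum hF]
  refine integral_congr_ae (Eventually.of_forall fun y => ?_)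
  simp only
  rw [scaledTest_apply h1 h2 hl]
  have hsum : Summable fun k : Fin 3 → ℤ => (l ^ 3)⁻¹ * ψ (l⁻¹ • (y - x + latticeVec k)) :=
    summable_of_hasFiniteSupport ((locallyFinite_periodization h2 hl x).point_finite y)
  rw [← hsum.tsum_smul_const]
  refine tsum_congr fun k => ?_
  rw [hFdef]
  simp only
  rw [hp k y, sub_add_eq_add_sub]

theorem ofFun_scaledTest {f : R3 → W} (hf : Continuous f) (hp : Periodic f) {ψ : R3 → ℝ}
    (h1 : ContDiff ℝ ∞ ψ) (h2 : tsupport ψ ⊆ Metric.closedBall 0 (1 / 4)) {l : ℝ} (hl : 0 < l)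
    (x : R3) : (ofFun f).1 (scaledTest ψ l x) = ∫ w, ψ w • f (x + l • w) :=
  ofFun_scaledTest' hf.locallyIntegrable hp h1 h2 hl x

end

end YMH

/-! ### Periodic extensions and uniqueness of the density of a distribution. -/

namespace YMH

/-- The periodic extension of a function on the cube. -/
noncomputable def perExt {S : Type*} (f : R3 → S) (x : R3) : S := f (x + latticeVec (toCube x))

theorem toCube_add (x : R3) (k : Fin 3 → ℤ) : toCube (x + latticeVec k) = toCube x - k := by
  ext i
  have : x i + (k i : ℝ) + 1 / 2 = x i + 1 / 2 + (k i : ℝ) := by ring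
  simp only [toCube, PiLp.add_apply, latticeVec_apply, Pi.sub_apply, this, Int.floor_add_intCast]
  ring

theorem periodic_perExt {S : Type*} (f : R3 → S) : Periodic (perExt f) := fun k x => by
  rw [perExt, perExt, toCube_add, add_assoc, ← latticeVec_add]
  congr 3
  abel

theorem perExt_of_mem {S : Type*} (f : R3 → S) {x : R3} (hx : x ∈ cube) : perExt f x = f x := by
  rw [perExt, eq_of_mem_cube hx (add_toCube_mem x)]
  simp

theorem measurePreserving_add_latticeVec (k : Fin 3 → ℤ) :
    MeasurePreserving (fun x : R3 => x - latticeVec k) volume volume :=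
  measurePreserving_sub_right (volume : Measure R3) (latticeVec k)

theorem Periodic.ae_of_ae_cube {p : R3 → Prop} (hp : Periodic p)
    (h : ∀ᵐ x ∂volume.restrict cube, p x) : ∀ᵐ x, p x := by
  rw [ae_restrict_iff' measurableSet_cube] at h
  have h1 : ∀ k : Fin 3 → ℤ, ∀ᵐ x, x - latticeVec k ∈ cube → p (x - latticeVec k) := fun k =>
    (measurePreserving_add_latticeVec k).quasiMeasurePreserving.ae h
  filter_upwards [ae_all_iff.2 h1] with x hx
  have := hx (-toCube x) (by
    simp only [latticeVec_neg, sub_neg_eq_add]; exact add_toCube_mem x)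
  rwa [latticeVec_neg, sub_neg_eq_add, hp (toCube x) x] at this

theorem Periodic.bound_of_ae {W : Type*} [NormedAddCommGroup W] {f : R3 → W} (hf : Continuous f)
    (hp : Periodic f) {M : ℝ} (h : ∀ᵐ x ∂volume.restrict cube, ‖f x‖ ≤ M) (x : R3) : ‖f x‖ ≤ M := by
  have h2 : ∀ᵐ x, ‖f x‖ ≤ M :=
    Periodic.ae_of_ae_cube (p := fun x => ‖f x‖ ≤ M) (fun k x => by simp [hp k x]) h
  by_contra hx
  have ho : IsOpen {x | ¬ ‖f x‖ ≤ M} := by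
    simp only [not_le]
    exact isOpen_lt continuous_const hf.norm
  exact (ho.measure_pos volume ⟨x, hx⟩).ne' (ae_iff.1 h2)

variable {W : Type*} [NormedAddCommGroup W] [NormedSpace ℝ W]

/-- Each translate of the cube carries a copy of `f`, and a compact set meets finitely many of them.
-/
theorem locallyIntegrable_perExt {f : R3 → W} (hf : IntegrableOn f cube) :
    LocallyIntegrable (perExt f) := by
  have h1 : ∀ k : Fin 3 → ℤ, IntegrableOn (perExt f) ((fun x => x - latticeVec k) ⁻¹' cube) := by
    intro k
    have h2 : IntegrableOn (perExt f) cube :=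
      hf.congr_fun (fun x hx => (perExt_of_mem f hx).symm) measurableSet_cube
    have h3 := (measurePreserving_add_latticeVec k).integrableOn_comp_preimage
      (MeasurableEquiv.subRight (latticeVec k)).measurableEmbedding (f := perExt f) (s := cube)
    refine (h3.2 h2).congr_fun (fun x _ => ?_) (measurableSet_cube.preimage (measurable_id.sub_const _))
    have := periodic_perExt f k (x - latticeVec k)
    simp only [Function.comp_apply]
    rw [← this, sub_add_cancel]
  refine locallyIntegrable_iff.2 fun K hK => ?_
  obtain ⟨R, hR⟩ := hK.isBounded.subset_closedBall (0 : R3)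
  have hsub : K ⊆ ⋃ k ∈ {k : Fin 3 → ℤ | ‖latticeVec k‖ ≤ R + 2}, (fun x => x - latticeVec k) ⁻¹' cube := by
    intro x hx
    refine Set.mem_biUnion (x := -toCube x) ?_ ?_
    · have h5 := mem_closedBall_zero_iff.1 (cube_subset_closedBall (add_toCube_mem x))
      have h6 := mem_closedBall_zero_iff.1 (hR hx)
      rw [Set.mem_ofPred_eq, latticeVec_neg, norm_neg]
      have : latticeVec (toCube x) = (x + latticeVec (toCube x)) - x := by abel
      rw [this]
      exact (norm_sub_le _ _).trans (by linarith)
    · simp only [Set.mem_preimage, latticeVec_neg, sub_neg_eq_add]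
      exact add_toCube_mem x
  refine IntegrableOn.mono_set ?_ hsub
  exact (integrableOn_finite_biUnion (finite_latticeVec _)).2 fun k _ => h1 k

theorem ofFun_congr {f g : R3 → W} (hf : IntegrableOn f cube) (h : ∀ x ∈ cube, f x = g x) :
    ofFun f = ofFun g := by
  ext φ
  change (ofFun f).1 φ = (ofFun g).1 φ
  have hg : IntegrableOn g cube := hf.congr_fun h measurableSet_cube
  rw [ofFun_apply hf, ofFun_apply hg]
  exact setIntegral_congr_fun measurableSet_cube fun x hx => by simp only [h x hx]

/-- The fundamental lemma of the calculus of variations is applied on balls of radius 1/4: a smooth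
function supported in such a ball is a translate of an admissible profile, hence a test function at
scale one. Countably many balls cover the space. -/
theorem ae_eq_zero_of_ofFun_eq_zero [CompleteSpace W] {f : R3 → W} (hf : IntegrableOn f cube)
    (h : ofFun f = 0) : ∀ᵐ x ∂volume.restrict cube, f x = 0 := by
  have hli := locallyIntegrable_perExt hf
  have h0 : ofFun (perExt f) = 0 := by
    rw [← ofFun_congr hf fun x hx => (perExt_of_mem f hx).symm, h]
  have h1 : ∀ p : R3, ∀ᵐ x, x ∈ Metric.ball p (1 / 4) → perExt f x = 0 := by
    intro p
    refine Metric.isOpen_ball.ae_eq_zero_of_integral_contDiff_smul_eq_zero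
      (hli.locallyIntegrableOn _) fun g hg _ hgs => ?_
    have h2 : ContDiff ℝ ∞ fun z => g (z + p) := hg.comp (by fun_prop)
    have h3 : tsupport (fun z => g (z + p)) ⊆ Metric.closedBall 0 (1 / 4) := by
      refine closure_minimal (fun z hz => ?_) Metric.isClosed_closedBall
      have := hgs (subset_tsupport g hz)
      rw [Metric.mem_ball, dist_eq_norm, add_sub_cancel_right] at this
      exact mem_closedBall_zero_iff.2 this.le
    have h4 := ofFun_scaledTest' hli (periodic_perExt f) h2 h3 one_pos p
    rw [h0] at h4
    have h5 : (0 : W) = ∫ w, g (w + p) • perExt f (p + (1 : ℝ) • w) := h4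
    have h6 := integral_add_right_eq_self (μ := (volume : Measure R3)) (fun y => g y • perExt f y) p
    rw [← h6, h5]
    simp [add_comm p]
  have h2 : ∀ᵐ x, perExt f x = 0 := by
    rw [ae_iff]
    refine measure_null_of_locally_null _ fun p _ => ?_
    refine ⟨Metric.ball p (1 / 4) ∩ {x | ¬ perExt f x = 0}, ?_, ?_⟩
    · rw [Set.inter_comm]
      exact inter_mem_nhdsWithin _ (Metric.ball_mem_nhds p (by norm_num))
    · have := ae_iff.1 (h1 p)
      convert this using 2
      ext x; simp
  filter_upwards [ae_restrict_of_ae h2, ae_restrict_mem measurableSet_cube] with x hx hm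
  rwa [perExt_of_mem f hm] at hx

theorem ae_eq_of_ofFun_eq [CompleteSpace W] {f g : R3 → W} (hf : IntegrableOn f cube)
    (hg : IntegrableOn g cube) (h : ofFun f = ofFun g) : f =ᵐ[volume.restrict cube] g := by
  have := ae_eq_zero_of_ofFun_eq_zero (hf.sub hg) (by
    have := ofFun_sub hf hg
    rw [h, sub_self] at this
    exact this)
  filter_upwards [this] with x hx
  exact sub_eq_zero.1 hx

theorem ofFun_injective [CompleteSpace W] {f g : R3 → W} (hf : Continuous f) (hg : Continuous g)
    (hfp : Periodic f) (hgp : Periodic g) (h : ofFun f = ofFun g) : f = g := by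
  have h1 := ae_eq_of_ofFun_eq (integrableOn_cube hf) (integrableOn_cube hg) h
  have h2 : f =ᵐ[volume] g :=
    Periodic.ae_of_ae_cube (p := fun x => f x = g x) (fun k x => by simp [hfp k x, hgp k x]) h1
  exact (Continuous.ae_eq_iff_eq volume hf hg).1 h2

/-! ### Norms of functions -/

/-- The norm is an infimum over densities, but all densities agree almost everywhere, and for a
continuous function an almost sure bound holds everywhere. -/
theorem supNorm_ofFun_le_iff [CompleteSpace W] {f : R3 → W} (hf : Continuous f) (hp : Periodic f)
    {M : ℝ} (hM : 0 ≤ M) : supNorm (ofFun f) ≤ ENNReal.ofReal M ↔ ∀ x, ‖f x‖ ≤ M := by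
  constructor
  · intro h
    refine Periodic.bound_of_ae hf hp ?_
    have h1 : eLpNorm f ∞ (volume.restrict cube) ≤ ENNReal.ofReal M := by
      refine le_trans ?_ h
      refine le_iInf fun g => le_iInf fun hg => le_iInf fun hgf => ?_
      exact (eLpNorm_congr_ae (ae_eq_of_ofFun_eq (hg.integrable le_top)
        (integrableOn_cube hf) hgf)).ge
    have h2 := ae_le_eLpNormEssSup (f := f) (μ := volume.restrict cube)
    filter_upwards [h2] with x hx
    rw [eLpNorm_exponent_top] at h1
    have := hx.trans h1
    rwa [← ofReal_norm, ENNReal.ofReal_le_ofReal_iff hM] at this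
  · intro h
    have hm : MemLp f ∞ (volume.restrict cube) :=
      memLp_top_of_bound hf.aestronglyMeasurable M (Eventually.of_forall h)
    rw [supNorm]
    refine iInf_le_of_le f ?_
    refine iInf_le_of_le hm ?_
    refine iInf_le_of_le rfl ?_
    rw [eLpNorm_exponent_top]
    exact eLpNormEssSup_le_of_ae_bound (Eventually.of_forall h)

theorem posHolderNorm_one_ofFun_le {f : R3 → W} (hf : Continuous f) (hp : Periodic f)
    {M K : ℝ} (hM : ∀ x, ‖f x‖ ≤ M) (hK : 0 ≤ K) (hL : ∀ x y, ‖f x - f y‖ ≤ K * ‖x - y‖) :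
    posHolderNorm 1 (ofFun f) ≤ ENNReal.ofReal (M + K) := by
  have hM0 : 0 ≤ M := (norm_nonneg _).trans (hM 0)
  rw [posHolderNorm]
  refine iInf_le_of_le f ?_
  refine iInf_le_of_le hp ?_
  refine iInf_le_of_le hf ?_
  refine iInf_le_of_le rfl ?_
  rw [ENNReal.ofReal_add hM0 hK]
  refine add_le_add (iSup_le fun x => ?_) (iSup_le fun x => iSup_le fun y => ?_)
  · rw [← ofReal_norm]; exact ENNReal.ofReal_le_ofReal (hM x)
  · rw [ENNReal.rpow_one]
    refine ENNReal.div_le_of_le_mul ?_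
    rw [← ofReal_norm, edist_eq_enorm_sub, ← ofReal_norm, ← ENNReal.ofReal_mul hK]
    exact ENNReal.ofReal_le_ofReal (hL x y)

/-- The strict inequality allows a representative to be extracted from the infimum; by continuity
and periodicity it can only be `f`. -/
theorem bounds_of_posHolderNorm_one_lt [CompleteSpace W] {f : R3 → W} (hf : Continuous f)
    (hp : Periodic f) {M : ℝ} (h : posHolderNorm 1 (ofFun f) < ENNReal.ofReal M) :
    (∀ x, ‖f x‖ ≤ M) ∧ ∀ x y, ‖f x - f y‖ ≤ M * ‖x - y‖ := by
  have hM : 0 < M := ENNReal.ofReal_pos.1 (bot_le.trans_lt h)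
  simp only [posHolderNorm, iInf_lt_iff] at h
  obtain ⟨g, hg, hgc, hgf, hlt⟩ := h
  obtain rfl := ofFun_injective hgc hf hg hp hgf
  constructor
  · intro x
    have := ((le_iSup (fun x => ‖g x‖ₑ) x).trans (le_self_add)).trans hlt.le
    rwa [← ofReal_norm, ENNReal.ofReal_le_ofReal_iff hM.le] at this
  · intro x y
    rcases eq_or_ne x y with rfl | hxy
    · simp
    have h1 := ((le_iSup₂ (f := fun x y => ‖g x - g y‖ₑ / edist x y ^ (1 : ℝ)) x y).trans
      (le_add_self)).trans hlt.le
    rw [ENNReal.rpow_one, edist_eq_enorm_sub] at h1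
    rw [ENNReal.div_le_iff (by simpa [sub_eq_zero] using hxy) (by simp), ← ofReal_norm,
      ← ofReal_norm, ← ENNReal.ofReal_mul hM.le, ENNReal.ofReal_le_ofReal_iff (by positivity)] at h1
    exact h1

/-- The number of derivatives in the definition of the Hölder norm. -/
noncomputable def rIdx (α : ℝ) : ℕ := (-⌈α - 1⌉).toNat

/-- A bound on the Hölder norm of negative exponent of a function. -/
def HB (α M : ℝ) (f : R3 → W) : Prop :=
  ∀ l ∈ Set.Ioc (0 : ℝ) 1, ∀ ψ ∈ bumps (rIdx α), ∀ x, ‖∫ w, ψ w • f (x + l • w)‖ ≤ M * l ^ α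

theorem abs_le_one_of_mem_bumps {r : ℕ} {ψ : R3 → ℝ} (h : ψ ∈ bumps r) (x : R3) : ‖ψ x‖ ≤ 1 := by
  have h1 := (le_iSup (fun x => ‖iteratedFDeriv ℝ 0 ψ x‖ₑ) x).trans
    (Finset.single_le_sum (f := fun j => ⨆ x, ‖iteratedFDeriv ℝ j ψ x‖ₑ) (fun _ _ => bot_le)
      (Finset.mem_range.2 (Nat.succ_pos r)))
  have h2 := h1.trans h.2.2
  rw [← ofReal_norm, norm_iteratedFDeriv_zero, ENNReal.ofReal_le_one] at h2
  exact h2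

/-- A bump is bounded by one and supported in the cube, which has volume one. -/
theorem norm_integral_bump_le {r : ℕ} {ψ : R3 → ℝ} (h : ψ ∈ bumps r) {f : R3 → W} {M : ℝ}
    (hM : ∀ x, ‖f x‖ ≤ M) (l : ℝ) (x : R3) : ‖∫ w, ψ w • f (x + l • w)‖ ≤ M := by
  have hs : ∀ w ∉ cube, ψ w • f (x + l • w) = 0 := fun w hw => by
    have : ψ w = 0 := image_eq_zero_of_notMem_tsupport fun hw' =>
      hw (closedBall_subset_cube (h.2.1 hw'))
    rw [this, zero_smul]
  rw [← setIntegral_eq_integral_of_forall_compl_eq_zero (s := cube) hs]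
  have := norm_setIntegral_le_of_norm_le_const (μ := (volume : Measure R3)) (s := cube) (C := M)
    (f := fun w => ψ w • f (x + l • w)) (by rw [volume_cube]; simp) fun w _ => by
      rw [norm_smul]
      calc _ ≤ 1 * M := mul_le_mul (abs_le_one_of_mem_bumps h w) (hM _) (norm_nonneg _) zero_le_one
        _ = M := one_mul M
  simpa [Measure.real, volume_cube] using this

theorem HB_of_bound {α : ℝ} (hα : α ≤ 0) {f : R3 → W} {M : ℝ} (hM : ∀ x, ‖f x‖ ≤ M) : HB α M f :=
  fun l hl _ hψ x => (norm_integral_bump_le hψ hM l x).trans (le_mul_of_one_le_right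
    ((norm_nonneg _).trans (hM 0)) (Real.one_le_rpow_of_pos_of_le_one_of_nonpos hl.1 hl.2 hα))

theorem negHolderNorm_ofFun_le_iff {f : R3 → W} (hf : Continuous f) (hp : Periodic f) {α M : ℝ}
    (hM : 0 ≤ M) : negHolderNorm α (ofFun f) ≤ ENNReal.ofReal M ↔ HB α M f := by
  have key : ∀ l ∈ Set.Ioc (0 : ℝ) 1, ∀ ψ ∈ bumps (rIdx α), ∀ x,
      ENNReal.ofReal (l ^ (-α)) * ‖(ofFun f).1 (scaledTest ψ l x)‖ₑ ≤ ENNReal.ofReal M ↔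
      ‖∫ w, ψ w • f (x + l • w)‖ ≤ M * l ^ α := by
    intro l hl ψ hψ x
    have hp0 : 0 < l ^ α := Real.rpow_pos_of_pos hl.1 _
    rw [ofFun_scaledTest hf hp hψ.1 hψ.2.1 hl.1, ← ofReal_norm,
      ← ENNReal.ofReal_mul (Real.rpow_nonneg hl.1.le _), ENNReal.ofReal_le_ofReal_iff hM,
      Real.rpow_neg hl.1.le, inv_mul_le_iff₀ hp0, mul_comm]
  constructor
  · intro h l hl ψ hψ x
    refine (key l hl ψ hψ x).1 (le_trans ?_ h)
    exact (le_iSup₂_of_le l hl (le_iSup₂_of_le ψ hψ (le_iSup_of_le x le_rfl)))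
  · intro h
    exact iSup₂_le fun l hl => iSup₂_le fun ψ hψ => iSup_le fun x =>
      (key l hl ψ hψ x).2 (h l hl ψ hψ x)

theorem HB_of_holderNorm_le [CompleteSpace W] {f : R3 → W} (hf : Continuous f) (hp : Periodic f)
    {α M : ℝ} (hα : α ≤ 0) (hM : 0 ≤ M) (h : holderNorm α (ofFun f) ≤ ENNReal.ofReal M) :
    HB α M f := by
  rcases hα.lt_or_eq with h1 | rfl
  · rw [holderNorm, if_pos h1] at h
    exact (negHolderNorm_ofFun_le_iff hf hp hM).1 h
  · rw [holderNorm, if_neg (lt_irrefl _), if_pos rfl] at h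
    exact HB_of_bound le_rfl ((supNorm_ofFun_le_iff hf hp hM).1 h)

theorem holderNorm_ofFun_le [CompleteSpace W] {f : R3 → W} (hf : Continuous f) (hp : Periodic f)
    {α M : ℝ} (hα : α ≤ 0) (hM : 0 ≤ M) (h : α < 0 → HB α M f) (h0 : α = 0 → ∀ x, ‖f x‖ ≤ M) :
    holderNorm α (ofFun f) ≤ ENNReal.ofReal M := by
  rcases hα.lt_or_eq with h1 | rfl
  · rw [holderNorm, if_pos h1]
    exact (negHolderNorm_ofFun_le_iff hf hp hM).2 (h h1)
  · rw [holderNorm, if_neg (lt_irrefl _), if_pos rfl]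
    exact (supNorm_ofFun_le_iff hf hp hM).2 (h0 rfl)

theorem holderNorm_ofFun_le_of_bound [CompleteSpace W] {f : R3 → W} (hf : Continuous f)
    (hp : Periodic f) {α M : ℝ} (hα : α ≤ 0) (hM : ∀ x, ‖f x‖ ≤ M) :
    holderNorm α (ofFun f) ≤ ENNReal.ofReal M :=
  holderNorm_ofFun_le hf hp hα ((norm_nonneg _).trans (hM 0)) (fun _ => HB_of_bound hα hM)
    fun _ => hM

theorem holderNorm_add_le {α : ℝ} (hα : α ≤ 0) (X Y : Dist W) :
    holderNorm α (X + Y) ≤ holderNorm α X + holderNorm α Y := by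
  rcases hα.lt_or_eq with h1 | rfl
  · simp only [holderNorm, if_pos h1]
    refine iSup₂_le fun l hl => iSup₂_le fun ψ hψ => iSup_le fun x => ?_
    have h2 : ∀ X : Dist W, ENNReal.ofReal (l ^ (-α)) * ‖X.1 (scaledTest ψ l x)‖ₑ ≤
        negHolderNorm α X := fun X =>
      (le_iSup₂_of_le l hl (le_iSup₂_of_le ψ hψ (le_iSup_of_le x le_rfl)))
    refine le_trans ?_ (add_le_add (h2 X) (h2 Y))
    rw [← mul_add]
    gcongr
    exact enorm_add_le _ _
  · simp only [holderNorm, lt_irrefl, if_false, if_true]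
    simp only [supNorm, ENNReal.iInf_add, ENNReal.add_iInf]
    refine le_iInf fun g => le_iInf fun hg => le_iInf fun hgY => le_iInf fun f => le_iInf fun hf =>
      le_iInf fun hfX => ?_
    refine iInf_le_of_le (fun x => g x + f x) (iInf_le_of_le (hg.add hf) (iInf_le_of_le ?_ ?_))
    · rw [ofFun_add (hg.integrable le_top) (hf.integrable le_top), hgY, hfX, add_comm]
    · rw [add_comm (eLpNorm f _ _)]
      exact eLpNorm_add_le hg.1 hf.1 le_top

end YMH

namespace YMH

/-! ### Decomposition of functions into bumps -/

/-- Leibniz' rule: each of the `r + 1` derivatives costs at most `2 ^ r * (A * B)`. Bounds on `b`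
are required only on the ball that contains the support of `a`, which lets `b` be a piece of a
function on the whole space. -/
theorem mul_mem_bumps {r : ℕ} {a b : R3 → ℝ} (ha : ContDiff ℝ ∞ a) (hb : ContDiff ℝ ∞ b)
    (hs : tsupport a ⊆ Metric.closedBall 0 (1 / 4)) {A B c : ℝ} (hA0 : 0 ≤ A)
    (hA : ∀ j ≤ r, ∀ w, ‖iteratedFDeriv ℝ j a w‖ ≤ A)
    (hB : ∀ j ≤ r, ∀ w ∈ Metric.closedBall (0 : R3) (1 / 4), ‖iteratedFDeriv ℝ j b w‖ ≤ B)
    (hc : 0 < c) (hABc : (r + 1) * 2 ^ r * (A * B) ≤ c) :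
    (fun w => c⁻¹ * (a w * b w)) ∈ bumps r := by
  have hB0 : 0 ≤ B := (norm_nonneg _).trans
    (hB 0 (Nat.zero_le _) 0 (Metric.mem_closedBall_self (by norm_num)))
  have hsm : ContDiff ℝ ∞ fun w => a w * b w := ha.mul hb
  have hs' : tsupport (fun w => a w * b w) ⊆ Metric.closedBall 0 (1 / 4) :=
    (closure_mono (Function.support_mul_subset_left a b)).trans hs
  have hs'' : tsupport (fun w => c⁻¹ * (a w * b w)) ⊆ Metric.closedBall 0 (1 / 4) :=
    (closure_mono (Function.support_mul_subset_right (fun _ => c⁻¹) _)).trans hs'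
  refine ⟨contDiff_const.mul hsm, hs'', ?_⟩
  have hb1 : ∀ j ≤ r, ∀ w, ‖iteratedFDeriv ℝ j (fun w => c⁻¹ * (a w * b w)) w‖ ≤
      c⁻¹ * (2 ^ r * (A * B)) := by
    intro j hj w
    by_cases hw : w ∈ Metric.closedBall (0 : R3) (1 / 4)
    · have e : (fun w => c⁻¹ * (a w * b w)) = c⁻¹ • fun w => a w * b w := rfl
      rw [e, iteratedFDeriv_const_smul_apply (hsm.contDiffAt.of_le (by exact_mod_cast le_top)),
        norm_smul, Real.norm_of_nonneg (by positivity)]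
      refine mul_le_mul_of_nonneg_left ?_ (by positivity)
      refine (norm_iteratedFDeriv_mul_le (N := ∞) ha hb w (by exact_mod_cast le_top)).trans ?_
      calc _ ≤ ∑ i ∈ Finset.range (j + 1), (j.choose i : ℝ) * (A * B) := by
            refine Finset.sum_le_sum fun i hi => ?_
            rw [mul_assoc]
            have := Finset.mem_range.1 hi
            gcongr
            · exact hA i (by omega) w
            · exact hB (j - i) (by omega) w hw
        _ = 2 ^ j * (A * B) := by
            rw [← Finset.sum_mul]
            congr 1
            exact_mod_cast Nat.sum_range_choose j
        _ ≤ _ := by gcongr; norm_num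
    · have : iteratedFDeriv ℝ j (fun w => c⁻¹ * (a w * b w)) w = 0 := by
        by_contra hne
        exact hw (hs'' (support_iteratedFDeriv_subset j hne))
      rw [this, norm_zero]
      positivity
  calc _ ≤ ∑ _j ∈ Finset.range (r + 1), ENNReal.ofReal (c⁻¹ * (2 ^ r * (A * B))) := by
        refine Finset.sum_le_sum fun j hj => iSup_le fun w => ?_
        rw [← ofReal_norm]
        exact ENNReal.ofReal_le_ofReal (hb1 j (by have := Finset.mem_range.1 hj; omega) w)
    _ = ENNReal.ofReal ((r + 1) * (c⁻¹ * (2 ^ r * (A * B)))) := by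
        rw [Finset.sum_const, Finset.card_range, ← ENNReal.ofReal_nsmul, nsmul_eq_mul]
        push_cast
        rfl
    _ ≤ 1 := by
        rw [ENNReal.ofReal_le_one]
        calc _ = c⁻¹ * ((r + 1) * 2 ^ r * (A * B)) := by ring
          _ ≤ c⁻¹ * c := by gcongr
          _ = 1 := inv_mul_cancel₀ hc.ne'

theorem exists_iteratedFDeriv_bound {a : R3 → ℝ} (ha : ContDiff ℝ ∞ a) (hs : HasCompactSupport a)
    (r : ℕ) : ∃ A, 0 ≤ A ∧ ∀ j ≤ r, ∀ w, ‖iteratedFDeriv ℝ j a w‖ ≤ A := by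
  have h1 : ∀ j : ℕ, ∃ A, ∀ w, ‖iteratedFDeriv ℝ j a w‖ ≤ A := fun j =>
    (ha.continuous_iteratedFDeriv (by exact_mod_cast le_top)).bounded_above_of_compact_support
      (hs.iteratedFDeriv j)
  choose A hA using h1
  refine ⟨∑ j ∈ Finset.range (r + 1), |A j|, by positivity, fun j hj w => ?_⟩
  exact ((hA j w).trans (le_abs_self _)).trans (Finset.single_le_sum (f := fun j => |A j|)
    (fun _ _ => abs_nonneg _) (Finset.mem_range.2 (by omega)))

/-- A fixed bump with integral one. -/
noncomputable def bump₀ : R3 → ℝ :=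
  (⟨1 / 8, 1 / 4, by norm_num, by norm_num⟩ : ContDiffBump (0 : R3)).normed volume

theorem contDiff_bump₀ : ContDiff ℝ ∞ bump₀ := ContDiffBump.contDiff_normed _

theorem integral_bump₀ : ∫ x, bump₀ x = 1 := ContDiffBump.integral_normed _

theorem tsupport_bump₀ : tsupport bump₀ ⊆ Metric.closedBall 0 (1 / 4) :=
  (ContDiffBump.tsupport_normed_eq _).subset

theorem hasCompactSupport_bump₀ : HasCompactSupport bump₀ := ContDiffBump.hasCompactSupport_normed _

theorem integrable_bump₀ : Integrable bump₀ :=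
  contDiff_bump₀.continuous.integrable_of_hasCompactSupport hasCompactSupport_bump₀

/-- A window of fixed size cut out of `g` around `y` is a multiple of a bump, and the multiple
inherits the decay of `g`, because `1 + ‖·‖` varies by at most a factor of two over the window. The
weight is integrable in `y`. -/
theorem exists_bump_translate_mem (g : SchwartzMap R3 ℝ) (r : ℕ) : ∃ C : ℝ, 0 < C ∧ ∀ y : R3,
    (fun w => (C * (1 + ‖y‖) ^ (-4 : ℝ))⁻¹ * (bump₀ w * g (w + y))) ∈ bumps r := by
  obtain ⟨A, hA0, hA⟩ := exists_iteratedFDeriv_bound contDiff_bump₀ hasCompactSupport_bump₀ r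
  choose D hD0 hD using fun n => schwartz_decay g n
  set S := ∑ j ∈ Finset.range (r + 1), D j
  have hS0 : 0 ≤ S := Finset.sum_nonneg fun j _ => (hD0 j).le
  refine ⟨(r + 1) * 2 ^ r * (A * (S * 2 ^ 4)) + 1, by positivity, fun y => ?_⟩
  refine mul_mem_bumps (A := A) (b := fun w => g (w + y)) (B := S * (2 ^ 4 * (1 + ‖y‖) ^ (-4 : ℝ))) contDiff_bump₀
    (g.smooth'.comp (by fun_prop)) tsupport_bump₀ hA0 hA ?_ (by positivity) ?_
  · intro j hj w hw
    rw [iteratedFDeriv_comp_add_right]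
    refine (hD j (w + y)).trans ?_
    have h1 : D j ≤ S := Finset.single_le_sum (f := D) (fun j _ => (hD0 j).le)
      (Finset.mem_range.2 (by omega))
    have h2 : 1 + ‖y‖ ≤ 2 * (1 + ‖w + y‖) := by
      have h3 := mem_closedBall_zero_iff.1 hw
      have h4 : y = (w + y) - w := by abel
      have h5 : ‖y‖ ≤ ‖w + y‖ + ‖w‖ := by
        conv_lhs => rw [h4]
        exact norm_sub_le _ _
      linarith [norm_nonneg (w + y)]
    have h5 : (2 * (1 + ‖w + y‖)) ^ (-4 : ℝ) ≤ (1 + ‖y‖) ^ (-4 : ℝ) :=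
      Real.rpow_le_rpow_of_nonpos (by positivity) h2 (by norm_num)
    rw [Real.mul_rpow (by norm_num) (by positivity)] at h5
    have h6 : (2 : ℝ) ^ (-4 : ℝ) = (2 ^ 4)⁻¹ := by
      rw [Real.rpow_neg (by norm_num)]; norm_num
    rw [h6, inv_mul_le_iff₀ (by positivity)] at h5
    gcongr
  · have : 0 < (1 + ‖y‖) ^ (-4 : ℝ) := by positivity
    nlinarith

/-- The constant in the bound on averages against a Schwartz function. -/
noncomputable def avgConst (g : SchwartzMap R3 ℝ) (r : ℕ) : ℝ :=
  (exists_bump_translate_mem g r).choose * ∫ y : R3, (1 + ‖y‖) ^ (-4 : ℝ)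

theorem avgConst_nonneg (g : SchwartzMap R3 ℝ) (r : ℕ) : 0 ≤ avgConst g r :=
  mul_nonneg (exists_bump_translate_mem g r).choose_spec.1.le
    (integral_nonneg fun _ => by positivity)

variable {W : Type*} [NormedAddCommGroup W] [NormedSpace ℝ W]

/-- Averages against a Schwartz function are controlled by averages against bumps. -/
theorem norm_integral_schwartz_le [CompleteSpace W] (g : SchwartzMap R3 ℝ) (r : ℕ) {f : R3 → W}
    (hf : Continuous f)
    {B : ℝ} (hB : ∀ x, ‖f x‖ ≤ B) {l M : ℝ}
    (hM : ∀ ψ ∈ bumps r, ∀ x, ‖∫ w, ψ w • f (x + l • w)‖ ≤ M) (x : R3) :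
    ‖∫ w, g w • f (x + l • w)‖ ≤ avgConst g r * M := by
  set C := (exists_bump_translate_mem g r).choose
  obtain ⟨hC0, hC⟩ : 0 < C ∧ _ := (exists_bump_translate_mem g r).choose_spec
  have hgf : Integrable fun w => g w • f (x + l • w) :=
    g.integrable.smul_bdd B (by fun_prop) (Eventually.of_forall fun w => hB _)
  have hint := hgf.convolution_integrand (ContinuousLinearMap.lsmul ℝ ℝ (E := W)).flip
    (integrable_bump₀.comp_neg) (μ := volume) (ν := volume)
  -- The integral of the translates of `bump₀` is one, a continuous partition of unity.
  have e1 : ∫ w, g w • f (x + l • w) = ∫ w, ∫ y, bump₀ (-(y - w)) • (g w • f (x + l • w)) := by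
    refine integral_congr_ae (Eventually.of_forall fun w => ?_)
    simp only
    rw [integral_smul_const]
    have : ∫ y, bump₀ (-(y - w)) = 1 := by
      simp_rw [neg_sub]
      rw [integral_sub_left_eq_self (fun y => bump₀ y) volume w, integral_bump₀]
    rw [this, one_smul]
  -- Recentring at `y` turns the inner integral into the average of `f` against a normalised bump at
  -- the same scale `l`, around the point `x + l • y`.
  have e2 : ∀ y, ∫ w, bump₀ (-(y - w)) • (g w • f (x + l • w)) =
      (C * (1 + ‖y‖) ^ (-4 : ℝ)) • ∫ w, ((C * (1 + ‖y‖) ^ (-4 : ℝ))⁻¹ * (bump₀ w * g (w + y))) •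
        f ((x + l • y) + l • w) := by
    intro y
    have hpos : 0 < C * (1 + ‖y‖) ^ (-4 : ℝ) := by positivity
    rw [← integral_smul, ← integral_add_right_eq_self (fun w => bump₀ (-(y - w)) •
      (g w • f (x + l • w))) y]
    refine integral_congr_ae (Eventually.of_forall fun w => ?_)
    simp only
    rw [smul_smul, smul_smul, mul_inv_cancel_left₀ hpos.ne']
    congr 2
    · congr 1; abel_nf
    · rw [smul_add]; abel
  have hsw : ∫ w, ∫ y, bump₀ (-(y - w)) • (g w • f (x + l • w)) =
      ∫ y, ∫ w, bump₀ (-(y - w)) • (g w • f (x + l • w)) :=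
    integral_integral_swap (f := fun w y => bump₀ (-(y - w)) • (g w • f (x + l • w))) hint.swap
  rw [e1, hsw]
  have hM0 : ∀ y, ‖∫ w, bump₀ (-(y - w)) • (g w • f (x + l • w))‖ ≤
      C * (1 + ‖y‖) ^ (-4 : ℝ) * M := by
    intro y
    rw [e2, norm_smul, Real.norm_of_nonneg (by positivity)]
    gcongr
    exact hM _ (hC y) _
  refine (norm_integral_le_of_norm_le ((integrable_decay.const_mul C).mul_const M)
    (Eventually.of_forall hM0)).trans ?_
  rw [integral_mul_const, integral_const_mul, avgConst]

theorem contDiff_test (φ : Test) : ContDiff ℝ ∞ (φ : R3 → ℝ) := φ.2.1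

theorem contDiff_test_add (φ : Test) (p : R3) : ContDiff ℝ ∞ fun z => (φ : R3 → ℝ) (z + p) :=
  (contDiff_test φ).comp (contDiff_id.add contDiff_const)

/-- A plateau function that is equal to one on the ball of radius `0.22`. -/
noncomputable def plateau : ContDiffBump (0 : R3) := ⟨0.22, 1 / 4, by norm_num, by norm_num⟩

/-- The point of the grid `(ℤ/4)³` with index `m`. -/
noncomputable def gridPt (m : Fin 3 → Fin 4) : R3 := WithLp.toLp 2 fun i => ((m i : ℕ) : ℝ) / 4

theorem tsupport_plateau : tsupport plateau ⊆ Metric.closedBall (0 : R3) (1 / 4) :=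
  (ContDiffBump.tsupport_eq _).subset

/-- The sum of the plateaus around the points of the grid. -/
noncomputable def gridSum : Test := ∑ m : Fin 3 → Fin 4, scaledTest plateau 1 (gridPt m)

theorem scaledTest_one_apply {ψ : R3 → ℝ} (h1 : ContDiff ℝ ∞ ψ)
    (h2 : tsupport ψ ⊆ Metric.closedBall 0 (1 / 4)) (x y : R3) :
    (scaledTest ψ 1 x : R3 → ℝ) y = ∑' k : Fin 3 → ℤ, ψ (y - x + latticeVec k) := by
  rw [scaledTest_apply h1 h2 one_pos]; simp

theorem summable_scaledTest_one {ψ : R3 → ℝ}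
    (h2 : tsupport ψ ⊆ Metric.closedBall 0 (1 / 4)) (x y : R3) :
    Summable fun k : Fin 3 → ℤ => ψ (y - x + latticeVec k) := by
  have : Summable fun k : Fin 3 → ℤ => ((1 : ℝ) ^ 3)⁻¹ * ψ ((1 : ℝ)⁻¹ • (y - x + latticeVec k)) :=
    summable_of_hasFiniteSupport ((locallyFinite_periodization h2 one_pos x).point_finite y)
  simpa using this

theorem gridSum_apply (y : R3) : (gridSum : R3 → ℝ) y =
    ∑ m : Fin 3 → Fin 4, (scaledTest plateau 1 (gridPt m) : R3 → ℝ) y := by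
  simp [gridSum]

/-- Every point is within 1/8 of the grid in each coordinate, hence at distance at most √3/8 < 0.22
from a grid point, where the plateau is one. -/
theorem gridSum_pos (y : R3) : 0 < (gridSum : R3 → ℝ) y := by
  rw [gridSum_apply]
  have hnn : ∀ m : Fin 3 → Fin 4, 0 ≤ (scaledTest plateau 1 (gridPt m) : R3 → ℝ) y := fun m => by
    rw [scaledTest_one_apply plateau.contDiff tsupport_plateau]
    exact tsum_nonneg fun _ => plateau.nonneg
  -- The nearest grid point has index `n`; its residue `m` modulo 4 selects the point in the
  -- fundamental grid and the quotient gives the lattice vector.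
  set n : Fin 3 → ℤ := fun i => round (4 * y i)
  set m : Fin 3 → Fin 4 := fun i => ⟨(n i % 4).toNat, by omega⟩
  set k : Fin 3 → ℤ := fun i => -(n i / 4)
  refine Finset.sum_pos' (fun m _ => hnn m) ⟨m, Finset.mem_univ _, ?_⟩
  rw [scaledTest_one_apply plateau.contDiff tsupport_plateau]
  refine (summable_scaledTest_one tsupport_plateau _ _).tsum_pos (fun _ => plateau.nonneg) k ?_
  have h1 : ∀ i, |(y - gridPt m + latticeVec k) i| ≤ 1 / 8 := by
    intro i
    have h2 : (((m i : ℕ) : ℝ)) = ((n i % 4 : ℤ) : ℝ) := by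
      have : ((n i % 4).toNat : ℤ) = n i % 4 := Int.toNat_of_nonneg (by omega)
      exact_mod_cast this
    have h3 : ((n i % 4 : ℤ) : ℝ) = n i - 4 * ((n i / 4 : ℤ) : ℝ) := by
      have : n i % 4 = n i - 4 * (n i / 4) := by omega
      exact_mod_cast this
    have h4 : (y - gridPt m + latticeVec k) i = (4 * y i - n i) / 4 := by
      simp only [PiLp.add_apply, PiLp.sub_apply, gridPt, latticeVec_apply, h2, h3, k]
      push_cast
      ring
    have h5 := abs_sub_round (4 * y i)
    rw [h4, abs_div, abs_of_pos (by norm_num : (0 : ℝ) < 4)]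
    change |4 * y i - (round (4 * y i) : ℝ)| / 4 ≤ 1 / 8
    linarith
  have h6 : plateau (y - gridPt m + latticeVec k) = 1 := by
    refine plateau.one_of_mem_closedBall ?_
    rw [mem_closedBall_zero_iff, EuclideanSpace.norm_eq]
    change _ ≤ (0.22 : ℝ)
    rw [Real.sqrt_le_left (by norm_num)]
    calc _ ≤ ∑ _i : Fin 3, (1 / 8 : ℝ) ^ 2 := by
          refine Finset.sum_le_sum fun i _ => ?_
          rw [Real.norm_eq_abs]
          have := h1 i
          gcongr
      _ ≤ _ := by simp; norm_num
  rw [h6]; exact one_pos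

/-- A smooth partition of unity subordinate to the grid cuts a test function into 64 profiles of
scale one. -/
theorem test_eq_sum_scaledTest (φ : Test) : φ = ∑ m : Fin 3 → Fin 4, scaledTest
    (fun z => plateau z * ((φ : R3 → ℝ) (z + gridPt m) / (gridSum : R3 → ℝ) (z + gridPt m)))
      1 (gridPt m) := by
  ext y
  have h1 : ∀ m : Fin 3 → Fin 4, (scaledTest (fun z => plateau z * ((φ : R3 → ℝ) (z + gridPt m) /
      (gridSum : R3 → ℝ) (z + gridPt m))) 1 (gridPt m) : R3 → ℝ) y =
      (scaledTest plateau 1 (gridPt m) : R3 → ℝ) y *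
        ((φ : R3 → ℝ) y / (gridSum : R3 → ℝ) y) := by
    intro m
    rw [scaledTest_one_apply plateau.contDiff tsupport_plateau, scaledTest_one_apply]
    · rw [← tsum_mul_right]
      refine tsum_congr fun k => ?_
      have e : y - gridPt m + latticeVec k + gridPt m = y + latticeVec k := by abel
      rw [e, φ.2.2 k y, gridSum.2.2 k y]
    · refine plateau.contDiff.mul (ContDiff.div ?_ ?_ fun z => (gridSum_pos _).ne')
      · exact contDiff_test_add φ _
      · exact contDiff_test_add gridSum _
    · exact (closure_mono (Function.support_mul_subset_left _ _)).trans tsupport_plateau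
  simp only [Submodule.coe_sum, Finset.sum_apply, h1]
  rw [← Finset.sum_mul, ← gridSum_apply, mul_div_cancel₀ _ (gridSum_pos y).ne']

theorem scaledTest_smul {ψ : R3 → ℝ} (h1 : ContDiff ℝ ∞ ψ)
    (h2 : tsupport ψ ⊆ Metric.closedBall 0 (1 / 4)) {l : ℝ} (hl : 0 < l) (x : R3) (c : ℝ) :
    scaledTest (fun w => c * ψ w) l x = c • scaledTest ψ l x := by
  ext y
  have h3 : tsupport (fun w => c * ψ w) ⊆ Metric.closedBall 0 (1 / 4) :=
    (closure_mono (Function.support_mul_subset_right (fun _ => c) _)).trans h2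
  rw [scaledTest_apply (contDiff_const.mul h1) h3 hl]
  change _ = c * (scaledTest ψ l x : R3 → ℝ) y
  rw [scaledTest_apply h1 h2 hl, ← tsum_mul_left]
  exact tsum_congr fun k => by ring

/-- The derivatives of the partition functions are bounded once and for all, so the constant does
not depend on the test function. -/
theorem exists_testBound (r : ℕ) : ∃ C : ℝ, 0 < C ∧ ∀ (φ : Test) (B : ℝ), 0 < B →
    (∀ j ≤ r, ∀ x, ‖iteratedFDeriv ℝ j (φ : R3 → ℝ) x‖ ≤ B) → ∀ m : Fin 3 → Fin 4,
    (fun z => (C * B)⁻¹ * (plateau z * ((φ : R3 → ℝ) (z + gridPt m) /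
      (gridSum : R3 → ℝ) (z + gridPt m)))) ∈ bumps r := by
  have hsm : ∀ m : Fin 3 → Fin 4, ContDiff ℝ ∞
      fun z => plateau z * ((gridSum : R3 → ℝ) (z + gridPt m))⁻¹ := fun m =>
    plateau.contDiff.mul ((contDiff_test_add gridSum _).inv
      fun z => (gridSum_pos _).ne')
  have hsu : ∀ m : Fin 3 → Fin 4, tsupport
      (fun z => plateau z * ((gridSum : R3 → ℝ) (z + gridPt m))⁻¹) ⊆ Metric.closedBall 0 (1 / 4) :=
    fun m => (closure_mono (Function.support_mul_subset_left _ _)).trans tsupport_plateau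
  choose A hA0 hA using fun m => exists_iteratedFDeriv_bound (hsm m)
    (HasCompactSupport.of_support_subset_isCompact
      (isCompact_closedBall (0 : R3) (1 / 4)) ((subset_tsupport _).trans (hsu m))) r
  obtain ⟨S, hS⟩ : ∃ S, ∀ m, A m ≤ S :=
    ⟨∑ m, A m, fun m => Finset.single_le_sum (fun m _ => hA0 m) (Finset.mem_univ m)⟩
  have hS0 : 0 ≤ S := (hA0 0).trans (hS 0)
  refine ⟨(r + 1) * 2 ^ r * S + 1, by positivity, fun φ B hB0 hB m => ?_⟩
  have := mul_mem_bumps (r := r) (hsm m) (b := fun z => (φ : R3 → ℝ) (z + gridPt m)) (B := B)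
    (c := ((r + 1) * 2 ^ r * S + 1) * B)
    (contDiff_test_add φ _) (hsu m) (hA0 m) (hA m) (fun j hj w _ => by
      rw [iteratedFDeriv_comp_add_right]; exact hB j hj _) (by positivity) (by
      have h1 := hS m
      have h2 : ((r : ℝ) + 1) * 2 ^ r * (A m * B) ≤ (r + 1) * 2 ^ r * (S * B) := by gcongr
      nlinarith)
  convert this using 3 with z
  rw [div_eq_mul_inv]; ring

/-- The constant in the bound of a distribution by its Hölder norm. -/
noncomputable def testConst (r : ℕ) : ℝ := 64 * (exists_testBound r).choose

theorem testConst_pos (r : ℕ) : 0 < testConst r :=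
  mul_pos (by norm_num) (exists_testBound r).choose_spec.1

theorem norm_apply_le_of_scaledTest_one {r : ℕ} (X : Dist W) {M : ℝ}
    (hM : ∀ ψ ∈ bumps r, ∀ x, ‖X.1 (scaledTest ψ 1 x)‖ ≤ M) {φ : Test} {B : ℝ} (hB0 : 0 < B)
    (hB : ∀ j ≤ r, ∀ x, ‖iteratedFDeriv ℝ j (φ : R3 → ℝ) x‖ ≤ B) :
    ‖X.1 φ‖ ≤ testConst r * B * M := by
  set C := (exists_testBound r).choose
  obtain ⟨hC0, hC⟩ : 0 < C ∧ _ := (exists_testBound r).choose_spec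
  rw [test_eq_sum_scaledTest φ, map_sum]
  have h1 : ∀ m : Fin 3 → Fin 4, ‖X.1 (scaledTest (fun z => plateau z * ((φ : R3 → ℝ) (z + gridPt m) /
      (gridSum : R3 → ℝ) (z + gridPt m))) 1 (gridPt m))‖ ≤ C * B * M := by
    intro m
    have hb := hC φ B hB0 hB m
    have hpos : 0 < C * B := by positivity
    have e : (fun z => plateau z * ((φ : R3 → ℝ) (z + gridPt m) /
      (gridSum : R3 → ℝ) (z + gridPt m))) = fun z => (C * B) * ((C * B)⁻¹ * (plateau z *
        ((φ : R3 → ℝ) (z + gridPt m) / (gridSum : R3 → ℝ) (z + gridPt m)))) := by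
      ext z; rw [mul_inv_cancel_left₀ hpos.ne']
    rw [e, scaledTest_smul hb.1 hb.2.1 one_pos, map_smul, norm_smul, Real.norm_of_nonneg hpos.le]
    exact mul_le_mul_of_nonneg_left (hM _ hb _) hpos.le
  refine (norm_sum_le _ _).trans ((Finset.sum_le_sum fun m _ => h1 m).trans (le_of_eq ?_))
  have e : testConst r = 64 * C := rfl
  rw [Finset.sum_const, e]
  simp
  ring

/-- A distribution is controlled by its Hölder norm. -/
theorem norm_apply_le_of_holderNorm {α : ℝ} (hα : α ≤ 0) {X : Dist W} {M : ℝ} (hM0 : 0 ≤ M)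
    (hM : holderNorm α X ≤ ENNReal.ofReal M) {φ : Test} {B : ℝ} (hB0 : 0 < B)
    (hB : ∀ j ≤ rIdx α, ∀ x, ‖iteratedFDeriv ℝ j (φ : R3 → ℝ) x‖ ≤ B) :
    ‖X.1 φ‖ ≤ (testConst (rIdx α) + 1) * B * M := by
  rcases hα.lt_or_eq with h1 | rfl
  · have h2 : ‖X.1 φ‖ ≤ testConst (rIdx α) * B * M := by
      refine norm_apply_le_of_scaledTest_one X (fun ψ hψ x => ?_) hB0 hB
      rw [holderNorm, if_pos h1] at hM
      have h3 : ENNReal.ofReal (1 ^ (-α)) * ‖X.1 (scaledTest ψ 1 x)‖ₑ ≤ negHolderNorm α X :=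
        (le_iSup₂_of_le 1 ⟨one_pos, le_rfl⟩ (le_iSup₂_of_le ψ hψ (le_iSup_of_le x le_rfl)))
      have h4 := h3.trans hM
      rwa [Real.one_rpow, ENNReal.ofReal_one, one_mul, ← ofReal_norm,
        ENNReal.ofReal_le_ofReal_iff hM0] at h4
    nlinarith [mul_nonneg hB0.le hM0]
  · rw [holderNorm, if_neg (lt_irrefl _), if_pos rfl] at hM
    have h2 : ‖X.1 φ‖ ≤ B * M := by
      -- The infimum defining the norm need not be attained, so a density is extracted only for
      -- bounds strictly above `M`.
      refine le_of_forall_gt_imp_ge_of_dense fun a ha => ?_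
      have ha' : M < a / B := by rwa [lt_div_iff₀' hB0]
      have h3 : supNorm X < ENNReal.ofReal (a / B) := hM.trans_lt
        ((ENNReal.ofReal_lt_ofReal_iff (hM0.trans_lt ha')).2 ha')
      simp only [supNorm, iInf_lt_iff] at h3
      obtain ⟨f, hf, hfX, hlt⟩ := h3
      rw [← hfX, ofFun_apply (hf.integrable le_top)]
      have h4 : ∀ᵐ x ∂volume.restrict cube, ‖f x‖ ≤ a / B := by
        have h2 := ae_le_eLpNormEssSup (f := f) (μ := volume.restrict cube)
        filter_upwards [h2] with x hx
        rw [eLpNorm_exponent_top] at hlt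
        have := hx.trans hlt.le
        rwa [← ofReal_norm, ENNReal.ofReal_le_ofReal_iff (hM0.trans ha'.le)] at this
      have h5 : ∀ᵐ x ∂volume.restrict cube, ‖(φ : R3 → ℝ) x • f x‖ ≤ a := by
        filter_upwards [h4] with x hx
        have h6 : ‖(φ : R3 → ℝ) x‖ ≤ B := by simpa using hB 0 (Nat.zero_le _) x
        rw [norm_smul]
        calc _ ≤ B * (a / B) := by gcongr
          _ = a := by field_simp
      have := norm_integral_le_of_norm_le_const h5
      simpa using this
    have := testConst_pos (rIdx 0)
    nlinarith [mul_nonneg hB0.le hM0, mul_nonneg this.le (mul_nonneg hB0.le hM0)]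

end YMH

namespace YMH

/-! ### Fourier series -/

/-- Products of absolutely summable series, splitting off the first coordinate. Summability of the
norms is part of the conclusion because the induction needs it. -/
theorem hasSum_prod_pi {R : Type*} [NormedCommRing R] [CompleteSpace R] (n : ℕ)
    (a : Fin n → ℤ → R) (s : Fin n → R) (hs : ∀ i, HasSum (a i) (s i))
    (hn : ∀ i, Summable fun k => ‖a i k‖) :
    HasSum (fun k : Fin n → ℤ => ∏ i, a i (k i)) (∏ i, s i) ∧
      Summable fun k : Fin n → ℤ => ‖∏ i, a i (k i)‖ := by
  induction n with
  | zero =>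
    constructor
    · simp only [Finset.univ_eq_empty, Finset.prod_empty]
      convert hasSum_unique (fun _ : Fin 0 → ℤ => (1 : R))
    · exact Summable.of_finite
  | succ n ih =>
    obtain ⟨ih1, ih2⟩ := ih (fun i => a i.succ) (fun i => s i.succ)
      (fun i => hs _) (fun i => hn _)
    have h1 := summable_mul_of_summable_norm (hn 0) ih2
    have h2 := (hs 0).mul ih1 h1
    have h3 := (hn 0).mul_norm ih2
    have he : ∀ x : ℤ × (Fin n → ℤ), ∏ i, a i (Fin.consEquiv (fun _ : Fin (n + 1) => ℤ) x i) =
        a 0 x.1 * ∏ i : Fin n, a i.succ (x.2 i) := fun x => by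
      rw [Fin.prod_univ_succ]; rfl
    constructor
    · rw [← (Fin.consEquiv (fun _ : Fin (n + 1) => ℤ)).hasSum_iff, Fin.prod_univ_succ]
      have h4 : HasSum (fun x => ∏ i, a i (Fin.consEquiv (fun _ : Fin (n + 1) => ℤ) x i))
          (s 0 * ∏ i : Fin n, s i.succ) := by
        rw [funext he]
        exact h2
      exact h4
    · rw [← (Fin.consEquiv (fun _ : Fin (n + 1) => ℤ)).summable_iff]
      exact h3.congr fun x => congrArg norm (he x).symm

/-- The eigenvalue `4π²|k|²` of the Fourier mode `k`. -/
noncomputable def eig (k : Fin 3 → ℤ) : ℝ := 4 * Real.pi ^ 2 * ∑ i, (k i : ℝ) ^ 2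

theorem eig_eq (k : Fin 3 → ℤ) : eig k = (2 * Real.pi * ‖latticeVec k‖) ^ 2 := by
  rw [eig, mul_pow, EuclideanSpace.norm_sq_eq, mul_pow]
  simp only [latticeVec_apply, Real.norm_eq_abs, sq_abs]
  ring

theorem summable_exp_neg_eig {t : ℝ} (ht : 0 < t) : Summable fun k => Real.exp (-(eig k * t)) := by
  have h1 : Summable fun n : ℤ => ‖Real.exp (-(4 * Real.pi ^ 2 * (n : ℝ) ^ 2 * t))‖ := by
    have := (HurwitzZeta.hasSum_int_evenKernel 0 (t := 4 * Real.pi * t) (by positivity)).summable.norm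
    refine this.congr fun n => ?_
    congr 2
    ring
  have h2 := (hasSum_prod_pi 3 (fun _ n => Real.exp (-(4 * Real.pi ^ 2 * (n : ℝ) ^ 2 * t))) _
    (fun _ => h1.of_norm.hasSum) (fun _ => h1)).1.summable
  refine h2.congr fun k => ?_
  rw [← Real.exp_sum]
  congr 1
  rw [eig, Finset.sum_neg_distrib, Finset.mul_sum, Finset.sum_mul]

/-- Half of the Gaussian factor absorbs the polynomial, by (r t - 1)² ≥ 0, and the other half is
summable. -/
theorem summable_exp_neg_eig_mul_pow {t : ℝ} (ht : 0 < t) (N : ℕ) :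
    Summable fun k => Real.exp (-(eig k * t)) * (1 + 2 * Real.pi * ‖latticeVec k‖) ^ N := by
  have hb : ∀ r : ℝ, 0 ≤ r → Real.exp (-(r ^ 2 * (t / 2))) * (1 + r) ^ N ≤
      N.factorial * Real.exp (1 + 1 / (2 * t)) := by
    intro r hr
    have h1 := Real.pow_div_factorial_le_exp (1 + r) (by linarith) N
    rw [div_le_iff₀' (by positivity)] at h1
    have h2 : -(r ^ 2 * (t / 2)) + (1 + r) ≤ 1 + 1 / (2 * t) := by
      have : 0 ≤ (r * t - 1) ^ 2 / (2 * t) := by positivity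
      have e : (r * t - 1) ^ 2 / (2 * t) = r ^ 2 * (t / 2) - r + 1 / (2 * t) := by
        field_simp; ring
      linarith
    calc _ ≤ Real.exp (-(r ^ 2 * (t / 2))) * (N.factorial * Real.exp (1 + r)) :=
          mul_le_mul_of_nonneg_left h1 (Real.exp_pos _).le
      _ = N.factorial * Real.exp (-(r ^ 2 * (t / 2)) + (1 + r)) := by
          rw [Real.exp_add (-(r ^ 2 * (t / 2)))]; ring
      _ ≤ _ := mul_le_mul_of_nonneg_left (Real.exp_le_exp.2 h2) (by positivity)
  refine Summable.of_nonneg_of_le (fun k => by positivity) (fun k => ?_)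
    ((summable_exp_neg_eig (half_pos ht)).mul_right (N.factorial * Real.exp (1 + 1 / (2 * t))))
  have := hb (2 * Real.pi * ‖latticeVec k‖) (by positivity)
  rw [← eig_eq] at this
  calc _ = Real.exp (-(eig k * (t / 2))) * (Real.exp (-(eig k * (t / 2))) *
        (1 + 2 * Real.pi * ‖latticeVec k‖) ^ N) := by
        rw [← mul_assoc, ← Real.exp_add]; congr 2; ring
    _ ≤ _ := mul_le_mul_of_nonneg_left this (Real.exp_pos _).le

theorem abs_iteratedDeriv_cos_le_one (n : ℕ) (x : ℝ) : |iteratedDeriv n Real.cos x| ≤ 1 := by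
  have : ∀ n : ℕ, (∀ x, |iteratedDeriv n Real.cos x| ≤ 1) ∧ ∀ x, |iteratedDeriv n Real.sin x| ≤ 1 := by
    intro n
    induction n with
    | zero => simp [Real.abs_cos_le_one, Real.abs_sin_le_one]
    | succ n ih =>
      constructor
      · intro x
        rw [Real.iteratedDeriv_add_one_cos, Pi.neg_apply, abs_neg]; exact ih.2 x
      · intro x
        rw [Real.iteratedDeriv_add_one_sin]; exact ih.1 x
  exact (this n).1 x

theorem cosTest_apply (k : Fin 3 → ℤ) (x y : R3) : (cosTest k x : R3 → ℝ) y =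
    Real.cos (2 * Real.pi * inner ℝ (latticeVec k) x - 2 * Real.pi * inner ℝ (latticeVec k) y) := by
  change Real.cos _ = _
  congr 1
  simp only [PiLp.inner_apply, latticeVec_apply, RCLike.inner_apply, conj_trivial]
  rw [← mul_sub, ← Finset.sum_sub_distrib]
  congr 1
  exact Finset.sum_congr rfl fun i _ => by ring

theorem norm_iteratedFDeriv_cosTest_le (k : Fin 3 → ℤ) (x : R3) (n : ℕ) (y : R3) :
    ‖iteratedFDeriv ℝ n (cosTest k x : R3 → ℝ) y‖ ≤
      n.factorial * (1 + 2 * Real.pi * ‖latticeVec k‖) ^ n := by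
  set A : R3 →L[ℝ] ℝ := (-(2 * Real.pi)) • innerSL ℝ (latticeVec k) with hA
  set c := 2 * Real.pi * inner ℝ (latticeVec k) x
  have e : (cosTest k x : R3 → ℝ) = Real.cos ∘ fun y => A y + c := by
    ext y
    rw [cosTest_apply]
    simp only [Function.comp_apply, hA, _root_.smul_apply, innerSL_apply_apply, smul_eq_mul]
    congr 1; ring
  have hAn : ‖A‖ ≤ 2 * Real.pi * ‖latticeVec k‖ := by
    rw [hA, norm_smul, innerSL_apply_norm, norm_neg, Real.norm_of_nonneg (by positivity)]
  have hf : fderiv ℝ (fun y => A y + c) = fun _ => A := by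
    ext1 y; rw [fderiv_add_const, A.fderiv]
  rw [e]
  have := norm_iteratedFDeriv_comp_le (𝕜 := ℝ) (N := ∞) (n := n) (C := 1)
    (D := 1 + 2 * Real.pi * ‖latticeVec k‖)
    Real.contDiff_cos (f := fun y : R3 => A y + c) (by fun_prop) (by exact_mod_cast le_top) y
    (fun i _ => by
      rw [norm_iteratedFDeriv_eq_norm_iteratedDeriv]; exact abs_iteratedDeriv_cos_le_one i _)
    (fun i hi _ => by
      obtain ⟨j, rfl⟩ : ∃ j, i = j + 1 := ⟨i - 1, by omega⟩
      rw [← norm_iteratedFDeriv_fderiv, hf]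
      rcases Nat.eq_zero_or_pos j with rfl | hj
      · rw [norm_iteratedFDeriv_zero, zero_add, pow_one]; linarith
      · rw [iteratedFDeriv_const_of_ne (by omega)]
        simp only [Pi.zero_apply, norm_zero]; positivity)
  simpa using this

theorem iteratedFDeriv_cosTest_bound (k : Fin 3 → ℤ) (x : R3) (N : ℕ) : ∀ j ≤ N, ∀ y,
    ‖iteratedFDeriv ℝ j (cosTest k x : R3 → ℝ) y‖ ≤
      N.factorial * (1 + 2 * Real.pi * ‖latticeVec k‖) ^ N := by
  intro j hj y
  refine (norm_iteratedFDeriv_cosTest_le k x j y).trans ?_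
  have : (1 : ℝ) ≤ 1 + 2 * Real.pi * ‖latticeVec k‖ := by
    have : 0 ≤ 2 * Real.pi * ‖latticeVec k‖ := by positivity
    linarith
  exact mul_le_mul (by exact_mod_cast Nat.factorial_le hj) (pow_le_pow_right₀ this hj)
    (by positivity) (by positivity)

variable {W : Type*} [NormedAddCommGroup W] [NormedSpace ℝ W]

/-- A distribution has finite order, so its Fourier modes grow at most polynomially, uniformly in
the base point. -/
theorem exists_mode_bound (X : Dist W) : ∃ (N : ℕ) (C : ℝ), 0 ≤ C ∧ ∀ k x,
    ‖X.1 (cosTest k x)‖ ≤ C * (1 + 2 * Real.pi * ‖latticeVec k‖) ^ N := by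
  obtain ⟨N, C, hC⟩ := X.2
  refine ⟨N, |C| * N.factorial, by positivity, fun k x => ?_⟩
  refine (hC _ _ (iteratedFDeriv_cosTest_bound k x N)).trans ?_
  rw [mul_assoc |C|]
  exact mul_le_mul_of_nonneg_right (le_abs_self C) (by positivity)

theorem heat_eq (t : ℝ) (X : Dist W) (x : R3) :
    heat t X x = ∑' k, Real.exp (-(eig k * t)) • X.1 (cosTest k x) := rfl

theorem summable_heat_norm (X : Dist W) {t : ℝ} (ht : 0 < t) (x : R3) :
    Summable fun k => ‖Real.exp (-(eig k * t)) • X.1 (cosTest k x)‖ := by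
  obtain ⟨N, C, _, hC⟩ := exists_mode_bound X
  refine Summable.of_nonneg_of_le (fun _ => norm_nonneg _) (fun k => ?_)
    ((summable_exp_neg_eig_mul_pow ht N).mul_left C)
  rw [norm_smul, Real.norm_of_nonneg (Real.exp_pos _).le]
  calc _ ≤ Real.exp (-(eig k * t)) * (C * (1 + 2 * Real.pi * ‖latticeVec k‖) ^ N) := by
        exact mul_le_mul_of_nonneg_left (hC k x) (Real.exp_pos _).le
    _ = _ := by ring

theorem heat_sub [CompleteSpace W] (X Y : Dist W) {t : ℝ} (ht : 0 < t) (x : R3) :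
    heat t (X - Y) x = heat t X x - heat t Y x := by
  simp only [heat_eq]
  rw [← (summable_heat_norm X ht x).of_norm.tsum_sub (summable_heat_norm Y ht x).of_norm]
  exact tsum_congr fun k => by rw [← smul_sub]; rfl

theorem cosTest_add_latticeVec (k m : Fin 3 → ℤ) (x : R3) :
    cosTest k (x + latticeVec m) = cosTest k x := by
  ext y
  rw [cosTest_apply, cosTest_apply, inner_add_right]
  have : inner ℝ (latticeVec k) (latticeVec m) = ((∑ i, k i * m i : ℤ) : ℝ) := by
    simp [PiLp.inner_apply, mul_comm]
  rw [this, mul_add, add_sub_right_comm, mul_comm (2 * Real.pi) ((_ : ℤ) : ℝ)]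
  exact Real.cos_add_int_mul_two_pi _ _

theorem periodic_heat (t : ℝ) (X : Dist W) : Periodic (heat t X) := fun m x => by
  simp only [heat_eq, cosTest_add_latticeVec]

/-- The test function `y ↦ sin (2π k · y)`. -/
noncomputable def sinTest (k : Fin 3 → ℤ) : Test :=
  ⟨fun y => Real.sin (2 * Real.pi * inner ℝ (latticeVec k) y), by
    constructor
    · exact Real.contDiff_sin.comp
        (contDiff_const.mul (innerSL ℝ (latticeVec k)).contDiff)
    · intro m y
      have : inner ℝ (latticeVec k) (latticeVec m) = ((∑ i, k i * m i : ℤ) : ℝ) := by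
        simp [PiLp.inner_apply, mul_comm]
      change Real.sin _ = Real.sin _
      rw [inner_add_right, this, mul_add, mul_comm (2 * Real.pi) ((_ : ℤ) : ℝ)]
      exact Real.sin_add_int_mul_two_pi _ _⟩

theorem apply_cosTest (X : Dist W) (k : Fin 3 → ℤ) (x : R3) : X.1 (cosTest k x) =
    Real.cos (2 * Real.pi * inner ℝ (latticeVec k) x) • X.1 (cosTest k 0) +
      Real.sin (2 * Real.pi * inner ℝ (latticeVec k) x) • X.1 (sinTest k) := by
  rw [← map_smul, ← map_smul, ← map_add]
  congr 1
  ext y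
  change _ = _ * (cosTest k 0 : R3 → ℝ) y + _ * Real.sin (2 * Real.pi * inner ℝ (latticeVec k) y)
  rw [cosTest_apply, cosTest_apply, Real.cos_sub]
  simp

/-- As a function of the base point a mode is a combination of a cosine and a sine. Writing the sine
as a shifted cosine, both are multiplied by the same Gaussian factor. -/
theorem hs_mode [CompleteSpace W] (X : Dist W) (k : Fin 3 → ℤ) {t : ℝ} (ht : 0 ≤ t) (x : R3) :
    hs t (fun y => X.1 (cosTest k y)) x = Real.exp (-(eig k * t)) • X.1 (cosTest k x) := by
  set θ : R3 := (2 * Real.pi * √t) • latticeVec k with hθ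
  have hn : -‖θ‖ ^ 2 = -(eig k * t) := by
    rw [hθ, norm_smul, Real.norm_of_nonneg (by positivity), eig_eq, mul_pow, mul_pow, mul_pow,
      mul_pow, Real.sq_sqrt ht]
    ring
  have e1 : ∀ w, 2 * Real.pi * inner ℝ (latticeVec k) (x + √t • w) =
      2 * Real.pi * inner ℝ (latticeVec k) x + inner ℝ θ w := by
    intro w
    rw [hθ, inner_add_right, inner_smul_right, real_inner_smul_left]; ring
  have hi : ∀ a : ℝ, Integrable fun w => gk w * Real.cos (a + inner ℝ θ w) := fun a => by
    have := integrable_gk.smul_bdd (f := fun w => Real.cos (a + inner ℝ θ w)) 1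
      (Continuous.aestronglyMeasurable (by fun_prop))
      (Eventually.of_forall fun w => Real.abs_cos_le_one _)
    exact this
  have e2 : ∀ w, gk w • X.1 (cosTest k (x + √t • w)) =
      (gk w * Real.cos (2 * Real.pi * inner ℝ (latticeVec k) x + inner ℝ θ w)) •
        X.1 (cosTest k 0) +
      (gk w * Real.cos ((2 * Real.pi * inner ℝ (latticeVec k) x - Real.pi / 2) + inner ℝ θ w)) •
        X.1 (sinTest k) := by
    intro w
    rw [apply_cosTest, e1, smul_add, smul_smul, smul_smul, sub_add_eq_add_sub,
      Real.cos_sub_pi_div_two]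
  rw [hs, integral_congr_ae (Eventually.of_forall e2),
    integral_add ((hi _).smul_const _) ((hi _).smul_const _), integral_smul_const,
    integral_smul_const, integral_gk_mul_cos, integral_gk_mul_cos, Real.cos_sub_pi_div_two, hn,
    mul_smul, mul_smul, ← smul_add, ← apply_cosTest]

theorem continuous_apply_cosTest (X : Dist W) (k : Fin 3 → ℤ) :
    Continuous fun x => X.1 (cosTest k x) := by
  have h : Continuous fun x : R3 => 2 * Real.pi * inner ℝ (latticeVec k) x :=
    continuous_const.mul (innerSL ℝ (latticeVec k)).continuous
  rw [funext (apply_cosTest X k)]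
  exact ((Real.continuous_cos.comp h).smul continuous_const).add
    ((Real.continuous_sin.comp h).smul continuous_const)

theorem continuous_heat [CompleteSpace W] (X : Dist W) {t : ℝ} (ht : 0 < t) : Continuous (heat t X) := by
  obtain ⟨N, C, _, hC⟩ := exists_mode_bound X
  refine continuous_tsum (fun k => (continuous_apply_cosTest X k).const_smul
    (Real.exp (-(eig k * t)))) ((summable_exp_neg_eig_mul_pow ht N).mul_left C) fun k x => ?_
  rw [norm_smul, Real.norm_of_nonneg (Real.exp_pos _).le]
  calc _ ≤ Real.exp (-(eig k * t)) * (C * (1 + 2 * Real.pi * ‖latticeVec k‖) ^ N) := by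
        exact mul_le_mul_of_nonneg_left (hC k x) (Real.exp_pos _).le
    _ = _ := by ring

/-- The semigroup property of the heat flow. -/
theorem hs_heat [CompleteSpace W] (X : Dist W) {s t : ℝ} (hs0 : 0 ≤ s) (ht : 0 < t) (x : R3) :
    hs s (heat t X) x = heat (s + t) X x := by
  obtain ⟨N, C, hC0, hC⟩ := exists_mode_bound X
  have hb : ∀ k w, ‖gk w • (Real.exp (-(eig k * t)) • X.1 (cosTest k (x + √s • w)))‖ ≤
      gk w * (C * (Real.exp (-(eig k * t)) * (1 + 2 * Real.pi * ‖latticeVec k‖) ^ N)) := by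
    intro k w
    rw [norm_smul, norm_smul, Real.norm_of_nonneg (gk_nonneg w), Real.norm_of_nonneg (Real.exp_pos _).le]
    have := gk_nonneg w
    calc _ ≤ gk w * (Real.exp (-(eig k * t)) * (C * (1 + 2 * Real.pi * ‖latticeVec k‖) ^ N)) := by
          exact mul_le_mul_of_nonneg_left
            (mul_le_mul_of_nonneg_left (hC k _) (Real.exp_pos _).le) this
      _ = _ := by ring
  have hi : ∀ k, Integrable fun w => gk w • (Real.exp (-(eig k * t)) • X.1 (cosTest k (x + √s • w))) := by
    intro k
    refine (integrable_gk.mul_const _).mono' (Continuous.aestronglyMeasurable ?_)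
      (Eventually.of_forall (hb k))
    exact continuous_gk.smul (((continuous_apply_cosTest X k).comp
      (continuous_const.add (continuous_id.const_smul (√s)))).const_smul _)
  have h1 : hs s (heat t X) x =
      ∫ w, ∑' k, gk w • (Real.exp (-(eig k * t)) • X.1 (cosTest k (x + √s • w))) := by
    refine integral_congr_ae (Eventually.of_forall fun w => ?_)
    simp only [heat_eq]
    rw [(summable_heat_norm X ht _).of_norm.tsum_const_smul]
  rw [h1, ← integral_tsum_of_summable_integral_norm hi, heat_eq]
  · refine tsum_congr fun k => ?_
    have h2 := hs_mode X k hs0 x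
    have h3 := hs_smul (Real.exp (-(eig k * t))) (fun y => X.1 (cosTest k y)) s x
    rw [h2, smul_smul, ← Real.exp_add] at h3
    rw [show -(eig k * (s + t)) = -(eig k * t) + -(eig k * s) by ring, ← h3]
    rfl
  · refine Summable.of_nonneg_of_le (fun k => integral_nonneg fun w => norm_nonneg _) (fun k => ?_)
      ((summable_exp_neg_eig_mul_pow ht N).mul_left C)
    refine (integral_mono (hi k).norm (integrable_gk.mul_const _) (hb k)).trans (le_of_eq ?_)
    rw [integral_mul_const, integral_gk, one_mul]

end YMH

/-! ### Poisson summation and smoothing estimates for the heat flow. -/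

namespace YMH

/-! ### The Gaussian and the Fourier description of the heat flow agree -/

theorem hasSum_congr_fun {ι A : Type*} [AddCommMonoid A] [TopologicalSpace A] {f g : ι → A} {a : A}
    (h : ∀ i, f i = g i) : HasSum f a ↔ HasSum g a := by
  rw [funext h]

/-- Poisson summation for the heat kernel. The kernel factorises over the coordinates, and in each
of them the identity is the functional equation of the Jacobi theta function. -/
theorem exists_hasSum_poisson {t : ℝ} (ht : 0 < t) (u : R3) : ∃ S : ℝ,
    HasSum (fun k => Real.exp (-(eig k * t)) * Real.cos (2 * Real.pi * inner ℝ (latticeVec k) u)) S ∧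
    HasSum (fun k => (√t ^ 3)⁻¹ * gk ((√t)⁻¹ • (u + latticeVec k))) S := by
  have hτ : 0 < 4 * Real.pi * t := by positivity
  set c : Fin 3 → ℝ := fun i => HurwitzZeta.cosKernel (u i) (4 * Real.pi * t) with hc
  have h1 := fun i : Fin 3 => HurwitzZeta.hasSum_int_cosKernel (u i) hτ
  have h1' := (hasSum_prod_pi 3 (fun i n => Complex.exp (2 * Real.pi * Complex.I * u i * n) *
    Real.exp (-Real.pi * n ^ 2 * (4 * Real.pi * t))) _ h1
    (fun i => (h1 i).summable.norm)).1
  have h2 := fun i : Fin 3 => HurwitzZeta.hasSum_int_evenKernel (u i) (one_div_pos.2 hτ)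
  have h2' := (hasSum_prod_pi 3 (fun i n => Real.exp (-Real.pi * (n + u i) ^ 2 *
    (1 / (4 * Real.pi * t)))) _ h2 (fun i => (h2 i).summable.norm)).1
  refine ⟨∏ i, c i, ?_, ?_⟩
  · have h3 := Complex.hasSum_re h1'
    rw [← Complex.ofReal_prod, Complex.ofReal_re] at h3
    convert h3 using 1
    ext k
    have e : ∏ i, (Complex.exp (2 * Real.pi * Complex.I * u i * k i) *
        Real.exp (-Real.pi * (k i : ℝ) ^ 2 * (4 * Real.pi * t))) =
        Complex.exp ((2 * Real.pi * inner ℝ (latticeVec k) u : ℝ) * Complex.I) *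
          (Real.exp (-(eig k * t)) : ℝ) := by
      rw [Finset.prod_mul_distrib, ← Complex.exp_sum, ← Complex.ofReal_prod, ← Real.exp_sum]
      congr 3
      · simp only [PiLp.inner_apply, latticeVec_apply, RCLike.inner_apply, conj_trivial]
        push_cast
        rw [Finset.mul_sum, Finset.sum_mul]
        exact Finset.sum_congr rfl fun i _ => by ring
      · rw [eig, Finset.mul_sum, Finset.sum_mul, ← Finset.sum_neg_distrib]
        exact Finset.sum_congr rfl fun i _ => by ring
    rw [e, Complex.re_mul_ofReal, Complex.exp_ofReal_mul_I_re, mul_comm]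
  · have h4 : ∏ i, HurwitzZeta.evenKernel (u i) (1 / (4 * Real.pi * t)) =
        (4 * Real.pi * t) ^ (3 / 2 : ℝ) * ∏ i, c i := by
      have : ∀ i : Fin 3, HurwitzZeta.evenKernel (u i) (1 / (4 * Real.pi * t)) =
          (4 * Real.pi * t) ^ (1 / 2 : ℝ) * c i := fun i => by
        rw [HurwitzZeta.evenKernel_functional_equation, one_div_one_div,
          Real.div_rpow zero_le_one hτ.le, Real.one_rpow, one_div_one_div]
      simp_rw [this]
      rw [Finset.prod_mul_distrib, Finset.prod_const, Finset.card_univ, Fintype.card_fin,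
        ← Real.rpow_natCast, ← Real.rpow_mul hτ.le]
      norm_num
    rw [h4] at h2'
    have h5 := h2'.mul_left (((4 * Real.pi * t) ^ (3 / 2 : ℝ))⁻¹)
    rw [inv_mul_cancel_left₀ (by positivity)] at h5
    refine (hasSum_congr_fun ?_).2 h5
    intro k
    have e1 : √t ^ 3 = t ^ (3 / 2 : ℝ) := by
      rw [Real.sqrt_eq_rpow, ← Real.rpow_natCast, ← Real.rpow_mul ht.le]; norm_num
    change (√t ^ 3)⁻¹ * (((4 * Real.pi) ^ (3 / 2 : ℝ))⁻¹ *
      Real.exp (-(1 / 4) * ‖(√t)⁻¹ • (u + latticeVec k)‖ ^ 2)) = _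
    rw [← mul_assoc, e1, ← mul_inv, ← Real.mul_rpow ht.le (by positivity), ← Real.exp_sum,
      mul_comm t]
    congr 2
    rw [norm_smul, mul_pow, norm_inv, inv_pow, Real.norm_of_nonneg (Real.sqrt_nonneg t),
      Real.sq_sqrt ht.le, EuclideanSpace.norm_sq_eq, Finset.mul_sum, Finset.mul_sum]
    refine Finset.sum_congr rfl fun i _ => ?_
    rw [Real.norm_eq_abs, sq_abs, PiLp.add_apply, latticeVec_apply]
    field_simp
    ring

variable {W : Type*} [NormedAddCommGroup W] [NormedSpace ℝ W]

/-- The Fourier series under the integral over the torus and the periodised Gaussian obtained by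
unfolding have the same sum at every point. -/
theorem heat_ofFun [CompleteSpace W] {f : R3 → W} (hf : Continuous f) (hp : Periodic f) {t : ℝ}
    (ht : 0 < t) (x : R3) : heat t (ofFun f) x = hs t f x := by
  obtain ⟨M, hM0, hM⟩ := hp.exists_bound hf
  set F : R3 → W := fun y => (√t ^ 3)⁻¹ • gk ((√t)⁻¹ • (y - x)) • f y with hF
  have hFi : Integrable F := by
    refine Integrable.smul _ ?_
    have h1 : Integrable fun y : R3 => gk ((√t)⁻¹ • (y - x)) :=
      (integrable_gk.comp_smul (inv_ne_zero (Real.sqrt_pos.2 ht).ne')).comp_sub_right x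
    exact h1.smul_bdd M hf.aestronglyMeasurable (Eventually.of_forall hM)
  have hce : ∀ k y, (cosTest k x : R3 → ℝ) y =
      Real.cos (2 * Real.pi * inner ℝ (latticeVec k) (y - x)) := by
    intro k y
    rw [cosTest_apply, ← mul_sub, ← inner_sub_right, ← neg_sub y x, inner_neg_right, mul_neg,
      Real.cos_neg]
  have hic := integrableOn_cube hf
  have hcont : ∀ k, Continuous fun y => Real.exp (-(eig k * t)) •
      ((cosTest k x : R3 → ℝ) y • f y) := fun k =>
    ((cosTest k x).2.1.continuous.smul hf).const_smul _
  have hi : ∀ k, IntegrableOn (fun y => Real.exp (-(eig k * t)) •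
      ((cosTest k x : R3 → ℝ) y • f y)) cube := fun k => integrableOn_cube (hcont k)
  have hb : ∀ k y, ‖Real.exp (-(eig k * t)) • ((cosTest k x : R3 → ℝ) y • f y)‖ ≤
      Real.exp (-(eig k * t)) * M := by
    intro k y
    rw [norm_smul, norm_smul, Real.norm_of_nonneg (Real.exp_pos _).le, hce]
    refine mul_le_mul_of_nonneg_left ?_ (Real.exp_pos _).le
    calc _ ≤ 1 * M := mul_le_mul (Real.abs_cos_le_one _) (hM y) (norm_nonneg _) zero_le_one
      _ = M := one_mul M
  rw [heat_eq]
  have h1 : ∀ k, Real.exp (-(eig k * t)) • (ofFun f).1 (cosTest k x) =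
      ∫ y in cube, Real.exp (-(eig k * t)) • ((cosTest k x : R3 → ℝ) y • f y) := fun k => by
    rw [ofFun_apply hic, ← integral_smul]
  simp_rw [h1]
  rw [integral_tsum_of_summable_integral_norm hi]
  · rw [hs_eq_integral_scaled ht, ← integral_smul, ← integral_cube_tsum hFi]
    refine integral_congr_ae (Eventually.of_forall fun y => ?_)
    obtain ⟨S, hS1, hS2⟩ := exists_hasSum_poisson ht (y - x)
    have h2 : HasSum (fun k => Real.exp (-(eig k * t)) • ((cosTest k x : R3 → ℝ) y • f y))
        (S • f y) := by
      have := hS1.smul_const (f y)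
      simpa only [mul_smul, hce] using this
    have h3 : HasSum (fun k => F (y + latticeVec k)) (S • f y) := by
      have := hS2.smul_const (f y)
      convert this using 1
      ext1 k
      simp only [hF, hp k y, mul_smul, add_sub_right_comm]
    simp only
    rw [h2.tsum_eq, h3.tsum_eq]
  · refine Summable.of_nonneg_of_le (fun k => integral_nonneg fun w => norm_nonneg _) (fun k => ?_)
      ((summable_exp_neg_eig ht).mul_right M)
    have := integral_mono (μ := volume.restrict cube) (hi k).norm
      (integrable_const _) (hb k)
    simpa [Measure.real, volume_cube] using this

theorem heat_zero (t : ℝ) (x : R3) : heat t (0 : Dist W) x = 0 := by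
  simp [heat_eq]

/-! ### Bounds for the heat flow in terms of Hölder norms -/

/-- The `j`-th derivative of the Gaussian kernel. -/
noncomputable def gkD (j : Fin 3) : SchwartzMap R3 ℝ :=
  LineDeriv.lineDerivOp (EuclideanSpace.single j (1 : ℝ)) gkS

theorem gkD_apply (j : Fin 3) (w : R3) : gkD j w = fderiv ℝ gk w (EuclideanSpace.single j 1) := by
  rw [gkD, SchwartzMap.lineDerivOp_apply_eq_fderiv]; rfl

theorem norm_le_sum_single (A : R3 →L[ℝ] W) :
    ‖A‖ ≤ ∑ j, ‖A (EuclideanSpace.single j 1)‖ := by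
  refine A.opNorm_le_bound (by positivity) fun v => ?_
  have hv : v = ∑ j, v j • EuclideanSpace.single j (1 : ℝ) := by
    ext i; simp [Finset.sum_apply, Pi.single_apply]
  conv_lhs => rw [hv, map_sum]
  rw [Finset.sum_mul]
  refine norm_sum_le_of_le _ fun j _ => ?_
  rw [map_smul, norm_smul, mul_comm]
  exact mul_le_mul_of_nonneg_left (PiLp.norm_apply_le v j) (norm_nonneg _)

/-- The constant in the smoothing estimates for the heat flow. -/
noncomputable def heatConst (α : ℝ) : ℝ :=
  avgConst gkS (rIdx α) + ∑ j, avgConst (gkD j) (rIdx α)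

theorem heatConst_nonneg (α : ℝ) : 0 ≤ heatConst α :=
  add_nonneg (avgConst_nonneg _ _) (Finset.sum_nonneg fun _ _ => avgConst_nonneg _ _)

theorem sqrt_rpow_eq {t : ℝ} (ht : 0 ≤ t) (α : ℝ) : √t ^ α = t ^ (α / 2) := by
  rw [Real.sqrt_eq_rpow, ← Real.rpow_mul ht]; congr 1; ring

/-- A Gaussian average at time `t` is an average against one fixed Schwartz function at scale `√t`,
and (√t)^α = t^{α/2}. Times above one are excluded because the norm tests only scales up to one. -/
theorem norm_hs_le_of_HB [CompleteSpace W] {f : R3 → W} (hf : Continuous f) {B : ℝ}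
    (hB : ∀ x, ‖f x‖ ≤ B) {α M : ℝ} (hM0 : 0 ≤ M) (hM : HB α M f) {t : ℝ} (ht : t ∈ Set.Ioc (0 : ℝ) 1) (x : R3) :
    ‖hs t f x‖ ≤ heatConst α * M * t ^ (α / 2) := by
  have hl : √t ∈ Set.Ioc (0 : ℝ) 1 := ⟨Real.sqrt_pos.2 ht.1, by rw [Real.sqrt_le_one]; exact ht.2⟩
  have := norm_integral_schwartz_le gkS (rIdx α) hf hB (hM _ hl) x
  rw [sqrt_rpow_eq ht.1.le, ← mul_assoc] at this
  refine this.trans ?_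
  have : avgConst gkS (rIdx α) ≤ heatConst α :=
    le_add_of_nonneg_right (Finset.sum_nonneg fun _ _ => avgConst_nonneg _ _)
  have := Real.rpow_nonneg ht.1.le (α / 2)
  gcongr

theorem norm_dhs_le_of_HB [CompleteSpace W] {f : R3 → W} (hf : Continuous f) {B : ℝ}
    (hB : ∀ x, ‖f x‖ ≤ B) {α M : ℝ} (hM0 : 0 ≤ M) (hM : HB α M f) {t : ℝ} (ht : t ∈ Set.Ioc (0 : ℝ) 1) (x : R3) :
    ‖dhs t f x‖ ≤ heatConst α * M * t ^ (α / 2 - 1 / 2) := by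
  have hl : √t ∈ Set.Ioc (0 : ℝ) 1 := ⟨Real.sqrt_pos.2 ht.1, by rw [Real.sqrt_le_one]; exact ht.2⟩
  rw [dhs, norm_smul, norm_neg, norm_inv, Real.norm_of_nonneg hl.1.le]
  have h1 : ‖∫ w, (fderiv ℝ gk w).smulRight (f (x + √t • w))‖ ≤
      ∑ j, avgConst (gkD j) (rIdx α) * (M * √t ^ α) := by
    refine (norm_le_sum_single _).trans (Finset.sum_le_sum fun j _ => ?_)
    rw [ContinuousLinearMap.integral_apply
      (integrable_dhs hf hB (√t) x)]
    simpa only [gkD_apply, ContinuousLinearMap.smulRight_apply] using norm_integral_schwartz_le (gkD j) (rIdx α) hf hB (hM _ hl) x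
  rw [← Finset.sum_mul] at h1
  have h2 : ∑ j, avgConst (gkD j) (rIdx α) ≤ heatConst α :=
    le_add_of_nonneg_left (avgConst_nonneg _ _)
  have h3 : t ^ (α / 2 - 1 / 2) = (√t)⁻¹ * √t ^ α := by
    rw [sqrt_rpow_eq ht.1.le, Real.rpow_sub ht.1, ← Real.sqrt_eq_rpow, div_eq_inv_mul]
  rw [h3]
  have h4 : 0 ≤ √t ^ α := Real.rpow_nonneg hl.1.le _
  have h5 := inv_nonneg.2 hl.1.le
  calc _ ≤ (√t)⁻¹ * ((∑ j, avgConst (gkD j) (rIdx α)) * (M * √t ^ α)) :=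
        mul_le_mul_of_nonneg_left h1 h5
    _ ≤ (√t)⁻¹ * (heatConst α * (M * √t ^ α)) := by gcongr
    _ = _ := by ring

theorem supNorm_neg (X : Dist W) : supNorm (-X) ≤ supNorm X := by
  refine le_iInf fun f => le_iInf fun hf => le_iInf fun h => ?_
  have hi : IntegrableOn f cube := hf.integrable (by norm_num)
  refine iInf_le_of_le (fun x => (-1 : ℝ) • f x) (iInf_le_of_le (hf.const_smul (-1 : ℝ)) (iInf_le_of_le ?_ ?_))
  · rw [← h]
    ext φ
    have hi' : IntegrableOn (fun x => (-1 : ℝ) • f x) cube := hi.smul (-1 : ℝ)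
    rw [ofFun_apply hi']
    change _ = -(ofFun f).1 φ
    rw [ofFun_apply hi, ← integral_neg]
    simp
  · simp only [neg_smul, one_smul]
    exact (eLpNorm_neg f ∞ _).le

theorem negHolderNorm_neg (α : ℝ) (X : Dist W) : negHolderNorm α (-X) = negHolderNorm α X := by
  simp [negHolderNorm]

theorem holderNorm_neg {α : ℝ} (hα : α ≤ 0) (X : Dist W) : holderNorm α (-X) = holderNorm α X := by
  unfold holderNorm
  split_ifs with h1 h2
  · exact negHolderNorm_neg α X
  · exact le_antisymm (supNorm_neg X) (by simpa using supNorm_neg (-X))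
  · exact absurd (lt_of_le_of_ne hα h2) h1

/-- A distribution is approximable if it is a limit of smooth functions in `C^α`. -/
def Approx (α : ℝ) (X : Dist W) : Prop :=
  ∀ ε : ℝ≥0∞, 0 < ε → ∃ f : R3 → W, ContDiff ℝ ∞ f ∧ Periodic f ∧ holderNorm α (X - ofFun f) < ε

theorem Approx.sub {α : ℝ} (hα : α ≤ 0) {X Y : Dist W} (hX : Approx α X) (hY : Approx α Y) :
    Approx α (X - Y) := by
  intro ε hε
  obtain ⟨f, hf, hfp, hfX⟩ := hX (ε / 2) (ENNReal.half_pos hε.ne')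
  obtain ⟨g, hg, hgp, hgY⟩ := hY (ε / 2) (ENNReal.half_pos hε.ne')
  refine ⟨fun x => f x - g x, hf.sub hg, fun k x => by simp [hfp k x, hgp k x], ?_⟩
  rw [ofFun_sub (integrableOn_cube hf.continuous) (integrableOn_cube hg.continuous),
    show X - Y - (ofFun f - ofFun g) = (X - ofFun f) + -(Y - ofFun g) by abel]
  calc _ ≤ _ := holderNorm_add_le hα _ _
    _ < ε / 2 + ε / 2 := by rw [holderNorm_neg hα]; exact ENNReal.add_lt_add hfX hgY
    _ = ε := ENNReal.add_halves ε

/-- A crude bound of the heat flow by a Hölder norm, valid for all distributions. -/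
theorem exists_crude_heat_bound {α : ℝ} (hα : α ≤ 0) {t : ℝ} (ht : 0 < t) : ∃ C : ℝ, 0 ≤ C ∧
    ∀ (X : Dist W) (M : ℝ), 0 ≤ M → holderNorm α X ≤ ENNReal.ofReal M → ∀ x, ‖heat t X x‖ ≤ C * M := by
  set N := rIdx α
  have hs := (summable_exp_neg_eig_mul_pow ht N).mul_left ((testConst N + 1) * N.factorial)
  have hc : 0 ≤ testConst N + 1 := by have := testConst_pos N; linarith
  refine ⟨∑' k, (testConst N + 1) * N.factorial * (Real.exp (-(eig k * t)) *
    (1 + 2 * Real.pi * ‖latticeVec k‖) ^ N), tsum_nonneg fun k => by positivity, fun X M hM0 hM x => ?_⟩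
  rw [heat_eq]
  refine tsum_of_norm_bounded (hs.hasSum.mul_right M) fun k => ?_
  rw [norm_smul, Real.norm_of_nonneg (Real.exp_pos _).le]
  have := norm_apply_le_of_holderNorm hα hM0 hM (φ := cosTest k x)
    (B := N.factorial * (1 + 2 * Real.pi * ‖latticeVec k‖) ^ N) (by positivity)
    (iteratedFDeriv_cosTest_bound k x N)
  calc _ ≤ Real.exp (-(eig k * t)) * _ := mul_le_mul_of_nonneg_left this (Real.exp_pos _).le
    _ = _ := by ring

/-- The bound with the right power of `t` is available for functions. A smooth approximation
transfers it to `X`: the error is controlled by the crude bound, whose constant depends badly on `t`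
but multiplies a quantity that tends to zero at fixed `t`. -/
theorem norm_heat_le [CompleteSpace W] {α : ℝ} (hα : α ≤ 0) {X : Dist W} (hX : Approx α X) {M : ℝ}
    (hM0 : 0 ≤ M) (hM : holderNorm α X ≤ ENNReal.ofReal M) {t : ℝ} (ht : t ∈ Set.Ioc (0 : ℝ) 1) (x : R3) :
    ‖heat t X x‖ ≤ heatConst α * M * t ^ (α / 2) := by
  obtain ⟨C, hC0, hC⟩ := exists_crude_heat_bound (W := W) hα ht.1
  have key : ∀ ε : ℝ, 0 < ε → ‖heat t X x‖ ≤ heatConst α * (M + ε) * t ^ (α / 2) + C * ε := by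
    intro ε hε
    obtain ⟨f, hf, hp, h⟩ := hX (ENNReal.ofReal ε) (by simpa using hε)
    obtain ⟨B, _, hB⟩ := hp.exists_bound hf.continuous
    have h1 : holderNorm α (ofFun f) ≤ ENNReal.ofReal (M + ε) := by
      have e : ofFun f = X + -(X - ofFun f) := by abel
      rw [e, ENNReal.ofReal_add hM0 hε.le]
      refine (holderNorm_add_le hα _ _).trans (add_le_add hM ?_)
      rw [holderNorm_neg hα]; exact h.le
    have h2 := norm_hs_le_of_HB hf.continuous hB (by positivity)
      (HB_of_holderNorm_le hf.continuous hp hα (by positivity) h1) ht x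
    have h3 := hC _ ε hε.le h.le x
    rw [heat_sub _ _ ht.1, heat_ofFun hf.continuous hp ht.1] at h3
    calc ‖heat t X x‖ = ‖hs t f x + (heat t X x - hs t f x)‖ := by congr 1; abel
      _ ≤ _ := norm_add_le _ _
      _ ≤ _ := add_le_add h2 h3
  have hlim : Tendsto (fun ε : ℝ => heatConst α * (M + ε) * t ^ (α / 2) + C * ε) (𝓝[>] 0)
      (𝓝 (heatConst α * (M + 0) * t ^ (α / 2) + C * 0)) := by
    refine tendsto_nhdsWithin_of_tendsto_nhds (Continuous.tendsto ?_ 0)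
    fun_prop
  have := ge_of_tendsto hlim (eventually_mem_nhdsWithin.mono fun ε hε => key ε hε)
  simpa using this

theorem exists_bound_heat [CompleteSpace W] (X : Dist W) {t : ℝ} (ht : 0 < t) :
    ∃ M, ∀ x, ‖heat t X x‖ ≤ M :=
  let ⟨M, _, h⟩ := (periodic_heat t X).exists_bound (continuous_heat X ht)
  ⟨M, h⟩

/-- After any positive time the heat flow of a distribution is a bounded continuous function, so the
regularity of Gaussian averages applies to the remaining time. -/
theorem hasFDerivAt_heat [CompleteSpace W] (X : Dist W) {s t : ℝ} (hs0 : 0 < s) (hst : s < t) (x : R3) :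
    HasFDerivAt (heat t X) (dhs (t - s) (heat s X) x) x := by
  obtain ⟨M, hM⟩ := exists_bound_heat X hs0
  have := hasFDerivAt_hs (sub_pos.2 hst) (continuous_heat X hs0) hM x
  have e : hs (t - s) (heat s X) = heat t X := by
    ext1 y; rw [hs_heat X (sub_nonneg.2 hst.le) hs0]; congr 1; ring
  rwa [e] at this

theorem fderiv_heat [CompleteSpace W] (X : Dist W) {s t : ℝ} (hs0 : 0 < s) (hst : s < t) (x : R3) :
    fderiv ℝ (heat t X) x = dhs (t - s) (heat s X) x := (hasFDerivAt_heat X hs0 hst x).fderiv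

/-- Half of the time is spent on reaching L^∞ and the other half on the gradient. -/
theorem norm_fderiv_heat_le [CompleteSpace W] {α : ℝ} (hα : α ≤ 0) {X : Dist W} (hX : Approx α X) {M : ℝ}
    (hM0 : 0 ≤ M) (hM : holderNorm α X ≤ ENNReal.ofReal M) {t : ℝ} (ht : t ∈ Set.Ioc (0 : ℝ) 1) (x : R3) :
    ‖fderiv ℝ (heat t X) x‖ ≤
      gradConst * heatConst α * (1 / 2) ^ (α / 2 - 1 / 2) * M * t ^ (α / 2 - 1 / 2) := by
  have h2 : 0 < t / 2 := half_pos ht.1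
  rw [fderiv_heat X h2 (half_lt_self ht.1), sub_half]
  refine (norm_dhs_le (norm_heat_le hα hX hM0 hM ⟨h2, by linarith [ht.2]⟩) _ x).trans (le_of_eq ?_)
  have : (√(t / 2))⁻¹ = (t / 2) ^ (-(1 / 2 : ℝ)) := by
    rw [Real.sqrt_eq_rpow, Real.rpow_neg h2.le]
  have e : (t / 2) ^ (α / 2 - 1 / 2) = (t / 2) ^ (-(1 / 2 : ℝ)) * (t / 2) ^ (α / 2) := by
    rw [← Real.rpow_add h2]; congr 1; ring
  have e2 : (t / 2) ^ (α / 2 - 1 / 2) = (1 / 2) ^ (α / 2 - 1 / 2) * t ^ (α / 2 - 1 / 2) := by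
    rw [← Real.mul_rpow (by norm_num) ht.1.le]; congr 1; ring
  calc _ = gradConst * heatConst α * M * ((t / 2) ^ (-(1 / 2 : ℝ)) * (t / 2) ^ (α / 2)) := by
        rw [this]; ring
    _ = _ := by rw [← e, e2]; ring

/-! ### Joint continuity -/

theorem continuousOn_heat [CompleteSpace W] (X : Dist W) :
    ContinuousOn (fun p : ℝ × R3 => heat p.1 X p.2) (Set.Ioi 0 ×ˢ Set.univ) := by
  rintro ⟨t, x⟩ ⟨ht, -⟩
  have ht : 0 < t := ht
  obtain ⟨M, hM⟩ := exists_bound_heat X (half_pos ht)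
  have hc := continuous_heat X (half_pos ht)
  have h := continuousWithinAt_hs (P := ℝ × R3) (S := Set.univ) (p₀ := (t, x))
    (τ := fun p => p.1 - t / 2) (ξ := fun p => p.2) (f := fun _ => heat (t / 2) X) (M := M)
    (by fun_prop) (by fun_prop) (fun y => (hc.comp continuous_snd).continuousWithinAt)
    (Eventually.of_forall fun _ => hc) (Eventually.of_forall fun _ => hM)
  refine ContinuousAt.continuousWithinAt ?_
  refine (continuousWithinAt_univ _ _).1 h |>.congr ?_
  filter_upwards [(continuous_fst.tendsto (t, x)).eventually (lt_mem_nhds (half_lt_self ht))] with p hp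
  have hp : t / 2 < p.1 := hp
  rw [hs_heat X (by linarith) (half_pos ht)]; congr 1; ring

theorem continuousOn_fderiv_heat [CompleteSpace W] (X : Dist W) :
    ContinuousOn (fun p : ℝ × R3 => fderiv ℝ (heat p.1 X) p.2) (Set.Ioi 0 ×ˢ Set.univ) := by
  rintro ⟨t, x⟩ ⟨ht, -⟩
  have ht : 0 < t := ht
  obtain ⟨M, hM⟩ := exists_bound_heat X (half_pos ht)
  have hc := continuous_heat X (half_pos ht)
  have h := continuousWithinAt_dhs (P := ℝ × R3) (S := Set.univ) (p₀ := (t, x))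
    (τ := fun p => p.1 - t / 2) (ξ := fun p => p.2) (f := fun _ => heat (t / 2) X) (M := M)
    (by fun_prop) (by simpa using ht) (by fun_prop)
    (fun y => (hc.comp continuous_snd).continuousWithinAt)
    (Eventually.of_forall fun _ => hc) (Eventually.of_forall fun _ => hM)
  refine ContinuousAt.continuousWithinAt ?_
  refine (continuousWithinAt_univ _ _).1 h |>.congr ?_
  filter_upwards [(continuous_fst.tendsto (t, x)).eventually (lt_mem_nhds (half_lt_self ht))] with p hp
  exact (fderiv_heat X (half_pos ht) hp _).symm

/-- The semigroup property of the Gaussian averages of periodic functions. -/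
theorem hs_hs [CompleteSpace W] {f : R3 → W} (hf : Continuous f) (hp : Periodic f) {s t : ℝ}
    (hs0 : 0 ≤ s) (ht : 0 ≤ t) (x : R3) : hs s (hs t f) x = hs (s + t) f x := by
  rcases ht.eq_or_lt with rfl | ht
  · rw [add_zero]; congr 1; ext1 y; exact hs_zero f y
  · have e : hs t f = heat t (ofFun f) := by ext1 y; exact (heat_ofFun hf hp ht y).symm
    rw [e, hs_heat _ hs0 ht, heat_ofFun hf hp (by positivity)]

end YMH

namespace YMH

/-! ### Time-dependent periodic functions -/

/-- `f` is a jointly continuous family, indexed by times in `I`, of functions on the torus. -/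
structure PerCont {S : Type*} [TopologicalSpace S] (I : Set ℝ) (f : ℝ → R3 → S) : Prop where
  cont : ContinuousOn (fun p : ℝ × R3 => f p.1 p.2) (I ×ˢ Set.univ)
  per : ∀ t ∈ I, Periodic (f t)

set_option linter.unusedSectionVars false

namespace PerCont

variable {W : Type*} [NormedAddCommGroup W] [NormedSpace ℝ W] {I : Set ℝ} {f g : ℝ → R3 → W}

theorem mono {S : Type*} [TopologicalSpace S] {f : ℝ → R3 → S} (hf : PerCont I f) {J : Set ℝ}
    (h : J ⊆ I) : PerCont J f :=
  ⟨hf.cont.mono (Set.prod_mono_left h), fun t ht => hf.per t (h ht)⟩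

theorem continuous {S : Type*} [TopologicalSpace S] {f : ℝ → R3 → S} (hf : PerCont I f) {t : ℝ}
    (ht : t ∈ I) : Continuous (f t) := by
  rw [← continuousOn_univ]
  exact hf.cont.comp (f := fun x => (t, x)) (by fun_prop) fun x _ => ⟨ht, trivial⟩

theorem comp {S S' : Type*} [TopologicalSpace S] [TopologicalSpace S'] {f : ℝ → R3 → S}
    (hf : PerCont I f) {g : S → S'} (hg : Continuous g) : PerCont I fun t x => g (f t x) :=
  ⟨hg.comp_continuousOn hf.cont, fun t ht k x => by rw [hf.per t ht]⟩

theorem prodMk {S S' : Type*} [TopologicalSpace S] [TopologicalSpace S'] {f : ℝ → R3 → S}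
    {g : ℝ → R3 → S'} (hf : PerCont I f) (hg : PerCont I g) : PerCont I fun t x => (f t x, g t x) :=
  ⟨hf.cont.prodMk hg.cont, fun t ht k x => by rw [hf.per t ht, hg.per t ht]⟩

theorem congr {S : Type*} [TopologicalSpace S] {f g : ℝ → R3 → S} (hf : PerCont I f)
    (h : ∀ t ∈ I, ∀ x, g t x = f t x) : PerCont I g :=
  ⟨hf.cont.congr fun p hp => h p.1 hp.1 p.2, fun t ht k x => by
    rw [h t ht, h t ht, hf.per t ht]⟩

theorem sub (hf : PerCont I f) (hg : PerCont I g) : PerCont I fun t x => f t x - g t x :=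
  (hf.prodMk hg).comp (g := fun p : W × W => p.1 - p.2) (by fun_prop)

theorem add (hf : PerCont I f) (hg : PerCont I g) : PerCont I fun t x => f t x + g t x :=
  (hf.prodMk hg).comp (g := fun p : W × W => p.1 + p.2) (by fun_prop)

theorem exists_bound (hf : PerCont I f) {K : Set ℝ} (hK : IsCompact K) (hKI : K ⊆ I) :
    ∃ M, 0 ≤ M ∧ ∀ s ∈ K, ∀ x, ‖f s x‖ ≤ M := by
  obtain ⟨M, hM⟩ := (hK.prod (isCompact_closedBall (0 : R3) 2)).exists_bound_of_continuousOn
    (hf.cont.mono (Set.prod_mono hKI (Set.subset_univ _)))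
  refine ⟨max M 0, le_max_right _ _, fun s hs x => ?_⟩
  obtain ⟨y, hy, hxy⟩ := (hf.per s (hKI hs)).exists_mem_cube x
  rw [hxy]
  exact (hM (s, y) ⟨hs, cube_subset_closedBall hy⟩).trans (le_max_left _ _)

theorem bound (hf : PerCont I f) {t : ℝ} (ht : t ∈ I) : ∃ M, 0 ≤ M ∧ ∀ x, ‖f t x‖ ≤ M :=
  (hf.per t ht).exists_bound (hf.continuous ht)

/-- Compactness of a closed ball containing the fundamental cube makes the bound uniform in space
for nearby times; periodicity extends it to all points. -/
theorem eventually_bound (hf : PerCont I f) {t : ℝ} (ht : t ∈ I) :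
    ∃ M, ∀ᶠ s in 𝓝[I] t, ∀ x, ‖f s x‖ ≤ M := by
  obtain ⟨M, _, hM⟩ := hf.bound ht
  refine ⟨M + 1, ?_⟩
  have h1 : ∀ᶠ s : I in 𝓝 ⟨t, ht⟩, ∀ y ∈ Metric.closedBall (0 : R3) 2, ‖f s y‖ ≤ M + 1 := by
    refine (isCompact_closedBall (0 : R3) 2).eventually_forall_of_forall_eventually
      (P := fun (s : I) y => ‖f s y‖ ≤ M + 1) fun y _ => ?_
    have hc : Continuous fun p : I × R3 => f p.1 p.2 :=
      hf.cont.comp_continuous (f := fun p : I × R3 => ((p.1 : ℝ), p.2)) (by fun_prop)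
        fun p => ⟨p.1.2, trivial⟩
    have h2 := (hc.norm.tendsto (⟨t, ht⟩, y)).eventually
      (gt_mem_nhds (show ‖f t y‖ < M + 1 by linarith [hM y]))
    exact h2.mono fun p hp => hp.le
  rw [nhdsWithin_eq_map_subtype_coe ht, eventually_map]
  filter_upwards [h1] with s hs x
  obtain ⟨y, hy, hxy⟩ := (hf.per s s.2).exists_mem_cube x
  rw [hxy]
  exact hs y (cube_subset_closedBall hy)

section Heat

variable {P : Type*} [TopologicalSpace P] [FirstCountableTopology P] {S : Set P} {τ σ : P → ℝ}
  {ξ : P → R3}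

theorem continuousOn_hs (hf : PerCont I f) (hτ : ContinuousOn τ S) (hσ : ContinuousOn σ S)
    (hσI : Set.MapsTo σ S I) (hξ : ContinuousOn ξ S) :
    ContinuousOn (fun p => hs (τ p) (f (σ p)) (ξ p)) S := by
  intro p hp
  obtain ⟨M, hM⟩ := hf.eventually_bound (hσI hp)
  have hn : Tendsto σ (𝓝[S] p) (𝓝[I] (σ p)) := (hσ p hp).tendsto_nhdsWithin hσI
  refine continuousWithinAt_hs (f := fun p => f (σ p)) (hτ p hp) (hξ p hp) (fun y => ?_) ?_
    (hn.eventually hM)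
  · refine ContinuousWithinAt.comp (g := fun r : ℝ × R3 => f r.1 r.2)
      (f := fun q : P × R3 => (σ q.1, q.2)) (x := (p, y)) (t := I ×ˢ Set.univ)
      (hf.cont (σ p, y) ⟨hσI hp, trivial⟩) ?_ (fun q hq => ⟨hσI hq.1, trivial⟩)
    exact ((hσ p hp).comp continuousWithinAt_fst fun q hq => hq.1).prodMk continuousWithinAt_snd
  · filter_upwards [self_mem_nhdsWithin] with q hq
    exact hf.continuous (hσI hq)

theorem continuousOn_dhs (hf : PerCont I f) (hτ : ContinuousOn τ S) (hτ0 : ∀ p ∈ S, 0 < τ p)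
    (hσ : ContinuousOn σ S) (hσI : Set.MapsTo σ S I) (hξ : ContinuousOn ξ S) :
    ContinuousOn (fun p => dhs (τ p) (f (σ p)) (ξ p)) S := by
  intro p hp
  obtain ⟨M, hM⟩ := hf.eventually_bound (hσI hp)
  have hn : Tendsto σ (𝓝[S] p) (𝓝[I] (σ p)) := (hσ p hp).tendsto_nhdsWithin hσI
  refine continuousWithinAt_dhs (f := fun p => f (σ p)) (hτ p hp) (hτ0 p hp) (hξ p hp)
    (fun y => ?_) ?_ (hn.eventually hM)
  · refine ContinuousWithinAt.comp (g := fun r : ℝ × R3 => f r.1 r.2)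
      (f := fun q : P × R3 => (σ q.1, q.2)) (x := (p, y)) (t := I ×ˢ Set.univ)
      (hf.cont (σ p, y) ⟨hσI hp, trivial⟩) ?_ (fun q hq => ⟨hσI hq.1, trivial⟩)
    exact ((hσ p hp).comp continuousWithinAt_fst fun q hq => hq.1).prodMk continuousWithinAt_snd
  · filter_upwards [self_mem_nhdsWithin] with q hq
    exact hf.continuous (hσI hq)

end Heat

end PerCont

variable {W : Type*} [NormedAddCommGroup W] [NormedSpace ℝ W]

theorem Periodic.hs {f : R3 → W} (hp : Periodic f) (t : ℝ) : Periodic (hs t f) := fun k x => by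
  rw [← hs_translate]; congr 1; ext1 y; exact hp k y

theorem Periodic.dhs {f : R3 → W} (hp : Periodic f) (t : ℝ) : Periodic (dhs t f) := fun k x => by
  simp only [YMH.dhs]
  congr 2
  ext1 w
  rw [add_right_comm, hp k]

theorem perCont_heat [CompleteSpace W] (X : Dist W) : PerCont (Set.Ioi 0) fun t => heat t X :=
  ⟨continuousOn_heat X, fun t _ => periodic_heat t X⟩

theorem Periodic.fderiv {f : R3 → W} (hp : Periodic f) : Periodic (fderiv ℝ f) := fun k x => by
  rw [← fderiv_comp_add_right]; congr 1; ext1 y; exact hp k y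

theorem perCont_fderiv_heat [CompleteSpace W] (X : Dist W) :
    PerCont (Set.Ioi 0) fun t => fderiv ℝ (heat t X) :=
  ⟨continuousOn_fderiv_heat X, fun t _ => (periodic_heat t X).fderiv⟩

/-! ### Beta integrals -/

/-- The integral of `(1 - σ)^{-a} σ^{-γ}` over the unit interval. -/
noncomputable def betaI (a γ : ℝ) : ℝ := ∫ σ in Set.Ioo (0 : ℝ) 1, (1 - σ) ^ (-a) * σ ^ (-γ)

theorem integrableOn_beta {a γ : ℝ} (ha : a < 1) (hγ : γ < 1) :
    IntegrableOn (fun σ : ℝ => (1 - σ) ^ (-a) * σ ^ (-γ)) (Set.Ioo 0 1) := by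
  have h := Complex.betaIntegral_convergent (u := (1 - γ : ℝ)) (v := (1 - a : ℝ))
    (by simpa using hγ) (by simpa using ha)
  rw [intervalIntegrable_iff_integrableOn_Ioo_of_le zero_le_one] at h
  refine h.norm.congr ((ae_restrict_iff' measurableSet_Ioo).2 (Eventually.of_forall fun σ hσ => ?_))
  have h1 : (0 : ℝ) < 1 - σ := by linarith [hσ.2]
  have e1 : ((σ : ℂ)) ^ (((1 - γ : ℝ) : ℂ) - 1) = ((σ ^ (-γ) : ℝ) : ℂ) := by
    rw [Complex.ofReal_cpow hσ.1.le]; congr 1; push_cast; ring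
  have e2 : (1 - (σ : ℂ)) ^ (((1 - a : ℝ) : ℂ) - 1) = (((1 - σ) ^ (-a) : ℝ) : ℂ) := by
    rw [Complex.ofReal_cpow h1.le]; congr 1 <;> push_cast <;> ring
  simp only
  rw [e1, e2, ← Complex.ofReal_mul, Complex.norm_real, Real.norm_of_nonneg, mul_comm]
  exact mul_nonneg (Real.rpow_nonneg hσ.1.le _) (Real.rpow_nonneg h1.le _)

theorem betaI_nonneg (a γ : ℝ) : 0 ≤ betaI a γ :=
  setIntegral_nonneg measurableSet_Ioo fun _ hσ => mul_nonneg
    (Real.rpow_nonneg (sub_nonneg.2 hσ.2.le) _) (Real.rpow_nonneg hσ.1.le _)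

theorem norm_setIntegral_le_betaI {V : Type*} [NormedAddCommGroup V] [NormedSpace ℝ V]
    {k : ℝ → V} {a γ M : ℝ} (ha : a < 1) (hγ : γ < 1)
    (h : ∀ σ ∈ Set.Ioo (0 : ℝ) 1, ‖k σ‖ ≤ M * ((1 - σ) ^ (-a) * σ ^ (-γ))) :
    ‖∫ σ in Set.Ioo (0 : ℝ) 1, k σ‖ ≤ M * betaI a γ := by
  rw [betaI, ← integral_const_mul]
  exact norm_integral_le_of_norm_le ((integrableOn_beta ha hγ).const_mul M)
    ((ae_restrict_iff' measurableSet_Ioo).2 (Eventually.of_forall h))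

theorem integrableOn_of_le_beta {V : Type*} [NormedAddCommGroup V]
    {k : ℝ → V} {a γ M : ℝ} (ha : a < 1) (hγ : γ < 1) (hc : ContinuousOn k (Set.Ioo 0 1))
    (h : ∀ σ ∈ Set.Ioo (0 : ℝ) 1, ‖k σ‖ ≤ M * ((1 - σ) ^ (-a) * σ ^ (-γ))) :
    IntegrableOn k (Set.Ioo (0 : ℝ) 1) :=
  ((integrableOn_beta ha hγ).const_mul M).mono' (hc.aestronglyMeasurable measurableSet_Ioo)
    ((ae_restrict_iff' measurableSet_Ioo).2 (Eventually.of_forall h))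

/-- Dominated convergence with the beta integrand. The power of the time variable is continuous away
from zero, so near `p₀` it exceeds its value there by at most one. -/
theorem continuousOn_setIntegral_kernel {V : Type*} [NormedAddCommGroup V] [NormedSpace ℝ V]
    {k : ℝ × R3 → ℝ → V} {T a γ M e : ℝ} (ha : a < 1) (hγ : γ < 1)
    (hc : ContinuousOn (fun q : (ℝ × R3) × ℝ => k q.1 q.2)
      ((Set.Ioc 0 T ×ˢ Set.univ) ×ˢ Set.Ioo 0 1))
    (hb : ∀ p ∈ Set.Ioc 0 T ×ˢ (Set.univ : Set R3), ∀ σ ∈ Set.Ioo (0 : ℝ) 1,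
      ‖k p σ‖ ≤ M * p.1 ^ e * ((1 - σ) ^ (-a) * σ ^ (-γ))) :
    ContinuousOn (fun p => ∫ σ in Set.Ioo (0 : ℝ) 1, k p σ) (Set.Ioc 0 T ×ˢ Set.univ) := by
  intro p₀ hp₀
  refine continuousWithinAt_of_dominated
    (bound := fun σ => (M * p₀.1 ^ e + 1) * ((1 - σ) ^ (-a) * σ ^ (-γ))) ?_ ?_
    ((integrableOn_beta ha hγ).const_mul _) ?_
  · filter_upwards [self_mem_nhdsWithin] with p hp
    refine ContinuousOn.aestronglyMeasurable ?_ measurableSet_Ioo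
    exact hc.comp (f := fun σ => (p, σ)) (by fun_prop) fun σ hσ => ⟨hp, hσ⟩
  · have h1 : ContinuousWithinAt (fun p : ℝ × R3 => M * p.1 ^ e) (Set.Ioc 0 T ×ˢ Set.univ) p₀ :=
      (continuousAt_const.mul (continuousAt_fst.rpow_const (Or.inl hp₀.1.1.ne'))).continuousWithinAt
    have h2 := h1.tendsto.eventually (gt_mem_nhds (lt_add_one _))
    filter_upwards [self_mem_nhdsWithin, h2] with p hp h3
    refine (ae_restrict_iff' measurableSet_Ioo).2 (Eventually.of_forall fun σ hσ => ?_)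
    refine (hb p hp σ hσ).trans (mul_le_mul_of_nonneg_right h3.le ?_)
    exact mul_nonneg (Real.rpow_nonneg (sub_nonneg.2 hσ.2.le) _) (Real.rpow_nonneg hσ.1.le _)
  · refine (ae_restrict_iff' measurableSet_Ioo).2 (Eventually.of_forall fun σ hσ => ?_)
    exact (hc (p₀, σ) ⟨hp₀, hσ⟩).comp (f := fun p => (p, σ))
      (by fun_prop) fun p hp => ⟨hp, hσ⟩

/-! ### Duhamel integrals -/

/-- The Duhamel integral `∫_0^t P_{t-s} f_s ds`, with the time variable scaled to `[0, 1]`. -/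
noncomputable def duh (f : ℝ → R3 → W) (t : ℝ) (x : R3) : W :=
  ∫ σ in Set.Ioo (0 : ℝ) 1, t • hs (t * (1 - σ)) (f (t * σ)) x

/-- The gradient of the Duhamel integral. -/
noncomputable def dduh (f : ℝ → R3 → W) (t : ℝ) (x : R3) : R3 →L[ℝ] W :=
  ∫ σ in Set.Ioo (0 : ℝ) 1, t • dhs (t * (1 - σ)) (f (t * σ)) x

theorem duh_eq (f : ℝ → R3 → W) (t : ℝ) (x : R3) :
    duh f t x = ∫ r in (0 : ℝ)..t, hs (t - r) (f r) x := by
  have := intervalIntegral.smul_integral_comp_mul_left (a := 0) (b := 1)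
    (fun r => hs (t - r) (f r) x) t
  rw [mul_zero, mul_one] at this
  rw [← this, duh, ← integral_Ioc_eq_integral_Ioo, ← intervalIntegral.integral_of_le zero_le_one,
    intervalIntegral.integral_smul]
  simp only [mul_sub, mul_one]

/-- A family of functions with the regularity that makes its Duhamel integral well-behaved. -/
structure Force (T a γ M : ℝ) (f : ℝ → R3 → W) : Prop extends PerCont (Set.Ioc 0 T) f where
  hs_le : ∀ s ∈ Set.Ioc 0 T, ∀ τ ∈ Set.Ioc (0 : ℝ) 1, ∀ x, ‖hs τ (f s) x‖ ≤ M * τ ^ (-a) * s ^ (-γ)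
  dhs_le : ∀ s ∈ Set.Ioc 0 T, ∀ τ ∈ Set.Ioc (0 : ℝ) 1, ∀ x,
    ‖dhs τ (f s) x‖ ≤ M * τ ^ (-(a + 1 / 2)) * s ^ (-γ)

theorem mul_mem_Ioc {T t σ : ℝ} (ht : t ∈ Set.Ioc 0 T) (hσ : σ ∈ Set.Ioo (0 : ℝ) 1) :
    t * σ ∈ Set.Ioc 0 T :=
  ⟨mul_pos ht.1 hσ.1, (mul_le_of_le_one_right ht.1.le hσ.2.le).trans ht.2⟩

theorem mul_one_sub_mem {T t σ : ℝ} (ht : t ∈ Set.Ioc 0 T) (hσ : σ ∈ Set.Ioo (0 : ℝ) 1) :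
    t * (1 - σ) ∈ Set.Ioc 0 T :=
  mul_mem_Ioc ht ⟨by linarith [hσ.2], by linarith [hσ.1]⟩

/-- Homogeneity: with times written as multiples of `t`, the two singularities produce the beta
integrand and one power of `t`. -/
theorem scaled_bound_eq {t σ : ℝ} (ht : 0 < t) (hσ : σ ∈ Set.Ioo (0 : ℝ) 1) (M a γ : ℝ) :
    t * (M * (t * (1 - σ)) ^ (-a) * (t * σ) ^ (-γ)) =
      M * t ^ (1 - a - γ) * ((1 - σ) ^ (-a) * σ ^ (-γ)) := by
  rw [Real.mul_rpow ht.le (by linarith [hσ.2]), Real.mul_rpow ht.le hσ.1.le]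
  have : t ^ (1 - a - γ) = t * t ^ (-a) * t ^ (-γ) := by
    rw [show 1 - a - γ = 1 + -a + -γ by ring, Real.rpow_add ht, Real.rpow_add ht, Real.rpow_one]
  rw [this]; ring

theorem norm_duh_le_of {f : ℝ → R3 → W} {t a γ M : ℝ} (ha : a < 1) (hγ : γ < 1) (ht : 0 < t) {x : R3}
    (h : ∀ σ ∈ Set.Ioo (0 : ℝ) 1, ‖hs (t * (1 - σ)) (f (t * σ)) x‖ ≤
      M * (t * (1 - σ)) ^ (-a) * (t * σ) ^ (-γ)) :
    ‖duh f t x‖ ≤ M * t ^ (1 - a - γ) * betaI a γ :=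
  norm_setIntegral_le_betaI ha hγ fun σ hσ => by
    rw [norm_smul, Real.norm_of_nonneg ht.le, ← scaled_bound_eq ht hσ]
    exact mul_le_mul_of_nonneg_left (h σ hσ) ht.le

theorem norm_dduh_le_of {f : ℝ → R3 → W} {t a γ M : ℝ} (ha : a < 1) (hγ : γ < 1) (ht : 0 < t) {x : R3}
    (h : ∀ σ ∈ Set.Ioo (0 : ℝ) 1, ‖dhs (t * (1 - σ)) (f (t * σ)) x‖ ≤
      M * (t * (1 - σ)) ^ (-a) * (t * σ) ^ (-γ)) :
    ‖dduh f t x‖ ≤ M * t ^ (1 - a - γ) * betaI a γ :=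
  norm_setIntegral_le_betaI ha hγ fun σ hσ => by
    rw [norm_smul, Real.norm_of_nonneg ht.le, ← scaled_bound_eq ht hσ]
    exact mul_le_mul_of_nonneg_left (h σ hσ) ht.le

namespace PerCont

variable {T : ℝ} {f : ℝ → R3 → W}

theorem continuousOn_kernel (hf : PerCont (Set.Ioc 0 T) f) :
    ContinuousOn (fun q : (ℝ × R3) × ℝ => q.1.1 • hs (q.1.1 * (1 - q.2)) (f (q.1.1 * q.2)) q.1.2)
      ((Set.Ioc 0 T ×ˢ Set.univ) ×ˢ Set.Ioo 0 1) :=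
  ContinuousOn.smul (f := fun q : (ℝ × R3) × ℝ => q.1.1) (Continuous.continuousOn (by fun_prop))
    (hf.continuousOn_hs (S := (Set.Ioc 0 T ×ˢ Set.univ) ×ˢ Set.Ioo 0 1)
      (τ := fun q : (ℝ × R3) × ℝ => q.1.1 * (1 - q.2)) (σ := fun q => q.1.1 * q.2)
      (ξ := fun q => q.1.2) (by fun_prop) (by fun_prop)
      (fun q hq => mul_mem_Ioc hq.1.1 hq.2) (by fun_prop))

theorem continuousOn_dkernel (hf : PerCont (Set.Ioc 0 T) f) :
    ContinuousOn (fun q : (ℝ × R3) × ℝ => q.1.1 • dhs (q.1.1 * (1 - q.2)) (f (q.1.1 * q.2)) q.1.2)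
      ((Set.Ioc 0 T ×ˢ Set.univ) ×ˢ Set.Ioo 0 1) :=
  ContinuousOn.smul (f := fun q : (ℝ × R3) × ℝ => q.1.1) (Continuous.continuousOn (by fun_prop))
    (hf.continuousOn_dhs (S := (Set.Ioc 0 T ×ˢ Set.univ) ×ˢ Set.Ioo 0 1)
      (τ := fun q : (ℝ × R3) × ℝ => q.1.1 * (1 - q.2)) (σ := fun q => q.1.1 * q.2)
      (ξ := fun q => q.1.2) (by fun_prop)
      (fun q hq => (mul_one_sub_mem hq.1.1 hq.2).1) (by fun_prop)
      (fun q hq => mul_mem_Ioc hq.1.1 hq.2) (by fun_prop))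

end PerCont

theorem Periodic.duh {T t : ℝ} {f : ℝ → R3 → W} (hp : ∀ t ∈ Set.Ioc 0 T, Periodic (f t))
    (ht : t ∈ Set.Ioc 0 T) : Periodic (duh f t) := fun k x =>
  setIntegral_congr_fun measurableSet_Ioo fun σ hσ => by
    beta_reduce
    rw [(hp _ (mul_mem_Ioc ht hσ)).hs]

theorem Periodic.dduh {T t : ℝ} {f : ℝ → R3 → W} (hp : ∀ t ∈ Set.Ioc 0 T, Periodic (f t))
    (ht : t ∈ Set.Ioc 0 T) : Periodic (dduh f t) := fun k x =>
  setIntegral_congr_fun measurableSet_Ioo fun σ hσ => by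
    beta_reduce
    rw [(hp _ (mul_mem_Ioc ht hσ)).dhs]

namespace Force

variable {T a γ M : ℝ} {f : ℝ → R3 → W}

theorem kernel_le (hf : Force T a γ M f) (hT : T ≤ 1) {t σ : ℝ} (ht : t ∈ Set.Ioc 0 T)
    (hσ : σ ∈ Set.Ioo (0 : ℝ) 1) (x : R3) :
    ‖t • hs (t * (1 - σ)) (f (t * σ)) x‖ ≤ M * t ^ (1 - a - γ) * ((1 - σ) ^ (-a) * σ ^ (-γ)) := by
  rw [norm_smul, Real.norm_of_nonneg ht.1.le, ← scaled_bound_eq ht.1 hσ]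
  refine mul_le_mul_of_nonneg_left (hf.hs_le _ (mul_mem_Ioc ht hσ) _ ?_ x) ht.1.le
  have := mul_one_sub_mem ht hσ
  exact ⟨this.1, this.2.trans hT⟩

theorem dkernel_le (hf : Force T a γ M f) (hT : T ≤ 1) {t σ : ℝ} (ht : t ∈ Set.Ioc 0 T)
    (hσ : σ ∈ Set.Ioo (0 : ℝ) 1) (x : R3) :
    ‖t • dhs (t * (1 - σ)) (f (t * σ)) x‖ ≤
      M * t ^ (1 - (a + 1 / 2) - γ) * ((1 - σ) ^ (-(a + 1 / 2)) * σ ^ (-γ)) := by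
  rw [norm_smul, Real.norm_of_nonneg ht.1.le, ← scaled_bound_eq ht.1 hσ]
  refine mul_le_mul_of_nonneg_left (hf.dhs_le _ (mul_mem_Ioc ht hσ) _ ?_ x) ht.1.le
  have := mul_one_sub_mem ht hσ
  exact ⟨this.1, this.2.trans hT⟩

theorem norm_duh_le (hf : Force T a γ M f) (hT : T ≤ 1) (ha : a < 1 / 2) (hγ : γ < 1) {t : ℝ}
    (ht : t ∈ Set.Ioc 0 T) (x : R3) : ‖duh f t x‖ ≤ M * t ^ (1 - a - γ) * betaI a γ :=
  norm_setIntegral_le_betaI (by linarith) hγ fun _ hσ => hf.kernel_le hT ht hσ x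

theorem norm_dduh_le (hf : Force T a γ M f) (hT : T ≤ 1) (ha : a < 1 / 2) (hγ : γ < 1) {t : ℝ}
    (ht : t ∈ Set.Ioc 0 T) (x : R3) :
    ‖dduh f t x‖ ≤ M * t ^ (1 - (a + 1 / 2) - γ) * betaI (a + 1 / 2) γ :=
  norm_setIntegral_le_betaI (by linarith) hγ fun _ hσ => hf.dkernel_le hT ht hσ x

theorem perCont_duh (hf : Force T a γ M f) (hT : T ≤ 1) (ha : a < 1 / 2) (hγ : γ < 1) :
    PerCont (Set.Ioc 0 T) (duh f) :=
  ⟨continuousOn_setIntegral_kernel (by linarith) hγ hf.continuousOn_kernel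
    fun p hp σ hσ => hf.kernel_le hT hp.1 hσ p.2, fun _ ht => Periodic.duh hf.per ht⟩

theorem perCont_dduh (hf : Force T a γ M f) (hT : T ≤ 1) (ha : a < 1 / 2) (hγ : γ < 1) :
    PerCont (Set.Ioc 0 T) (dduh f) :=
  ⟨continuousOn_setIntegral_kernel (by linarith) hγ hf.continuousOn_dkernel
    fun p hp σ hσ => hf.dkernel_le hT hp.1 hσ p.2, fun _ ht => Periodic.dduh hf.per ht⟩

theorem continuousOn_kernel_apply (hf : Force T a γ M f) {t : ℝ} (ht : t ∈ Set.Ioc 0 T) (x : R3) :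
    ContinuousOn (fun σ => t • hs (t * (1 - σ)) (f (t * σ)) x) (Set.Ioo 0 1) :=
  hf.continuousOn_kernel.comp (f := fun σ => ((t, x), σ)) (by fun_prop)
    fun _ hσ => ⟨⟨ht, trivial⟩, hσ⟩

theorem continuousOn_dkernel_apply (hf : Force T a γ M f) {t : ℝ} (ht : t ∈ Set.Ioc 0 T) (x : R3) :
    ContinuousOn (fun σ => t • dhs (t * (1 - σ)) (f (t * σ)) x) (Set.Ioo 0 1) :=
  hf.continuousOn_dkernel.comp (f := fun σ => ((t, x), σ)) (by fun_prop)
    fun _ hσ => ⟨⟨ht, trivial⟩, hσ⟩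

theorem integrableOn_kernel (hf : Force T a γ M f) (hT : T ≤ 1) (ha : a < 1 / 2) (hγ : γ < 1) {t : ℝ}
    (ht : t ∈ Set.Ioc 0 T) (x : R3) :
    IntegrableOn (fun σ => t • hs (t * (1 - σ)) (f (t * σ)) x) (Set.Ioo 0 1) :=
  integrableOn_of_le_beta (by linarith) hγ (hf.continuousOn_kernel_apply ht x)
    fun _ hσ => hf.kernel_le hT ht hσ x

theorem integrableOn_dkernel (hf : Force T a γ M f) (hT : T ≤ 1) (ha : a < 1 / 2) (hγ : γ < 1)
    {t : ℝ} (ht : t ∈ Set.Ioc 0 T) (x : R3) :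
    IntegrableOn (fun σ => t • dhs (t * (1 - σ)) (f (t * σ)) x) (Set.Ioo 0 1) :=
  integrableOn_of_le_beta (by linarith) hγ (hf.continuousOn_dkernel_apply ht x)
    fun _ hσ => hf.dkernel_le hT ht hσ x

/-- The gradient costs another half power of the elapsed time; `a < 1 / 2` keeps the singularity
integrable. -/
theorem hasFDerivAt_duh (hf : Force T a γ M f) (hT : T ≤ 1) (ha : a < 1 / 2) (hγ : γ < 1) {t : ℝ}
    (ht : t ∈ Set.Ioc 0 T) (x : R3) : HasFDerivAt (duh f t) (dduh f t x) x := by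
  refine hasFDerivAt_integral_of_dominated_of_fderiv_le (s := Set.univ)
    (F' := fun y σ => t • dhs (t * (1 - σ)) (f (t * σ)) y)
    (bound := fun σ => M * t ^ (1 - (a + 1 / 2) - γ) * ((1 - σ) ^ (-(a + 1 / 2)) * σ ^ (-γ)))
    univ_mem (Eventually.of_forall fun y => (hf.integrableOn_kernel hT ha hγ ht y).1)
    (hf.integrableOn_kernel hT ha hγ ht x) (hf.integrableOn_dkernel hT ha hγ ht x).1 ?_
    ((integrableOn_beta (by linarith) hγ).const_mul _) ?_
  · exact (ae_restrict_iff' measurableSet_Ioo).2 (Eventually.of_forall fun σ hσ y _ =>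
      hf.dkernel_le hT ht hσ y)
  · refine (ae_restrict_iff' measurableSet_Ioo).2 (Eventually.of_forall fun σ hσ y _ => ?_)
    have h1 := mul_mem_Ioc ht hσ
    obtain ⟨B, _, hB⟩ := hf.bound h1
    exact (hasFDerivAt_hs (mul_one_sub_mem ht hσ).1 (hf.continuous h1) hB y).const_smul t

theorem duh_sub {g : ℝ → R3 → W} {a' γ' M' : ℝ} (hf : Force T a γ M f) (hg : Force T a' γ' M' g) (hT : T ≤ 1)
    (ha : a < 1 / 2) (hγ : γ < 1) (ha' : a' < 1 / 2) (hγ' : γ' < 1) {t : ℝ} (ht : t ∈ Set.Ioc 0 T)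
    (x : R3) : duh (fun t x => f t x - g t x) t x = duh f t x - duh g t x := by
  rw [duh, duh, duh, ← integral_sub (hf.integrableOn_kernel hT ha hγ ht x)
    (hg.integrableOn_kernel hT ha' hγ' ht x)]
  refine setIntegral_congr_fun measurableSet_Ioo fun σ hσ => ?_
  have h1 := mul_mem_Ioc ht hσ
  obtain ⟨B, _, hB⟩ := hf.bound h1
  obtain ⟨B', _, hB'⟩ := hg.bound h1
  rw [hs_sub (hf.continuous h1) hB (hg.continuous h1) hB', smul_sub]

theorem dduh_sub {g : ℝ → R3 → W} {a' γ' M' : ℝ} (hf : Force T a γ M f) (hg : Force T a' γ' M' g) (hT : T ≤ 1)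
    (ha : a < 1 / 2) (hγ : γ < 1) (ha' : a' < 1 / 2) (hγ' : γ' < 1) {t : ℝ} (ht : t ∈ Set.Ioc 0 T)
    (x : R3) : dduh (fun t x => f t x - g t x) t x = dduh f t x - dduh g t x := by
  rw [dduh, dduh, dduh, ← integral_sub (hf.integrableOn_dkernel hT ha hγ ht x)
    (hg.integrableOn_dkernel hT ha' hγ' ht x)]
  refine setIntegral_congr_fun measurableSet_Ioo fun σ hσ => ?_
  have h1 := mul_mem_Ioc ht hσ
  obtain ⟨B, _, hB⟩ := hf.bound h1
  obtain ⟨B', _, hB'⟩ := hg.bound h1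
  beta_reduce
  rw [dhs_sub (hf.continuous h1) hB (hg.continuous h1) hB', smul_sub]

end Force

/-- A family of functions bounded by `K s^{-γ}` is a force. -/
theorem PerCont.force {T γ K : ℝ} {f : ℝ → R3 → W} (hf : PerCont (Set.Ioc 0 T) f) (hK : 0 ≤ K)
    (h : ∀ s ∈ Set.Ioc 0 T, ∀ x, ‖f s x‖ ≤ K * s ^ (-γ)) :
    Force T 0 γ ((1 + gradConst) * K) f where
  toPerCont := hf
  hs_le s hs0 τ hτ x := by
    refine (norm_hs_le (h s hs0) τ x).trans ?_
    rw [neg_zero, Real.rpow_zero, mul_one]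
    have := Real.rpow_nonneg hs0.1.le (-γ)
    refine mul_le_mul_of_nonneg_right ?_ this
    nlinarith [gradConst_nonneg]
  dhs_le s hs0 τ hτ x := by
    refine (norm_dhs_le (h s hs0) τ x).trans ?_
    rw [zero_add, Real.rpow_neg hτ.1.le, ← Real.sqrt_eq_rpow]
    have h1 := Real.rpow_nonneg hs0.1.le (-γ)
    have h2 : 0 ≤ (√τ)⁻¹ := by positivity
    calc gradConst * (√τ)⁻¹ * (K * s ^ (-γ)) = gradConst * (K * ((√τ)⁻¹ * s ^ (-γ))) := by ring
      _ ≤ (1 + gradConst) * (K * ((√τ)⁻¹ * s ^ (-γ))) := by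
        have : 0 ≤ K * ((√τ)⁻¹ * s ^ (-γ)) := by positivity
        nlinarith
      _ = _ := by ring

/-- A family of functions bounded by `M s^{-γ}` in `C^α` is a force. -/
theorem PerCont.force_of_HB [CompleteSpace W] {T γ α M : ℝ} {f : ℝ → R3 → W}
    (hf : PerCont (Set.Ioc 0 T) f) (hM : 0 ≤ M)
    (h : ∀ s ∈ Set.Ioc 0 T, HB α (M * s ^ (-γ)) (f s)) :
    Force T (-α / 2) γ (heatConst α * M) f where
  toPerCont := hf
  hs_le s hs0 τ hτ x := by
    obtain ⟨B, _, hB⟩ := hf.bound hs0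
    have := norm_hs_le_of_HB (hf.continuous hs0) hB
      (mul_nonneg hM (Real.rpow_nonneg hs0.1.le _)) (h s hs0) hτ x
    refine this.trans (le_of_eq ?_)
    rw [show -(-α / 2) = α / 2 by ring]; ring
  dhs_le s hs0 τ hτ x := by
    obtain ⟨B, _, hB⟩ := hf.bound hs0
    have := norm_dhs_le_of_HB (hf.continuous hs0) hB
      (mul_nonneg hM (Real.rpow_nonneg hs0.1.le _)) (h s hs0) hτ x
    refine this.trans (le_of_eq ?_)
    rw [show -(-α / 2 + 1 / 2) = α / 2 - 1 / 2 by ring]; ring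

end YMH

/-! ### Duhamel integrals averaged against kernels. -/

namespace YMH

variable {W : Type*} [NormedAddCommGroup W] [NormedSpace ℝ W]

/-- Fubini. With the Gaussian as weight it gives the semigroup property of Duhamel integrals, and
with a bump it gives their Hölder norms. -/
theorem Force.integral_smul_duh {T a γ M : ℝ} {f : ℝ → R3 → W} (hf : Force T a γ M f) (hT : T ≤ 1)
    (ha : a < 1 / 2) (hγ : γ < 1) {t : ℝ} (ht : t ∈ Set.Ioc 0 T) {c : R3 → ℝ} (hc : Continuous c)
    (hci : Integrable c) (x : R3) (l : ℝ) :
    ∫ w, c w • duh f t (x + l • w) =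
      ∫ σ in Set.Ioo (0 : ℝ) 1, t • ∫ w, c w • hs (t * (1 - σ)) (f (t * σ)) (x + l • w) := by
  have h1 : ∀ w, c w • duh f t (x + l • w) = ∫ σ in Set.Ioo (0 : ℝ) 1,
      c w • (t • hs (t * (1 - σ)) (f (t * σ)) (x + l • w)) := fun w => (integral_smul _ _).symm
  simp_rw [h1]
  rw [integral_integral_swap]
  · refine integral_congr_ae (Eventually.of_forall fun σ => ?_)
    beta_reduce
    rw [← integral_smul]
    exact integral_congr_ae (Eventually.of_forall fun w => smul_comm _ _ _)
  · have hb := hci.norm.mul_prod ((integrableOn_beta (a := a) (by linarith) hγ).const_mul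
      (M * t ^ (1 - a - γ)))
    have e : (volume : Measure R3).prod (volume.restrict (Set.Ioo (0 : ℝ) 1)) =
        ((volume : Measure R3).prod volume).restrict (Set.univ ×ˢ Set.Ioo (0 : ℝ) 1) := by
      rw [← Measure.prod_restrict, Measure.restrict_univ]
    have hms : MeasurableSet ((Set.univ : Set R3) ×ˢ Set.Ioo (0 : ℝ) 1) :=
      MeasurableSet.univ.prod measurableSet_Ioo
    refine hb.mono' ?_ ?_
    · rw [e]
      refine ContinuousOn.aestronglyMeasurable ?_ hms
      refine ContinuousOn.smul (f := fun q : R3 × ℝ => c q.1) (by fun_prop) ?_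
      exact hf.continuousOn_kernel.comp (f := fun q : R3 × ℝ => ((t, x + l • q.1), q.2))
        (by fun_prop) fun q hq => ⟨⟨ht, trivial⟩, hq.2⟩
    · rw [e]
      refine (ae_restrict_iff' hms).2 (Eventually.of_forall fun q hq => ?_)
      simp only [Function.uncurry]
      rw [norm_smul]
      exact mul_le_mul_of_nonneg_left (hf.kernel_le hT ht hq.2 _) (norm_nonneg _)

theorem Force.intervalIntegrable {T a γ M : ℝ} {f : ℝ → R3 → W} (hf : Force T a γ M f)
    (hT : T ≤ 1) (ha : a < 1 / 2) (hγ : γ < 1) {t : ℝ} (ht : t ∈ Set.Ioc 0 T) (x : R3) :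
    IntervalIntegrable (fun r => hs (t - r) (f r) x) volume 0 t := by
  have h1 : IntegrableOn (fun σ => t⁻¹ • (t • hs (t * (1 - σ)) (f (t * σ)) x)) (Set.Ioo 0 1) :=
    (hf.integrableOn_kernel hT ha hγ ht x).smul t⁻¹
  replace h1 := (intervalIntegrable_iff_integrableOn_Ioo_of_le zero_le_one).2 h1
  have h2 : (fun σ => t⁻¹ • (t • hs (t * (1 - σ)) (f (t * σ)) x)) =
      fun σ => (fun r => hs (t - r) (f r) x) (t * σ) := by
    ext1 σ
    rw [smul_smul, inv_mul_cancel₀ ht.1.ne', one_smul, mul_sub, mul_one]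
  rw [h2] at h1
  have h3 := h1.comp_mul_left (c := t⁻¹)
  simpa [mul_inv_cancel_left₀ ht.1.ne'] using h3

/-- The Duhamel integral restarted at a positive time. -/
theorem Force.duh_restart [CompleteSpace W] {T a γ M : ℝ} {f : ℝ → R3 → W} (hf : Force T a γ M f)
    (hT : T ≤ 1) (ha : a < 1 / 2) (hγ : γ < 1) {s t : ℝ} (hs0 : 0 < s) (hst : s ≤ t) (ht : t ≤ T)
    (x : R3) : duh f t x = hs (t - s) (duh f s) x + ∫ r in s..t, hs (t - r) (f r) x := by
  have ht0 : 0 < t := hs0.trans_le hst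
  have hi := hf.intervalIntegrable hT ha hγ ⟨ht0, ht⟩ x
  have hi1 : IntervalIntegrable (fun r => hs (t - r) (f r) x) volume 0 s :=
    hi.mono_set (by rw [Set.uIcc_of_le hs0.le, Set.uIcc_of_le ht0.le]; exact Set.Icc_subset_Icc_right hst)
  have hi2 : IntervalIntegrable (fun r => hs (t - r) (f r) x) volume s t :=
    hi.mono_set (by rw [Set.uIcc_of_le hst, Set.uIcc_of_le ht0.le]; exact Set.Icc_subset_Icc_left hs0.le)
  rw [duh_eq, ← intervalIntegral.integral_add_adjacent_intervals hi1 hi2]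
  congr 1
  have h4 := intervalIntegral.smul_integral_comp_mul_left (a := 0) (b := 1)
    (fun r => hs (t - r) (f r) x) s
  rw [mul_zero, mul_one] at h4
  have hsT : s ∈ Set.Ioc 0 T := ⟨hs0, hst.trans ht⟩
  rw [← h4, ← intervalIntegral.integral_smul, intervalIntegral.integral_of_le zero_le_one,
    integral_Ioc_eq_integral_Ioo]
  -- The heat flow passes under the Duhamel integral and combines with the inner heat flow.
  have h5 := hf.integral_smul_duh hT ha hγ hsT continuous_gk integrable_gk x √(t - s)
  change _ = ∫ w, gk w • duh f s (x + √(t - s) • w)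
  rw [h5]
  refine setIntegral_congr_fun measurableSet_Ioo fun σ hσ => ?_
  beta_reduce
  congr 1
  have h6 := mul_mem_Ioc hsT hσ
  have := hs_hs (hf.continuous h6) (hf.per _ h6) (sub_nonneg.2 hst) (mul_one_sub_mem hsT hσ).1.le x
  rw [show t - s * σ = t - s + s * (1 - σ) by ring, ← this]
  rfl

/-- The heat flow is an average of translates, and the bound is invariant under translation. -/
theorem HB.hs [CompleteSpace W] {α M : ℝ} {g : R3 → W} (hg : Continuous g) {B : ℝ} (hB : ∀ x, ‖g x‖ ≤ B)
    (h : HB α M g) (τ : ℝ) : HB α M (hs τ g) := by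
  intro l hl ψ hψ x
  have hψi : Integrable ψ := hψ.1.continuous.integrable_of_hasCompactSupport
    (HasCompactSupport.of_support_subset_isCompact (isCompact_closedBall (0 : R3) (1 / 4))
      ((subset_tsupport _).trans hψ.2.1))
  have e1 : ∫ w, ψ w • YMH.hs τ g (x + l • w) =
      ∫ z, gk z • ∫ w, ψ w • g (x + √τ • z + l • w) := by
    have h1 : ∀ w, ψ w • YMH.hs τ g (x + l • w) =
        ∫ z, ψ w • (gk z • g (x + l • w + √τ • z)) := fun w => (integral_smul _ _).symm
    simp_rw [h1]
    rw [integral_integral_swap]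
    · refine integral_congr_ae (Eventually.of_forall fun z => ?_)
      beta_reduce
      rw [← integral_smul]
      refine integral_congr_ae (Eventually.of_forall fun w => ?_)
      beta_reduce
      rw [smul_comm, add_right_comm]
    · refine ((hψi.norm.mul_prod integrable_gk).mul_const B).mono' ?_ (Eventually.of_forall fun q => ?_)
      · refine Continuous.aestronglyMeasurable ?_
        have := hψ.1.continuous
        have := continuous_gk
        fun_prop
      · simp only [Function.uncurry]
        rw [norm_smul, norm_smul, Real.norm_of_nonneg (gk_nonneg _), mul_assoc]
        exact mul_le_mul_of_nonneg_left (mul_le_mul_of_nonneg_left (hB _) (gk_nonneg _))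
          (norm_nonneg _)
  rw [e1]
  calc _ ≤ ∫ z, gk z * (M * l ^ α) := by
        refine norm_integral_le_of_norm_le (integrable_gk.mul_const _)
          (Eventually.of_forall fun z => ?_)
        rw [norm_smul, Real.norm_of_nonneg (gk_nonneg z)]
        exact mul_le_mul_of_nonneg_left (h l hl ψ hψ _) (gk_nonneg z)
    _ = _ := by rw [integral_mul_const, integral_gk, one_mul]

/-- Interpolation between the scale of the test function and the scale of the heat flow. -/
theorem norm_bump_hs_le [CompleteSpace W] {α b M : ℝ} (hb : b ≤ 0) (hαb : α ≤ b) {g : R3 → W}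
    (hg : Continuous g) {B : ℝ} (hB : ∀ x, ‖g x‖ ≤ B) (hM : 0 ≤ M) (h : HB α M g) {τ : ℝ}
    (hτ : τ ∈ Set.Ioc (0 : ℝ) 1) {l : ℝ} (hl : l ∈ Set.Ioc (0 : ℝ) 1) {ψ : R3 → ℝ}
    (hψ : ψ ∈ bumps (rIdx α)) (x : R3) :
    ‖∫ w, ψ w • hs τ g (x + l • w)‖ ≤ (1 + heatConst α) * M * l ^ b * τ ^ ((α - b) / 2) := by
  have hc := heatConst_nonneg α
  have hτ0 : 0 < √τ := Real.sqrt_pos.2 hτ.1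
  have hP : 0 ≤ M * l ^ b * τ ^ ((α - b) / 2) :=
    mul_nonneg (mul_nonneg hM (Real.rpow_nonneg hl.1.le _)) (Real.rpow_nonneg hτ.1.le _)
  rw [← sqrt_rpow_eq hτ.1.le] at hP ⊢
  -- If the test function is wider than the heat kernel, the smoothing is ignored; if it is
  -- narrower, the pointwise bound at scale `√τ` is better. The sign of each exponent lets the other
  -- scale be inserted.
  rcases le_total √τ l with h1 | h1
  · calc _ ≤ M * l ^ α := (h.hs hg hB τ) l hl ψ hψ x
      _ = M * l ^ b * l ^ (α - b) := by
        rw [mul_assoc, ← Real.rpow_add hl.1]; congr 2; ring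
      _ ≤ M * l ^ b * √τ ^ (α - b) := by
        refine mul_le_mul_of_nonneg_left ?_ (mul_nonneg hM (Real.rpow_nonneg hl.1.le _))
        exact Real.rpow_le_rpow_of_nonpos hτ0 h1 (by linarith)
      _ ≤ _ := by nlinarith
  · calc _ ≤ heatConst α * M * τ ^ (α / 2) :=
        norm_integral_bump_le hψ (norm_hs_le_of_HB hg hB hM h hτ) l x
      _ = heatConst α * M * (√τ ^ b * √τ ^ (α - b)) := by
        rw [← Real.rpow_add hτ0, ← sqrt_rpow_eq hτ.1.le]; congr 2; ring
      _ ≤ heatConst α * M * (l ^ b * √τ ^ (α - b)) := by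
        have := Real.rpow_le_rpow_of_nonpos hl.1 h1 hb
        have := Real.rpow_nonneg hτ0.le (α - b)
        gcongr
      _ ≤ _ := by nlinarith

/-- The Schauder estimate. Interpolation gives the integrand (t(1-σ))^{-(1-δ)} (tσ)^{-δ} times l^b,
whose powers of `t` cancel the Jacobian exactly, so the bound is uniform in time. Equality of the
derivative counts is needed because both norms must test against the same bumps. -/
theorem HB.duh [CompleteSpace W] {T α b δ M : ℝ} {f : ℝ → R3 → W} (hf : PerCont (Set.Ioc 0 T) f)
    (hT : T ≤ 1) (hM : 0 ≤ M) (hδ : δ < 1) (hα : -1 < α) (hb : b ≤ 0) (hbα : b = α + 2 * (1 - δ))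
    (hr : rIdx b = rIdx α) (h : ∀ s ∈ Set.Ioc 0 T, HB α (M * s ^ (-δ)) (f s)) {t : ℝ}
    (ht : t ∈ Set.Ioc 0 T) : HB b ((1 + heatConst α) * betaI (1 - δ) δ * M) (duh f t) := by
  intro l hl ψ hψ x
  rw [hr] at hψ
  have hF := hf.force_of_HB hM h
  have hψi : Integrable ψ := hψ.1.continuous.integrable_of_hasCompactSupport
    (HasCompactSupport.of_support_subset_isCompact (isCompact_closedBall (0 : R3) (1 / 4))
      ((subset_tsupport _).trans hψ.2.1))
  rw [hF.integral_smul_duh hT (by linarith) hδ ht hψ.1.continuous hψi]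
  refine (norm_setIntegral_le_betaI (a := 1 - δ) (γ := δ) (M := (1 + heatConst α) * M * l ^ b)
    (by linarith) hδ fun σ hσ => ?_).trans (le_of_eq (by ring))
  have h1 := mul_mem_Ioc ht hσ
  have h2 := mul_one_sub_mem ht hσ
  obtain ⟨B, _, hB⟩ := hf.bound h1
  have h3 := norm_bump_hs_le hb (by linarith) (hf.continuous h1) hB
    (mul_nonneg hM (Real.rpow_nonneg h1.1.le _)) (h _ h1) ⟨h2.1, h2.2.trans hT⟩ hl hψ x
  rw [norm_smul, Real.norm_of_nonneg ht.1.le]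
  have h4 := scaled_bound_eq ht.1 hσ ((1 + heatConst α) * M * l ^ b) (1 - δ) δ
  rw [show 1 - (1 - δ) - δ = 0 by ring, Real.rpow_zero, mul_one] at h4
  rw [← h4]
  refine mul_le_mul_of_nonneg_left (h3.trans (le_of_eq ?_)) ht.1.le
  rw [show (α - b) / 2 = -(1 - δ) by rw [hbα]; ring]
  ring

end YMH

namespace YMH

variable {W : Type*} [NormedAddCommGroup W] [NormedSpace ℝ W]

/-! ### Second derivatives of Gaussian averages -/

theorem Periodic.perCont {S : Type*} [TopologicalSpace S] {f : R3 → S} (hp : Periodic f)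
    (hf : Continuous f) : PerCont Set.univ fun _ : ℝ => f :=
  ⟨(hf.comp continuous_snd).continuousOn, fun _ _ => hp⟩

theorem continuous_hs {f : R3 → W} (hf : Continuous f) (hp : Periodic f) (t : ℝ) :
    Continuous (hs t f) := by
  have := (hp.perCont hf).continuousOn_hs (S := (Set.univ : Set R3)) (τ := fun _ => t)
    (σ := fun _ => 0) (ξ := fun x => x) (by fun_prop) (by fun_prop) (fun _ _ => trivial) (by fun_prop)
  exact continuousOn_univ.1 this

theorem continuous_dhs {f : R3 → W} (hf : Continuous f) (hp : Periodic f) {t : ℝ} (ht : 0 < t) :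
    Continuous (dhs t f) := by
  have := (hp.perCont hf).continuousOn_dhs (S := (Set.univ : Set R3)) (τ := fun _ => t)
    (σ := fun _ => 0) (ξ := fun x => x) (by fun_prop) (fun _ _ => ht) (by fun_prop)
    (fun _ _ => trivial) (by fun_prop)
  exact continuousOn_univ.1 this

/-- The second derivative of `hs t f`. -/
noncomputable def ddhs (t : ℝ) (f : R3 → W) (x : R3) : R3 →L[ℝ] R3 →L[ℝ] W :=
  dhs (t / 2) (dhs (t / 2) f) x

/-- The gradient of P_{t/2} P_{t/2} f, taken on the inner factor. A second derivative then falls on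
the outer Gaussian. -/
theorem dhs_eq_hs_dhs [CompleteSpace W] {f : R3 → W} (hf : Continuous f) (hp : Periodic f) {t : ℝ}
    (ht : 0 < t) (x : R3) : dhs t f x = hs (t / 2) (dhs (t / 2) f) x := by
  have h2 := half_pos ht
  obtain ⟨M, _, hM⟩ := hp.exists_bound hf
  rw [← dhs_eq_hs (fun y => hasFDerivAt_hs h2 hf hM y) (continuous_dhs hf hp h2)
    (norm_hs_le hM _) (norm_dhs_le hM _) h2]
  have h3 := hasFDerivAt_hs h2 (continuous_hs hf hp (t / 2)) (norm_hs_le hM _) x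
  have e : hs (t / 2) (hs (t / 2) f) = hs t f := by
    ext1 y; rw [hs_hs hf hp h2.le h2.le, add_halves]
  rw [e] at h3
  exact (hasFDerivAt_hs ht hf hM x).unique h3

theorem hasFDerivAt_dhs [CompleteSpace W] {f : R3 → W} (hf : Continuous f) (hp : Periodic f) {t : ℝ}
    (ht : 0 < t) (x : R3) : HasFDerivAt (dhs t f) (ddhs t f x) x := by
  have h2 := half_pos ht
  obtain ⟨M, _, hM⟩ := hp.exists_bound hf
  rw [funext fun y => dhs_eq_hs_dhs hf hp ht y]
  exact hasFDerivAt_hs h2 (continuous_dhs hf hp h2) (norm_dhs_le hM _) x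

theorem norm_ddhs_le_of {f : R3 → W} {t M : ℝ} (hM : ∀ x, ‖dhs (t / 2) f x‖ ≤ M) (x : R3) :
    ‖ddhs t f x‖ ≤ gradConst * (√(t / 2))⁻¹ * M := norm_dhs_le hM _ x

theorem Periodic.ddhs {f : R3 → W} (hp : Periodic f) (t : ℝ) : Periodic (ddhs t f) :=
  (hp.dhs _).dhs _

theorem PerCont.continuousOn_ddhs {I : Set ℝ} {f : ℝ → R3 → W} (hf : PerCont I f) {P : Type*}
    [TopologicalSpace P] [FirstCountableTopology P] {S : Set P} {τ σ : P → ℝ} {ξ : P → R3}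
    (hτ : ContinuousOn τ S) (hτ0 : ∀ p ∈ S, 0 < τ p) (hσ : ContinuousOn σ S)
    (hσI : Set.MapsTo σ S I) (hξ : ContinuousOn ξ S) :
    ContinuousOn (fun p => ddhs (τ p) (f (σ p)) (ξ p)) S := by
  intro p hp
  obtain ⟨M, hM⟩ := hf.eventually_bound (hσI hp)
  have hn : Tendsto σ (𝓝[S] p) (𝓝[I] (σ p)) := (hσ p hp).tendsto_nhdsWithin hσI
  have hτ2 : ContinuousOn (fun p => τ p / 2) S := hτ.div_const 2
  have hpos := half_pos (hτ0 p hp)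
  have h1 : ContinuousOn (fun q : P × R3 => dhs (τ q.1 / 2) (f (σ q.1)) q.2) (S ×ˢ Set.univ) :=
    hf.continuousOn_dhs (S := S ×ˢ Set.univ) (τ := fun q : P × R3 => τ q.1 / 2)
      (σ := fun q => σ q.1) (ξ := fun q => q.2)
      (hτ2.comp continuousOn_fst fun q hq => hq.1) (fun q hq => half_pos (hτ0 _ hq.1))
      (hσ.comp continuousOn_fst fun q hq => hq.1) (fun q hq => hσI hq.1) continuousOn_snd
  -- A lower bound on the inner heating time near `p` makes the bound on the inner gradient uniform.
  have h2 : ∀ᶠ q in 𝓝[S] p, τ p / 4 < τ q / 2 :=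
    (hτ2 p hp).tendsto.eventually (lt_mem_nhds (by linarith))
  refine continuousWithinAt_dhs (τ := fun p => τ p / 2) (f := fun p => dhs (τ p / 2) (f (σ p)))
    (M := gradConst * (√(τ p / 4))⁻¹ * |M|) (hτ2 p hp) hpos (hξ p hp)
    (fun y => h1 (p, y) ⟨hp, trivial⟩) ?_ ?_
  · filter_upwards [self_mem_nhdsWithin] with q hq
    rw [← continuousOn_univ]
    exact h1.comp (f := fun y => (q, y)) (by fun_prop) fun y _ => ⟨hq, trivial⟩
  · filter_upwards [hn.eventually hM, h2] with q hq hq2 y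
    refine (norm_dhs_le (fun x => (hq x).trans (le_abs_self M)) _ y).trans ?_
    have h3 : (√(τ q / 2))⁻¹ ≤ (√(τ p / 4))⁻¹ :=
      inv_anti₀ (Real.sqrt_pos.2 (by linarith)) (Real.sqrt_le_sqrt hq2.le)
    have := gradConst_nonneg
    gcongr

/-! ### Hölder continuity with exponent one half -/

/-- The constant in the smoothing estimate for Hölder continuous functions. -/
noncomputable def gradHolderConst : ℝ := ∫ w, ‖fderiv ℝ gk w‖ * √‖w‖

theorem integrable_fderiv_gk_sqrt : Integrable fun w : R3 => ‖fderiv ℝ gk w‖ * √‖w‖ := by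
  have h1 : Integrable fun w : R3 => ‖w‖ * ‖fderiv ℝ gk w‖ := by
    have := (SchwartzMap.fderivCLM ℝ R3 ℝ gkS).integrable_pow_mul volume 1
    simpa using this
  have hc := continuous_fderiv_gk
  refine (integrable_fderiv_gk.norm.add h1).mono' (Continuous.aestronglyMeasurable (by fun_prop))
    (Eventually.of_forall fun w => ?_)
  have h2 : √‖w‖ ≤ 1 + ‖w‖ := by
    rw [Real.sqrt_le_left (by positivity)]
    nlinarith [norm_nonneg w]
  rw [Real.norm_of_nonneg (by positivity)]
  simp only [Pi.add_apply]
  nlinarith [norm_nonneg (fderiv ℝ gk w)]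

theorem dhs_const [CompleteSpace W] {t : ℝ} (ht : 0 < t) (c : W) (x : R3) :
    dhs t (fun _ => c) x = 0 := by
  have h := hasFDerivAt_hs ht (f := fun _ : R3 => c) continuous_const (M := ‖c‖) (fun _ => le_rfl) x
  have e : hs t (fun _ : R3 => c) = fun _ => c := by
    ext1 y; simp [hs, integral_smul_const, integral_gk]
  rw [e] at h
  exact h.unique (hasFDerivAt_const c x)

/-- The gradient of the Gaussian has mean zero, so the value at the centre can be subtracted and the
Hölder bound contributes t^{1/4}. -/
theorem norm_dhs_le_of_holder [CompleteSpace W] {f : R3 → W} (hf : Continuous f) {M : ℝ}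
    (hM : ∀ x, ‖f x‖ ≤ M) {H : ℝ} (hH : ∀ x y, ‖f x - f y‖ ≤ H * √‖x - y‖) {t : ℝ} (ht : 0 < t)
    (x : R3) : ‖dhs t f x‖ ≤ gradHolderConst * ((√t)⁻¹ * √√t) * H := by
  have e : dhs t f x = dhs t (fun y => f y - f x) x := by
    rw [dhs_sub hf hM continuous_const (M' := ‖f x‖) (fun _ => le_rfl), dhs_const ht, sub_zero]
  rw [e, dhs, norm_smul, norm_neg, norm_inv, Real.norm_of_nonneg (Real.sqrt_nonneg t)]
  calc _ ≤ (√t)⁻¹ * ∫ w, (‖fderiv ℝ gk w‖ * √‖w‖) * (√√t * H) := by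
        refine mul_le_mul_of_nonneg_left ?_ (by positivity)
        refine norm_integral_le_of_norm_le (integrable_fderiv_gk_sqrt.mul_const _)
          (Eventually.of_forall fun w => ?_)
        rw [ContinuousLinearMap.norm_smulRight_apply, mul_assoc]
        refine mul_le_mul_of_nonneg_left ((hH _ _).trans (le_of_eq ?_)) (norm_nonneg _)
        rw [add_sub_cancel_left, norm_smul, Real.norm_of_nonneg (Real.sqrt_nonneg t),
          Real.sqrt_mul (Real.sqrt_nonneg t)]
        ring
    _ = _ := by rw [integral_mul_const, gradHolderConst]; ring

/-- Interpolation between a uniform and a Lipschitz bound: a quantity below two numbers is below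
their geometric mean. -/
theorem le_sqrt_mul_of_le {a A B d : ℝ} (ha : 0 ≤ a) (hA : a ≤ A) (hB : a ≤ B * d) (hB0 : 0 ≤ B) : a ≤ √(A * B) * √d := by
  rw [← Real.sqrt_mul (mul_nonneg (ha.trans hA) hB0)]
  refine Real.le_sqrt_of_sq_le ?_
  rw [sq, mul_assoc]
  exact mul_le_mul hA hB ha (ha.trans hA)

theorem norm_sub_le_of_hasFDerivAt {f : R3 → W} {f' : R3 → R3 →L[ℝ] W}
    (hf : ∀ x, HasFDerivAt f (f' x) x) {K : ℝ} (hK : ∀ x, ‖f' x‖ ≤ K) (x y : R3) :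
    ‖f x - f y‖ ≤ K * ‖x - y‖ :=
  convex_univ.norm_image_sub_le_of_norm_hasFDerivWithin_le
    (fun z _ => (hf z).hasFDerivWithinAt) (fun z _ => hK z) trivial trivial

theorem holder_of_hasFDerivAt {f : R3 → W} {f' : R3 → R3 →L[ℝ] W}
    (hf : ∀ x, HasFDerivAt f (f' x) x) {M K : ℝ} (hM : ∀ x, ‖f x‖ ≤ M) (hK : ∀ x, ‖f' x‖ ≤ K)
    (x y : R3) : ‖f x - f y‖ ≤ √((M + M) * K) * √‖x - y‖ :=
  le_sqrt_mul_of_le (norm_nonneg _) ((norm_sub_le _ _).trans (add_le_add (hM x) (hM y)))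
    (norm_sub_le_of_hasFDerivAt hf hK x y) ((norm_nonneg _).trans (hK x))

theorem inv_sqrt_eq_rpow {τ : ℝ} (hτ : 0 ≤ τ) : (√τ)⁻¹ = τ ^ (-(1 / 2 : ℝ)) := by
  rw [Real.sqrt_eq_rpow, Real.rpow_neg hτ]

/-- The gradient of a Gaussian average is Hölder continuous, with an integrable singularity. -/
theorem holder_dhs [CompleteSpace W] {f : R3 → W} (hf : Continuous f) (hp : Periodic f) {K : ℝ}
    (hK : ∀ x, ‖f x‖ ≤ K) {t : ℝ} (ht : 0 < t) (x y : R3) :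
    ‖dhs t f x - dhs t f y‖ ≤ 2 * (gradConst + 1) ^ 2 * K * t ^ (-(3 / 4 : ℝ)) * √‖x - y‖ := by
  have hK0 : 0 ≤ K := (norm_nonneg _).trans (hK 0)
  have hg := gradConst_nonneg
  have h2 := half_pos ht
  have h1 := holder_of_hasFDerivAt (hasFDerivAt_dhs hf hp ht) (norm_dhs_le hK t)
    (norm_ddhs_le_of (norm_dhs_le hK (t / 2))) x y
  refine h1.trans (mul_le_mul_of_nonneg_right ?_ (Real.sqrt_nonneg _))
  have hs0 : 0 < √t := Real.sqrt_pos.2 ht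
  have e1 : (√(t / 2))⁻¹ * (√(t / 2))⁻¹ = 2 * t⁻¹ := by
    rw [← mul_inv, Real.mul_self_sqrt h2.le]; field_simp
  -- The exponent is the geometric mean of the rate t^{-1/2} for the gradient and t^{-1} for the
  -- second derivative.
  have e2 : (√t)⁻¹ * t⁻¹ = (t ^ (-(3 / 4 : ℝ))) ^ 2 := by
    rw [inv_sqrt_eq_rpow ht.le, ← Real.rpow_neg_one t, ← Real.rpow_add ht, ← Real.rpow_natCast,
      ← Real.rpow_mul ht.le]
    norm_num
  rw [Real.sqrt_le_left (by positivity)]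
  calc _ = 4 * gradConst ^ 3 * K ^ 2 * ((√t)⁻¹ * t⁻¹) := by
        linear_combination (2 * gradConst ^ 3 * K ^ 2 * (√t)⁻¹) * e1
    _ = 4 * gradConst ^ 3 * (K ^ 2 * (t ^ (-(3 / 4 : ℝ))) ^ 2) := by rw [e2]; ring
    _ ≤ 4 * (gradConst + 1) ^ 4 * (K ^ 2 * (t ^ (-(3 / 4 : ℝ))) ^ 2) := by
        refine mul_le_mul_of_nonneg_right ?_ (by positivity)
        have : gradConst ^ 3 ≤ (gradConst + 1) ^ 3 := by gcongr; linarith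
        have : (gradConst + 1) ^ 3 ≤ (gradConst + 1) ^ 4 :=
          pow_le_pow_right₀ (by linarith) (by norm_num)
        linarith
    _ = _ := by ring

theorem norm_smul_of_nonneg' {V : Type*} [NormedAddCommGroup V] [NormedSpace ℝ V] {c : ℝ}
    (hc : 0 ≤ c) (v : V) : ‖c • v‖ = c * ‖v‖ := by
  rw [norm_smul, Real.norm_of_nonneg hc]

theorem aestronglyMeasurable_Ioo {V : Type*} [NormedAddCommGroup V] {k : ℝ → V} {a b : ℝ}
    (hc : ContinuousOn k (Set.Ioo a b)) :
    AEStronglyMeasurable k (volume.restrict (Set.Ioo a b)) :=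
  hc.aestronglyMeasurable measurableSet_Ioo

/-! ### Second derivatives of Duhamel integrals -/

/-- The second derivative of the Duhamel integral. -/
noncomputable def ddduh (f : ℝ → R3 → W) (t : ℝ) (x : R3) : R3 →L[ℝ] R3 →L[ℝ] W :=
  ∫ σ in Set.Ioo (0 : ℝ) 1, t • ddhs (t * (1 - σ)) (f (t * σ)) x

/-- The rate t^{-1} of the second derivative is not integrable; Hölder continuity of exponent one
half improves it to t^{-3/4}, which is. -/
theorem norm_ddhs_le_of_holder [CompleteSpace W] {f : R3 → W} (hf : Continuous f) {M : ℝ}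
    (hM : ∀ x, ‖f x‖ ≤ M) {H : ℝ} (hH : ∀ x y, ‖f x - f y‖ ≤ H * √‖x - y‖) {t : ℝ} (ht : 0 < t)
    (x : R3) : ‖ddhs t f x‖ ≤
      gradConst * gradHolderConst * (1 / 2) ^ (-(3 / 4 : ℝ)) * H * t ^ (-(3 / 4 : ℝ)) := by
  have h2 := half_pos ht
  refine (norm_ddhs_le_of (norm_dhs_le_of_holder hf hM hH h2) x).trans (le_of_eq ?_)
  have e : (√(t / 2))⁻¹ * ((√(t / 2))⁻¹ * √√(t / 2)) = (t / 2) ^ (-(3 / 4 : ℝ)) := by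
    rw [inv_sqrt_eq_rpow h2.le, Real.sqrt_eq_rpow √(t / 2), sqrt_rpow_eq h2.le,
      ← Real.rpow_add h2, ← Real.rpow_add h2]
    norm_num
  have e2 : (t / 2) ^ (-(3 / 4 : ℝ)) = (1 / 2) ^ (-(3 / 4 : ℝ)) * t ^ (-(3 / 4 : ℝ)) := by
    rw [← Real.mul_rpow (by norm_num) ht.le]; congr 1; ring
  calc _ = gradConst * gradHolderConst * H * ((√(t / 2))⁻¹ * ((√(t / 2))⁻¹ * √√(t / 2))) := by ring
    _ = _ := by rw [e, e2]; ring

namespace PerCont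

variable {T : ℝ} {f : ℝ → R3 → W}

theorem continuousOn_ddkernel (hf : PerCont (Set.Ioc 0 T) f) :
    ContinuousOn (fun q : (ℝ × R3) × ℝ => q.1.1 • ddhs (q.1.1 * (1 - q.2)) (f (q.1.1 * q.2)) q.1.2)
      ((Set.Ioc 0 T ×ˢ Set.univ) ×ˢ Set.Ioo 0 1) :=
  ContinuousOn.smul (f := fun q : (ℝ × R3) × ℝ => q.1.1) (Continuous.continuousOn (by fun_prop))
    (hf.continuousOn_ddhs (S := (Set.Ioc 0 T ×ˢ Set.univ) ×ˢ Set.Ioo 0 1)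
      (τ := fun q : (ℝ × R3) × ℝ => q.1.1 * (1 - q.2)) (σ := fun q => q.1.1 * q.2)
      (ξ := fun q => q.1.2) (by fun_prop)
      (fun q hq => (mul_one_sub_mem hq.1.1 hq.2).1) (by fun_prop)
      (fun q hq => mul_mem_Ioc hq.1.1 hq.2) (by fun_prop))

variable [CompleteSpace W] {H : ℝ}

theorem ddkernel_le (hf : PerCont (Set.Ioc 0 T) f)
    (hH : ∀ s ∈ Set.Ioc 0 T, ∀ x y, ‖f s x - f s y‖ ≤ H * √‖x - y‖) {t σ : ℝ}
    (ht : t ∈ Set.Ioc 0 T) (hσ : σ ∈ Set.Ioo (0 : ℝ) 1) (x : R3) :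
    ‖t • ddhs (t * (1 - σ)) (f (t * σ)) x‖ ≤
      gradConst * gradHolderConst * (1 / 2) ^ (-(3 / 4 : ℝ)) * H * t ^ (1 - 3 / 4 - 0 : ℝ) *
        ((1 - σ) ^ (-(3 / 4 : ℝ)) * σ ^ (-0 : ℝ)) := by
  refine (norm_smul_of_nonneg' (V := R3 →L[ℝ] R3 →L[ℝ] W) ht.1.le _).trans_le ?_
  rw [← scaled_bound_eq ht.1 hσ]
  have h1 := mul_mem_Ioc ht hσ
  obtain ⟨M, _, hM⟩ := hf.bound h1
  refine mul_le_mul_of_nonneg_left ?_ ht.1.le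
  rw [neg_zero, Real.rpow_zero, mul_one]
  exact norm_ddhs_le_of_holder (hf.continuous h1) hM (hH _ h1) (mul_one_sub_mem ht hσ).1 x

theorem perCont_ddduh (hf : PerCont (Set.Ioc 0 T) f)
    (hH : ∀ s ∈ Set.Ioc 0 T, ∀ x y, ‖f s x - f s y‖ ≤ H * √‖x - y‖) :
    PerCont (Set.Ioc 0 T) (ddduh f) :=
  ⟨continuousOn_setIntegral_kernel (by norm_num) (by norm_num) hf.continuousOn_ddkernel
    fun p hp σ hσ => hf.ddkernel_le hH hp.1 hσ p.2, fun t ht k x =>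
      setIntegral_congr_fun measurableSet_Ioo fun σ hσ => by
        beta_reduce
        rw [(hf.per _ (mul_mem_Ioc ht hσ)).ddhs]⟩

theorem hasFDerivAt_dduh (hf : PerCont (Set.Ioc 0 T) f)
    (hH : ∀ s ∈ Set.Ioc 0 T, ∀ x y, ‖f s x - f s y‖ ≤ H * √‖x - y‖) {a γ M : ℝ} (hF : Force T a γ M f)
    (hT : T ≤ 1) (ha : a < 1 / 2) (hγ : γ < 1) {t : ℝ} (ht : t ∈ Set.Ioc 0 T) (x : R3) :
    HasFDerivAt (dduh f t) (ddduh f t x) x := by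
  refine hasFDerivAt_integral_of_dominated_of_fderiv_le (𝕜 := ℝ) (s := Set.univ)
    (F' := fun y σ => t • ddhs (t * (1 - σ)) (f (t * σ)) y)
    (bound := fun σ => gradConst * gradHolderConst * (1 / 2) ^ (-(3 / 4 : ℝ)) * H *
      t ^ (1 - 3 / 4 - 0 : ℝ) * ((1 - σ) ^ (-(3 / 4 : ℝ)) * σ ^ (-0 : ℝ)))
    univ_mem (Eventually.of_forall fun y => (hF.integrableOn_dkernel hT ha hγ ht y).1)
    (hF.integrableOn_dkernel hT ha hγ ht x) ?_ ?_
    ((integrableOn_beta (by norm_num) (by norm_num)).const_mul _) ?_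
  · refine aestronglyMeasurable_Ioo ?_
    exact hf.continuousOn_ddkernel.comp (f := fun σ => ((t, x), σ)) (by fun_prop)
      fun _ hσ => ⟨⟨ht, trivial⟩, hσ⟩
  · exact (ae_restrict_iff' measurableSet_Ioo).2 (Eventually.of_forall fun σ hσ y _ =>
      hf.ddkernel_le hH ht hσ y)
  · refine (ae_restrict_iff' measurableSet_Ioo).2 (Eventually.of_forall fun σ hσ y _ => ?_)
    have h1 := mul_mem_Ioc ht hσ
    exact (hasFDerivAt_dhs (hf.continuous h1) (hf.per _ h1) (mul_one_sub_mem ht hσ).1 y).const_smul t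

/-- The gradient of a Duhamel integral is Hölder continuous. -/
theorem holder_dduh (hf : PerCont (Set.Ioc 0 T) f) {K : ℝ}
    (hK : ∀ s ∈ Set.Ioc 0 T, ∀ x, ‖f s x‖ ≤ K) {a γ M : ℝ} (hF : Force T a γ M f)
    (hT : T ≤ 1) (ha : a < 1 / 2) (hγ : γ < 1) {t : ℝ} (ht : t ∈ Set.Ioc 0 T) (x y : R3) :
    ‖dduh f t x - dduh f t y‖ ≤
      2 * (gradConst + 1) ^ 2 * K * betaI (3 / 4) 0 * √‖x - y‖ := by
  have hK0 : 0 ≤ K := (norm_nonneg _).trans (hK t ht 0)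
  rw [dduh, dduh, ← integral_sub (hF.integrableOn_dkernel hT ha hγ ht x)
    (hF.integrableOn_dkernel hT ha hγ ht y)]
  have h1 := norm_setIntegral_le_betaI (a := 3 / 4) (γ := 0)
    (M := (2 * (gradConst + 1) ^ 2 * K * √‖x - y‖) * t ^ (1 - 3 / 4 - 0 : ℝ))
    (k := fun σ => t • dhs (t * (1 - σ)) (f (t * σ)) x - t • dhs (t * (1 - σ)) (f (t * σ)) y)
    (by norm_num) (by norm_num) fun σ hσ => ?_
  · refine h1.trans ?_
    have h2 : t ^ (1 - 3 / 4 - 0 : ℝ) ≤ 1 :=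
      Real.rpow_le_one ht.1.le (ht.2.trans hT) (by norm_num)
    have h3 := betaI_nonneg (3 / 4) 0
    calc _ ≤ 2 * (gradConst + 1) ^ 2 * K * √‖x - y‖ * 1 * betaI (3 / 4) 0 := by gcongr
      _ = _ := by ring
  · have h2 := mul_mem_Ioc ht hσ
    rw [← smul_sub, norm_smul, Real.norm_of_nonneg ht.1.le, ← scaled_bound_eq ht.1 hσ, neg_zero,
      Real.rpow_zero, mul_one]
    refine mul_le_mul_of_nonneg_left ((holder_dhs (hf.continuous h2) (hf.per _ h2) (hK _ h2)
      (mul_one_sub_mem ht hσ).1 x y).trans (le_of_eq (by ring))) ht.1.le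

end PerCont

end YMH

namespace YMH

/-! ### Mild solutions of semilinear heat equations -/

theorem PerCont.comp_time {S : Type*} [TopologicalSpace S] {I J : Set ℝ} {f : ℝ → R3 → S}
    (hf : PerCont I f) {φ : ℝ → ℝ} (hφ : ContinuousOn φ J) (h : Set.MapsTo φ J I) :
    PerCont J fun t => f (φ t) :=
  ⟨hf.cont.comp (f := fun p : ℝ × R3 => (φ p.1, p.2))
    ((hφ.comp continuousOn_fst fun _ hq => hq.1).prodMk continuousOn_snd)
    fun _ hq => ⟨h hq.1, trivial⟩, fun _ ht => hf.per _ (h ht)⟩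

theorem exists_lipschitz_bound {E F : Type*} [NormedAddCommGroup E] [NormedSpace ℝ E]
    [FiniteDimensional ℝ E] [NormedAddCommGroup F] [NormedSpace ℝ F] {N : E → F}
    (hN : ContDiff ℝ 1 N) (R : ℝ) :
    ∃ L, 0 ≤ L ∧ ∀ p q, ‖p‖ ≤ R → ‖q‖ ≤ R → ‖N p - N q‖ ≤ L * ‖p - q‖ := by
  have := FiniteDimensional.proper_real E
  obtain ⟨L, hL⟩ := (isCompact_closedBall (0 : E) R).exists_bound_of_continuousOn
    (hN.continuous_fderiv one_ne_zero).continuousOn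
  refine ⟨|L|, abs_nonneg _, fun p q hp hq => ?_⟩
  exact (convex_closedBall (0 : E) R).norm_image_sub_le_of_norm_fderiv_le
    (fun x _ => hN.differentiable one_ne_zero x) (fun x hx => (hL x hx).trans (le_abs_self L))
    (by simpa using hq) (by simpa using hp)

variable {W : Type*} [NormedAddCommGroup W] [NormedSpace ℝ W]

theorem PerCont.continuousOn_duhamel {I : Set ℝ} {f : ℝ → R3 → W} (hf : PerCont I f) {s t : ℝ}
    (h : Set.Icc s t ⊆ I) (x : R3) : ContinuousOn (fun r => hs (t - r) (f r) x) (Set.Icc s t) :=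
  hf.continuousOn_hs (S := Set.Icc s t) (τ := fun r => t - r) (σ := fun r => r)
    (ξ := fun _ => x) (by fun_prop) (by fun_prop) (fun _ hr => h hr) (by fun_prop)

/-- `u`, with gradient `u'`, is a mild solution of `∂_t u = Δ u + N(u, ∇u)` on `(0, T)`. -/
structure Mild (N : W × (R3 →L[ℝ] W) → W) (T : ℝ) (u : ℝ → R3 → W) (u' : ℝ → R3 → R3 →L[ℝ] W) :
    Prop where
  pc : PerCont (Set.Ioo 0 T) u
  pc' : PerCont (Set.Ioo 0 T) u'
  deriv : ∀ t ∈ Set.Ioo 0 T, ∀ x, HasFDerivAt (u t) (u' t x) x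
  mild : ∀ s t, 0 < s → s < t → t < T → ∀ x,
    u t x = hs (t - s) (u s) x + ∫ r in s..t, hs (t - r) (fun y => N (u r y, u' r y)) x

namespace Mild

variable {N : W × (R3 →L[ℝ] W) → W} {T : ℝ} {u : ℝ → R3 → W} {u' : ℝ → R3 → R3 →L[ℝ] W}

theorem perCont_force (h : Mild N T u u') (hN : Continuous N) :
    PerCont (Set.Ioo 0 T) fun r y => N (u r y, u' r y) := (h.pc.prodMk h.pc').comp hN

/-- Restarting at a positive time removes the singularity of the data: the force is bounded on the
new interval. The formula for the gradient follows from uniqueness of the derivative. -/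
theorem exists_rep (h : Mild N T u u') (hN : Continuous N) {s₀ T₁ : ℝ} (h0 : 0 < s₀) (hT1 : T₁ ≤ 1)
    (hT : s₀ + T₁ < T) {g : ℝ → R3 → W} (hg : g = fun r y => N (u (s₀ + r) y, u' (s₀ + r) y)) :
    ∃ K, 0 ≤ K ∧ PerCont (Set.Ioc 0 T₁) g ∧ (∀ s ∈ Set.Ioc 0 T₁, ∀ x, ‖g s x‖ ≤ K) ∧
      Force T₁ 0 0 ((1 + gradConst) * K) g ∧
      (∀ t ∈ Set.Ioc 0 T₁, ∀ x, u (s₀ + t) x = hs t (u s₀) x + duh g t x) ∧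
      ∀ t ∈ Set.Ioc 0 T₁, ∀ x, u' (s₀ + t) x = dhs t (u s₀) x + dduh g t x := by
  have hf := h.perCont_force hN
  have hmem : ∀ t ∈ Set.Ioc 0 T₁, s₀ + t ∈ Set.Ioo 0 T := fun t ht =>
    ⟨by linarith [ht.1], by linarith [ht.2]⟩
  have hgc : PerCont (Set.Ioc 0 T₁) g := by
    rw [hg]; exact hf.comp_time (φ := fun r => s₀ + r) (by fun_prop) hmem
  obtain ⟨K, hK0, hK⟩ := hf.exists_bound (isCompact_Icc (a := s₀) (b := s₀ + T₁)) (fun r hr =>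
    ⟨by linarith [hr.1], by linarith [hr.2]⟩)
  have hgK : ∀ s ∈ Set.Ioc 0 T₁, ∀ x, ‖g s x‖ ≤ K := fun s hs x => by
    rw [hg]; exact hK _ ⟨by linarith [hs.1], by linarith [hs.2]⟩ x
  have hF : Force T₁ 0 0 ((1 + gradConst) * K) g := hgc.force hK0 fun s hs x => by
    simpa using hgK s hs x
  have hu : ∀ t ∈ Set.Ioc 0 T₁, ∀ x, u (s₀ + t) x = hs t (u s₀) x + duh g t x := by
    intro t ht x
    rw [h.mild s₀ (s₀ + t) h0 (by linarith [ht.1]) (hmem t ht).2 x, duh_eq, add_sub_cancel_left]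
    congr 1
    have := intervalIntegral.integral_comp_add_left (a := 0) (b := t)
      (fun r => hs (s₀ + t - r) (fun y => N (u r y, u' r y)) x) s₀
    rw [add_zero] at this
    rw [← this, hg]
    simp only [add_sub_add_left_eq_sub]
  refine ⟨K, hK0, hgc, hgK, hF, hu, fun t ht x => ?_⟩
  have hs0 : s₀ ∈ Set.Ioo 0 T := ⟨h0, by linarith [ht.1, ht.2]⟩
  obtain ⟨M, _, hM⟩ := h.pc.bound hs0
  have h1 := (hasFDerivAt_hs ht.1 (h.pc.continuous hs0) hM x).add
    (hF.hasFDerivAt_duh hT1 (by norm_num) (by norm_num) ht x)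
  refine (h.deriv _ (hmem t ht) x).unique (h1.congr_of_eventuallyEq ?_)
  exact Eventually.of_forall fun y => hu t ht y

/-- A bounded force already has a Duhamel integral with Hölder gradient. The restart takes place
strictly before the interval of interest, so the homogeneous part is not singular there. -/
theorem exists_holder [CompleteSpace W] (h : Mild N T u u') (hN : Continuous N) {s₀ s₁ t₁ : ℝ} (h0 : 0 < s₀)
    (h01 : s₀ < s₁) (ht1 : t₁ < T) (hle : t₁ - s₀ ≤ 1) :
    ∃ H, ∀ t ∈ Set.Icc s₁ t₁, ∀ x y, ‖u' t x - u' t y‖ ≤ H * √‖x - y‖ := by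
  rcases lt_or_ge t₁ s₁ with hlt | hst
  · exact ⟨0, fun t ht => absurd (ht.1.trans ht.2) (not_le.2 hlt)⟩
  obtain ⟨K, hK0, hg, hgK, hF, -, hrep⟩ := h.exists_rep hN h0 hle (by linarith) rfl
  have hs0 : s₀ ∈ Set.Ioo 0 T := ⟨h0, by linarith⟩
  obtain ⟨M, hM0, hM⟩ := h.pc.bound hs0
  refine ⟨2 * (gradConst + 1) ^ 2 * M * (s₁ - s₀) ^ (-(3 / 4 : ℝ)) +
    2 * (gradConst + 1) ^ 2 * K * betaI (3 / 4) 0, fun t ht x y => ?_⟩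
  have htm : t - s₀ ∈ Set.Ioc 0 (t₁ - s₀) := ⟨by linarith [ht.1], by linarith [ht.2]⟩
  have hx := hrep _ htm x
  have hy := hrep _ htm y
  rw [add_sub_cancel] at hx hy
  rw [hx, hy, add_sub_add_comm, add_mul]
  refine (norm_add_le _ _).trans (add_le_add ?_ ?_)
  · refine (holder_dhs (h.pc.continuous hs0) (h.pc.per _ hs0) hM htm.1 x y).trans ?_
    have h3 := Real.rpow_le_rpow_of_nonpos (sub_pos.2 h01) (show s₁ - s₀ ≤ t - s₀ by linarith [ht.1])
      (show (-(3 / 4 : ℝ)) ≤ 0 by norm_num)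
    have := gradConst_nonneg
    gcongr
  · exact hg.holder_dduh hgK hF hle (by norm_num) (by norm_num) htm x y

/-- The bootstrap: `u` and `u'` are bounded and Hölder continuous, the nonlinearity is Lipschitz on
their range, so the force is Hölder continuous and its Duhamel integral is twice differentiable. Two
restarts are used, the first for the Hölder bound and the second for the representation. -/
theorem exists_second_local [FiniteDimensional ℝ W] (h : Mild N T u u') (hN : ContDiff ℝ 1 N)
    {s₀ s₁ t₁ : ℝ} (h0 : 0 < s₀) (h01 : s₀ < s₁) (h1 : s₁ < t₁) (ht1 : t₁ < T) (hle : t₁ - s₀ ≤ 1) :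
    ∃ v : ℝ → R3 → R3 →L[ℝ] R3 →L[ℝ] W, PerCont (Set.Ioc s₁ t₁) v ∧ ∀ t ∈ Set.Ioc s₁ t₁, ∀ x, HasFDerivAt (u' t) (v t x) x := by
  have := FiniteDimensional.complete ℝ W
  obtain ⟨H, hH⟩ := h.exists_holder hN.continuous h0 h01 ht1 hle
  have hsub : Set.Icc s₁ t₁ ⊆ Set.Ioo 0 T := fun r hr => ⟨by linarith [hr.1], by linarith [hr.2]⟩
  obtain ⟨A, hA0, hA⟩ := h.pc.exists_bound (isCompact_Icc (a := s₁) (b := t₁)) hsub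
  obtain ⟨A', hA0', hA'⟩ := h.pc'.exists_bound (isCompact_Icc (a := s₁) (b := t₁)) hsub
  obtain ⟨L, hL0, hL⟩ := exists_lipschitz_bound hN (A + A')
  obtain ⟨K, hK0, hg, hgK, hF, -, hrep⟩ := h.exists_rep hN.continuous (s₀ := s₁) (T₁ := t₁ - s₁)
    (h0.trans h01) (by linarith) (by linarith) rfl
  set g : ℝ → R3 → W := fun r y => N (u (s₁ + r) y, u' (s₁ + r) y) with hgdef
  have hmem : ∀ s ∈ Set.Ioc 0 (t₁ - s₁), s₁ + s ∈ Set.Icc s₁ t₁ := fun s hs =>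
    ⟨by linarith [hs.1], by linarith [hs.2]⟩
  have hgH : ∀ s ∈ Set.Ioc 0 (t₁ - s₁), ∀ x y, ‖g s x - g s y‖ ≤
      (L * (√((A + A) * A') + H)) * √‖x - y‖ := by
    intro s hs x y
    have hm := hmem s hs
    have hb : ∀ z, ‖(u (s₁ + s) z, u' (s₁ + s) z)‖ ≤ A + A' := fun z => by
      rw [Prod.norm_def]
      exact max_le ((hA _ hm z).trans (by linarith)) ((hA' _ hm z).trans (by linarith))
    refine (hL _ _ (hb x) (hb y)).trans ?_
    rw [mul_assoc]
    refine mul_le_mul_of_nonneg_left ?_ hL0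
    have h2 := holder_of_hasFDerivAt (h.deriv _ (hsub hm)) (hA _ hm) (hA' _ hm) x y
    have h3 := hH _ hm x y
    rw [Prod.norm_def, add_mul]
    exact max_le (h2.trans (le_add_of_nonneg_right ((norm_nonneg _).trans h3)))
      (h3.trans (le_add_of_nonneg_left ((norm_nonneg _).trans h2)))
  have hs1 : s₁ ∈ Set.Ioo 0 T := hsub ⟨le_rfl, h1.le⟩
  refine ⟨fun t x => ddhs (t - s₁) (u s₁) x + ddduh g (t - s₁) x, ?_, fun t ht x => ?_⟩
  · refine PerCont.add ⟨?_, fun t _ => (h.pc.per _ hs1).ddhs _⟩ ?_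
    · exact ((h.pc.per _ hs1).perCont (h.pc.continuous hs1)).continuousOn_ddhs
        (S := Set.Ioc s₁ t₁ ×ˢ Set.univ) (τ := fun p : ℝ × R3 => p.1 - s₁) (σ := fun _ => 0)
        (ξ := fun p => p.2) (by fun_prop) (fun p hp => sub_pos.2 hp.1.1) (by fun_prop)
        (fun _ _ => trivial) (by fun_prop)
    · exact (hg.perCont_ddduh hgH).comp_time (φ := fun t => t - s₁) (by fun_prop) fun t ht =>
        ⟨sub_pos.2 ht.1, by linarith [ht.2]⟩
  · have htm : t - s₁ ∈ Set.Ioc 0 (t₁ - s₁) := ⟨sub_pos.2 ht.1, by linarith [ht.2]⟩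
    have h2 := (hasFDerivAt_dhs (h.pc.continuous hs1) (h.pc.per _ hs1) htm.1 x).add
      (hg.hasFDerivAt_dduh hgH hF (by linarith) (by norm_num) (by norm_num) htm x)
    refine h2.congr_of_eventuallyEq (Eventually.of_forall fun y => ?_)
    have := hrep _ htm y
    rwa [add_sub_cancel] at this

theorem exists_second [FiniteDimensional ℝ W] (h : Mild N T u u') (hN : ContDiff ℝ 1 N) (hT : T ≤ 1) :
    ∃ v : ℝ → R3 → R3 →L[ℝ] R3 →L[ℝ] W, PerCont (Set.Ioo 0 T) v ∧ ∀ t ∈ Set.Ioo 0 T, ∀ x, HasFDerivAt (u' t) (v t x) x := by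
  have key : ∀ t ∈ Set.Ioo 0 T, ∃ (s₁ t₁ : ℝ) (v : ℝ → R3 → R3 →L[ℝ] R3 →L[ℝ] W), t ∈ Set.Ioo s₁ t₁ ∧ PerCont (Set.Ioc s₁ t₁) v ∧
      ∀ t ∈ Set.Ioc s₁ t₁, ∀ x, HasFDerivAt (u' t) (v t x) x := by
    intro t ht
    -- A quarter of the distance to the ends leaves room for both restart times before `t` and for
    -- an interval after it.
    set d := min t (T - t) / 4
    have hd1 : d ≤ t / 4 := div_le_div_of_nonneg_right (min_le_left _ _) (by norm_num)
    have hd2 : d ≤ (T - t) / 4 := div_le_div_of_nonneg_right (min_le_right _ _) (by norm_num)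
    have hd0 : 0 < d := div_pos (lt_min ht.1 (sub_pos.2 ht.2)) (by norm_num)
    obtain ⟨v, hv, hv'⟩ := h.exists_second_local hN (s₀ := t - 2 * d) (s₁ := t - d) (t₁ := t + d)
      (by linarith [ht.1]) (by linarith) (by linarith) (by linarith [ht.2]) (by linarith)
    exact ⟨_, _, v, ⟨by linarith, by linarith⟩, hv, hv'⟩
  have hd : ∀ t ∈ Set.Ioo 0 T, ∀ x, HasFDerivAt (u' t) (fderiv ℝ (u' t) x) x := by
    intro t ht x
    obtain ⟨s₁, t₁, v, hm, hv, hv'⟩ := key t ht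
    exact (hv' t ⟨hm.1, hm.2.le⟩ x).differentiableAt.hasFDerivAt
  refine ⟨fun t x => fderiv ℝ (u' t) x, ⟨?_, fun t ht => (h.pc'.per t ht).fderiv⟩, hd⟩
  rintro ⟨t, x⟩ ⟨ht, -⟩
  obtain ⟨s₁, t₁, v, hm, hv, hv'⟩ := key t ht
  have h1 := hv.cont.continuousAt (x := (t, x)) (prod_mem_nhds (Ioc_mem_nhds hm.1 hm.2) univ_mem)
  refine (h1.congr ?_).continuousWithinAt
  filter_upwards [prod_mem_nhds (Ioc_mem_nhds hm.1 hm.2) univ_mem] with p hp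
  exact (hv' p.1 hp.1 p.2).fderiv.symm

end Mild

/-- The nonlinearity of the equation solved by a solution together with its gradient. -/
noncomputable def jetN (N : W × (R3 →L[ℝ] W) → W)
    (q : (W × (R3 →L[ℝ] W)) × (R3 →L[ℝ] W × (R3 →L[ℝ] W))) : W × (R3 →L[ℝ] W) :=
  (N q.1, (fderiv ℝ N q.1).comp q.2)

theorem contDiff_jetN {N : W × (R3 →L[ℝ] W) → W} (hN : ContDiff ℝ ∞ N) : ContDiff ℝ ∞ (jetN N) := by
  have h1 : ContDiff ℝ ∞ (fderiv ℝ N) := hN.fderiv_right (by simp)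
  exact (hN.comp contDiff_fst).prodMk ((h1.comp contDiff_fst).clm_comp contDiff_snd)

theorem hs_prodMk {W' : Type*} [NormedAddCommGroup W'] [NormedSpace ℝ W'] [CompleteSpace W]
    [CompleteSpace W'] {f : R3 → W} {g : R3 → W'} (hf : Continuous f)
    {M : ℝ} (hM : ∀ x, ‖f x‖ ≤ M) (hg : Continuous g) {M' : ℝ} (hM' : ∀ x, ‖g x‖ ≤ M') (t : ℝ)
    (x : R3) : hs t (fun y => (f y, g y)) x = (hs t f x, hs t g x) := by
  have hb : ∀ y, ‖(f y, g y)‖ ≤ max M M' := fun y => by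
    rw [Prod.norm_def]; exact max_le_max (hM y) (hM' y)
  have h1 := hs_clm (ContinuousLinearMap.fst ℝ W W') (hf.prodMk hg) hb t x
  have h2 := hs_clm (ContinuousLinearMap.snd ℝ W W') (hf.prodMk hg) hb t x
  exact Prod.ext h1.symm h2.symm

/-- Differentiating the mild formula: the gradient commutes with the heat flow and falls on the
nonlinearity, where the chain rule gives the second component of `jetN`. Hence every regularity
statement about `u` can be applied to its gradient as well. -/
theorem Mild.jet [FiniteDimensional ℝ W] {N : W × (R3 →L[ℝ] W) → W} {T : ℝ} {u : ℝ → R3 → W}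
    {u' : ℝ → R3 → R3 →L[ℝ] W} (h : Mild N T u u') (hN : ContDiff ℝ 1 N) (hT : T ≤ 1)
    {u'' : ℝ → R3 → R3 →L[ℝ] R3 →L[ℝ] W} (hc : PerCont (Set.Ioo 0 T) u'')
    (hu'' : ∀ t ∈ Set.Ioo 0 T, ∀ x, HasFDerivAt (u' t) (u'' t x) x) :
    Mild (jetN N) T (fun t x => (u t x, u' t x)) (fun t x => (u' t x).prod (u'' t x)) := by
  have := FiniteDimensional.complete ℝ W
  have hf := h.perCont_force hN.continuous
  have hdU : ∀ t ∈ Set.Ioo 0 T, ∀ x, HasFDerivAt (fun x => (u t x, u' t x))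
      ((u' t x).prod (u'' t x)) x := fun t ht x => (h.deriv t ht x).prodMk (hu'' t ht x)
  have hpU' : PerCont (Set.Ioo 0 T) fun t x => (u' t x).prod (u'' t x) :=
    (h.pc'.prodMk hc).comp (g := fun p : (R3 →L[ℝ] W) × (R3 →L[ℝ] R3 →L[ℝ] W) => p.1.prod p.2)
      (ContinuousLinearMap.prodₗᵢ (𝕜 := ℝ) (E := R3) (F := W) (G := R3 →L[ℝ] W) ℝ).continuous
  have hcf : Continuous (fderiv ℝ N) := hN.continuous_fderiv one_ne_zero
  have hf' : PerCont (Set.Ioo 0 T) fun t x =>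
      (fderiv ℝ N (u t x, u' t x)).comp ((u' t x).prod (u'' t x)) :=
    ((h.pc.prodMk h.pc').prodMk hpU').comp
      (g := fun q : (W × (R3 →L[ℝ] W)) × (R3 →L[ℝ] W × (R3 →L[ℝ] W)) =>
        (fderiv ℝ N q.1).comp q.2) ((hcf.comp continuous_fst).clm_comp continuous_snd)
  have hdf : ∀ t ∈ Set.Ioo 0 T, ∀ x, HasFDerivAt (fun x => N (u t x, u' t x))
      ((fderiv ℝ N (u t x, u' t x)).comp ((u' t x).prod (u'' t x))) x := fun t ht x =>
    (hN.differentiable one_ne_zero _).hasFDerivAt.comp x (hdU t ht x)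
  refine ⟨h.pc.prodMk h.pc', hpU', hdU, fun s t hs0 hst ht x => ?_⟩
  have hs' : s ∈ Set.Ioo 0 T := ⟨hs0, hst.trans ht⟩
  obtain ⟨A, _, hA⟩ := h.pc.bound hs'
  obtain ⟨A', _, hA'⟩ := h.pc'.bound hs'
  have hsub : Set.Icc s t ⊆ Set.Ioo 0 T := fun r hr => ⟨by linarith [hr.1], by linarith [hr.2]⟩
  have hle : Set.uIcc s t = Set.Icc s t := Set.uIcc_of_le hst.le
  have hi1 : IntervalIntegrable (fun r => hs (t - r) (fun y => jetN N ((u r y, u' r y),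
      (u' r y).prod (u'' r y))) x) volume s t := by
    refine ContinuousOn.intervalIntegrable ?_
    rw [hle]
    exact (hf.prodMk hf').continuousOn_duhamel hsub x
  have hcomp : ∀ r ∈ Set.Icc s t, hs (t - r) (fun y => jetN N ((u r y, u' r y),
      (u' r y).prod (u'' r y))) x = (hs (t - r) (fun y => N (u r y, u' r y)) x,
        hs (t - r) (fun y => (fderiv ℝ N (u r y, u' r y)).comp ((u' r y).prod (u'' r y))) x) := by
    intro r hr
    obtain ⟨B, _, hB⟩ := hf.bound (hsub hr)
    obtain ⟨B', _, hB'⟩ := hf'.bound (hsub hr)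
    exact hs_prodMk (hf.continuous (hsub hr)) hB (hf'.continuous (hsub hr)) hB' _ _
  rw [hs_prodMk (h.pc.continuous hs') hA (h.pc'.continuous hs') hA']
  refine Prod.ext ?_ ?_
  · rw [Prod.fst_add]
    have h1 := (ContinuousLinearMap.fst ℝ W (R3 →L[ℝ] W)).intervalIntegral_comp_comm hi1
    simp only [ContinuousLinearMap.coe_fst'] at h1
    rw [← h1, h.mild s t hs0 hst ht x]
    dsimp only
    congr 1
    refine intervalIntegral.integral_congr fun r hr => ?_
    rw [hle] at hr
    simp only [hcomp r hr]
  · rw [Prod.snd_add]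
    have h1 := (ContinuousLinearMap.snd ℝ W (R3 →L[ℝ] W)).intervalIntegral_comp_comm hi1
    simp only [ContinuousLinearMap.coe_snd'] at h1
    rw [← h1]
    obtain ⟨K, hK0, hg, hgK, hF, -, hrep⟩ := h.exists_rep hN.continuous hs0 (T₁ := t - s)
      (by linarith) (by linarith) rfl
    have htm : t - s ∈ Set.Ioc 0 (t - s) := ⟨by linarith, le_rfl⟩
    have h2 := hrep _ htm x
    rw [add_sub_cancel] at h2
    rw [h2, dhs_eq_hs (h.deriv s hs') (h.pc'.continuous hs') hA hA' htm.1]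
    -- Under the Duhamel integral the gradient moves from the heat kernel to the force, which is now
    -- differentiable.
    have h3 : dduh (fun r y => N (u (s + r) y, u' (s + r) y)) (t - s) x =
        duh (fun r y => (fderiv ℝ N (u (s + r) y, u' (s + r) y)).comp
          ((u' (s + r) y).prod (u'' (s + r) y))) (t - s) x := by
      refine setIntegral_congr_fun measurableSet_Ioo fun σ hσ => ?_
      have h4 := mul_mem_Ioc htm hσ
      have h5 : s + (t - s) * σ ∈ Set.Ioo 0 T := ⟨by linarith [h4.1], by linarith [h4.2]⟩
      obtain ⟨B, _, hB⟩ := hf.bound h5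
      obtain ⟨B', _, hB'⟩ := hf'.bound h5
      beta_reduce
      rw [dhs_eq_hs (hdf _ h5) (hf'.continuous h5) hB hB' (mul_one_sub_mem htm hσ).1]
    rw [h3, duh_eq]
    have h6 := intervalIntegral.integral_comp_add_left (a := 0) (b := t - s)
      (fun r => hs (t - r) (fun y => (fderiv ℝ N (u r y, u' r y)).comp
          ((u' r y).prod (u'' r y))) x) s
    rw [add_zero, add_sub_cancel] at h6
    dsimp only
    congr 1
    rw [show (fun r => hs (t - s - r) (fun y => (fderiv ℝ N (u (s + r) y, u' (s + r) y)).comp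
          ((u' (s + r) y).prod (u'' (s + r) y))) x) = fun r => hs (t - (s + r)) (fun y =>
          (fderiv ℝ N (u (s + r) y, u' (s + r) y)).comp
          ((u' (s + r) y).prod (u'' (s + r) y))) x by ext1 r; rw [sub_sub], h6]
    refine intervalIntegral.integral_congr fun r hr => ?_
    rw [hle] at hr
    simp only [hcomp r hr]

end YMH

namespace YMH

/-! ### Time derivatives and joint smoothness of mild solutions -/

variable {W : Type*} [NormedAddCommGroup W] [NormedSpace ℝ W]

/-- The trace of a bilinear form, that is, the Laplacian as a function of the second derivative. -/
noncomputable def traceL : (R3 →L[ℝ] R3 →L[ℝ] W) →L[ℝ] W :=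
  ∑ j : Fin 3, (ContinuousLinearMap.apply ℝ W (EuclideanSpace.single j (1 : ℝ))).comp
    (ContinuousLinearMap.apply ℝ (R3 →L[ℝ] W) (EuclideanSpace.single j (1 : ℝ)))

theorem traceL_apply (A : R3 →L[ℝ] R3 →L[ℝ] W) : traceL A =
    ∑ j : Fin 3, A (EuclideanSpace.single j 1) (EuclideanSpace.single j 1) := by
  simp [traceL]

theorem contDiff_traceL {n : WithTop ℕ∞} :
    ContDiff ℝ n fun A : R3 →L[ℝ] R3 →L[ℝ] W => traceL A := by
  simp only [traceL_apply]
  exact ContDiff.sum fun j _ => (contDiff_id.clm_apply contDiff_const).clm_apply contDiff_const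

/-- The backward formula `hasDerivAt_hs_sub` for a function constant in time, with time reversed. -/
theorem hasDerivAt_hs [CompleteSpace W] {g : R3 → W} {g' : R3 → R3 →L[ℝ] W}
    {g'' : R3 → R3 →L[ℝ] R3 →L[ℝ] W} (hp : Periodic g) (h1 : ∀ x, HasFDerivAt g (g' x) x)
    (h2 : ∀ x, HasFDerivAt g' (g'' x) x) (hc : Continuous g'') {t : ℝ} (ht : 0 < t) (x : R3) :
    HasDerivAt (fun r => hs r g x) (hs t (fun y => traceL (g'' y)) x) t := by
  have e1 : g' = fderiv ℝ g := funext fun y => (h1 y).fderiv.symm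
  have e2 : g'' = fderiv ℝ g' := funext fun y => (h2 y).fderiv.symm
  have hg : Continuous g := continuous_iff_continuousAt.2 fun y => (h1 y).continuousAt
  have hg' : Continuous g' := continuous_iff_continuousAt.2 fun y => (h2 y).continuousAt
  have hp' : Periodic g' := e1 ▸ hp.fderiv
  have hp'' : Periodic g'' := e2 ▸ hp'.fderiv
  obtain ⟨M, _, hM⟩ := hp.exists_bound hg
  obtain ⟨M', _, hM'⟩ := hp'.exists_bound hg'
  obtain ⟨M'', hM0'', hM''⟩ := hp''.exists_bound hc
  have hpd : ∀ j, pd j g = fun y => g' y (EuclideanSpace.single j 1) := fun j => by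
    ext1 y; rw [e1]; rfl
  have hpd' : ∀ j y, HasFDerivAt (pd j g) ((ContinuousLinearMap.apply ℝ W
      (EuclideanSpace.single j (1 : ℝ))).comp (g'' y)) y := fun j y => by
    rw [hpd]
    exact (ContinuousLinearMap.apply ℝ W (EuclideanSpace.single j (1 : ℝ))).hasFDerivAt.comp y (h2 y)
  have key := hasDerivAt_hs_sub (u := fun _ => g)
    (u' := fun _ y => (g' y).comp (ContinuousLinearMap.snd ℝ ℝ R3))
    (f'' := fun j y => (ContinuousLinearMap.apply ℝ W
      (EuclideanSpace.single j (1 : ℝ))).comp (g'' y)) (t := t) (s := t - t) x (I := Set.univ)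
    univ_mem (by simpa using ht)
    (fun r _ y => (h1 y).comp (r, y) hasFDerivAt_snd) (by fun_prop) (M := M)
    (K := M' * ‖ContinuousLinearMap.snd ℝ ℝ R3‖)
    (K' := ∑ j : Fin 3, ‖ContinuousLinearMap.apply ℝ W (EuclideanSpace.single j (1 : ℝ))‖ * M'') hM
    (fun r _ y => (ContinuousLinearMap.opNorm_comp_le _ _).trans
      (mul_le_mul_of_nonneg_right (hM' y) (norm_nonneg _)))
    hpd' (fun j => by fun_prop) (fun j y => (ContinuousLinearMap.opNorm_comp_le _ _).trans
      ((mul_le_mul_of_nonneg_left (hM'' y) (norm_nonneg _)).trans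
        (Finset.single_le_sum (f := fun j : Fin 3 => ‖ContinuousLinearMap.apply ℝ W
          (EuclideanSpace.single j (1 : ℝ))‖ * M'')
          (fun i _ => by positivity) (Finset.mem_univ j))))
  have key2 := key.comp_const_sub t t
  have e3 : (fun y => ((g' y).comp (ContinuousLinearMap.snd ℝ ℝ R3)) ((1 : ℝ), (0 : R3)) -
      ∑ j, pd j (pd j g) y) = fun y => (-1 : ℝ) • traceL (g'' y) := by
    ext1 y
    have e4 : ∀ j, pd j (pd j g) y = g'' y (EuclideanSpace.single j 1) (EuclideanSpace.single j 1) :=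
      fun j => by rw [pd, (hpd' j y).fderiv]; rfl
    simp [e4, traceL_apply]
  rw [e3, hs_smul] at key2
  simpa using key2

/-- The derivative at positive times has a limit at zero, which is then the one-sided derivative
there. -/
theorem hasDerivWithinAt_hs_zero [CompleteSpace W] {g : R3 → W} {g' : R3 → R3 →L[ℝ] W}
    {g'' : R3 → R3 →L[ℝ] R3 →L[ℝ] W} (hp : Periodic g) (h1 : ∀ x, HasFDerivAt g (g' x) x)
    (h2 : ∀ x, HasFDerivAt g' (g'' x) x) (hc : Continuous g'') (x : R3) :
    HasDerivWithinAt (fun r => hs r g x) (traceL (g'' x)) (Set.Ici 0) 0 := by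
  have hg : Continuous g := continuous_iff_continuousAt.2 fun y => (h1 y).continuousAt
  have hp'' : Periodic g'' := by
    have e1 : g' = fderiv ℝ g := funext fun y => (h1 y).fderiv.symm
    have e2 : g'' = fderiv ℝ g' := funext fun y => (h2 y).fderiv.symm
    rw [e2, e1]; exact hp.fderiv.fderiv
  have hcont : ∀ f : R3 → W, Continuous f → Periodic f →
      ContinuousOn (fun r => hs r f x) Set.univ := fun f hf hpf =>
    (hpf.perCont hf).continuousOn_hs (τ := fun r : ℝ => r) (σ := fun _ => 0) (ξ := fun _ => x)
      (by fun_prop) (by fun_prop) (fun _ _ => trivial) (by fun_prop)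
  refine hasDerivWithinAt_Ici_of_tendsto_deriv (s := Set.Ioi 0)
    (fun r hr => (hasDerivAt_hs hp h1 h2 hc hr x).differentiableAt.differentiableWithinAt)
    ((hcont g hg hp 0 trivial).mono (Set.subset_univ _))
    self_mem_nhdsWithin ?_
  have h3 := (continuousOn_univ.1 (hcont (fun y => traceL (g'' y)) (by fun_prop)
    (fun k y => congrArg traceL (hp'' k y)))).tendsto 0
  rw [hs_zero] at h3
  refine (h3.mono_left nhdsWithin_le_nhds).congr' ?_
  filter_upwards [self_mem_nhdsWithin] with r hr
  exact (hasDerivAt_hs hp h1 h2 hc hr x).deriv.symm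

/-- The forcing term over a short interval is asymptotic to the length of the interval. -/
theorem PerCont.hasDerivWithinAt_duhamel [CompleteSpace W] {a b : ℝ} {f : ℝ → R3 → W}
    (hf : PerCont (Set.Ioo a b) f) {t : ℝ} (ht : t ∈ Set.Ioo a b) (x : R3) :
    HasDerivWithinAt (fun r => ∫ v in t..r, hs (r - v) (f v) x) (f t x) (Set.Ici t) t := by
  -- The mean of the integrand over the interval, written over [0, 1]; it is continuous at `t` from
  -- the right, and its value there is `f t x`.
  set G : ℝ → W := fun r => ∫ σ in (0 : ℝ)..1, hs ((r - t) * (1 - σ)) (f (t + (r - t) * σ)) x with hG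
  have e1 : ∀ r, ∫ v in t..r, hs (r - v) (f v) x = (r - t) • G r := by
    intro r
    rw [hG]
    have := intervalIntegral.smul_integral_comp_mul_left (a := 0) (b := 1)
      (fun v => hs (r - t - v) (f (t + v)) x) (r - t)
    rw [mul_zero, mul_one] at this
    have h2 := intervalIntegral.integral_comp_add_left (a := 0) (b := r - t)
      (fun v => hs (r - v) (f v) x) t
    rw [add_zero, add_sub_cancel] at h2
    rw [← h2]
    simp only [← sub_sub]
    rw [← this]
    simp only [mul_sub, mul_one]
  have hcont : ContinuousOn (fun q : ℝ × ℝ => hs ((q.1 - t) * (1 - q.2)) (f (t + (q.1 - t) * q.2)) x)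
      (Set.Ico t b ×ˢ Set.Icc 0 1) :=
    hf.continuousOn_hs (τ := fun q : ℝ × ℝ => (q.1 - t) * (1 - q.2))
      (σ := fun q => t + (q.1 - t) * q.2) (ξ := fun _ => x) (by fun_prop) (by fun_prop)
      (fun q hq => ⟨by nlinarith [hq.1.1, hq.2.1, ht.1], by
        nlinarith [hq.1.1, hq.1.2, hq.2.1, hq.2.2]⟩) (by fun_prop)
  obtain ⟨M, hM⟩ := hf.eventually_bound ht
  have hGc : ContinuousWithinAt G (Set.Ici t) t := by
    have h0 : ∀ᶠ r in 𝓝[Set.Ici t] t, r ∈ Set.Ico t b := Ico_mem_nhdsGE ht.2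
    obtain ⟨B, _, hB⟩ := hf.exists_bound (isCompact_Icc (a := t) (b := (t + b) / 2))
      (fun r hr => ⟨ht.1.trans_le hr.1, by linarith [hr.2, ht.2]⟩)
    have h0' : ∀ᶠ r in 𝓝[Set.Ici t] t, r ∈ Set.Ico t ((t + b) / 2) :=
      Ico_mem_nhdsGE (by linarith [ht.2])
    refine intervalIntegral.continuousWithinAt_of_dominated_interval (bound := fun _ => B) ?_ ?_
      (by simp) ?_
    · filter_upwards [h0] with r hr
      rw [Set.uIoc_of_le zero_le_one]
      refine ContinuousOn.aestronglyMeasurable ?_ measurableSet_Ioc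
      exact hcont.comp (f := fun σ => (r, σ)) (by fun_prop) fun σ hσ => ⟨hr, hσ.1.le, hσ.2⟩
    · filter_upwards [h0'] with r hr
      refine Eventually.of_forall fun σ hσ => norm_hs_le (hB _ ?_) _ _
      rw [Set.uIoc_of_le zero_le_one] at hσ
      exact ⟨by nlinarith [hr.1, hσ.1], by nlinarith [hr.1, hr.2, hσ.1, hσ.2]⟩
    · refine Eventually.of_forall fun σ hσ => ?_
      rw [Set.uIoc_of_le zero_le_one] at hσ
      have h3 := hcont (t, σ) ⟨⟨le_rfl, ht.2⟩, hσ.1.le, hσ.2⟩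
      have h4 : ContinuousWithinAt (fun r => hs ((r - t) * (1 - σ)) (f (t + (r - t) * σ)) x)
          (Set.Ico t b) t :=
        h3.comp (f := fun r => (r, σ)) (by fun_prop) fun r hr => ⟨hr, hσ.1.le, hσ.2⟩
      exact h4.mono_of_mem_nhdsWithin h0
  have hG0 : G t = f t x := by
    simp [hG, hs_zero]
  rw [hasDerivWithinAt_iff_tendsto_slope, ← hG0]
  have h5 : Tendsto G (𝓝[Set.Ici t \ {t}] t) (𝓝 (G t)) :=
    hGc.tendsto.mono_left (nhdsWithin_mono _ Set.sdiff_subset)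
  refine h5.congr' ?_
  filter_upwards [self_mem_nhdsWithin] with r hr
  rw [slope_def_module, e1, e1, sub_self, zero_smul, sub_zero, smul_smul,
    inv_mul_cancel₀ (sub_ne_zero.2 hr.2), one_smul]

/-- The mild formula runs forward in time and therefore yields only a right derivative. That
derivative is continuous, and a continuous function with continuous right derivative is a primitive
of it. -/
theorem Mild.hasDerivAt_time [CompleteSpace W] {N : W × (R3 →L[ℝ] W) → W} {T : ℝ} {u : ℝ → R3 → W}
    {u' : ℝ → R3 → R3 →L[ℝ] W} (h : Mild N T u u') (hN : Continuous N)
    {u'' : ℝ → R3 → R3 →L[ℝ] R3 →L[ℝ] W} (hc : PerCont (Set.Ioo 0 T) u'')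
    (hu'' : ∀ t ∈ Set.Ioo 0 T, ∀ x, HasFDerivAt (u' t) (u'' t x) x) {t : ℝ}
    (ht : t ∈ Set.Ioo 0 T) (x : R3) :
    HasDerivAt (fun r => u r x) (traceL (u'' t x) + N (u t x, u' t x)) t := by
  have hf := h.perCont_force hN
  set G : ℝ → W := fun r => traceL (u'' r x) + N (u r x, u' r x) with hG
  have hGc : ContinuousOn G (Set.Ioo 0 T) := by
    have h1 := (hc.comp (g := traceL) (by fun_prop)).add hf
    exact h1.cont.comp (f := fun r => (r, x)) (by fun_prop) fun r hr => ⟨hr, trivial⟩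
  have huc : ContinuousOn (fun r => u r x) (Set.Ioo 0 T) :=
    h.pc.cont.comp (f := fun r => (r, x)) (by fun_prop) fun r hr => ⟨hr, trivial⟩
  have hright : ∀ r ∈ Set.Ioo 0 T, HasDerivWithinAt (fun r => u r x) (G r) (Set.Ici r) r := by
    intro r hr
    have h1 := hasDerivWithinAt_hs_zero (h.pc.per r hr) (h.deriv r hr) (hu'' r hr)
      (hc.continuous hr) x
    have h2 : HasDerivWithinAt (fun v => hs (v - r) (u r) x) (traceL (u'' r x)) (Set.Ici r) r := by
      have h3 : HasDerivWithinAt (fun r_1 => hs r_1 (u r) x) (traceL (u'' r x)) (Set.Ici 0) (r - r) := by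
        rwa [sub_self]
      have h4 := h3.scomp (h := fun v => v - r) (s := Set.Ici r) r
        ((hasDerivAt_id r).sub_const r).hasDerivWithinAt fun v hv =>
          Set.mem_Ici.2 (sub_nonneg.2 hv)
      rw [one_smul] at h4
      exact h4
    refine (h2.add (hf.hasDerivWithinAt_duhamel hr x)).congr_of_eventuallyEq ?_ ?_
    · filter_upwards [Ico_mem_nhdsGE hr.2] with v hv
      rcases hv.1.eq_or_lt with rfl | hlt
      · simp [hs_zero]
      · exact h.mild r v hr.1 hlt hv.2 x
    · simp [hs_zero]
  set s := t / 2
  set T' := (t + T) / 2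
  have hs0 : 0 < s := half_pos ht.1
  have hst : s < t := half_lt_self ht.1
  have htT' : t < T' := by have := ht.2; simp only [T']; linarith
  have hT' : T' < T := by have := ht.2; simp only [T']; linarith
  have hsub : Set.Icc s T' ⊆ Set.Ioo 0 T := fun r hr => ⟨hs0.trans_le hr.1, hr.2.trans_lt hT'⟩
  have hint : ∀ r ∈ Set.Ioo 0 T, HasDerivAt (fun r => ∫ v in s..r, G v) (G r) r := by
    intro r hr
    refine intervalIntegral.integral_hasDerivAt_right ?_
      (hGc.stronglyMeasurableAtFilter isOpen_Ioo r hr) (hGc.continuousAt (isOpen_Ioo.mem_nhds hr))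
    refine (hGc.mono fun v hv => ?_).intervalIntegrable
    rw [Set.mem_uIcc] at hv
    rcases hv with hv | hv
    · exact ⟨hs0.trans_le hv.1, hv.2.trans_lt hr.2⟩
    · exact ⟨hr.1.trans_le hv.1, hv.2.trans_lt ((hst.trans ht.2))⟩
  -- The difference from the primitive is continuous with vanishing right derivative.
  have hconst := constant_of_has_deriv_right_zero (a := s) (b := T')
    (f := fun r => u r x - ∫ v in s..r, G v)
    (((huc.mono hsub).sub fun r hr => (hint r (hsub hr)).continuousAt.continuousWithinAt))
    (fun r hr => by
      have hr' := hsub (Set.Ico_subset_Icc_self hr)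
      have := (hright r hr').sub (hint r hr').hasDerivWithinAt
      rwa [sub_self] at this)
  have heq : ∀ r ∈ Set.Icc s T', u r x = u s x + ∫ v in s..r, G v := by
    intro r hr
    have := hconst r hr
    simp only [intervalIntegral.integral_same, sub_zero] at this
    rw [← this]; abel
  refine ((hint t ht).const_add (u s x)).congr_of_eventuallyEq ?_
  filter_upwards [Icc_mem_nhds hst htT'] with r hr using heq r hr

/-- The target space is quantified inside the induction because the induction hypothesis is applied
to jets, which take values in larger spaces. -/
theorem contDiffOn_mild (n : ℕ) {T : ℝ} (hT : T ≤ 1) : ∀ {W : Type*} [NormedAddCommGroup W]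
    [NormedSpace ℝ W] [FiniteDimensional ℝ W] {N : W × (R3 →L[ℝ] W) → W} {u : ℝ → R3 → W}
    {u' : ℝ → R3 → R3 →L[ℝ] W}, ContDiff ℝ ∞ N → Mild N T u u' →
    ContDiffOn ℝ n (fun p : ℝ × R3 => u p.1 p.2) (Set.Ioo 0 T ×ˢ Set.univ) := by
  induction n with
  | zero =>
    intro W _ _ _ N u u' hN h
    exact contDiffOn_zero.2 h.pc.cont
  | succ n ih =>
    intro W _ _ _ N u u' hN h
    have := FiniteDimensional.complete ℝ W
    have hN1 : ContDiff ℝ 1 N := hN.of_le (by simp)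
    obtain ⟨u'', hc, hu''⟩ := h.exists_second hN1 hT
    have hU := h.jet hN1 hT hc hu''
    have hNU := contDiff_jetN hN
    have hNU1 : ContDiff ℝ 1 (jetN N) := hNU.of_le (by simp)
    obtain ⟨U'', hcU, hU''⟩ := hU.exists_second hNU1 hT
    have hU2 := hU.jet hNU1 hT hcU hU''
    have hopen : IsOpen (Set.Ioo 0 T ×ˢ (Set.univ : Set R3)) := isOpen_Ioo.prod isOpen_univ
    have c1 := ih hNU hU
    -- One jet gives the regularity of the gradient; the time derivative also involves the
    -- Laplacian, for which the jet of the jet is needed.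
    have c2 := ih (contDiff_jetN hNU) hU2
    have cu' : ContDiffOn ℝ n (fun p : ℝ × R3 => u' p.1 p.2) (Set.Ioo 0 T ×ˢ Set.univ) :=
      contDiff_snd.comp_contDiffOn c1
    have cU' : ContDiffOn ℝ n (fun p : ℝ × R3 => (u' p.1 p.2).prod (u'' p.1 p.2))
        (Set.Ioo 0 T ×ˢ Set.univ) := contDiff_snd.comp_contDiffOn c2
    have cu'' : ContDiffOn ℝ n (fun p : ℝ × R3 => u'' p.1 p.2) (Set.Ioo 0 T ×ˢ Set.univ) := by
      have h1 : ContDiffOn ℝ n (fun p : ℝ × R3 =>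
          (ContinuousLinearMap.snd ℝ W (R3 →L[ℝ] W)).comp ((u' p.1 p.2).prod (u'' p.1 p.2)))
          (Set.Ioo 0 T ×ˢ Set.univ) := contDiffOn_const.clm_comp cU'
      exact h1
    set d : ℝ → R3 → ℝ →L[ℝ] W := fun t x =>
      ContinuousLinearMap.toSpanSingleton ℝ (traceL (u'' t x) + N (u t x, u' t x)) with hd
    have cd : ContDiffOn ℝ n (fun p : ℝ × R3 => d p.1 p.2) (Set.Ioo 0 T ×ˢ Set.univ) := by
      have h1 : ContDiffOn ℝ n (fun p : ℝ × R3 => traceL (u'' p.1 p.2) + N (u p.1 p.2, u' p.1 p.2))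
          (Set.Ioo 0 T ×ˢ Set.univ) :=
        ContDiffOn.add (f := fun p : ℝ × R3 => traceL (u'' p.1 p.2))
          (contDiff_traceL.comp_contDiffOn cu'')
          ((hN.of_le (by exact_mod_cast le_top)).comp_contDiffOn c1)
      exact (ContinuousLinearMap.toSpanSingletonCLE (𝕜 := ℝ) (E := W)).contDiff.comp_contDiffOn h1
    have hfd : ∀ p ∈ Set.Ioo 0 T ×ˢ (Set.univ : Set R3), HasFDerivAt (fun p : ℝ × R3 => u p.1 p.2)
        ((d p.1 p.2).coprod (u' p.1 p.2)) p := by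
      intro p hp
      have hm := hopen.mem_nhds hp
      refine (hasStrictFDerivAt_uncurry_coprod (f := u) (f₁ := d) (f₂ := u') ?_ ?_ ?_ ?_).hasFDerivAt
      · filter_upwards [hm] with q hq
        exact (h.hasDerivAt_time hN.continuous hc hu'' hq.1 q.2).hasFDerivAt
      · filter_upwards [hm] with q hq using h.deriv q.1 hq.1 q.2
      · exact cd.continuousOn.continuousAt hm
      · exact cu'.continuousOn.continuousAt hm
    rw [Nat.cast_add, Nat.cast_one, contDiffOn_succ_iff_fderiv_of_isOpen hopen]
    refine ⟨fun p hp => (hfd p hp).differentiableAt.differentiableWithinAt, fun hn => by simp at hn, ?_⟩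
    have h2 : ContDiffOn ℝ n (fun p : ℝ × R3 => (d p.1 p.2).coprod (u' p.1 p.2))
        (Set.Ioo 0 T ×ˢ Set.univ) := by
      have e : (fun p : ℝ × R3 => (d p.1 p.2).coprod (u' p.1 p.2)) = fun p =>
          (d p.1 p.2).comp (ContinuousLinearMap.fst ℝ ℝ R3) +
          (u' p.1 p.2).comp (ContinuousLinearMap.snd ℝ ℝ R3) := by
        ext1 p; ext <;> simp
      rw [e]
      exact (cd.clm_comp contDiffOn_const).add (cu'.clm_comp contDiffOn_const)
    exact h2.congr fun p hp => (hfd p hp).fderiv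

end YMH

namespace YMH

/-! ### The semilinear structure of the Yang–Mills–Higgs flow -/

theorem pd_eq {W : Type*} [NormedAddCommGroup W] [NormedSpace ℝ W] {f : R3 → W}
    {f' : R3 →L[ℝ] W} {x : R3} (h : HasFDerivAt f f' x) (j : Fin 3) :
    pd j f x = f' (EuclideanSpace.single j 1) := by rw [pd, h.fderiv]

section

variable {F : Type*} [NormedAddCommGroup F] [InnerProductSpace ℝ F] [FiniteDimensional ℝ F]
  {V : Type*} [NormedAddCommGroup V] [InnerProductSpace ℝ V] [FiniteDimensional ℝ V]

theorem exists_bracket (G : Type*) [Group G] [TopologicalSpace G] [ChartedSpace F G]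
    [LieGroup 𝓘(ℝ, F) ∞ G] : ∃ b : F →L[ℝ] F →L[ℝ] F, ∀ x y, br G x y = b x y := by
  -- The Lie algebra structure asks for the regularity `minSmoothness ℝ 3`, which over the reals is
  -- three.
  have : LieGroup 𝓘(ℝ, F) (minSmoothness ℝ 3) G := by
    rw [minSmoothness_of_isRCLikeNormedField]
    infer_instance
  have h : IsBilinearMap ℝ (br (F := F) G) :=
    { add_left := fun x y z => add_lie (L := GroupLieAlgebra 𝓘(ℝ, F) G)
        (M := GroupLieAlgebra 𝓘(ℝ, F) G) x y z
      smul_left := fun c x y => smul_lie (R := ℝ) (L := GroupLieAlgebra 𝓘(ℝ, F) G)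
        (M := GroupLieAlgebra 𝓘(ℝ, F) G) c x y
      add_right := fun x y z => lie_add (L := GroupLieAlgebra 𝓘(ℝ, F) G)
        (M := GroupLieAlgebra 𝓘(ℝ, F) G) x y z
      smul_right := fun c x y => lie_smul (R := ℝ) (L := GroupLieAlgebra 𝓘(ℝ, F) G)
        (M := GroupLieAlgebra 𝓘(ℝ, F) G) c x y }
  exact ⟨h.toContinuousBilinearMap, fun x y => rfl⟩

theorem exists_action {G : Type*} [Group G] [TopologicalSpace G] [ChartedSpace F G]
    (ρ : G →* (V ≃ₗᵢ[ℝ] V)) (hρ : ∀ v : V, ContMDiff 𝓘(ℝ, F) 𝓘(ℝ, V) ∞ fun g : G => ρ g v) :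
    ∃ b : V →L[ℝ] F →L[ℝ] V, ∀ v : V, act (F := F) ρ v = b v := by
  have hd : ∀ v : V, MDifferentiableAt 𝓘(ℝ, F) 𝓘(ℝ, V) (fun g : G => ρ g v) 1 := fun v =>
    (hρ v).mdifferentiableAt (by simp)
  have hadd : ∀ v w, act (F := F) ρ (v + w) = act (F := F) ρ v + act (F := F) ρ w := fun v w => by
    have e : (fun g : G => ρ g (v + w)) = (fun g : G => ρ g v) + fun g : G => ρ g w := by
      ext1 g; simp
    unfold act
    rw [e]
    exact mfderiv_add (hd v) (hd w)
  have hsmul : ∀ (c : ℝ) v, act (F := F) ρ (c • v) = c • act (F := F) ρ v := fun c v => by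
    have e : (fun g : G => ρ g (c • v)) = c • fun g : G => ρ g v := by
      ext1 g; simp
    unfold act
    rw [e]
    exact const_smul_mfderiv (hd v) c
  let l : V →ₗ[ℝ] F →L[ℝ] V :=
    { toFun := fun v => act (F := F) ρ v, map_add' := hadd, map_smul' := hsmul }
  exact ⟨LinearMap.toContinuousLinearMap l, fun v => rfl⟩

theorem exists_moment {G : Type*} [Group G] [TopologicalSpace G] [ChartedSpace F G]
    (ρ : G →* (V ≃ₗᵢ[ℝ] V)) {b : V →L[ℝ] F →L[ℝ] V} (hb : ∀ v : V, act (F := F) ρ v = b v) :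
    ∃ m : V →L[ℝ] V →L[ℝ] F, ∀ u v, bilB (F := F) ρ u v = m u v := by
  have h : IsBilinearMap ℝ (bilB (F := F) ρ) :=
    { add_left := fun x y z => by simp [bilB]
      smul_left := fun c x y => by simp [bilB]
      add_right := fun x y z => by simp [bilB, hb]
      smul_right := fun c x y => by simp [bilB, hb] }
  exact ⟨h.toContinuousBilinearMap, fun x y => rfl⟩

variable (F V) in
/-- The projection to a component of the gauge field. -/
noncomputable def prA (i : Fin 3) : Fields F V →L[ℝ] F :=
  (PiLp.proj 2 (fun _ : Fin 3 => F) i).comp (WithLp.fstL 2 ℝ (PiLp 2 fun _ : Fin 3 => F) V)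

variable (F V) in
/-- The projection to the Higgs field. -/
noncomputable def prV : Fields F V →L[ℝ] V := WithLp.sndL 2 ℝ (PiLp 2 fun _ : Fin 3 => F) V

theorem prA_apply (i : Fin 3) (X : Fields F V) : prA F V i X = X.fst i := rfl

theorem prV_apply (X : Fields F V) : prV F V X = X.snd := rfl

theorem fields_ext {X Y : Fields F V} (h : ∀ i, prA F V i X = prA F V i Y)
    (h' : prV F V X = prV F V Y) : X = Y := by
  apply WithLp.ofLp_injective
  refine Prod.ext ?_ h'
  exact PiLp.ext h

/-- The quadratic part of the flow, as a function of the field and its derivative. -/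
noncomputable def quadForm (b : F →L[ℝ] F →L[ℝ] F) (a : V →L[ℝ] F →L[ℝ] V)
    (m : V →L[ℝ] V →L[ℝ] F) (u : Fields F V) (A : R3 →L[ℝ] Fields F V) : Fields F V :=
  let D := fun j => A (EuclideanSpace.single j 1)
  WithLp.toLp 2
    (WithLp.toLp 2 fun i =>
      ∑ j, (b (prA F V j (D j)) (prA F V i u) + b (prA F V j u) (prA F V i (D j))
        + b (prA F V j u) (prA F V i (D j) - prA F V j (D i)) + b (prA F V i u) (prA F V j (D j)))
        - m (prV F V (D i)) (prV F V u),
     ∑ j, (a (prV F V (D j)) (prA F V j u) + a (prV F V u) (prA F V j (D j))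
        + a (prV F V (D j)) (prA F V j u)) - ∑ j, a (prV F V u) (prA F V j (D j)))

theorem isBilinearMap_quadForm (b : F →L[ℝ] F →L[ℝ] F) (a : V →L[ℝ] F →L[ℝ] V)
    (m : V →L[ℝ] V →L[ℝ] F) : IsBilinearMap ℝ (quadForm b a m) where
  add_left x y z := by
    refine fields_ext (fun i => ?_) ?_ <;>
      simp [prA_apply, prV_apply, quadForm, Fin.sum_univ_three] <;> abel
  smul_left c x z := by
    refine fields_ext (fun i => ?_) ?_ <;>
      simp [prA_apply, prV_apply, quadForm, Fin.sum_univ_three, smul_add, smul_sub]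
  add_right x y z := by
    refine fields_ext (fun i => ?_) ?_ <;>
      simp [prA_apply, prV_apply, quadForm, Fin.sum_univ_three] <;> abel
  smul_right c x z := by
    refine fields_ext (fun i => ?_) ?_ <;>
      simp [prA_apply, prV_apply, quadForm, Fin.sum_univ_three, smul_add, smul_sub]

/-- The quadratic expressions that enter the cubic part of the flow. -/
noncomputable def cubicInner (b : F →L[ℝ] F →L[ℝ] F) (a : V →L[ℝ] F →L[ℝ] V) (u v : Fields F V) :
    (Fin 3 → Fin 3 → F) × (Fin 3 → V) :=
  (fun j i => b (prA F V j u) (prA F V i v), fun i => a (prV F V u) (prA F V i v))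

theorem isBilinearMap_cubicInner (b : F →L[ℝ] F →L[ℝ] F) (a : V →L[ℝ] F →L[ℝ] V) :
    IsBilinearMap ℝ (cubicInner b a) where
  add_left x y z := by
    refine Prod.ext (funext₂ fun i j => ?_) (funext fun i => ?_) <;>
      simp [cubicInner]
  smul_left c x z := by
    refine Prod.ext (funext₂ fun i j => ?_) (funext fun i => ?_) <;>
      simp [cubicInner]
  add_right x y z := by
    refine Prod.ext (funext₂ fun i j => ?_) (funext fun i => ?_) <;>
      simp [cubicInner]
  smul_right c x z := by
    refine Prod.ext (funext₂ fun i j => ?_) (funext fun i => ?_) <;>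
      simp [cubicInner]

/-- The bilinear map that turns the expressions `cubicInner` into the cubic part of the flow. -/
noncomputable def cubicOuter (b : F →L[ℝ] F →L[ℝ] F) (a : V →L[ℝ] F →L[ℝ] V)
    (m : V →L[ℝ] V →L[ℝ] F) (u : Fields F V) (p : (Fin 3 → Fin 3 → F) × (Fin 3 → V)) :
    Fields F V :=
  WithLp.toLp 2
    (WithLp.toLp 2 fun i => ∑ j, b (prA F V j u) (p.1 j i) - m (p.2 i) (prV F V u),
     ∑ j, a (p.2 j) (prA F V j u))

theorem isBilinearMap_cubicOuter (b : F →L[ℝ] F →L[ℝ] F) (a : V →L[ℝ] F →L[ℝ] V)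
    (m : V →L[ℝ] V →L[ℝ] F) : IsBilinearMap ℝ (cubicOuter b a m) where
  add_left x y z := by
    refine fields_ext (fun i => ?_) ?_ <;>
      simp [prA_apply, prV_apply, cubicOuter, Fin.sum_univ_three] <;> abel
  smul_left c x z := by
    refine fields_ext (fun i => ?_) ?_ <;>
      simp [prA_apply, prV_apply, cubicOuter, Fin.sum_univ_three, smul_add, smul_sub]
  add_right x y z := by
    refine fields_ext (fun i => ?_) ?_ <;>
      simp [prA_apply, prV_apply, cubicOuter, Fin.sum_univ_three] <;> abel
  smul_right c x z := by
    refine fields_ext (fun i => ?_) ?_ <;>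
      simp [prA_apply, prV_apply, cubicOuter, Fin.sum_univ_three, smul_add, smul_sub]

variable {G : Type*} [Group G] [TopologicalSpace G] [ChartedSpace F G]

/-- The term -d_a^* F_a contains Δa_i - ∂_i Σ_j ∂_j a_j, and the DeTurck term adds ∂_i Σ_j ∂_j a_j.
Second derivatives commute, so only the Laplacian remains at top order, and the rest is sorted by
degree. -/
theorem flowRHS_eq (ρ : G →* (V ≃ₗᵢ[ℝ] V)) {b : F →L[ℝ] F →L[ℝ] F} (hb : ∀ x y, br G x y = b x y)
    {a : V →L[ℝ] F →L[ℝ] V} (ha : ∀ v : V, act (F := F) ρ v = a v) {m : V →L[ℝ] V →L[ℝ] F}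
    (hm : ∀ u v, bilB (F := F) ρ u v = m u v) {X : R3 → Fields F V} (hX : ContDiff ℝ 2 X) (x : R3) :
    flowRHS ρ X x = traceL (fderiv ℝ (fderiv ℝ X) x) + (quadForm b a m (X x) (fderiv ℝ X x)
      + cubicOuter b a m (X x) (cubicInner b a (X x) (X x))) := by
  set e : Fin 3 → R3 := fun j => EuclideanSpace.single j 1 with he
  have h1 : ∀ y, HasFDerivAt X (fderiv ℝ X y) y := fun y =>
    (hX.differentiable (by norm_num) y).hasFDerivAt
  have h2 : HasFDerivAt (fderiv ℝ X) (fderiv ℝ (fderiv ℝ X) x) x :=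
    ((hX.fderiv_right (m := 1) (by norm_num)).differentiable (by norm_num) x).hasFDerivAt
  set A := fderiv ℝ X x with hA
  set S := fderiv ℝ (fderiv ℝ X) x with hS
  have hsymm : ∀ i j, S (e i) (e j) = S (e j) (e i) := fun i j =>
    (hX.contDiffAt.isSymmSndFDerivAt (by simp)).eq _ _
  have hD : ∀ i, HasFDerivAt (fun y => fderiv ℝ X y (e i)) (S.flip (e i)) x := fun i => by
    simpa using h2.clm_apply (hasFDerivAt_const (e i) x)
  have ga : ∀ i y, HasFDerivAt (gaugePart X i) ((prA F V i).comp (fderiv ℝ X y)) y := fun i y =>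
    (prA F V i).hasFDerivAt.comp y (h1 y)
  have gv : ∀ y, HasFDerivAt (higgsPart X) ((prV F V).comp (fderiv ℝ X y)) y := fun y =>
    (prV F V).hasFDerivAt.comp y (h1 y)
  have pa : ∀ j i, pd j (gaugePart X i) = fun y => prA F V i (fderiv ℝ X y (e j)) := fun j i =>
    funext fun y => pd_eq (ga i y) j
  have pv : ∀ j, pd j (higgsPart X) = fun y => prV F V (fderiv ℝ X y (e j)) := fun j =>
    funext fun y => pd_eq (gv y) j
  have da : ∀ i k, HasFDerivAt (fun y => prA F V i (fderiv ℝ X y (e k)))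
      ((prA F V i).comp (S.flip (e k))) x := fun i k => (prA F V i).hasFDerivAt.comp x (hD k)
  have dv : ∀ k, HasFDerivAt (fun y => prV F V (fderiv ℝ X y (e k)))
      ((prV F V).comp (S.flip (e k))) x := fun k => (prV F V).hasFDerivAt.comp x (hD k)
  have pcurv : ∀ i j, pd j (curv G (gaugePart X) j i) x = prA F V i (S (e j) (e j))
      - prA F V j (S (e i) (e j)) + (b (prA F V j (X x)) (prA F V i (A (e j)))
        + b (prA F V j (A (e j))) (prA F V i (X x))) := fun i j => by
    have : curv G (gaugePart X) j i = fun y => prA F V i (fderiv ℝ X y (e j))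
        - prA F V j (fderiv ℝ X y (e i)) + b (gaugePart X j y) (gaugePart X i y) := by
      ext1 y; simp only [curv, pa, hb]
    rw [this, hsymm i j]
    exact pd_eq (((da i j).sub (da j i)).add (b.hasFDerivAt_of_bilinear (ga j x) (ga i x))) j
  have pcod : ∀ i, pd i (codiff (gaugePart X)) x = -∑ j, prA F V j (S (e i) (e j)) := fun i => by
    have : codiff (gaugePart X) = fun y => -∑ j, prA F V j (fderiv ℝ X y (e j)) := by
      ext1 y; simp only [codiff, pa]
    rw [this]
    refine (pd_eq (HasFDerivAt.fun_sum fun j _ => da j j).neg i).trans ?_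
    simp [he]
  have pcov : ∀ j, pd j (covDerivV ρ (gaugePart X) (higgsPart X) j) x = prV F V (S (e j) (e j))
      + (a (prV F V (X x)) (prA F V j (A (e j))) + a (prV F V (A (e j))) (prA F V j (X x))) :=
    fun j => by
    have : covDerivV ρ (gaugePart X) (higgsPart X) j = fun y => prV F V (fderiv ℝ X y (e j))
        + a (higgsPart X y) (gaugePart X j y) := by
      ext1 y; simp only [covDerivV, pv, ha]
    rw [this]
    exact pd_eq ((dv j).add (a.hasFDerivAt_of_bilinear (gv x) (ga j x))) j
  have ga' : ∀ i, gaugePart X i x = prA F V i (X x) := fun i => rfl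
  have gv' : higgsPart X x = prV F V (X x) := rfl
  refine fields_ext (fun i => ?_) ?_
  · have : prA F V i (flowRHS ρ X x) = -covDivTwo G (gaugePart X) (curv G (gaugePart X)) i x
        - covDeriv G (gaugePart X) (codiff (gaugePart X)) i x
        - bilB ρ (covDerivV ρ (gaugePart X) (higgsPart X) i x) (higgsPart X x) := rfl
    rw [this]
    have q1 : prA F V i (quadForm b a m (X x) A) = ∑ j, (b (prA F V j (A (e j))) (prA F V i (X x))
        + b (prA F V j (X x)) (prA F V i (A (e j)))
        + b (prA F V j (X x)) (prA F V i (A (e j)) - prA F V j (A (e i)))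
        + b (prA F V i (X x)) (prA F V j (A (e j))))
        - m (prV F V (A (e i))) (prV F V (X x)) := rfl
    have q2 : prA F V i (cubicOuter b a m (X x) (cubicInner b a (X x) (X x))) =
        ∑ j, b (prA F V j (X x)) (b (prA F V j (X x)) (prA F V i (X x)))
          - m (a (prV F V (X x)) (prA F V i (X x))) (prV F V (X x)) := rfl
    rw [map_add, map_add, q1, q2, traceL_apply]
    simp only [covDivTwo, covDeriv, pcurv, pcod, curv, codiff, covDerivV, pa, pv, hb, ha, hm, ga',
      gv', ← hA, Fin.sum_univ_three, map_add, map_sub, map_neg, neg_neg,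
      add_apply]
    abel
  · have : prV F V (flowRHS ρ X x) = -covDivV ρ (gaugePart X)
        (covDerivV ρ (gaugePart X) (higgsPart X)) x
        + act ρ (higgsPart X x) (codiff (gaugePart X) x) := rfl
    rw [this]
    have q1 : prV F V (quadForm b a m (X x) A) =
        ∑ j, (a (prV F V (A (e j))) (prA F V j (X x)) + a (prV F V (X x)) (prA F V j (A (e j)))
        + a (prV F V (A (e j))) (prA F V j (X x)))
          - ∑ j, a (prV F V (X x)) (prA F V j (A (e j))) := rfl
    have q2 : prV F V (cubicOuter b a m (X x) (cubicInner b a (X x) (X x))) =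
        ∑ j, a (a (prV F V (X x)) (prA F V j (X x))) (prA F V j (X x)) := rfl
    rw [map_add, map_add, q1, q2, traceL_apply]
    simp only [covDivV, pcov, covDerivV, codiff, pa, pv, ha, ga', gv', ← hA,
      Fin.sum_univ_three, map_add, map_neg, neg_neg, add_apply]
    abel

end

/-! ### Bounds for the cubic and the quadratic nonlinearity. -/

section

variable {W : Type*} [NormedAddCommGroup W] [NormedSpace ℝ W]

/-- A locally Lipschitz map with cubic growth. -/
structure IsCubic (C : W → W) (K : ℝ) : Prop where
  nonneg : 0 ≤ K
  smooth : ContDiff ℝ ∞ C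
  zero : C 0 = 0
  lip : ∀ u v, ‖C u - C v‖ ≤ K * (‖u‖ + ‖v‖) ^ 2 * ‖u - v‖

/-- Telescoping: one of the three arguments is changed at a time. -/
theorem isCubic_of_bilinear {M : Type*} [NormedAddCommGroup M] [NormedSpace ℝ M]
    (D : W →L[ℝ] M →L[ℝ] W) (E : W →L[ℝ] W →L[ℝ] M) :
    IsCubic (fun u => D u (E u u)) (‖D‖ * ‖E‖) where
  nonneg := by positivity
  smooth := by fun_prop
  zero := by simp
  lip u v := by
    have e : D u (E u u) - D v (E v v) = D (u - v) (E u u) + D v (E (u - v) u)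
        + D v (E v (u - v)) := by
      simp only [map_sub, sub_apply]; abel
    have key : ∀ x y z, ‖D x (E y z)‖ ≤ ‖D‖ * ‖E‖ * (‖x‖ * ‖y‖ * ‖z‖) := fun x y z => by
      calc ‖D x (E y z)‖ ≤ ‖D‖ * ‖x‖ * ‖E y z‖ := D.le_opNorm₂ _ _
        _ ≤ ‖D‖ * ‖x‖ * (‖E‖ * ‖y‖ * ‖z‖) := by gcongr; exact E.le_opNorm₂ _ _
        _ = _ := by ring
    rw [e]
    refine (norm_add₃_le.trans (add_le_add_three (key _ _ _) (key _ _ _) (key _ _ _))).trans ?_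
    rw [← mul_add, ← mul_add, mul_assoc (‖D‖ * ‖E‖)]
    refine mul_le_mul_of_nonneg_left ?_ (by positivity)
    have h : 0 ≤ ‖u‖ * ‖v‖ * ‖u - v‖ := by positivity
    nlinarith

end

theorem IsBilinearMap.exists_bound {U V W : Type*} [NormedAddCommGroup U] [NormedSpace ℝ U]
    [FiniteDimensional ℝ U] [NormedAddCommGroup V] [NormedSpace ℝ V] [FiniteDimensional ℝ V]
    [NormedAddCommGroup W] [NormedSpace ℝ W] {f : U → V → W} (h : IsBilinearMap ℝ f) :
    ∃ q, 0 ≤ q ∧ (∀ u v, ‖f u v‖ ≤ q * ‖u‖ * ‖v‖) ∧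
      ContDiff ℝ ∞ fun p : U × V => f p.1 p.2 := by
  refine ⟨‖h.toContinuousBilinearMap‖, ContinuousLinearMap.opNorm_nonneg _,
    fun u v => h.toContinuousBilinearMap.le_opNorm₂ u v, ?_⟩
  have : ContDiff ℝ ∞ fun p : U × V => h.toContinuousBilinearMap p.1 p.2 := by fun_prop
  exact this

/-- A bounded bilinear map of a field and its gradient. -/
structure IsQuadratic {W : Type*} [NormedAddCommGroup W] [NormedSpace ℝ W]
    (Q : W → (R3 →L[ℝ] W) → W) (q : ℝ) : Prop where
  nonneg : 0 ≤ q
  bil : IsBilinearMap ℝ Q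
  smooth : ContDiff ℝ ∞ fun p : W × (R3 →L[ℝ] W) => Q p.1 p.2
  le : ∀ u A, ‖Q u A‖ ≤ q * ‖u‖ * ‖A‖

namespace IsQuadratic

variable {W : Type*} [NormedAddCommGroup W] [NormedSpace ℝ W] {Q : W → (R3 →L[ℝ] W) → W} {q : ℝ}

theorem sub_left (h : IsQuadratic Q q) (u v : W) (A : R3 →L[ℝ] W) :
    Q (u - v) A = Q u A - Q v A := congrArg (fun l => l A) (map_sub h.bil.toLinearMap u v)

theorem sub_right (h : IsQuadratic Q q) (u : W) (A B : R3 →L[ℝ] W) :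
    Q u (A - B) = Q u A - Q u B := map_sub (h.bil.toLinearMap u) A B

theorem zero_left (h : IsQuadratic Q q) (A : R3 →L[ℝ] W) : Q 0 A = 0 := by
  simpa using h.sub_left 0 0 A

end IsQuadratic

/-- All that the analysis needs to know about the group and the representation; the remaining work
concerns an abstract semilinear heat equation. -/
theorem exists_semilinear_form {F : Type*} [NormedAddCommGroup F] [InnerProductSpace ℝ F]
    [FiniteDimensional ℝ F] {G : Type*} [Group G] [TopologicalSpace G] [ChartedSpace F G]
    [LieGroup 𝓘(ℝ, F) ∞ G] {V : Type*} [NormedAddCommGroup V] [InnerProductSpace ℝ V]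
    [FiniteDimensional ℝ V] (ρ : G →* (V ≃ₗᵢ[ℝ] V))
    (hρ : ∀ v : V, ContMDiff 𝓘(ℝ, F) 𝓘(ℝ, V) ∞ fun g : G => ρ g v) :
    ∃ (Q : Fields F V → (R3 →L[ℝ] Fields F V) → Fields F V) (C : Fields F V → Fields F V)
      (q K : ℝ), IsQuadratic Q q ∧ IsCubic C K ∧ ∀ X : R3 → Fields F V, ContDiff ℝ 2 X → ∀ x, flowRHS ρ X x =
        traceL (fderiv ℝ (fderiv ℝ X) x) + (Q (X x) (fderiv ℝ X x) + C (X x)) := by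
  obtain ⟨b, hb⟩ := exists_bracket (F := F) G
  obtain ⟨a, ha⟩ := exists_action (F := F) ρ hρ
  obtain ⟨m, hm⟩ := exists_moment ρ ha
  have hQ := isBilinearMap_quadForm b a m
  obtain ⟨q, hq, hle, hsm⟩ := IsBilinearMap.exists_bound (U := Fields F V)
    (V := R3 →L[ℝ] Fields F V) (W := Fields F V) hQ
  refine ⟨_, _, q, _, ⟨hq, hQ, hsm, hle⟩, isCubic_of_bilinear (isBilinearMap_cubicOuter b a m).toContinuousBilinearMap
      (isBilinearMap_cubicInner b a).toContinuousBilinearMap, fun X hX x => ?_⟩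
  exact flowRHS_eq ρ hb ha hm hX x

end YMH

namespace YMH

/-! ### The fixed point problem in weighted spaces -/

variable {W : Type*} [NormedAddCommGroup W] [NormedSpace ℝ W]

/-- The weighted bounds at time `t` of a function value and of a gradient. -/
def WB (e t d : ℝ) (p : W × (R3 →L[ℝ] W)) : Prop :=
  ‖p.1‖ ≤ d * t ^ (e / 2) ∧ ‖p.2‖ ≤ d * t ^ (e / 2 - 1 / 2)

namespace WB

variable {e t d d' : ℝ} {p q : W × (R3 →L[ℝ] W)}

theorem mono (h : WB e t d p) (ht : 0 < t) (hd : d ≤ d') : WB e t d' p :=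
  ⟨h.1.trans (mul_le_mul_of_nonneg_right hd (Real.rpow_nonneg ht.le _)),
    h.2.trans (mul_le_mul_of_nonneg_right hd (Real.rpow_nonneg ht.le _))⟩

theorem add (h : WB e t d p) (h' : WB e t d' q) : WB e t (d + d') (p + q) :=
  ⟨(norm_add_le _ _).trans (by rw [add_mul]; exact add_le_add h.1 h'.1),
    (norm_add_le _ _).trans (by rw [add_mul]; exact add_le_add h.2 h'.2)⟩

theorem sub (h : WB e t d p) (h' : WB e t d' q) : WB e t (d + d') (p - q) :=
  ⟨(norm_sub_le _ _).trans (by rw [add_mul]; exact add_le_add h.1 h'.1),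
    (norm_sub_le _ _).trans (by rw [add_mul]; exact add_le_add h.2 h'.2)⟩

theorem nonneg (h : WB e t d p) (ht : 0 < t) : 0 ≤ d :=
  nonneg_of_mul_nonneg_left ((norm_nonneg _).trans h.1) (Real.rpow_pos_of_pos ht _)

theorem of_forall {c k : ℝ} (h : ∀ n : ℕ, WB e t (c + k * (1 / 2) ^ n) p) : WB e t c p := by
  have h0 : Tendsto (fun n : ℕ => c + k * (1 / 2 : ℝ) ^ n) atTop (𝓝 (c + k * 0)) :=
    ((tendsto_pow_atTop_nhds_zero_of_lt_one (by norm_num) (by norm_num)).const_mul k).const_add c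
  rw [mul_zero, add_zero] at h0
  exact ⟨ge_of_tendsto' (h0.mul_const _) fun n => (h n).1,
    ge_of_tendsto' (h0.mul_const _) fun n => (h n).2⟩

theorem eq_zero (h : WB e t 0 p) : p = 0 := by
  refine Prod.ext (norm_le_zero_iff.1 ?_) (norm_le_zero_iff.1 ?_)
  · simpa using h.1
  · simpa using h.2

end WB

/-- The part of the nonlinearity that involves the remainder, and the cubic part. -/
noncomputable def restN (Q : W → (R3 →L[ℝ] W) → W) (C : W → W) (r z : W × (R3 →L[ℝ] W)) : W :=
  Q r.1 r.2 + Q r.1 z.2 + Q z.1 r.2 + C (z.1 + r.1)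

/-- Relations between the exponents of the weights. -/
structure Exps (η b γ : ℝ) : Prop where
  eta_le : η ≤ 0
  b_le : b ≤ 0
  rr : 1 / 2 - b ≤ γ
  rz : 1 / 2 - (b + η) / 2 ≤ γ
  rrr : -(3 * b / 2) ≤ γ
  zzz : -(3 * η / 2) ≤ γ
  lt_one : γ < 1

/-- A product of weights becomes a single power of `t`; since `t ≤ 1`, any exponent at least `-γ`
may be replaced by `-γ`. -/
theorem norm_quadratic_sub_le {Q : W → (R3 →L[ℝ] W) → W} {q : ℝ} (hQ : IsQuadratic Q q) {a c : W}
    {a' c' : R3 →L[ℝ] W} {t m d p p' γ : ℝ} (ht : t ∈ Set.Ioc (0 : ℝ) 1) (hm : 0 ≤ m) (hd : 0 ≤ d)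
    (hpq : -γ ≤ p + p') (ha' : ‖a'‖ ≤ m * t ^ p') (hc : ‖c‖ ≤ m * t ^ p)
    (h : ‖a - c‖ ≤ d * t ^ p) (h' : ‖a' - c'‖ ≤ d * t ^ p') :
    ‖Q a a' - Q c c'‖ ≤ 2 * q * m * d * t ^ (-γ) := by
  have e : Q a a' - Q c c' = Q (a - c) a' + Q c (a' - c') := by
    rw [hQ.sub_left, hQ.sub_right]; abel
  have hq0 := hQ.nonneg
  have hp := Real.rpow_nonneg ht.1.le p
  have hq := Real.rpow_nonneg ht.1.le p'
  calc ‖Q a a' - Q c c'‖ ≤ q * ‖a - c‖ * ‖a'‖ + q * ‖c‖ * ‖a' - c'‖ := by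
        rw [e]; exact (norm_add_le _ _).trans (add_le_add (hQ.le _ _) (hQ.le _ _))
    _ ≤ q * (d * t ^ p) * (m * t ^ p') + q * (m * t ^ p) * (d * t ^ p') := by gcongr
    _ = 2 * q * m * d * t ^ (p + p') := by rw [Real.rpow_add ht.1]; ring
    _ ≤ _ := mul_le_mul_of_nonneg_left (Real.rpow_le_rpow_of_exponent_ge ht.1 ht.2 hpq)
        (by positivity)

variable {Q : W → (R3 →L[ℝ] W) → W} {C : W → W} {q K η b γ : ℝ}

/-- The exponents are b - 1/2 for the square of the remainder, (b + η)/2 - 1/2 for each cross term,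
and at worst 3·min(η, b)/2 for the cubic term. All are at least `-γ` by `Exps`. The product of the
heat flow with its own gradient is absent, which is what makes this possible. -/
theorem norm_restN_sub_le (hQ : IsQuadratic Q q) (hC : IsCubic C K) (he : Exps η b γ) {t m d : ℝ}
    (ht : t ∈ Set.Ioc (0 : ℝ) 1) (hm : 1 ≤ m) {r s z y : W × (R3 →L[ℝ] W)} (hr : WB b t m r)
    (hs : WB b t m s) (hz : WB η t m z) (hy : WB η t m y) (hrs : WB b t d (r - s))
    (hzy : WB η t d (z - y)) :
    ‖restN Q C r z - restN Q C s y‖ ≤ (6 * q + 32 * K) * m ^ 2 * d * t ^ (-γ) := by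
  have hm0 : 0 ≤ m := zero_le_one.trans hm
  have hd := hrs.nonneg ht.1
  have hK := hC.nonneg
  have hq0 := hQ.nonneg
  have h1 := norm_quadratic_sub_le hQ (γ := γ) ht hm0 hd (by linarith [he.rr]) hr.2 hs.1 hrs.1 hrs.2
  have h2 := norm_quadratic_sub_le hQ (γ := γ) ht hm0 hd (by linarith [he.rz]) hz.2 hs.1 hrs.1 hzy.2
  have h3 := norm_quadratic_sub_le hQ (γ := γ) ht hm0 hd (by linarith [he.rz]) hr.2 hy.1 hzy.1 hrs.2
  -- For the cubic term both fields are given the worse of the two weights.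
  set μ := min η b with hμ
  have pb : t ^ (b / 2) ≤ t ^ (μ / 2) := Real.rpow_le_rpow_of_exponent_ge ht.1 ht.2
    (by linarith [min_le_right η b])
  have pη : t ^ (η / 2) ≤ t ^ (μ / 2) := Real.rpow_le_rpow_of_exponent_ge ht.1 ht.2
    (by linarith [min_le_left η b])
  have hsum : ∀ {c : ℝ} {u v : W}, 0 ≤ c → ‖u‖ ≤ c * t ^ (η / 2) → ‖v‖ ≤ c * t ^ (b / 2) →
      ‖u + v‖ ≤ 2 * c * t ^ (μ / 2) := fun {c u v} hc hu hv => by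
    have := norm_add_le u v
    have h1 := mul_le_mul_of_nonneg_left pb hc
    have h2 := mul_le_mul_of_nonneg_left pη hc
    linarith
  have h4 : ‖C (z.1 + r.1) - C (y.1 + s.1)‖ ≤ 32 * K * m ^ 2 * d * t ^ (-γ) := by
    have e : z.1 + r.1 - (y.1 + s.1) = (z - y).1 + (r - s).1 := by
      simp only [Prod.fst_sub]; abel
    have k1 := hsum hm0 hz.1 hr.1
    have k2 := hsum hm0 hy.1 hs.1
    have k3 := hsum hd hzy.1 hrs.1
    have hp : 0 ≤ t ^ (μ / 2) := Real.rpow_nonneg ht.1.le _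
    calc ‖C (z.1 + r.1) - C (y.1 + s.1)‖
        ≤ K * (‖z.1 + r.1‖ + ‖y.1 + s.1‖) ^ 2 * ‖(z - y).1 + (r - s).1‖ := e ▸ hC.lip _ _
      _ ≤ K * (2 * m * t ^ (μ / 2) + 2 * m * t ^ (μ / 2)) ^ 2 * (2 * d * t ^ (μ / 2)) := by gcongr
      _ = 32 * K * m ^ 2 * d * t ^ (μ / 2 + μ / 2 + μ / 2) := by
        rw [Real.rpow_add ht.1, Real.rpow_add ht.1]; ring
      _ ≤ _ := by
        refine mul_le_mul_of_nonneg_left (Real.rpow_le_rpow_of_exponent_ge ht.1 ht.2 ?_)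
          (by positivity)
        rcases min_choice η b with h | h <;> rw [hμ, h]
        · linarith [he.zzz]
        · linarith [he.rrr]
  have e : restN Q C r z - restN Q C s y = (Q r.1 r.2 - Q s.1 s.2) + (Q r.1 z.2 - Q s.1 y.2) +
      (Q z.1 r.2 - Q y.1 s.2) + (C (z.1 + r.1) - C (y.1 + s.1)) := by
    simp only [restN]; abel
  rw [e]
  have h5 : 6 * q * m * d * t ^ (-γ) ≤ 6 * q * m ^ 2 * d * t ^ (-γ) := by
    have hp : 0 ≤ t ^ (-γ) := Real.rpow_nonneg ht.1.le _
    have : m ≤ m ^ 2 := by nlinarith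
    gcongr
  have h6 := norm_add₄_le (a := Q r.1 r.2 - Q s.1 s.2) (b := Q r.1 z.2 - Q s.1 y.2)
    (c := Q z.1 r.2 - Q y.1 s.2) (d := C (z.1 + r.1) - C (y.1 + s.1))
  linarith

/-- Functions on `(0, T] × T³` with weighted bounds on the values and the gradients. -/
structure Ctl (T e m : ℝ) (U : ℝ → R3 → W × (R3 →L[ℝ] W)) : Prop where
  pc : PerCont (Set.Ioc 0 T) U
  le : ∀ t ∈ Set.Ioc 0 T, ∀ x, WB e t m (U t x)

theorem Ctl.mono {T T' e m m' : ℝ} {U : ℝ → R3 → W × (R3 →L[ℝ] W)} (h : Ctl T e m U)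
    (hT : T' ≤ T) (hm : m ≤ m') : Ctl T' e m' U :=
  ⟨h.pc.mono (Set.Ioc_subset_Ioc_right hT), fun t ht x =>
    (h.le t ⟨ht.1, ht.2.trans hT⟩ x).mono ht.1 hm⟩

theorem norm_restN_le (hQ : IsQuadratic Q q) (hC : IsCubic C K) (he : Exps η b γ) {t m : ℝ}
    (ht : t ∈ Set.Ioc (0 : ℝ) 1) (hm : 1 ≤ m) {r z : W × (R3 →L[ℝ] W)} (hr : WB b t m r)
    (hz : WB η t m z) : ‖restN Q C r z‖ ≤ (6 * q + 32 * K) * m ^ 3 * t ^ (-γ) := by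
  have h0 : ∀ e, WB e t m (0 : W × (R3 →L[ℝ] W)) := fun e => by
    have hm0 : 0 ≤ m := zero_le_one.trans hm
    constructor <;> simp only [Prod.fst_zero, Prod.snd_zero, norm_zero] <;>
      exact mul_nonneg hm0 (Real.rpow_nonneg ht.1.le _)
  have := norm_restN_sub_le hQ hC he ht hm hr (h0 b) hz (h0 η)
    (by simpa using hr) (by simpa using hz)
  have e : restN Q C (0 : W × (R3 →L[ℝ] W)) 0 = 0 := by simp [restN, hC.zero, hQ.zero_left]
  rw [e, sub_zero] at this
  calc _ ≤ _ := this
    _ = _ := by ring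

theorem continuous_restN (hQ : IsQuadratic Q q) (hC : IsCubic C K) :
    Continuous fun p : (W × (R3 →L[ℝ] W)) × (W × (R3 →L[ℝ] W)) => restN Q C p.1 p.2 := by
  have h1 := hC.smooth.continuous
  have h2 := hQ.smooth.continuous
  refine ((Continuous.add ?_ ?_).add ?_).add (h1.comp (by fun_prop))
  · exact h2.comp (by fun_prop : Continuous fun p : (W × (R3 →L[ℝ] W)) × (W × (R3 →L[ℝ] W)) =>
      (p.1.1, p.1.2))
  · exact h2.comp (by fun_prop : Continuous fun p : (W × (R3 →L[ℝ] W)) × (W × (R3 →L[ℝ] W)) =>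
      (p.1.1, p.2.2))
  · exact h2.comp (by fun_prop : Continuous fun p : (W × (R3 →L[ℝ] W)) × (W × (R3 →L[ℝ] W)) =>
      (p.2.1, p.1.2))

theorem Ctl.perCont_rest {T m m' e e' : ℝ} {U Z : ℝ → R3 → W × (R3 →L[ℝ] W)} (hQ : IsQuadratic Q q) (hC : IsCubic C K)
    (hU : Ctl T e m U) (hZ : Ctl T e' m' Z) :
    PerCont (Set.Ioc 0 T) fun t x => restN Q C (U t x) (Z t x) :=
  (hU.pc.prodMk hZ.pc).comp (continuous_restN hQ hC)

theorem Ctl.force_rest (hQ : IsQuadratic Q q) (hC : IsCubic C K) (he : Exps η b γ) {T m : ℝ} (hT : T ≤ 1) (hm : 1 ≤ m)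
    {U Z : ℝ → R3 → W × (R3 →L[ℝ] W)} (hU : Ctl T b m U) (hZ : Ctl T η m Z) :
    Force T 0 γ ((1 + gradConst) * ((6 * q + 32 * K) * m ^ 3))
      fun t x => restN Q C (U t x) (Z t x) :=
  (Ctl.perCont_rest hQ hC hU hZ).force (by have := hC.nonneg; have := hQ.nonneg; positivity)
    fun s hs x => norm_restN_le hQ hC he ⟨hs.1, hs.2.trans hT⟩ hm (hU.le s hs x) (hZ.le s hs x)

/-- The Duhamel integral and its gradient. -/
noncomputable def duhP (f : ℝ → R3 → W) (t : ℝ) (x : R3) : W × (R3 →L[ℝ] W) :=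
  (duh f t x, dduh f t x)

theorem Force.perCont_duhP {T a γ M : ℝ} {f : ℝ → R3 → W} (hf : Force T a γ M f) (hT : T ≤ 1)
    (ha : a < 1 / 2) (hγ : γ < 1) : PerCont (Set.Ioc 0 T) (duhP f) :=
  (hf.perCont_duh hT ha hγ).prodMk (hf.perCont_dduh hT ha hγ)

theorem Force.duhP_sub {T a γ M a' γ' M' : ℝ} {f g : ℝ → R3 → W} (hf : Force T a γ M f)
    (hg : Force T a' γ' M' g) (hT : T ≤ 1) (ha : a < 1 / 2) (hγ : γ < 1) (ha' : a' < 1 / 2)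
    (hγ' : γ' < 1) {t : ℝ} (ht : t ∈ Set.Ioc 0 T) (x : R3) :
    duhP (fun t x => f t x - g t x) t x = duhP f t x - duhP g t x :=
  Prod.ext (hf.duh_sub hg hT ha hγ ha' hγ' ht x) (hf.dduh_sub hg hT ha hγ ha' hγ' ht x)

/-- The constant in the estimate of the Duhamel integral of a function of size `s ^ (-γ)`. -/
noncomputable def duhConst (γ : ℝ) : ℝ := (1 + gradConst) * (betaI 0 γ + betaI (1 / 2) γ)

theorem duhConst_nonneg (γ : ℝ) : 0 ≤ duhConst γ :=
  mul_nonneg (by linarith [gradConst_nonneg]) (add_nonneg (betaI_nonneg _ _) (betaI_nonneg _ _))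

/-- The force has no singularity in the heating time, so the integral gains t^{1-γ} ≤ T^{1-γ}; the
weight t^{b/2} ≥ 1 is simply given away. The power of `T` is the source of the contraction. -/
theorem wb_duhP {T k : ℝ} {f : ℝ → R3 → W} (hf : PerCont (Set.Ioc 0 T) f) (hT : T ≤ 1)
    (hγ : γ < 1) (hb : b ≤ 0) (hk : 0 ≤ k) (h : ∀ s ∈ Set.Ioc 0 T, ∀ x, ‖f s x‖ ≤ k * s ^ (-γ))
    {t : ℝ} (ht : t ∈ Set.Ioc 0 T) (x : R3) :
    WB b t (duhConst γ * k * T ^ (1 - γ)) (duhP f t x) := by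
  have hF := hf.force hk h
  have h1 := hF.norm_duh_le hT (by norm_num) hγ ht x
  have h2 := hF.norm_dduh_le hT (by norm_num) hγ ht x
  have hg := gradConst_nonneg
  have b1 := betaI_nonneg 0 γ
  have b2 := betaI_nonneg (1 / 2) γ
  have hT0 : 0 < T := ht.1.trans_le ht.2
  have p0 : 0 ≤ T ^ (1 - γ) := Real.rpow_nonneg hT0.le _
  have p1 : t ^ (1 - γ) ≤ T ^ (1 - γ) := Real.rpow_le_rpow ht.1.le ht.2 (by linarith)
  have p2 : 1 ≤ t ^ (b / 2) := Real.one_le_rpow_of_pos_of_le_one_of_nonpos ht.1 (ht.2.trans hT)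
    (by linarith)
  have p3 : t ^ (1 - (0 + 1 / 2) - γ) ≤ T ^ (1 - γ) * t ^ (b / 2 - 1 / 2) := by
    calc t ^ (1 - (0 + 1 / 2) - γ) = t ^ (1 - γ) * t ^ (-(1 / 2) : ℝ) := by
          rw [← Real.rpow_add ht.1]; ring_nf
      _ ≤ T ^ (1 - γ) * t ^ (b / 2 - 1 / 2) := by
          refine mul_le_mul p1 (Real.rpow_le_rpow_of_exponent_ge ht.1 (ht.2.trans hT) (by linarith))
            (Real.rpow_nonneg ht.1.le _) p0
  have p4 : 0 ≤ t ^ (b / 2 - 1 / 2) := Real.rpow_nonneg ht.1.le _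
  constructor
  · calc ‖duh f t x‖ ≤ (1 + gradConst) * k * t ^ (1 - 0 - γ) * betaI 0 γ := h1
      _ ≤ (1 + gradConst) * k * (T ^ (1 - γ) * t ^ (b / 2)) * (betaI 0 γ + betaI (1 / 2) γ) := by
        rw [sub_zero]
        have : t ^ (1 - γ) ≤ T ^ (1 - γ) * t ^ (b / 2) := p1.trans (le_mul_of_one_le_right p0 p2)
        gcongr
        linarith
      _ = _ := by rw [duhConst]; ring
  · calc ‖dduh f t x‖ ≤ (1 + gradConst) * k * t ^ (1 - (0 + 1 / 2) - γ) * betaI (0 + 1 / 2) γ := h2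
      _ ≤ (1 + gradConst) * k * (T ^ (1 - γ) * t ^ (b / 2 - 1 / 2)) *
          (betaI 0 γ + betaI (1 / 2) γ) := by
        rw [zero_add] at p3 ⊢
        gcongr
        linarith
      _ = _ := by rw [duhConst]; ring

theorem exp_neg_le_rpow {y ε : ℝ} (hy : 0 < y) (h0 : 0 ≤ ε) (h1 : ε ≤ 1) :
    Real.exp (-y) ≤ y ^ (-ε) := by
  rw [Real.exp_neg, Real.rpow_neg hy.le]
  refine inv_anti₀ (Real.rpow_pos_of_pos hy _) ?_
  rcases le_total y 1 with h | h
  · exact (Real.rpow_le_one hy.le h h0).trans (Real.one_le_exp hy.le)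
  · calc y ^ ε ≤ y ^ (1 : ℝ) := Real.rpow_le_rpow_of_exponent_le h h1
      _ = y := Real.rpow_one y
      _ ≤ Real.exp y := by linarith [Real.add_one_le_exp y]

/-- An exponential weight in time. From e^{Λs} = e^{Λt} e^{-Λ(t-s)} and e^{-y} ≤ y^{-ε} comes the
factor Λ^{-ε}, at the price of a slightly worse singularity (t-s)^{-ε}. Smallness thus comes from
large `Λ` and not from small `T`. -/
theorem wb_duhP_exp {T k ε Λ : ℝ} {f : ℝ → R3 → W} (hT : T ≤ 1)
    (hγ : γ < 1) (hb : b ≤ 0) (hε0 : 0 ≤ ε) (hε : ε < 1 / 2) (hεγ : ε ≤ 1 - γ) (hΛ : 0 < Λ)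
    (h : ∀ s ∈ Set.Ioc 0 T, ∀ x, ‖f s x‖ ≤ k * Real.exp (Λ * s) * s ^ (-γ))
    {t : ℝ} (ht : t ∈ Set.Ioc 0 T) (x : R3) :
    WB b t ((1 + gradConst) * (betaI ε γ + betaI (ε + 1 / 2) γ) * Λ ^ (-ε) * k * Real.exp (Λ * t))
      (duhP f t x) := by
  have hg := gradConst_nonneg
  have b1 := betaI_nonneg ε γ
  have b2 := betaI_nonneg (ε + 1 / 2) γ
  have hk : 0 ≤ k := by
    have h1 := (norm_nonneg _).trans (h t ht x)
    have h2 := Real.rpow_pos_of_pos ht.1 (-γ)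
    exact nonneg_of_mul_nonneg_left (nonneg_of_mul_nonneg_left h1 h2) (Real.exp_pos _)
  have ht1 := ht.2.trans hT
  have key : ∀ σ ∈ Set.Ioo (0 : ℝ) 1, ∀ y, ‖f (t * σ) y‖ ≤
      k * Real.exp (Λ * t) * Λ ^ (-ε) * (t * (1 - σ)) ^ (-ε) * (t * σ) ^ (-γ) := fun σ hσ y => by
    have hpos := (mul_one_sub_mem ht hσ).1
    have e1 : Real.exp (Λ * (t * σ)) ≤ Real.exp (Λ * t) * (Λ ^ (-ε) * (t * (1 - σ)) ^ (-ε)) := by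
      rw [← Real.mul_rpow hΛ.le hpos.le]
      calc Real.exp (Λ * (t * σ)) = Real.exp (Λ * t) * Real.exp (-(Λ * (t * (1 - σ)))) := by
            rw [← Real.exp_add]; ring_nf
        _ ≤ _ := mul_le_mul_of_nonneg_left
          (exp_neg_le_rpow (mul_pos hΛ hpos) hε0 (by linarith)) (Real.exp_pos _).le
    have p := Real.rpow_nonneg (mul_mem_Ioc ht hσ).1.le (-γ)
    calc ‖f (t * σ) y‖ ≤ k * Real.exp (Λ * (t * σ)) * (t * σ) ^ (-γ) := h _ (mul_mem_Ioc ht hσ) y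
      _ ≤ k * (Real.exp (Λ * t) * (Λ ^ (-ε) * (t * (1 - σ)) ^ (-ε))) * (t * σ) ^ (-γ) := by gcongr
      _ = _ := by ring
  have h1 : ‖duh f t x‖ ≤ _ := norm_duh_le_of (a := ε) (γ := γ)
    (M := k * Real.exp (Λ * t) * Λ ^ (-ε)) (by linarith) hγ ht.1 fun σ hσ =>
      norm_hs_le (key σ hσ) _ _
  have h2 : ‖dduh f t x‖ ≤ _ := norm_dduh_le_of (a := ε + 1 / 2) (γ := γ)
    (M := gradConst * (k * Real.exp (Λ * t) * Λ ^ (-ε))) (by linarith) hγ ht.1 fun σ hσ => by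
      have hpos := (mul_one_sub_mem ht hσ).1
      refine (norm_dhs_le (key σ hσ) _ _).trans (le_of_eq ?_)
      have : (√(t * (1 - σ)))⁻¹ * (t * (1 - σ)) ^ (-ε) = (t * (1 - σ)) ^ (-(ε + 1 / 2)) := by
        rw [Real.sqrt_eq_rpow, ← Real.rpow_neg hpos.le, ← Real.rpow_add hpos]; ring_nf
      rw [← this]; ring
  have pΛ := Real.rpow_nonneg hΛ.le (-ε)
  have pe := (Real.exp_pos (Λ * t)).le
  have p1 : t ^ (1 - ε - γ) ≤ t ^ (b / 2) :=
    Real.rpow_le_rpow_of_exponent_ge ht.1 ht1 (by linarith)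
  have p2 : t ^ (1 - (ε + 1 / 2) - γ) ≤ t ^ (b / 2 - 1 / 2) :=
    Real.rpow_le_rpow_of_exponent_ge ht.1 ht1 (by linarith)
  have p3 := Real.rpow_nonneg ht.1.le (b / 2)
  have p4 := Real.rpow_nonneg ht.1.le (b / 2 - 1 / 2)
  constructor
  · calc ‖duh f t x‖ ≤ _ := h1
      _ ≤ (1 + gradConst) * (k * Real.exp (Λ * t) * Λ ^ (-ε)) * t ^ (b / 2) *
          (betaI ε γ + betaI (ε + 1 / 2) γ) := by
        refine mul_le_mul ?_ (by linarith) b1 (by positivity)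
        refine mul_le_mul ?_ p1 (Real.rpow_nonneg ht.1.le _) (by positivity)
        exact le_mul_of_one_le_left (by positivity) (by linarith)
      _ = _ := by ring
  · calc ‖dduh f t x‖ ≤ _ := h2
      _ ≤ (1 + gradConst) * (k * Real.exp (Λ * t) * Λ ^ (-ε)) * t ^ (b / 2 - 1 / 2) *
          (betaI ε γ + betaI (ε + 1 / 2) γ) := by
        refine mul_le_mul ?_ (by linarith) b2 (by positivity)
        refine mul_le_mul ?_ p2 (Real.rpow_nonneg ht.1.le _) (by positivity)
        exact mul_le_mul_of_nonneg_right (by linarith) (by positivity)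
      _ = _ := by ring

end YMH

/-! ### Uniqueness, Lipschitz dependence and existence of fixed points. -/

namespace YMH

variable {W : Type*} [NormedAddCommGroup W] [NormedSpace ℝ W]
  {Q : W → (R3 →L[ℝ] W) → W} {C : W → W} {q K η b γ : ℝ}

/-- Solutions of the fixed point problem on `(0, T]`. -/
structure Fixed (Q : W → (R3 →L[ℝ] W) → W) (C : W → W) (T b m : ℝ)
    (S Z U : ℝ → R3 → W × (R3 →L[ℝ] W)) : Prop extends Ctl T b m U where
  eqn : ∀ t ∈ Set.Ioc 0 T, ∀ x, U t x = S t x + duhP (fun s y => restN Q C (U s y) (Z s y)) t x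

theorem Fixed.mono {T T' m m' : ℝ} {S Z U : ℝ → R3 → W × (R3 →L[ℝ] W)} (h : Fixed Q C T b m S Z U)
    (hT : T' ≤ T) (hm : m ≤ m') : Fixed Q C T' b m' S Z U :=
  ⟨h.toCtl.mono hT hm, fun t ht x => h.eqn t ⟨ht.1, ht.2.trans hT⟩ x⟩

/-- No smallness relating `T` and `m` is assumed, so that a solution of arbitrary size in B can be
compared with the constructed one. A bound on the weighted difference improves by a factor two, and
it can be iterated starting from the trivial bound. -/
theorem Fixed.unique (hQ : IsQuadratic Q q) (hC : IsCubic C K) (he : Exps η b γ) {T m : ℝ}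
    (hT : T ≤ 1) (hm : 1 ≤ m) {S Z U V : ℝ → R3 → W × (R3 →L[ℝ] W)} (hZ : Ctl T η m Z)
    (hU : Fixed Q C T b m S Z U) (hV : Fixed Q C T b m S Z V) :
    ∀ t ∈ Set.Ioc 0 T, ∀ x, U t x = V t x := by
  -- Half of the room below one; as `γ ≥ 1 / 2`, also ε + 1/2 < 1, which the gradient estimate
  -- needs.
  set ε : ℝ := (1 - γ) / 2 with hε
  have hγ := he.lt_one
  have hγ0 : 1 / 2 ≤ γ := by linarith [he.rr, he.b_le]
  set c : ℝ := (1 + gradConst) * (betaI ε γ + betaI (ε + 1 / 2) γ) with hc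
  set k : ℝ := (6 * q + 32 * K) * m ^ 2 with hk
  obtain ⟨Λ, hΛ0, hΛ⟩ : ∃ Λ : ℝ, 0 < Λ ∧ c * Λ ^ (-ε) * k ≤ 1 / 2 := by
    have h1 : Tendsto (fun Λ : ℝ => c * Λ ^ (-ε) * k) atTop (𝓝 (c * 0 * k)) :=
      ((tendsto_rpow_neg_atTop (by linarith)).const_mul c).mul_const k
    rw [mul_zero, zero_mul] at h1
    obtain ⟨Λ, h2, h3⟩ := ((h1.eventually_le_const (by norm_num : (0 : ℝ) < 1 / 2)).and
      (eventually_gt_atTop 0)).exists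
    exact ⟨Λ, h3, h2⟩
  have step : ∀ d : ℝ, (∀ t ∈ Set.Ioc 0 T, ∀ x, WB b t (d * Real.exp (Λ * t)) (U t x - V t x)) →
      ∀ t ∈ Set.Ioc 0 T, ∀ x, WB b t (d / 2 * Real.exp (Λ * t)) (U t x - V t x) := by
    intro d hd t ht x
    have hd0 : 0 ≤ d := nonneg_of_mul_nonneg_left ((hd t ht x).nonneg ht.1) (Real.exp_pos _)
    have h1 := hU.force_rest hQ hC he hT hm hZ
    have h2 := hV.force_rest hQ hC he hT hm hZ
    have e : U t x - V t x = duhP (fun s y => restN Q C (U s y) (Z s y) -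
        restN Q C (V s y) (Z s y)) t x := by
      rw [h1.duhP_sub h2 hT (by norm_num) hγ (by norm_num) hγ ht, hU.eqn t ht x, hV.eqn t ht x]
      abel
    rw [e]
    refine (wb_duhP_exp (k := k * d) (ε := ε) hT hγ he.b_le (by linarith) (by linarith)
      (by linarith) hΛ0 (fun s hs y => ?_) ht x).mono ht.1 ?_
    · have hs1 : s ∈ Set.Ioc (0 : ℝ) 1 := ⟨hs.1, hs.2.trans hT⟩
      have := norm_restN_sub_le hQ hC he hs1 hm (hU.le s hs y) (hV.le s hs y) (hZ.le s hs y)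
        (hZ.le s hs y) (hd s hs y) (by
          rw [sub_self]
          constructor <;> simp only [Prod.fst_zero, Prod.snd_zero, norm_zero] <;>
            exact mul_nonneg (mul_nonneg hd0 (Real.exp_pos _).le) (Real.rpow_nonneg hs.1.le _))
      calc _ ≤ _ := this
        _ = _ := by rw [hk]; ring
    · calc c * Λ ^ (-ε) * (k * d) * Real.exp (Λ * t)
          = (c * Λ ^ (-ε) * k) * (d * Real.exp (Λ * t)) := by ring
        _ ≤ 1 / 2 * (d * Real.exp (Λ * t)) := mul_le_mul_of_nonneg_right hΛ (by positivity)
        _ = _ := by ring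
  have all : ∀ n : ℕ, ∀ t ∈ Set.Ioc 0 T, ∀ x,
      WB b t (2 * m * (1 / 2) ^ n * Real.exp (Λ * t)) (U t x - V t x) := by
    intro n
    induction n with
    | zero =>
      intro t ht x
      refine ((hU.le t ht x).sub (hV.le t ht x)).mono ht.1 ?_
      have : 1 ≤ Real.exp (Λ * t) := Real.one_le_exp (mul_nonneg hΛ0.le ht.1.le)
      rw [pow_zero, mul_one]
      nlinarith
    | succ n ih =>
      intro t ht x
      have := step _ ih t ht x
      rwa [show 2 * m * (1 / 2 : ℝ) ^ n / 2 = 2 * m * (1 / 2) ^ (n + 1) by ring] at this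
  intro t ht x
  refine sub_eq_zero.1 (WB.eq_zero (e := b) (t := t) (WB.of_forall
    (k := 2 * m * Real.exp (Λ * t)) fun n => ?_))
  have := all n t ht x
  rwa [show 2 * m * (1 / 2 : ℝ) ^ n * Real.exp (Λ * t) =
    0 + 2 * m * Real.exp (Λ * t) * (1 / 2) ^ n by ring] at this

theorem wb_duhP_rest_sub (hQ : IsQuadratic Q q) (hC : IsCubic C K) (he : Exps η b γ) {T m d : ℝ}
    (hT : T ≤ 1) (hm : 1 ≤ m) (hd0 : 0 ≤ d) {Z Z' U V : ℝ → R3 → W × (R3 →L[ℝ] W)}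
    (hZ : Ctl T η m Z) (hZ' : Ctl T η m Z') (hU : Ctl T b m U) (hV : Ctl T b m V)
    (hUV : ∀ t ∈ Set.Ioc 0 T, ∀ x, WB b t d (U t x - V t x))
    (hZZ : ∀ t ∈ Set.Ioc 0 T, ∀ x, WB η t d (Z t x - Z' t x)) {t : ℝ} (ht : t ∈ Set.Ioc 0 T)
    (x : R3) : WB b t (duhConst γ * ((6 * q + 32 * K) * m ^ 2 * d) * T ^ (1 - γ))
      (duhP (fun s y => restN Q C (U s y) (Z s y)) t x
        - duhP (fun s y => restN Q C (V s y) (Z' s y)) t x) := by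
  have hγ := he.lt_one
  rw [← (hU.force_rest hQ hC he hT hm hZ).duhP_sub (hV.force_rest hQ hC he hT hm hZ') hT
    (by norm_num) hγ (by norm_num) hγ ht]
  refine wb_duhP ((hU.perCont_rest hQ hC hZ).sub (hV.perCont_rest hQ hC hZ')) hT hγ he.b_le
    (by have := hC.nonneg; have := hQ.nonneg; positivity) (fun s hs y => ?_) ht x
  exact norm_restN_sub_le hQ hC he ⟨hs.1, hs.2.trans hT⟩ hm (hU.le s hs y) (hV.le s hs y)
    (hZ.le s hs y) (hZ'.le s hs y) (hUV s hs y) (hZZ s hs y)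

/-- A difference of size d' is improved to d + (d' + d)/2 by the equation. The fixed point of this
affine map is 3d, and the trivial initial bound 2m is halved away. -/
theorem Fixed.lipschitz (hQ : IsQuadratic Q q) (hC : IsCubic C K) (he : Exps η b γ) {T m d : ℝ}
    (hT : T ≤ 1) (hm : 1 ≤ m) (hd0 : 0 ≤ d)
    (hs : duhConst γ * ((6 * q + 32 * K) * m ^ 3) * T ^ (1 - γ) ≤ 1 / 2)
    {S S' Z Z' U V : ℝ → R3 → W × (R3 →L[ℝ] W)}
    (hZ : Ctl T η m Z) (hZ' : Ctl T η m Z') (hU : Fixed Q C T b m S Z U)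
    (hV : Fixed Q C T b m S' Z' V)
    (hSS : ∀ t ∈ Set.Ioc 0 T, ∀ x, WB b t d (S t x - S' t x))
    (hZZ : ∀ t ∈ Set.Ioc 0 T, ∀ x, WB η t d (Z t x - Z' t x)) :
    ∀ t ∈ Set.Ioc 0 T, ∀ x, WB b t (3 * d) (U t x - V t x) := by
  have hq := hQ.nonneg
  have hK := hC.nonneg
  have all : ∀ n : ℕ, ∀ t ∈ Set.Ioc 0 T, ∀ x,
      WB b t (3 * d + 2 * m * (1 / 2) ^ n) (U t x - V t x) := by
    intro n
    induction n with
    | zero =>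
      intro t ht x
      exact ((hU.le t ht x).sub (hV.le t ht x)).mono ht.1 (by simp; linarith)
    | succ n ih =>
      intro t ht x
      set d' := 3 * d + 2 * m * (1 / 2 : ℝ) ^ n with hd'
      have hm0 : 0 ≤ m := by linarith
      have hp : 0 ≤ 2 * m * (1 / 2 : ℝ) ^ n := by positivity
      have h1 := wb_duhP_rest_sub hQ hC he hT hm (add_nonneg (hp.trans (by linarith : _ ≤ d')) hd0)
        hZ hZ' hU.toCtl hV.toCtl (fun t ht x => (ih t ht x).mono ht.1 (le_add_of_nonneg_right hd0))
        (fun t ht x => (hZZ t ht x).mono ht.1 (le_add_of_nonneg_left (hp.trans (by linarith)))) ht x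
      have e : U t x - V t x = (S t x - S' t x) + (duhP (fun s y => restN Q C (U s y) (Z s y)) t x
          - duhP (fun s y => restN Q C (V s y) (Z' s y)) t x) := by
        rw [hU.eqn t ht x, hV.eqn t ht x]; abel
      rw [e]
      refine ((hSS t ht x).add h1).mono ht.1 ?_
      have hT0 : 0 < T := ht.1.trans_le ht.2
      have h2 : duhConst γ * ((6 * q + 32 * K) * m ^ 2) * T ^ (1 - γ) ≤ 1 / 2 := by
        refine le_trans ?_ hs
        have hp := Real.rpow_nonneg hT0.le (1 - γ)
        have hp' := duhConst_nonneg γ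
        have : m ^ 2 ≤ m ^ 3 := pow_le_pow_right₀ hm (by norm_num)
        gcongr
      calc d + duhConst γ * ((6 * q + 32 * K) * m ^ 2 * (d' + d)) * T ^ (1 - γ)
          = d + (duhConst γ * ((6 * q + 32 * K) * m ^ 2) * T ^ (1 - γ)) * (d' + d) := by ring
        _ ≤ d + 1 / 2 * (d' + d) := by
          have : 0 ≤ d' + d := add_nonneg (hp.trans (by linarith)) hd0
          gcongr
        _ = _ := by rw [hd']; ring
  exact fun t ht x => WB.of_forall fun n => all n t ht x

/-- Picard iteration. -/
noncomputable def picard (Q : W → (R3 →L[ℝ] W) → W) (C : W → W)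
    (S Z : ℝ → R3 → W × (R3 →L[ℝ] W)) : ℕ → ℝ → R3 → W × (R3 →L[ℝ] W)
  | 0 => S
  | n + 1 => fun t x => S t x + duhP (fun s y => restN Q C (picard Q C S Z n s y) (Z s y)) t x

/-- The weights blow up only at time zero, so convergence is uniform on times at least `t₀ / 2`, and
continuity is local. -/
theorem PerCont.of_tendsto {T e A : ℝ} {F : ℕ → ℝ → R3 → W × (R3 →L[ℝ] W)}
    {U : ℝ → R3 → W × (R3 →L[ℝ] W)} (he : e ≤ 0) (hF : ∀ n, PerCont (Set.Ioc 0 T) (F n))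
    (h : ∀ n, ∀ t ∈ Set.Ioc 0 T, ∀ x, WB e t (A * (1 / 2) ^ n) (F n t x - U t x)) :
    PerCont (Set.Ioc 0 T) U := by
  have hlim : ∀ c : ℝ, Tendsto (fun n : ℕ => A * (1 / 2 : ℝ) ^ n * c) atTop (𝓝 0) := fun c => by
    have := ((tendsto_pow_atTop_nhds_zero_of_lt_one (by norm_num : (0 : ℝ) ≤ 1 / 2)
      (by norm_num)).const_mul A).mul_const c
    simpa using this
  have hpt : ∀ t ∈ Set.Ioc 0 T, ∀ x, Tendsto (fun n => F n t x) atTop (𝓝 (U t x)) := by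
    intro t ht x
    have h0 := (hlim (t ^ (e / 2))).add (hlim (t ^ (e / 2 - 1 / 2)))
    rw [add_zero] at h0
    refine tendsto_iff_norm_sub_tendsto_zero.2 (squeeze_zero (fun _ => norm_nonneg _)
      (fun n => ?_) h0)
    have hn := h n t ht x
    exact max_le (hn.1.trans (le_add_of_nonneg_right ((norm_nonneg _).trans hn.2)))
      (hn.2.trans (le_add_of_nonneg_left ((norm_nonneg _).trans hn.1)))
  refine ⟨?_, fun t ht k x => tendsto_nhds_unique (hpt t ht _)
    ((hpt t ht x).congr fun n => ((hF n).per t ht k x).symm)⟩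
  have hloc : TendstoLocallyUniformlyOn (fun n (p : ℝ × R3) => F n p.1 p.2)
      (fun p : ℝ × R3 => U p.1 p.2) atTop (Set.Ioc 0 T ×ˢ Set.univ) := by
    rw [Metric.tendstoLocallyUniformlyOn_iff]
    rintro ε hε ⟨t₀, x₀⟩ ⟨ht₀, -⟩
    have ht₀' : 0 < t₀ := ht₀.1
    refine ⟨{p | t₀ / 2 < p.1} ∩ Set.Ioc 0 T ×ˢ Set.univ, inter_mem (mem_nhdsWithin_of_mem_nhds
      ((isOpen_lt continuous_const continuous_fst).mem_nhds (by simp; linarith)))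
      self_mem_nhdsWithin, ?_⟩
    have h1 := (hlim ((t₀ / 2) ^ (e / 2))).add (hlim ((t₀ / 2) ^ (e / 2 - 1 / 2)))
    rw [add_zero] at h1
    filter_upwards [h1.eventually_lt_const hε] with n hn
    rintro ⟨t, x⟩ ⟨ht1, ht, -⟩
    have ht1' : t₀ / 2 < t := ht1
    have hn' := h n t ht x
    have hA := hn'.nonneg ht.1
    have p1 : t ^ (e / 2) ≤ (t₀ / 2) ^ (e / 2) :=
      Real.rpow_le_rpow_of_nonpos (by linarith) ht1'.le (by linarith)
    have p2 : t ^ (e / 2 - 1 / 2) ≤ (t₀ / 2) ^ (e / 2 - 1 / 2) :=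
      Real.rpow_le_rpow_of_nonpos (by linarith) ht1'.le (by linarith)
    have q1 := mul_le_mul_of_nonneg_left p1 hA
    have q2 := mul_le_mul_of_nonneg_left p2 hA
    rw [dist_comm, dist_eq_norm]
    refine lt_of_le_of_lt (max_le ?_ ?_) hn
    · exact (hn'.1.trans q1).trans (le_add_of_nonneg_right (((norm_nonneg _).trans hn'.2).trans q2))
    · exact (hn'.2.trans q2).trans (le_add_of_nonneg_left (((norm_nonneg _).trans hn'.1).trans q1))
  exact hloc.continuousOn (Frequently.of_forall fun n => (hF n).cont)

/-- The iterates exceed the source by at most 1/2 and their successive differences halve. The limit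
is taken pointwise in the complete target space, so no Banach space of weighted functions is
required. -/
theorem exists_fixed [CompleteSpace W] (hQ : IsQuadratic Q q) (hC : IsCubic C K) (he : Exps η b γ)
    {T m A : ℝ} (hT : T ≤ 1) (hm : 1 ≤ m) (hA : A + 1 ≤ m)
    (hs : duhConst γ * ((6 * q + 32 * K) * m ^ 3) * T ^ (1 - γ) ≤ 1 / 2)
    {S Z : ℝ → R3 → W × (R3 →L[ℝ] W)} (hS : Ctl T b A S) (hZ : Ctl T η m Z) :
    ∃ U, Fixed Q C T b (A + 1) S Z U := by
  have hq := hQ.nonneg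
  have hK := hC.nonneg
  have hm0 : 0 ≤ m := by linarith
  have hγ := he.lt_one
  have ctl : ∀ n, Ctl T b (A + 1) (picard Q C S Z n) := by
    intro n
    induction n with
    | zero => exact hS.mono le_rfl (by linarith)
    | succ n ih =>
      have ih' : Ctl T b m (picard Q C S Z n) := ih.mono le_rfl hA
      have hF := ih'.force_rest hQ hC he hT hm hZ
      refine ⟨(hS.pc.prodMk (hF.perCont_duhP hT (by norm_num) hγ)).comp
        (g := fun p => p.1 + p.2) (by fun_prop), fun t ht x => ?_⟩
      refine ((hS.le t ht x).add (wb_duhP (k := (6 * q + 32 * K) * m ^ 3)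
        (ih'.perCont_rest hQ hC hZ) hT hγ he.b_le (by positivity)
        (fun s hs y => norm_restN_le hQ hC he ⟨hs.1, hs.2.trans hT⟩ hm (ih'.le s hs y)
          (hZ.le s hs y)) ht x)).mono ht.1 ?_
      linarith
  have small : ∀ {T' : ℝ}, 0 < T' → T' ≤ T → ∀ d, 0 ≤ d →
      duhConst γ * ((6 * q + 32 * K) * m ^ 2 * d) * T ^ (1 - γ) ≤ 1 / 2 * d := by
    intro T' h0 h1 d hd
    refine le_trans ?_ (mul_le_mul_of_nonneg_right hs hd)
    have hp := Real.rpow_nonneg (h0.trans_le h1).le (1 - γ)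
    have hp' := duhConst_nonneg γ
    have : m ^ 2 ≤ m ^ 3 := pow_le_pow_right₀ hm (by norm_num)
    calc _ = duhConst γ * ((6 * q + 32 * K) * m ^ 2) * T ^ (1 - γ) * d := by ring
      _ ≤ _ := by gcongr
  have cauchy : ∀ n, ∀ t ∈ Set.Ioc 0 T, ∀ x,
      WB b t ((1 / 2) ^ n) (picard Q C S Z n t x - picard Q C S Z (n + 1) t x) := by
    intro n
    induction n with
    | zero =>
      intro t ht x
      have h1 := wb_duhP (k := (6 * q + 32 * K) * m ^ 3)
        ((hS.mono le_rfl (by linarith : A ≤ m)).perCont_rest hQ hC hZ) hT hγ he.b_le (by positivity)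
        (fun s hs y => norm_restN_le hQ hC he ⟨hs.1, hs.2.trans hT⟩ hm
          ((hS.le s hs y).mono hs.1 (by linarith)) (hZ.le s hs y)) ht x
      have h2 := h1.mono ht.1 (hs.trans (by norm_num : (1 : ℝ) / 2 ≤ (1 / 2) ^ 0))
      have e : picard Q C S Z 0 t x - picard Q C S Z (0 + 1) t x =
          -duhP (fun s y => restN Q C (S s y) (Z s y)) t x := by
        simp only [picard]; abel
      rw [e]
      exact ⟨by simpa using h2.1, by simpa using h2.2⟩
    | succ n ih =>
      intro t ht x
      have h1 := wb_duhP_rest_sub hQ hC he hT hm (by positivity) hZ hZ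
        ((ctl n).mono le_rfl hA) ((ctl (n + 1)).mono le_rfl hA) ih (fun t ht x => by
          rw [sub_self]
          constructor <;> simp only [Prod.fst_zero, Prod.snd_zero, norm_zero] <;>
            exact mul_nonneg (by positivity) (Real.rpow_nonneg ht.1.le _)) ht x
      have e : picard Q C S Z (n + 1) t x - picard Q C S Z (n + 1 + 1) t x =
          duhP (fun s y => restN Q C (picard Q C S Z n s y) (Z s y)) t x
          - duhP (fun s y => restN Q C (picard Q C S Z (n + 1) s y) (Z s y)) t x := by
        simp only [picard]; abel
      rw [e]
      exact h1.mono ht.1 ((small ht.1 ht.2 _ (by positivity)).trans (by rw [pow_succ]; linarith))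
  have hex : ∀ t x, ∃ u : W × (R3 →L[ℝ] W), t ∈ Set.Ioc 0 T →
      ∀ n, WB b t (2 * (1 / 2) ^ n) (picard Q C S Z n t x - u) := by
    intro t x
    by_cases ht : t ∈ Set.Ioc 0 T
    · have hc1 : ∀ n, dist (picard Q C S Z n t x).1 (picard Q C S Z (n + 1) t x).1 ≤
          t ^ (b / 2) * (1 / 2) ^ n := fun n => by
        rw [dist_eq_norm, mul_comm]; exact (cauchy n t ht x).1
      have hc2 : ∀ n, dist (picard Q C S Z n t x).2 (picard Q C S Z (n + 1) t x).2 ≤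
          t ^ (b / 2 - 1 / 2) * (1 / 2) ^ n := fun n => by
        rw [dist_eq_norm, mul_comm]; exact (cauchy n t ht x).2
      obtain ⟨u1, hu1⟩ := cauchySeq_tendsto_of_complete
        (cauchySeq_of_le_geometric (1 / 2) _ (by norm_num) hc1)
      obtain ⟨u2, hu2⟩ := cauchySeq_tendsto_of_complete
        (cauchySeq_of_le_geometric (1 / 2) _ (by norm_num) hc2)
      refine ⟨(u1, u2), fun _ n => ⟨?_, ?_⟩⟩
      · have := dist_le_of_le_geometric_of_tendsto (1 / 2) _ (by norm_num) hc1 hu1 n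
        rw [dist_eq_norm] at this
        refine this.trans (le_of_eq ?_)
        ring
      · have := dist_le_of_le_geometric_of_tendsto (1 / 2) _ (by norm_num) hc2 hu2 n
        rw [dist_eq_norm] at this
        refine this.trans (le_of_eq ?_)
        ring
    · exact ⟨0, fun h => absurd h ht⟩
  choose U hU using hex
  have hU' : ∀ n, ∀ t ∈ Set.Ioc 0 T, ∀ x, WB b t (2 * (1 / 2) ^ n) (picard Q C S Z n t x - U t x) :=
    fun n t ht x => hU t x ht n
  have hUc : Ctl T b (A + 1) U := by
    refine ⟨PerCont.of_tendsto he.b_le (fun n => (ctl n).pc) hU', fun t ht x =>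
      WB.of_forall (k := 2) fun n => ?_⟩
    have := ((ctl n).le t ht x).sub (hU' n t ht x)
    rwa [sub_sub_cancel] at this
  refine ⟨U, hUc, fun t ht x => sub_eq_zero.1 (WB.eq_zero (e := b) (t := t)
    (WB.of_forall (k := 2) fun n => ?_))⟩
  have h1 := wb_duhP_rest_sub hQ hC he hT hm (by positivity) hZ hZ
    ((ctl n).mono le_rfl hA) (hUc.mono le_rfl hA) (hU' n) (fun t ht x => by
      rw [sub_self]
      constructor <;> simp only [Prod.fst_zero, Prod.snd_zero, norm_zero] <;>
        exact mul_nonneg (by positivity) (Real.rpow_nonneg ht.1.le _)) ht x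
  have h2 := (h1.sub (hU' (n + 1) t ht x)).mono ht.1 (d' := 0 + 2 * (1 / 2) ^ n) (by
    have := small ht.1 ht.2 (2 * (1 / 2) ^ n) (by positivity)
    have h3 : (1 / 2 : ℝ) ^ (n + 1) = (1 / 2) ^ n * (1 / 2) := pow_succ _ _
    linarith)
  -- The defect of the limit is expressed by the distances of two consecutive iterates to it, both
  -- of which tend to zero.
  have e : U t x - (S t x + duhP (fun s y => restN Q C (U s y) (Z s y)) t x) =
      duhP (fun s y => restN Q C (picard Q C S Z n s y) (Z s y)) t x
        - duhP (fun s y => restN Q C (U s y) (Z s y)) t x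
        - (picard Q C S Z (n + 1) t x - U t x) := by
    simp only [picard]; abel
  rw [e]
  exact h2

end YMH

namespace YMH

variable {W : Type*} [NormedAddCommGroup W] [NormedSpace ℝ W]

/-! ### The leading term of the remainder -/

/-- The constant in the estimates of the Duhamel integral of a function of size `t ^ (-δ)` in
`C^β`. -/
noncomputable def baseConst (β δ : ℝ) : ℝ :=
  heatConst β * (betaI (-β / 2) δ + betaI (-β / 2 + 1 / 2) δ) +
    (1 + heatConst β) * betaI (1 - δ) δ

theorem baseConst_nonneg (β δ : ℝ) : 0 ≤ baseConst β δ := by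
  have h1 := heatConst_nonneg β
  have h2 := betaI_nonneg (-β / 2) δ
  have h3 := betaI_nonneg (-β / 2 + 1 / 2) δ
  have h4 := betaI_nonneg (1 - δ) δ
  unfold baseConst
  positivity

/-- The exponents match: 1 + β/2 - δ = b/2, and half a power less for the gradient. No power of `T`
is gained, so this term is treated as a source and not as a perturbation. -/
theorem wb_duhP_of_HB [CompleteSpace W] {T β δ b M : ℝ} {f : ℝ → R3 → W}
    (hf : PerCont (Set.Ioc 0 T) f) (hT : T ≤ 1) (hM : 0 ≤ M) (hδ : δ < 1) (hβ : -1 < β)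
    (hb : b = β + 2 * (1 - δ)) (h : ∀ s ∈ Set.Ioc 0 T, HB β (M * s ^ (-δ)) (f s)) {t : ℝ}
    (ht : t ∈ Set.Ioc 0 T) (x : R3) : WB b t (baseConst β δ * M) (duhP f t x) := by
  have hF := hf.force_of_HB hM h
  have h1 := hF.norm_duh_le hT (by linarith) hδ ht x
  have h2 := hF.norm_dduh_le hT (by linarith) hδ ht x
  have c1 := heatConst_nonneg β
  have c2 := betaI_nonneg (-β / 2) δ
  have c3 := betaI_nonneg (-β / 2 + 1 / 2) δ
  have c4 := betaI_nonneg (1 - δ) δ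
  constructor
  · refine h1.trans ?_
    rw [show 1 - -β / 2 - δ = b / 2 by rw [hb]; ring, mul_right_comm]
    refine mul_le_mul_of_nonneg_right ?_ (Real.rpow_nonneg ht.1.le _)
    rw [mul_right_comm]
    refine mul_le_mul_of_nonneg_right ?_ hM
    have : 0 ≤ heatConst β * betaI (-β / 2 + 1 / 2) δ + (1 + heatConst β) * betaI (1 - δ) δ := by
      positivity
    unfold baseConst
    linarith
  · refine h2.trans ?_
    rw [show 1 - (-β / 2 + 1 / 2) - δ = b / 2 - 1 / 2 by rw [hb]; ring, mul_right_comm]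
    refine mul_le_mul_of_nonneg_right ?_ (Real.rpow_nonneg ht.1.le _)
    rw [mul_right_comm]
    refine mul_le_mul_of_nonneg_right ?_ hM
    have : 0 ≤ heatConst β * betaI (-β / 2) δ + (1 + heatConst β) * betaI (1 - δ) δ := by
      positivity
    unfold baseConst
    linarith

/-- Throughout (-1, 0) the norm tests against bumps with one controlled derivative, so the norms of
exponents β and b use the same bumps. -/
theorem rIdx_eq_two {α : ℝ} (h : α ∈ Set.Ioc (-1 : ℝ) 0) (h0 : α < 0) : rIdx α = 1 := by
  have : ⌈α - 1⌉ = -1 := by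
    rw [Int.ceil_eq_iff]
    push_cast
    constructor <;> linarith [h.1]
  rw [rIdx, this]
  rfl

theorem HB_duh [CompleteSpace W] {T β δ b M : ℝ} {f : ℝ → R3 → W}
    (hf : PerCont (Set.Ioc 0 T) f) (hT : T ≤ 1) (hM : 0 ≤ M) (hδ : δ < 1) (hβ : -1 < β)
    (hb : b = β + 2 * (1 - δ)) (hb0 : b < 0)
    (h : ∀ s ∈ Set.Ioc 0 T, HB β (M * s ^ (-δ)) (f s)) {t : ℝ}
    (ht : t ∈ Set.Ioc 0 T) : HB b (baseConst β δ * M) (duh f t) := by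
  have hβb : β < b := by linarith
  have h1 := HB.duh hf hT hM hδ hβ hb0.le hb
    (by rw [rIdx_eq_two ⟨by linarith, hb0.le⟩ hb0, rIdx_eq_two ⟨hβ, by linarith⟩ (by linarith)]) h ht
  have c1 := heatConst_nonneg β
  have c2 := betaI_nonneg (-β / 2) δ
  have c3 := betaI_nonneg (-β / 2 + 1 / 2) δ
  intro l hl ψ hψ x
  refine (h1 l hl ψ hψ x).trans (mul_le_mul_of_nonneg_right
    (mul_le_mul_of_nonneg_right ?_ hM) (Real.rpow_nonneg hl.1.le _))
  have : 0 ≤ heatConst β * (betaI (-β / 2) δ + betaI (-β / 2 + 1 / 2) δ) := by positivity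
  unfold baseConst
  linarith

/-! ### From fixed points to mild solutions -/

/-- The heat flow together with its gradient. -/
noncomputable def heatP (X : Dist W) (t : ℝ) (x : R3) : W × (R3 →L[ℝ] W) :=
  (heat t X x, fderiv ℝ (heat t X) x)

/-- The quadratic nonlinearity of the heat flow. -/
noncomputable def heatQ (Q : W → (R3 →L[ℝ] W) → W) (X : Dist W) (t : ℝ) (x : R3) : W :=
  Q (heat t X x) (fderiv ℝ (heat t X) x)

theorem perCont_heatP [CompleteSpace W] (X : Dist W) : PerCont (Set.Ioi 0) (heatP X) :=
  (perCont_heat X).prodMk (perCont_fderiv_heat X)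

variable {Q : W → (R3 →L[ℝ] W) → W} {C : W → W} {q K η b γ : ℝ}

theorem IsQuadratic.perCont_heatQ [CompleteSpace W] (hQ : IsQuadratic Q q) (X : Dist W) :
    PerCont (Set.Ioi 0) (heatQ Q X) :=
  (perCont_heatP X).comp (g := fun p => Q p.1 p.2) hQ.smooth.continuous

theorem restN_add_eq (hQ : IsQuadratic Q q) (r z : W × (R3 →L[ℝ] W)) :
    Q (z.1 + r.1) (z.2 + r.2) + C (z.1 + r.1) = Q z.1 z.2 + restN Q C r z := by
  rw [restN, hQ.bil.add_left, hQ.bil.add_right, hQ.bil.add_right]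
  abel

theorem hasFDerivAt_heat_fderiv [CompleteSpace W] (X : Dist W) {t : ℝ} (ht : 0 < t) (x : R3) :
    HasFDerivAt (heat t X) (fderiv ℝ (heat t X) x) x :=
  (hasFDerivAt_heat X (half_pos ht) (half_lt_self ht) x).differentiableAt.hasFDerivAt

/-- The heat flow and both Duhamel integrals are restarted at time `s`; their forces add up to the
full nonlinearity evaluated at heat flow plus remainder. -/
theorem Fixed.mild [CompleteSpace W] (hQ : IsQuadratic Q q) (hC : IsCubic C K) (he : Exps η b γ)
    {T m a δ M : ℝ} (hT : T ≤ 1) (hm : 1 ≤ m) (X : Dist W) (hg : Force T a δ M (heatQ Q X))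
    (ha : a < 1 / 2) (hδ : δ < 1) (hZ : Ctl T η m (heatP X)) {U : ℝ → R3 → W × (R3 →L[ℝ] W)}
    (hU : Fixed Q C T b m (duhP (heatQ Q X)) (heatP X) U) :
    Mild (fun p => Q p.1 p.2 + C p.1) T (fun t x => heat t X x + (U t x).1)
      (fun t x => fderiv ℝ (heat t X) x + (U t x).2) := by
  have hR := hU.force_rest hQ hC he hT hm hZ
  have hγ := he.lt_one
  set f : ℝ → R3 → W := fun s y => restN Q C (U s y) (heatP X s y) with hf
  have hsub : Set.Ioo 0 T ⊆ Set.Ioc 0 T := Set.Ioo_subset_Ioc_self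
  have hsub' : Set.Ioo 0 T ⊆ Set.Ioi 0 := fun t ht => ht.1
  have hU1 : ∀ t ∈ Set.Ioc 0 T, ∀ x, (U t x).1 = duh (heatQ Q X) t x + duh f t x := fun t ht x =>
    congrArg Prod.fst (hU.eqn t ht x)
  have hU2 : ∀ t ∈ Set.Ioc 0 T, ∀ x, (U t x).2 = dduh (heatQ Q X) t x + dduh f t x := fun t ht x =>
    congrArg Prod.snd (hU.eqn t ht x)
  refine ⟨?_, ?_, fun t ht x => ?_, fun s t hs0 hst htT x => ?_⟩
  · exact ((perCont_heat X).mono hsub').add ((hU.pc.mono hsub).comp continuous_fst)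
  · exact ((perCont_fderiv_heat X).mono hsub').add ((hU.pc.mono hsub).comp continuous_snd)
  · have h1 := (hg.hasFDerivAt_duh hT ha hδ (hsub ht) x).add
      (hR.hasFDerivAt_duh hT (by norm_num) hγ (hsub ht) x)
    rw [hU2 t (hsub ht) x]
    have e : (fun x => heat t X x + (U t x).1) = heat t X + (duh (heatQ Q X) t + duh f t) := by
      ext1 y; rw [hU1 t (hsub ht) y]; rfl
    rw [e]
    exact (hasFDerivAt_heat_fderiv X ht.1 x).add h1
  · have hsT : s ∈ Set.Ioc 0 T := ⟨hs0, by linarith⟩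
    have ht : t ∈ Set.Ioc 0 T := ⟨by linarith, htT.le⟩
    have r1 := hg.duh_restart hT ha hδ hs0 hst.le htT.le x
    have r2 := hR.duh_restart hT (by norm_num) hγ hs0 hst.le htT.le x
    have hpc1 : PerCont (Set.Ioc 0 T) (duh (heatQ Q X)) := hg.perCont_duh hT ha hδ
    have hpc2 : PerCont (Set.Ioc 0 T) (duh f) := hR.perCont_duh hT (by norm_num) hγ
    obtain ⟨B1, -, hB1⟩ := hpc1.bound hsT
    obtain ⟨B2, -, hB2⟩ := hpc2.bound hsT
    obtain ⟨B3, hB3⟩ := exists_bound_heat X hs0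
    have e1 : hs (t - s) (fun y => heat s X y + (U s y).1) x = heat t X x +
        (hs (t - s) (duh (heatQ Q X) s) x + hs (t - s) (duh f s) x) := by
      have e : (fun y => heat s X y + (U s y).1) =
          fun y => heat s X y + (duh (heatQ Q X) s y + duh f s y) := by
        ext1 y; rw [hU1 s hsT y]
      rw [e, hs_add (continuous_heat X hs0) hB3 (g := fun y => duh (heatQ Q X) s y + duh f s y)
        ((hpc1.continuous hsT).add (hpc2.continuous hsT))
        (fun y => (norm_add_le _ _).trans (add_le_add (hB1 y) (hB2 y))),
        hs_add (hpc1.continuous hsT) hB1 (hpc2.continuous hsT) hB2,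
        hs_heat X (by linarith) hs0, sub_add_cancel]
    have e2 : ∫ r in s..t, hs (t - r) (fun y => (fun p : W × (R3 →L[ℝ] W) => Q p.1 p.2 + C p.1)
        (heat r X y + (U r y).1, fderiv ℝ (heat r X) y + (U r y).2)) x =
        (∫ r in s..t, hs (t - r) (heatQ Q X r) x) + ∫ r in s..t, hs (t - r) (f r) x := by
      have hmem : Set.uIcc s t ⊆ Set.uIcc 0 t := by
        rw [Set.uIcc_of_le hst.le, Set.uIcc_of_le (by linarith)]
        exact Set.Icc_subset_Icc_left hs0.le
      rw [← intervalIntegral.integral_add ((hg.intervalIntegrable hT ha hδ ht x).mono_set hmem)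
        ((hR.intervalIntegrable hT (by norm_num) hγ ht x).mono_set hmem)]
      refine intervalIntegral.integral_congr fun r hr => ?_
      rw [Set.uIcc_of_le hst.le] at hr
      have hr' : r ∈ Set.Ioc 0 T := ⟨by linarith [hr.1], by linarith [hr.2]⟩
      obtain ⟨A1, -, hA1⟩ := hg.toPerCont.bound hr'
      obtain ⟨A2, -, hA2⟩ := hR.toPerCont.bound hr'
      rw [← hs_add (hg.toPerCont.continuous hr') hA1 (hR.toPerCont.continuous hr') hA2]
      congr 1
      ext1 y
      exact restN_add_eq hQ (U r y) (heatP X r y)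
    rw [e1, e2, hU1 t ht x, r1, r2]
    abel

/-- Mild solutions are classical solutions. -/
theorem Mild.classical [FiniteDimensional ℝ W] {N : W × (R3 →L[ℝ] W) → W} {T : ℝ}
    {u : ℝ → R3 → W} {u' : ℝ → R3 → R3 →L[ℝ] W} (h : Mild N T u u') (hN : ContDiff ℝ ∞ N)
    (hT : T ≤ 1) : ContDiffOn ℝ ∞ (fun p : ℝ × R3 => u p.1 p.2) (Set.Ioo 0 T ×ˢ Set.univ) ∧
      ∀ t ∈ Set.Ioo 0 T, ContDiff ℝ ∞ (u t) ∧ ∀ x, HasDerivAt (fun r => u r x)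
        (traceL (fderiv ℝ (fderiv ℝ (u t)) x) + N (u t x, fderiv ℝ (u t) x)) t := by
  have := FiniteDimensional.complete ℝ W
  have hs : ContDiffOn ℝ ∞ (fun p : ℝ × R3 => u p.1 p.2) (Set.Ioo 0 T ×ˢ Set.univ) :=
    contDiffOn_infty.2 fun n => contDiffOn_mild n hT hN h
  refine ⟨hs, fun t ht => ⟨?_, fun x => ?_⟩⟩
  · have : ContDiffOn ℝ ∞ (u t) Set.univ :=
      hs.comp (f := fun x : R3 => (t, x)) (by fun_prop) fun x _ => ⟨ht, trivial⟩
    exact contDiffOn_univ.1 this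
  · obtain ⟨v, hv, hv'⟩ := h.exists_second (hN.of_le (by simp)) hT
    have e1 : fderiv ℝ (u t) = u' t := funext fun y => (h.deriv t ht y).fderiv
    rw [e1, (hv' t ht x).fderiv]
    exact h.hasDerivAt_time hN.continuous hv hv' ht x

end YMH

namespace YMH

/-! ### Norms of initial conditions and bounds on their heat flow -/

section

variable {W : Type*} [NormedAddCommGroup W] [NormedSpace ℝ W]

theorem HB.clm [CompleteSpace W] {V : Type*} [NormedAddCommGroup V] [NormedSpace ℝ V]
    [CompleteSpace V] {α M : ℝ} {f : R3 → V} (hf : Continuous f) (h : HB α M f) (A : V →L[ℝ] W) :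
    HB α (‖A‖ * M) fun x => A (f x) := by
  intro l hl ψ hψ x
  have hi : Integrable fun w => ψ w • f (x + l • w) := by
    refine Continuous.integrable_of_hasCompactSupport ?_ ?_
    · have := hψ.1.continuous
      fun_prop
    · exact (HasCompactSupport.of_support_subset_isCompact (isCompact_closedBall 0 (1 / 4))
        ((subset_tsupport _).trans hψ.2.1)).smul_right
  have e : ∫ w, ψ w • A (f (x + l • w)) = A (∫ w, ψ w • f (x + l • w)) := by
    rw [← A.integral_comp_comm hi]; simp
  rw [e, mul_assoc]
  exact (A.le_opNorm _).trans (mul_le_mul_of_nonneg_left (h l hl ψ hψ x) (norm_nonneg _))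

/-- The constant in the estimates of the heat flow and its gradient in terms of the norm in
`C^η`. -/
noncomputable def heatPConst (η : ℝ) : ℝ :=
  heatConst η + gradConst * heatConst η * (1 / 2) ^ (η / 2 - 1 / 2)

theorem heatPConst_nonneg (η : ℝ) : 0 ≤ heatPConst η := by
  have h1 := heatConst_nonneg η
  have h2 := gradConst_nonneg
  unfold heatPConst
  positivity

theorem wb_heatP [CompleteSpace W] {η A : ℝ} (hη : η ≤ 0) {X : Dist W} (hX : Approx η X)
    (hA0 : 0 ≤ A) (hA : holderNorm η X ≤ ENNReal.ofReal A) {t : ℝ} (ht : t ∈ Set.Ioc (0 : ℝ) 1)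
    (x : R3) : WB η t (heatPConst η * A) (heatP X t x) := by
  have h1 := heatConst_nonneg η
  have h2 := gradConst_nonneg
  have h3 : 0 ≤ gradConst * heatConst η * (1 / 2 : ℝ) ^ (η / 2 - 1 / 2) := by positivity
  constructor
  · refine (norm_heat_le hη hX hA0 hA ht x).trans (mul_le_mul_of_nonneg_right
      (mul_le_mul_of_nonneg_right ?_ hA0) (Real.rpow_nonneg ht.1.le _))
    unfold heatPConst; linarith
  · refine (norm_fderiv_heat_le hη hX hA0 hA ht x).trans (mul_le_mul_of_nonneg_right
      (mul_le_mul_of_nonneg_right ?_ hA0) (Real.rpow_nonneg ht.1.le _))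
    unfold heatPConst; linarith

theorem ctl_heatP [CompleteSpace W] {η A : ℝ} (hη : η ≤ 0) {X : Dist W} (hX : Approx η X)
    (hA0 : 0 ≤ A) (hA : holderNorm η X ≤ ENNReal.ofReal A) {T : ℝ} (hT : T ≤ 1) :
    Ctl T η (heatPConst η * A) (heatP X) :=
  ⟨(perCont_heatP X).mono fun _ ht => ht.1, fun _ ht x =>
    wb_heatP hη hX hA0 hA ⟨ht.1, ht.2.trans hT⟩ x⟩

theorem heatP_sub [CompleteSpace W] (X Y : Dist W) {t : ℝ} (ht : 0 < t) (x : R3) :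
    heatP (X - Y) t x = heatP X t x - heatP Y t x := by
  refine Prod.ext (heat_sub X Y ht x) ?_
  have e : heat t (X - Y) = fun x => heat t X x - heat t Y x := funext (heat_sub X Y ht)
  have h := (hasFDerivAt_heat_fderiv X ht x).sub (hasFDerivAt_heat_fderiv Y ht x)
  change fderiv ℝ (heat t (X - Y)) x = _
  rw [e]
  exact h.fderiv

theorem holderNorm_zero [CompleteSpace W] {α : ℝ} (hα : α ≤ 0) :
    holderNorm α (0 : Dist W) = 0 := by
  rw [← ofFun_zero]
  refine le_antisymm ((holderNorm_ofFun_le_of_bound (M := 0) continuous_const (fun _ _ => rfl) hα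
    fun x => by simp).trans (by simp)) zero_le

theorem holderNorm_sub_le {α : ℝ} (hα : α ≤ 0) (X Y : Dist W) :
    holderNorm α (X - Y) ≤ holderNorm α X + holderNorm α Y := by
  rw [sub_eq_add_neg, ← holderNorm_neg hα Y]
  exact holderNorm_add_le hα _ _

theorem holderNorm_sub_comm {α : ℝ} (hα : α ≤ 0) (X Y : Dist W) :
    holderNorm α (X - Y) = holderNorm α (Y - X) := by
  rw [← holderNorm_neg hα, neg_sub]

end

section

variable {W : Type*} [NormedAddCommGroup W] [InnerProductSpace ℝ W] [FiniteDimensional ℝ W]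

theorem continuous_quad (X : Dist W) {t : ℝ} (ht : 0 < t) : Continuous (quad t X) := by
  have := FiniteDimensional.complete ℝ W
  have h1 := continuous_heat X ht
  have h2 := (perCont_fderiv_heat X).continuous ht
  have h3 : Continuous fun x => (WithLp.toLp 2 fun j => pd j (heat t X) x :
      PiLp 2 fun _ : Fin 3 => W) := by
    refine (PiLp.continuous_toLp 2 _).comp (continuous_pi fun j => ?_)
    exact h2.clm_apply continuous_const
  exact ((TensorProduct.mk ℝ W (PiLp 2 fun _ : Fin 3 => W)).toContinuousBilinearMap.continuous.comp
    h1).clm_apply h3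

theorem periodic_quad (t : ℝ) (X : Dist W) : Periodic (quad t X) := fun k x => by
  have h1 := periodic_heat t X
  have h2 := h1.fderiv
  simp only [quad, pd, h1 k x, h2 k x]

theorem quad_zero (t : ℝ) (x : R3) : quad t (0 : Dist W) x = 0 := by
  simp [quad, heat_zero]

/-- The universal property of the tensor product, composed with the map `J` that rebuilds the
gradient from the partial derivatives. -/
theorem exists_quad_clm {Q : W → (R3 →L[ℝ] W) → W} {q : ℝ} (hQ : IsQuadratic Q q) :
    ∃ L : (W ⊗[ℝ] PiLp 2 (fun _ : Fin 3 => W)) →L[ℝ] W, ∀ t X x,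
      heatQ Q X t x = L (quad t X x) := by
  let J : PiLp 2 (fun _ : Fin 3 => W) →ₗ[ℝ] (R3 →L[ℝ] W) :=
    { toFun := fun d => ∑ j, (EuclideanSpace.proj j : R3 →L[ℝ] ℝ).smulRight (d j)
      map_add' := fun d d' => by
        ext v; simp [Finset.sum_add_distrib]
      map_smul' := fun c d => by
        ext v; simp [Finset.smul_sum, smul_comm c] }
  let L₀ : (W ⊗[ℝ] PiLp 2 (fun _ : Fin 3 => W)) →ₗ[ℝ] W :=
    TensorProduct.lift ((hQ.bil.toLinearMap).compl₂ J)
  refine ⟨LinearMap.toContinuousLinearMap L₀, fun t X x => ?_⟩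
  have e : fderiv ℝ (heat t X) x = J (WithLp.toLp 2 fun j => pd j (heat t X) x) := by
    ext v
    have hv : v = ∑ j, v j • EuclideanSpace.single j (1 : ℝ) := by
      ext i; simp [Finset.sum_apply, Pi.single_apply]
    conv_lhs => rw [hv, map_sum]
    simp [J, pd]
  change Q _ _ = L₀ (quad t X x)
  rw [e]
  rfl

/-- Linearity over the tensor N_t is the point: differences of the quadratic force are images of
N_t(X) - N_t(Y), so they are controlled by ⦀X;Y⦀ and not by norms of X and Y separately. -/
theorem exists_HB_heatQ {Q : W → (R3 →L[ℝ] W) → W} {q : ℝ} (hQ : IsQuadratic Q q) {β δ : ℝ}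
    (hβ : β ≤ 0) : ∃ κ, 0 ≤ κ ∧ ∀ (X Y : Dist W) (P : ℝ), 0 ≤ P →
      fancy β δ X Y ≤ ENNReal.ofReal P → ∀ s ∈ Set.Ioc (0 : ℝ) 1,
        HB β (κ * P * s ^ (-δ)) fun x => heatQ Q X s x - heatQ Q Y s x := by
  have := FiniteDimensional.complete ℝ W
  have := FiniteDimensional.complete ℝ (W ⊗[ℝ] PiLp 2 (fun _ : Fin 3 => W))
  obtain ⟨L, hL⟩ := exists_quad_clm hQ
  refine ⟨‖L‖, ContinuousLinearMap.opNorm_nonneg _, fun X Y P hP h s hs => ?_⟩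
  have hs0 : 0 < s ^ δ := Real.rpow_pos_of_pos hs.1 _
  have h1 : ENNReal.ofReal (s ^ δ) * holderNorm β (ofFun fun x => quad s X x - quad s Y x) ≤
      ENNReal.ofReal P := le_trans (le_iSup₂ (f := fun (t : ℝ) (_ : t ∈ Set.Ioc (0 : ℝ) 1) =>
      ENNReal.ofReal (t ^ δ) * holderNorm β (ofFun fun x => quad t X x - quad t Y x)) s hs) h
  have h2 : holderNorm β (ofFun fun x => quad s X x - quad s Y x) ≤
      ENNReal.ofReal (P * s ^ (-δ)) := by
    rw [mul_comm, ← ENNReal.le_div_iff_mul_le (by simp [hs0]) (by simp),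
      ← ENNReal.ofReal_div_of_pos hs0] at h1
    rwa [Real.rpow_neg hs.1.le, ← div_eq_mul_inv]
  have hc : Continuous fun x => quad s X x - quad s Y x :=
    (continuous_quad X hs.1).sub (continuous_quad Y hs.1)
  have h3 := HB_of_holderNorm_le hc (fun k x => by
    simp only [periodic_quad s X k x, periodic_quad s Y k x]) hβ
    (mul_nonneg hP (Real.rpow_nonneg hs.1.le _)) h2
  have h4 := h3.clm hc L
  simp only [map_sub, ← hL, ← mul_assoc] at h4
  exact h4

theorem heatQ_zero {Q : W → (R3 →L[ℝ] W) → W} {q : ℝ} (hQ : IsQuadratic Q q) (s : ℝ) (x : R3) :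
    heatQ Q (0 : Dist W) s x = 0 := by
  rw [heatQ, heat_zero, hQ.zero_left]

theorem fancy_comm {β δ : ℝ} (hβ : β ≤ 0) (X Y : Dist W) : fancy β δ X Y = fancy β δ Y X := by
  unfold fancy
  congr 1; ext t; congr 1; ext ht
  have hX := integrableOn_cube (continuous_quad X ht.1)
  have hY := integrableOn_cube (continuous_quad Y ht.1)
  rw [ofFun_sub hX hY, ofFun_sub hY hX, holderNorm_sub_comm hβ]

theorem fancy_triangle {β δ : ℝ} (hβ : β ≤ 0) (X Y Z : Dist W) :
    fancy β δ X Z ≤ fancy β δ X Y + fancy β δ Y Z := by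
  refine iSup₂_le fun t ht => ?_
  have hX := integrableOn_cube (continuous_quad X ht.1)
  have hY := integrableOn_cube (continuous_quad Y ht.1)
  have hZ := integrableOn_cube (continuous_quad Z ht.1)
  have h : ∀ X Y : Dist W, ENNReal.ofReal (t ^ δ) *
      holderNorm β (ofFun fun x => quad t X x - quad t Y x) ≤ fancy β δ X Y := fun X Y =>
    le_iSup₂ (f := fun (t : ℝ) (_ : t ∈ Set.Ioc (0 : ℝ) 1) =>
      ENNReal.ofReal (t ^ δ) * holderNorm β (ofFun fun x => quad t X x - quad t Y x)) t ht
  refine le_trans ?_ (add_le_add (h X Y) (h Y Z))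
  rw [← mul_add, ofFun_sub hX hZ, ofFun_sub hX hY, ofFun_sub hY hZ]
  refine mul_le_mul_right ?_ _
  rw [← sub_add_sub_cancel (ofFun (quad t X)) (ofFun (quad t Y)) (ofFun (quad t Z))]
  exact holderNorm_add_le hβ _ _

theorem theta_comm {η β δ : ℝ} (hη : η ≤ 0) (hβ : β ≤ 0) (X Y : Dist W) :
    theta η β δ X Y = theta η β δ Y X := by
  rw [theta, theta, fancy_comm hβ, holderNorm_sub_comm hη]

theorem theta_triangle {η β δ : ℝ} (hη : η ≤ 0) (hβ : β ≤ 0) (X Y Z : Dist W) :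
    theta η β δ X Z ≤ theta η β δ X Y + theta η β δ Y Z := by
  have h1 : holderNorm η (X - Z) ≤ holderNorm η (X - Y) + holderNorm η (Y - Z) := by
    rw [← sub_add_sub_cancel X Y Z]; exact holderNorm_add_le hη _ _
  calc theta η β δ X Z ≤ (holderNorm η (X - Y) + holderNorm η (Y - Z)) +
        (fancy β δ X Y + fancy β δ Y Z) := add_le_add h1 (fancy_triangle hβ X Y Z)
    _ = _ := by unfold theta; ring

/-- The heat flow of a smooth function is bounded together with its gradient. -/
theorem exists_bound_heatP_ofFun {f : R3 → W} (hf : ContDiff ℝ ∞ f) (hp : Periodic f) :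
    ∃ M, 0 ≤ M ∧ ∀ t, 0 < t → ∀ x, ‖heat t (ofFun f) x‖ ≤ M ∧
      ‖fderiv ℝ (heat t (ofFun f)) x‖ ≤ M := by
  have := FiniteDimensional.complete ℝ W
  have hd : ∀ x, HasFDerivAt f (fderiv ℝ f x) x := fun x =>
    (hf.differentiable (by simp) x).hasFDerivAt
  have hc' : Continuous (fderiv ℝ f) := hf.continuous_fderiv (by simp)
  obtain ⟨M, hM0, hM⟩ := hp.exists_bound hf.continuous
  obtain ⟨M', hM0', hM'⟩ := hp.fderiv.exists_bound hc'
  refine ⟨M + M', by positivity, fun t ht x => ⟨?_, ?_⟩⟩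
  · rw [heat_ofFun hf.continuous hp ht]
    exact (norm_hs_le hM t x).trans (by linarith)
  · have e : heat t (ofFun f) = hs t f := funext (heat_ofFun hf.continuous hp ht)
    rw [e, (hasFDerivAt_hs ht hf.continuous hM x).fderiv, dhs_eq_hs hd hc' hM hM' ht]
    exact (norm_hs_le hM' t x).trans (by linarith)

theorem fancy_ofFun_lt_top {β δ : ℝ} (hβ : β ≤ 0) (hδ : 0 ≤ δ) {f : R3 → W}
    (hf : ContDiff ℝ ∞ f) (hp : Periodic f) : fancy β δ (ofFun f) 0 < ⊤ := by
  have := FiniteDimensional.complete ℝ W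
  have := FiniteDimensional.complete ℝ (W ⊗[ℝ] PiLp 2 (fun _ : Fin 3 => W))
  obtain ⟨M, hM0, hM⟩ := exists_bound_heatP_ofFun hf hp
  have hn : ∀ t, 0 < t → ∀ x, ‖quad t (ofFun f) x‖ ≤ M * (3 * M) := fun t ht x => by
    rw [quad, TensorProduct.norm_tmul]
    have h1 : ‖(WithLp.toLp 2 fun j => pd j (heat t (ofFun f)) x : PiLp 2 fun _ : Fin 3 => W)‖ ≤
        3 * M := by
      rw [PiLp.norm_eq_of_L2, Real.sqrt_le_left (by positivity)]
      have h2 : ∀ j, ‖pd j (heat t (ofFun f)) x‖ ≤ M := fun j => by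
        refine (ContinuousLinearMap.le_opNorm _ _).trans ?_
        rw [PiLp.norm_single, norm_one, mul_one]
        exact (hM t ht x).2
      calc ∑ j, ‖pd j (heat t (ofFun f)) x‖ ^ 2 ≤ ∑ _j : Fin 3, M ^ 2 :=
            Finset.sum_le_sum fun j _ => pow_le_pow_left₀ (norm_nonneg _) (h2 j) 2
        _ ≤ (3 * M) ^ 2 := by simp; nlinarith
    exact mul_le_mul (hM t ht x).1 h1 (norm_nonneg _) hM0
  refine lt_of_le_of_lt (iSup₂_le fun t ht => ?_)
    (ENNReal.ofReal_lt_top (r := M * (3 * M)))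
  have h3 : holderNorm β (ofFun fun x => quad t (ofFun f) x - quad t 0 x) ≤
      ENNReal.ofReal (M * (3 * M)) := by
    simp only [quad_zero, sub_zero]
    exact holderNorm_ofFun_le_of_bound (continuous_quad _ ht.1) (periodic_quad _ _) hβ (hn t ht.1)
  calc _ ≤ 1 * ENNReal.ofReal (M * (3 * M)) := by
        refine mul_le_mul' ?_ h3
        rw [← ENNReal.ofReal_one]
        exact ENNReal.ofReal_le_ofReal (Real.rpow_le_one ht.1.le ht.2 hδ)
    _ = _ := one_mul _

/-- The triangle inequality through a smooth function at distance less than one, for which all norms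
are finite. -/
theorem theta_lt_top {η β δ : ℝ} (hη : η ≤ 0) (hβ : β ≤ 0) (hδ : 0 ≤ δ) {X : Dist W}
    (hX : X ∈ initSpace η β δ) : theta η β δ X 0 < ⊤ := by
  have := FiniteDimensional.complete ℝ W
  obtain ⟨f, hf, hp, h⟩ := hX 1 one_pos
  refine (theta_triangle hη hβ X (ofFun f) 0).trans_lt (ENNReal.add_lt_top.2
    ⟨h.trans ENNReal.one_lt_top, ENNReal.add_lt_top.2 ⟨?_, fancy_ofFun_lt_top hβ hδ hf hp⟩⟩)
  obtain ⟨M, _, hM⟩ := hp.exists_bound hf.continuous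
  rw [sub_zero]
  exact (holderNorm_ofFun_le_of_bound hf.continuous hp hη hM).trans_lt ENNReal.ofReal_lt_top

theorem approx_of_mem {η β δ : ℝ} {X : Dist W} (hX : X ∈ initSpace η β δ) : Approx η X := by
  intro ε hε
  obtain ⟨f, hf, hp, h⟩ := hX ε hε
  exact ⟨f, hf, hp, lt_of_le_of_lt le_self_add h⟩

end

end YMH

namespace YMH

/-! ### Remainders built from fixed points -/

/-- The largest of the four required exponents is below one because b > -1/2, η + b > -1, b > -2/3
(implied by the first) and η > -2/3, in the order of the maxima. -/
theorem exps_of_admissible {η β δ : ℝ} (h : Admissible η β δ) :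
    ∃ γ, Exps η (betaHat β δ) γ := by
  obtain ⟨h1, h2, h3, h4, h5⟩ := h
  set b := betaHat β δ
  refine ⟨max (max (1 / 2 - b) (1 / 2 - (b + η) / 2)) (max (-(3 * b / 2)) (-(3 * η / 2))),
    h1.2, h4.2, (le_max_left _ _).trans (le_max_left _ _),
    (le_max_right _ _).trans (le_max_left _ _), (le_max_left _ _).trans (le_max_right _ _),
    (le_max_right _ _).trans (le_max_right _ _), ?_⟩
  refine max_lt (max_lt ?_ ?_) (max_lt ?_ ?_) <;> linarith [h1.1, h4.1]

section

variable {W : Type*} [NormedAddCommGroup W] [NormedSpace ℝ W]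

theorem PerCont.tendsto_uniform {I : Set ℝ} {f : ℝ → R3 → W} (hf : PerCont I f) {t : ℝ}
    (ht : t ∈ I) {K : Set ℝ} (hK : IsCompact K) (hKI : K ⊆ I) (htK : t ∈ K) {ε : ℝ} (hε : 0 < ε) :
    ∀ᶠ s in 𝓝[K] t, ∀ x, ‖f s x - f t x‖ ≤ ε := by
  have hc := (hK.prod (isCompact_closedBall (0 : R3) 2)).uniformContinuousOn_of_continuous
    (hf.cont.mono (Set.prod_mono hKI (Set.subset_univ _)))
  obtain ⟨d, hd, h⟩ := Metric.uniformContinuousOn_iff.1 hc ε hε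
  filter_upwards [inter_mem_nhdsWithin K (Metric.ball_mem_nhds t hd)] with s hs x
  have hx := cube_subset_closedBall (add_toCube_mem x)
  have := h (s, x + latticeVec (toCube x)) ⟨hs.1, hx⟩ (t, x + latticeVec (toCube x)) ⟨htK, hx⟩
    (by simpa [Prod.dist_eq] using hs.2)
  rw [dist_eq_norm] at this
  simp only [hf.per s (hKI hs.1) _ x, hf.per t ht _ x] at this
  exact this.le

theorem norm_duh_le_rpow {T k γ : ℝ} {f : ℝ → R3 → W} (hf : PerCont (Set.Ioc 0 T) f) (hT : T ≤ 1)
    (hγ : γ < 1) (hk : 0 ≤ k) (h : ∀ s ∈ Set.Ioc 0 T, ∀ x, ‖f s x‖ ≤ k * s ^ (-γ))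
    {t : ℝ} (ht : t ∈ Set.Ioc 0 T) (x : R3) : ‖duh f t x‖ ≤ duhConst γ * k * t ^ (1 - γ) := by
  have h1 := (hf.force hk h).norm_duh_le hT (by norm_num) hγ ht x
  have hg := gradConst_nonneg
  have b1 := betaI_nonneg 0 γ
  have b2 := betaI_nonneg (1 / 2) γ
  have p := Real.rpow_nonneg ht.1.le (1 - γ)
  calc ‖duh f t x‖ ≤ (1 + gradConst) * k * t ^ (1 - 0 - γ) * betaI 0 γ := h1
    _ ≤ (1 + gradConst) * k * t ^ (1 - γ) * (betaI 0 γ + betaI (1 / 2) γ) := by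
      rw [sub_zero]; gcongr; linarith
    _ = _ := by rw [duhConst]; ring

/-- The leading term is genuinely measured in C^b, by bumps if `b < 0` and pointwise if `b = 0`,
while the better part `g` is bounded in the supremum norm. -/
theorem holderNorm_duh_add_le [CompleteSpace W] {T β δ b M N : ℝ} {f : ℝ → R3 → W}
    (hf : PerCont (Set.Ioc 0 T) f) (hT : T ≤ 1) (hM : 0 ≤ M) (hδ : δ < 1) (hβ : -1 < β)
    (hb : b = β + 2 * (1 - δ)) (hb0 : b ≤ 0)
    (h : ∀ s ∈ Set.Ioc 0 T, HB β (M * s ^ (-δ)) (f s)) {t : ℝ}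
    (ht : t ∈ Set.Ioc 0 T) {g : R3 → W} (hg : Continuous g) (hgp : Periodic g)
    (hgN : ∀ x, ‖g x‖ ≤ N) :
    holderNorm b (ofFun fun x => duh f t x + g x) ≤ ENNReal.ofReal (baseConst β δ * M + N) := by
  have hN : 0 ≤ N := (norm_nonneg _).trans (hgN 0)
  have hpc := (hf.force_of_HB hM h).perCont_duh hT (by linarith) hδ
  have hc := hpc.continuous ht
  rw [ofFun_add (integrableOn_cube hc) (integrableOn_cube hg),
    ENNReal.ofReal_add (mul_nonneg (baseConst_nonneg _ _) hM) hN]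
  refine (holderNorm_add_le hb0 _ _).trans (add_le_add ?_
    (holderNorm_ofFun_le_of_bound hg hgp hb0 hgN))
  refine holderNorm_ofFun_le hc (hpc.per t ht) hb0 (mul_nonneg (baseConst_nonneg _ _) hM)
    (fun hb' => HB_duh hf hT hM hδ hβ hb hb' h ht) fun hb' x => ?_
  have := (wb_duhP_of_HB hf hT hM hδ hβ hb h ht x).1
  rwa [hb', zero_div, Real.rpow_zero, mul_one] at this

/-- The factor 4 counts one for the Hölder norm, one for the supremum, and two for the C¹ norm,
which contains the supremum again besides the Lipschitz constant. -/
theorem bNorm_le_of_wb [CompleteSpace W] {b T d : ℝ} (hT : T ≤ 1)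
    {R : Set.Icc (0 : ℝ) T → Dist W} {r : ℝ → R3 → W × (R3 →L[ℝ] W)}
    (hR : ∀ t : Set.Icc (0 : ℝ) T, 0 < (t : ℝ) → R t = ofFun fun x => (r t x).1)
    (hr : PerCont (Set.Ioo 0 T) r) (hd : ∀ t ∈ Set.Ioo 0 T, ∀ x, WB b t d (r t x))
    (hD : ∀ t ∈ Set.Ioo 0 T, ∀ x, HasFDerivAt (fun y => (r t y).1) (r t x).2 x)
    (hh : ∀ t : Set.Icc (0 : ℝ) T, (t : ℝ) ∈ Set.Ioo 0 T → holderNorm b (R t) ≤ ENNReal.ofReal d) :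
    bNorm b R ≤ ENNReal.ofReal (4 * d) := by
  refine iSup₂_le fun t ht => ?_
  have ht0 : (0 : ℝ) < t := ht.1
  have hd0 := (hd t ht 0).nonneg ht0
  have hc : Continuous fun x => (r t x).1 := continuous_fst.comp (hr.continuous ht)
  have hp : Periodic fun x => (r t x).1 := fun k x => by simp only [hr.per t ht k x]
  have p1 := Real.rpow_nonneg ht0.le (b / 2)
  have p2 := Real.rpow_nonneg ht0.le (b / 2 - 1 / 2)
  have h0 : holderNorm 0 (R t) ≤ ENNReal.ofReal (d * (t : ℝ) ^ (b / 2)) := by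
    simp only [holderNorm, lt_irrefl, if_false, if_true]
    rw [hR t ht0]
    exact (supNorm_ofFun_le_iff hc hp (by positivity)).2 fun x => (hd t ht x).1
  have h1 : holderNorm 1 (R t) ≤
      ENNReal.ofReal (d * (t : ℝ) ^ (b / 2) + d * (t : ℝ) ^ (b / 2 - 1 / 2)) := by
    rw [holderNorm, if_neg (by norm_num), if_neg (by norm_num), hR t ht0]
    refine posHolderNorm_one_ofFun_le hc hp (fun x => (hd t ht x).1) (by positivity) fun x y => ?_
    exact convex_univ.norm_image_sub_le_of_norm_hasFDerivWithin_le
      (fun z _ => (hD t ht z).hasFDerivWithinAt) (fun z _ => (hd t ht z).2) trivial trivial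
  have e0 : ENNReal.ofReal ((t : ℝ) ^ (-b / 2)) * holderNorm 0 (R t) ≤ ENNReal.ofReal d := by
    refine (mul_le_mul_right h0 _).trans ?_
    rw [← ENNReal.ofReal_mul (Real.rpow_nonneg ht0.le _), mul_left_comm, ← Real.rpow_add ht0]
    simp [neg_div]
  have e1 : ENNReal.ofReal ((t : ℝ) ^ (1 / 2 - b / 2)) * holderNorm 1 (R t) ≤
      ENNReal.ofReal (2 * d) := by
    refine (mul_le_mul_right h1 _).trans ?_
    rw [← ENNReal.ofReal_mul (Real.rpow_nonneg ht0.le _), mul_add, mul_left_comm,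
      mul_left_comm _ d, ← Real.rpow_add ht0, ← Real.rpow_add ht0]
    refine ENNReal.ofReal_le_ofReal ?_
    have q1 : (t : ℝ) ^ (1 / 2 - b / 2 + b / 2) ≤ 1 :=
      Real.rpow_le_one ht0.le (ht.2.le.trans hT) (by norm_num)
    have q2 : (t : ℝ) ^ (1 / 2 - b / 2 + (b / 2 - 1 / 2)) = 1 := by
      rw [show 1 / 2 - b / 2 + (b / 2 - 1 / 2) = 0 by ring, Real.rpow_zero]
    rw [q2]
    nlinarith
  calc _ ≤ ENNReal.ofReal d + ENNReal.ofReal d + ENNReal.ofReal (2 * d) :=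
        add_le_add (add_le_add (hh t ht) e0) e1
    _ = _ := by
      rw [← ENNReal.ofReal_add hd0 hd0, ← ENNReal.ofReal_add (by positivity) (by positivity)]
      ring_nf

open Classical in
/-- The curve of distributions given by a function on `(0, T] × T³`, starting from zero. -/
noncomputable def remOf (T : ℝ) (U : ℝ → R3 → W × (R3 →L[ℝ] W)) (t : Set.Icc (0 : ℝ) T) : Dist W :=
  if 0 < (t : ℝ) then ofFun fun x => (U t x).1 else 0

theorem remOf_of_pos {T : ℝ} {U : ℝ → R3 → W × (R3 →L[ℝ] W)} {t : Set.Icc (0 : ℝ) T}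
    (ht : 0 < (t : ℝ)) : remOf T U t = ofFun fun x => (U t x).1 := if_pos ht

/-- Continuity at time zero is the hypothesis `h0`; at positive times the function is uniformly
continuous in the supremum norm, which is stronger. -/
theorem tendsto_remOf [CompleteSpace W] {b T T' : ℝ} (hb : b ≤ 0) (hTT : T ≤ T')
    {U : ℝ → R3 → W × (R3 →L[ℝ] W)} (hU : PerCont (Set.Ioc 0 T') U)
    (h0 : Tendsto (fun s : ℝ => holderNorm b (ofFun fun x => (U s x).1)) (𝓝[>] 0) (𝓝 0))
    (t : Set.Icc (0 : ℝ) T) :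
    Tendsto (fun s => holderNorm b (remOf T U s - remOf T U t)) (𝓝 t) (𝓝 0) := by
  rcases t.2.1.eq_or_lt with ht | ht
  · have e : remOf T U t = 0 := if_neg (by rw [← ht]; exact lt_irrefl _)
    simp only [e, sub_zero]
    rw [ENNReal.tendsto_nhds_zero] at h0 ⊢
    intro ε hε
    have h1 : ∀ᶠ s in 𝓝 (t : ℝ), s ∈ Set.Ioi (0 : ℝ) →
        holderNorm b (ofFun fun x => (U s x).1) ≤ ε := by
      rw [← ht]; exact eventually_nhdsWithin_iff.1 (h0 ε hε)
    filter_upwards [continuous_subtype_val.continuousAt.eventually h1] with s hs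
    rcases s.2.1.eq_or_lt with hs0 | hs0
    · rw [remOf, if_neg (by rw [← hs0]; exact lt_irrefl _), holderNorm_zero hb]
      exact zero_le
    · rw [remOf_of_pos hs0]; exact hs hs0
  · have hpc : PerCont (Set.Ioc 0 T') fun t x => (U t x).1 := hU.comp continuous_fst
    rw [ENNReal.tendsto_nhds_zero]
    intro ε hε
    obtain ⟨e, he0, he⟩ := ENNReal.lt_iff_exists_nnreal_btwn.1 hε
    have he0' : (0 : ℝ) < e := by exact_mod_cast he0
    have htm : (t : ℝ) ∈ Set.Icc ((t : ℝ) / 2) T := ⟨by linarith, t.2.2⟩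
    have h1 := hpc.tendsto_uniform ⟨ht, t.2.2.trans hTT⟩ (K := Set.Icc ((t : ℝ) / 2) T)
      isCompact_Icc (fun s hs => ⟨by linarith [hs.1], hs.2.trans hTT⟩) htm he0'
    rw [eventually_nhdsWithin_iff] at h1
    filter_upwards [continuous_subtype_val.continuousAt.eventually h1,
      continuous_subtype_val.continuousAt.eventually (lt_mem_nhds (half_lt_self ht))] with s hs hs'
    have hs0 : (0 : ℝ) < s := by linarith
    have hsI : (s : ℝ) ∈ Set.Ioc 0 T' := ⟨hs0, s.2.2.trans hTT⟩
    have htI : (t : ℝ) ∈ Set.Ioc 0 T' := ⟨ht, t.2.2.trans hTT⟩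
    rw [remOf_of_pos hs0, remOf_of_pos ht, ← ofFun_sub (integrableOn_cube (hpc.continuous hsI))
      (integrableOn_cube (hpc.continuous htI))]
    have hc : Continuous fun x => (U s x).1 - (U t x).1 :=
      (hpc.continuous hsI).sub (hpc.continuous htI)
    refine (holderNorm_ofFun_le_of_bound hc (fun k x => ?_) hb (hs ⟨hs'.le, s.2.2⟩)).trans ?_
    · simp only [hU.per s hsI k x, hU.per t htI k x]
    · rw [ENNReal.ofReal_coe_nnreal]; exact he.le

end

/-- The standing assumptions on the nonlinearity and on the exponents. -/
structure Setup {W : Type*} [NormedAddCommGroup W] [InnerProductSpace ℝ W]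
    (Q : W → (R3 →L[ℝ] W) → W) (C : W → W) (q K η β δ b γ κ : ℝ) : Prop where
  quad : IsQuadratic Q q
  cub : IsCubic C K
  exps : Exps η b γ
  beta_gt : -1 < β
  beta_le : β ≤ 0
  delta_nonneg : 0 ≤ δ
  delta_lt : δ < 1
  b_eq : b = β + 2 * (1 - δ)
  kappa_nonneg : 0 ≤ κ
  heatQ_bound : ∀ (X Y : Dist W) (P : ℝ), 0 ≤ P → fancy β δ X Y ≤ ENNReal.ofReal P →
    ∀ s ∈ Set.Ioc (0 : ℝ) 1, HB β (κ * P * s ^ (-δ)) fun x => heatQ Q X s x - heatQ Q Y s x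

namespace Setup

variable {W : Type*} [NormedAddCommGroup W] [InnerProductSpace ℝ W] [FiniteDimensional ℝ W]
  {Q : W → (R3 →L[ℝ] W) → W} {C : W → W} {q K η β δ b γ κ : ℝ}

theorem HB_heatQ (h : Setup Q C q K η β δ b γ κ) {X : Dist W} {P : ℝ} (hP : 0 ≤ P)
    (hX : fancy β δ X 0 ≤ ENNReal.ofReal P) {s : ℝ} (hs : s ∈ Set.Ioc (0 : ℝ) 1) :
    HB β (κ * P * s ^ (-δ)) (heatQ Q X s) := by
  have := h.heatQ_bound X 0 P hP hX s hs
  simpa only [heatQ_zero h.quad, sub_zero] using this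

theorem perCont_heatQ (h : Setup Q C q K η β δ b γ κ) (X : Dist W) (T : ℝ) :
    PerCont (Set.Ioc 0 T) (heatQ Q X) := by
  have := FiniteDimensional.complete ℝ W
  exact (h.quad.perCont_heatQ X).mono fun t ht => ht.1

theorem force_heatQ (h : Setup Q C q K η β δ b γ κ) {X : Dist W} {P : ℝ} (hP : 0 ≤ P)
    (hX : fancy β δ X 0 ≤ ENNReal.ofReal P) {T : ℝ} (hT : T ≤ 1) :
    Force T (-β / 2) δ (heatConst β * (κ * P)) (heatQ Q X) := by
  have := FiniteDimensional.complete ℝ W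
  exact (h.perCont_heatQ X T).force_of_HB (mul_nonneg h.kappa_nonneg hP) fun s hs =>
    h.HB_heatQ hP hX ⟨hs.1, hs.2.trans hT⟩

theorem half_lt (h : Setup Q C q K η β δ b γ κ) : -β / 2 < 1 / 2 := by linarith [h.beta_gt]

theorem ctl_base (h : Setup Q C q K η β δ b γ κ) {X : Dist W} {P : ℝ} (hP : 0 ≤ P)
    (hX : fancy β δ X 0 ≤ ENNReal.ofReal P) {T : ℝ} (hT : T ≤ 1) :
    Ctl T b (baseConst β δ * (κ * P)) (duhP (heatQ Q X)) := by
  have := FiniteDimensional.complete ℝ W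
  refine ⟨(h.force_heatQ hP hX hT).perCont_duhP hT h.half_lt h.delta_lt, fun t ht x => ?_⟩
  exact wb_duhP_of_HB (h.perCont_heatQ X T) hT (mul_nonneg h.kappa_nonneg hP) h.delta_lt h.beta_gt
    h.b_eq (fun s hs => h.HB_heatQ hP hX ⟨hs.1, hs.2.trans hT⟩) ht x

variable {T m : ℝ} {X Y : Dist W} {U V : ℝ → R3 → W × (R3 →L[ℝ] W)}

theorem hasFDerivAt_fixed (h : Setup Q C q K η β δ b γ κ) {P : ℝ} (hP : 0 ≤ P)
    (hX : fancy β δ X 0 ≤ ENNReal.ofReal P) (hT : T ≤ 1) (hm : 1 ≤ m) (hZ : Ctl T η m (heatP X))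
    (hU : Fixed Q C T b m (duhP (heatQ Q X)) (heatP X) U) {t : ℝ} (ht : t ∈ Set.Ioc 0 T) (x : R3) :
    HasFDerivAt (fun y => (U t y).1) (U t x).2 x := by
  have e : (fun y => (U t y).1) = duh (heatQ Q X) t +
      duh (fun s y => restN Q C (U s y) (heatP X s y)) t :=
    funext fun y => congrArg Prod.fst (hU.eqn t ht y)
  rw [e, show (U t x).2 = _ from congrArg Prod.snd (hU.eqn t ht x)]
  exact ((h.force_heatQ hP hX hT).hasFDerivAt_duh hT h.half_lt h.delta_lt ht x).add
    ((hU.force_rest h.quad h.cub h.exps hT hm hZ).hasFDerivAt_duh hT (by norm_num)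
      h.exps.lt_one ht x)

theorem norm_duh_rest_le (h : Setup Q C q K η β δ b γ κ) (hT : T ≤ 1) (hm : 1 ≤ m)
    (hZ : Ctl T η m (heatP X)) (hU : Ctl T b m U) {t : ℝ} (ht : t ∈ Set.Ioc 0 T) (x : R3) :
    ‖duh (fun s y => restN Q C (U s y) (heatP X s y)) t x‖ ≤
      duhConst γ * ((6 * q + 32 * K) * m ^ 3) * t ^ (1 - γ) :=
  norm_duh_le_rpow (hU.perCont_rest h.quad h.cub hZ) hT h.exps.lt_one
    (by have := h.quad.nonneg; have := h.cub.nonneg; positivity)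
    (fun s hs y => norm_restN_le h.quad h.cub h.exps ⟨hs.1, hs.2.trans hT⟩ hm (hU.le s hs y)
      (hZ.le s hs y)) ht x

/-- The source is linear in the bound `P` on ⦀X⦀ and the rest is at most 1/2 by the choice of the
time, so Θ(X) does not appear in the estimate. -/
theorem bNorm_remOf_le (h : Setup Q C q K η β δ b γ κ) {P : ℝ} (hP : 0 ≤ P)
    (hX : fancy β δ X 0 ≤ ENNReal.ofReal P) (hT : T ≤ 1) (hm : 1 ≤ m) (hZ : Ctl T η m (heatP X))
    (hs : duhConst γ * ((6 * q + 32 * K) * m ^ 3) * T ^ (1 - γ) ≤ 1 / 2)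
    (hU : Fixed Q C T b m (duhP (heatQ Q X)) (heatP X) U)
    (hU' : Ctl T b (baseConst β δ * (κ * P) + 1) U) {T₀ : ℝ} (hT₀ : T₀ ≤ T) :
    (∀ t ∈ Set.Ioc 0 T, holderNorm b (ofFun fun x => (U t x).1) ≤
      ENNReal.ofReal (baseConst β δ * (κ * P) + 1)) ∧
    bNorm b (remOf T₀ U) ≤ ENNReal.ofReal (4 * (baseConst β δ * (κ * P) + 1)) := by
  have := FiniteDimensional.complete ℝ W
  have hh : ∀ t ∈ Set.Ioc 0 T, holderNorm b (ofFun fun x => (U t x).1) ≤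
      ENNReal.ofReal (baseConst β δ * (κ * P) + 1) := by
    intro t ht
    have e : (fun y => (U t y).1) = fun y => duh (heatQ Q X) t y +
        duh (fun s y => restN Q C (U s y) (heatP X s y)) t y :=
      funext fun y => congrArg Prod.fst (hU.eqn t ht y)
    have hpc := (hU.force_rest h.quad h.cub h.exps hT hm hZ).perCont_duh hT (by norm_num)
      h.exps.lt_one
    rw [e]
    refine holderNorm_duh_add_le (h.perCont_heatQ X T) hT (mul_nonneg h.kappa_nonneg hP) h.delta_lt
      h.beta_gt h.b_eq h.exps.b_le (fun s hs => h.HB_heatQ hP hX ⟨hs.1, hs.2.trans hT⟩) ht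
      (hpc.continuous ht) (hpc.per t ht) fun x => ?_
    refine (h.norm_duh_rest_le hT hm hZ hU.toCtl ht x).trans (le_trans ?_ (hs.trans (by norm_num)))
    have h1 := duhConst_nonneg γ
    have h2 := h.quad.nonneg
    have h3 := h.cub.nonneg
    exact mul_le_mul_of_nonneg_left (Real.rpow_le_rpow ht.1.le ht.2 (by linarith [h.exps.lt_one]))
      (by positivity)
  have hsub : ∀ t ∈ Set.Ioo 0 T₀, t ∈ Set.Ioc 0 T := fun t ht => ⟨ht.1, ht.2.le.trans hT₀⟩
  refine ⟨hh, bNorm_le_of_wb (hT₀.trans hT) (fun t ht => remOf_of_pos ht) (hU.pc.mono hsub)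
    (fun t ht x => hU'.le t (hsub t ht) x)
    (fun t ht x => h.hasFDerivAt_fixed hP hX hT hm hZ hU (hsub t ht) x) fun t ht => ?_⟩
  rw [remOf_of_pos ht.1]
  exact hh t (hsub t ht)

/-- The leading terms differ by the Duhamel integral of the difference of the quadratic forces,
controlled by `P'`. The constant 12 is the 4 of `bNorm_le_of_wb` times the 3 of `Fixed.lipschitz`.
-/
theorem bNorm_remOf_sub_le (h : Setup Q C q K η β δ b γ κ) {P P' d : ℝ} (hP : 0 ≤ P) (hP' : 0 ≤ P')
    (hX : fancy β δ X 0 ≤ ENNReal.ofReal P) (hY : fancy β δ Y 0 ≤ ENNReal.ofReal P)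
    (hXY : fancy β δ X Y ≤ ENNReal.ofReal P') (hT : T ≤ 1) (hm : 1 ≤ m)
    (hZ : Ctl T η m (heatP X)) (hZ' : Ctl T η m (heatP Y))
    (hd : ∀ t ∈ Set.Ioc 0 T, ∀ x, WB η t d (heatP X t x - heatP Y t x)) (hd0 : 0 ≤ d)
    (hdP : baseConst β δ * (κ * P') ≤ d)
    (hs : duhConst γ * ((6 * q + 32 * K) * m ^ 3) * T ^ (1 - γ) ≤ 1 / 2)
    (hU : Fixed Q C T b m (duhP (heatQ Q X)) (heatP X) U)
    (hV : Fixed Q C T b m (duhP (heatQ Q Y)) (heatP Y) V) {T₀ : ℝ} (hT₀ : T₀ ≤ T) :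
    bNorm b (remOf T₀ U - remOf T₀ V) ≤ ENNReal.ofReal (12 * d) := by
  have := FiniteDimensional.complete ℝ W
  have hγ := h.exps.lt_one
  have hκP := mul_nonneg h.kappa_nonneg hP'
  have hFX := h.force_heatQ hP hX hT
  have hFY := h.force_heatQ hP hY hT
  have hpc : PerCont (Set.Ioc 0 T) fun t x => heatQ Q X t x - heatQ Q Y t x :=
    hFX.toPerCont.sub hFY.toPerCont
  have hHB : ∀ s ∈ Set.Ioc 0 T, HB β (κ * P' * s ^ (-δ)) fun x => heatQ Q X s x - heatQ Q Y s x :=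
    fun s hs => h.heatQ_bound X Y P' hP' hXY s ⟨hs.1, hs.2.trans hT⟩
  have hSS : ∀ t ∈ Set.Ioc 0 T, ∀ x, WB b t d (duhP (heatQ Q X) t x - duhP (heatQ Q Y) t x) := by
    intro t ht x
    rw [← hFX.duhP_sub hFY hT h.half_lt h.delta_lt h.half_lt h.delta_lt ht x]
    exact (wb_duhP_of_HB hpc hT hκP h.delta_lt h.beta_gt h.b_eq hHB ht x).mono ht.1 hdP
  have hUV := Fixed.lipschitz h.quad h.cub h.exps hT hm hd0 hs hZ hZ' hU hV hSS hd
  have hRU := hU.force_rest h.quad h.cub h.exps hT hm hZ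
  have hRV := hV.force_rest h.quad h.cub h.exps hT hm hZ'
  have hrest := (hU.perCont_rest h.quad h.cub hZ).sub (hV.perCont_rest h.quad h.cub hZ')
  have hq := h.quad.nonneg
  have hK := h.cub.nonneg
  have hh : ∀ t ∈ Set.Ioc 0 T, holderNorm b (ofFun fun x => (U t x).1 - (V t x).1) ≤
      ENNReal.ofReal (3 * d) := by
    intro t ht
    have hc := (hRU.perCont_duh hT (by norm_num) hγ).sub (hRV.perCont_duh hT (by norm_num) hγ)
    have e : (fun x => (U t x).1 - (V t x).1) = fun x =>
        duh (fun t x => heatQ Q X t x - heatQ Q Y t x) t x +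
        (duh (fun s y => restN Q C (U s y) (heatP X s y)) t x -
          duh (fun s y => restN Q C (V s y) (heatP Y s y)) t x) := by
      ext1 x
      rw [hFX.duh_sub hFY hT h.half_lt h.delta_lt h.half_lt h.delta_lt ht x,
        show (U t x).1 = _ from congrArg Prod.fst (hU.eqn t ht x),
        show (V t x).1 = _ from congrArg Prod.fst (hV.eqn t ht x)]
      simp only [Prod.fst_add, duhP]
      abel
    rw [e]
    -- Half, from the smallness of the time, of the bound 3d on the differences.
    refine (holderNorm_duh_add_le (N := 3 / 2 * d) hpc hT hκP h.delta_lt h.beta_gt h.b_eq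
      h.exps.b_le hHB ht (hc.continuous ht) (hc.per t ht) fun x => ?_).trans
      (ENNReal.ofReal_le_ofReal (by linarith))
    rw [← hRU.duh_sub hRV hT (by norm_num) hγ (by norm_num) hγ ht x]
    refine (norm_duh_le_rpow (k := (6 * q + 32 * K) * m ^ 2 * (3 * d)) hrest hT hγ (by positivity)
      (fun s hs y => norm_restN_sub_le h.quad h.cub h.exps ⟨hs.1, hs.2.trans hT⟩ hm (hU.le s hs y)
      (hV.le s hs y) (hZ.le s hs y) (hZ'.le s hs y) (hUV s hs y)
      ((hd s hs y).mono hs.1 (by linarith))) ht x).trans ?_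
    have h1 := duhConst_nonneg γ
    have h2 : t ^ (1 - γ) ≤ T ^ (1 - γ) := Real.rpow_le_rpow ht.1.le ht.2 (by linarith)
    have h3 : m ^ 2 ≤ m ^ 3 := pow_le_pow_right₀ hm (by norm_num)
    have h4 : 0 ≤ t ^ (1 - γ) := Real.rpow_nonneg ht.1.le _
    calc duhConst γ * ((6 * q + 32 * K) * m ^ 2 * (3 * d)) * t ^ (1 - γ)
        ≤ duhConst γ * ((6 * q + 32 * K) * m ^ 3 * (3 * d)) * T ^ (1 - γ) := by gcongr
      _ = duhConst γ * ((6 * q + 32 * K) * m ^ 3) * T ^ (1 - γ) * (3 * d) := by ring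
      _ ≤ 1 / 2 * (3 * d) := by gcongr
      _ = _ := by ring
  have hsub : ∀ t ∈ Set.Ioo 0 T₀, t ∈ Set.Ioc 0 T := fun t ht => ⟨ht.1, ht.2.le.trans hT₀⟩
  have hcU : PerCont (Set.Ioc 0 T) fun t x => (U t x).1 := hU.pc.comp continuous_fst
  have hcV : PerCont (Set.Ioc 0 T) fun t x => (V t x).1 := hV.pc.comp continuous_fst
  have hR : ∀ t : Set.Icc (0 : ℝ) T₀, 0 < (t : ℝ) → (remOf T₀ U - remOf T₀ V) t =
      ofFun fun x => (U t x - V t x).1 := fun t ht => by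
    have htm : (t : ℝ) ∈ Set.Ioc 0 T := ⟨ht, t.2.2.trans hT₀⟩
    rw [Pi.sub_apply, remOf_of_pos ht, remOf_of_pos ht,
      ← ofFun_sub (integrableOn_cube (hcU.continuous htm)) (integrableOn_cube (hcV.continuous htm))]
    rfl
  have := bNorm_le_of_wb (r := fun t x => U t x - V t x) (hT₀.trans hT) hR
    (((hU.pc.prodMk hV.pc).comp (g := fun p => p.1 - p.2) (by fun_prop)).mono hsub)
    (fun t ht x => hUV t (hsub t ht) x)
    (fun t ht x => (h.hasFDerivAt_fixed hP hX hT hm hZ hU (hsub t ht) x).sub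
      (h.hasFDerivAt_fixed hP hY hT hm hZ' hV (hsub t ht) x)) fun t ht => by
        rw [hR t ht.1]; exact hh t (hsub t ht)
  refine this.trans (le_of_eq ?_)
  ring_nf

/-- The leading term of the remainder is scale invariant and need not be small at small times.
Replacing `X` by a smooth `f` changes it by a multiple of ⦀X;f⦀, uniformly in time; the term for `f`
vanishes linearly and the rest like s^{1-γ}. -/
theorem tendsto_holderNorm_fixed (h : Setup Q C q K η β δ b γ κ) (hT0 : 0 < T)
    (hX : X ∈ initSpace η β δ) (hT : T ≤ 1) (hm : 1 ≤ m) (hZ : Ctl T η m (heatP X))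
    (hU : Fixed Q C T b m (duhP (heatQ Q X)) (heatP X) U) :
    Tendsto (fun s : ℝ => holderNorm b (ofFun fun x => (U s x).1)) (𝓝[>] 0) (𝓝 0) := by
  have := FiniteDimensional.complete ℝ W
  have hγ := h.exps.lt_one
  have hq := h.quad.nonneg
  have htop := theta_lt_top h.exps.eta_le h.beta_le h.delta_nonneg hX
  have hXP : fancy β δ X 0 ≤ ENNReal.ofReal (theta η β δ X 0).toReal := by
    rw [ENNReal.ofReal_toReal htop.ne]; exact le_add_self
  have hFX := h.force_heatQ ENNReal.toReal_nonneg hXP hT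
  have hR := hU.force_rest h.quad h.cub h.exps hT hm hZ
  rw [ENNReal.tendsto_nhds_zero]
  intro ε hε
  obtain ⟨e, he0, he⟩ := ENNReal.lt_iff_exists_nnreal_btwn.1 hε
  have he0' : (0 : ℝ) < e := by exact_mod_cast he0
  have hbc := baseConst_nonneg β δ
  have hκ := h.kappa_nonneg
  -- Makes the error of the approximation strictly smaller than the target `e`, leaving room for the
  -- terms that tend to zero.
  set ε' : ℝ := e / (2 * (baseConst β δ * κ + 1)) with hε'
  have hε'0 : 0 < ε' := by positivity
  obtain ⟨f, hf, hp, hfX⟩ := hX (ENNReal.ofReal ε') (by simpa using hε'0)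
  have hfX' : fancy β δ X (ofFun f) ≤ ENNReal.ofReal ε' := le_trans le_add_self hfX.le
  obtain ⟨M, hM0, hM⟩ := exists_bound_heatP_ofFun hf hp
  have hbd : ∀ s ∈ Set.Ioc 0 T, ∀ x, ‖heatQ Q (ofFun f) s x‖ ≤ q * M * M * s ^ (-0 : ℝ) := by
    intro s hs x
    rw [neg_zero, Real.rpow_zero, mul_one]
    have hMs := hM s hs.1 x
    refine (h.quad.le _ _).trans ?_
    gcongr
    · exact hMs.1
    · exact hMs.2
  have hpf := h.perCont_heatQ (ofFun f) T
  have hFf := hpf.force (by positivity) hbd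
  have hsmall : Tendsto (fun s : ℝ => baseConst β δ * (κ * ε') + (duhConst 0 * (q * M * M) *
      s ^ (1 - 0 : ℝ) + duhConst γ * ((6 * q + 32 * K) * m ^ 3) * s ^ (1 - γ))) (𝓝[>] 0)
      (𝓝 (baseConst β δ * (κ * ε') + (duhConst 0 * (q * M * M) *
      0 ^ (1 - 0 : ℝ) + duhConst γ * ((6 * q + 32 * K) * m ^ 3) * 0 ^ (1 - γ)))) := by
    refine Tendsto.mono_left (ContinuousAt.tendsto ?_) nhdsWithin_le_nhds
    have h1 : ContinuousAt (fun s : ℝ => s ^ (1 - 0 : ℝ)) 0 :=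
      Real.continuousAt_rpow_const _ _ (Or.inr (by norm_num))
    have h2 : ContinuousAt (fun s : ℝ => s ^ (1 - γ)) 0 :=
      Real.continuousAt_rpow_const _ _ (Or.inr (by linarith))
    exact continuousAt_const.add ((continuousAt_const.mul h1).add (continuousAt_const.mul h2))
  rw [Real.zero_rpow (by norm_num), Real.zero_rpow (by linarith), mul_zero, mul_zero, add_zero,
    add_zero] at hsmall
  have hlt : baseConst β δ * (κ * ε') < e := by
    have : baseConst β δ * (κ * ε') = e * (baseConst β δ * κ / (2 * (baseConst β δ * κ + 1))) := by
      rw [hε']; ring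
    rw [this]
    have h0 : 0 ≤ baseConst β δ * κ := by positivity
    exact mul_lt_of_lt_one_right he0' ((div_lt_one (by positivity)).2 (by linarith))
  have hT0' : Set.Ioc 0 T ∈ 𝓝[>] (0 : ℝ) := Ioc_mem_nhdsGT hT0
  filter_upwards [hsmall.eventually_lt_const hlt, hT0'] with s hs hsT
  have e1 : (fun x => (U s x).1) = fun x =>
      duh (fun t x => heatQ Q X t x - heatQ Q (ofFun f) t x) s x +
      (duh (heatQ Q (ofFun f)) s x + duh (fun s y => restN Q C (U s y) (heatP X s y)) s x) := by
    ext1 x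
    rw [hFX.duh_sub hFf hT h.half_lt h.delta_lt (by norm_num) (by norm_num) hsT x,
      show (U s x).1 = _ from congrArg Prod.fst (hU.eqn s hsT x)]
    simp only [Prod.fst_add, duhP]
    abel
  have hc := (hFf.perCont_duh hT (by norm_num) (by norm_num)).add
    (hR.perCont_duh hT (by norm_num) hγ)
  rw [e1]
  refine (holderNorm_duh_add_le ((h.perCont_heatQ X T).sub hpf) hT (mul_nonneg hκ hε'0.le)
    h.delta_lt h.beta_gt h.b_eq h.exps.b_le
    (fun r hr => h.heatQ_bound X (ofFun f) ε' hε'0.le hfX' r ⟨hr.1, hr.2.trans hT⟩) hsT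
    (hc.continuous hsT) (hc.per s hsT) fun x => (norm_add_le _ _).trans (add_le_add
      (norm_duh_le_rpow hpf hT (by norm_num) (by positivity) hbd hsT x)
      (h.norm_duh_rest_le hT hm hZ hU.toCtl hsT x))).trans ?_
  refine le_trans (ENNReal.ofReal_le_ofReal hs.le) ?_
  rw [ENNReal.ofReal_coe_nnreal]
  exact he.le

end Setup

end YMH

namespace YMH

/-! ### Classical solutions are fixed points -/

section

variable {W : Type*} [NormedAddCommGroup W] [NormedSpace ℝ W]

/-- Smooth functions on `(0, T) × T³`. -/
structure SmoothPer (T : ℝ) (v : ℝ → R3 → W) : Prop where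
  smooth : ContDiffOn ℝ ∞ (fun p : ℝ × R3 => v p.1 p.2) (Set.Ioo 0 T ×ˢ Set.univ)
  per : ∀ t ∈ Set.Ioo 0 T, Periodic (v t)

namespace SmoothPer

variable {T : ℝ} {v : ℝ → R3 → W}

theorem isOpen_cyl (T : ℝ) : IsOpen (Set.Ioo 0 T ×ˢ (Set.univ : Set R3)) :=
  isOpen_Ioo.prod isOpen_univ

theorem perCont (h : SmoothPer T v) : PerCont (Set.Ioo 0 T) v :=
  ⟨h.smooth.continuousOn, h.per⟩

theorem hasFDerivAt (h : SmoothPer T v) {t : ℝ} (ht : t ∈ Set.Ioo 0 T) (x : R3) :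
    HasFDerivAt (fun p : ℝ × R3 => v p.1 p.2) (fderiv ℝ (fun p : ℝ × R3 => v p.1 p.2) (t, x))
      (t, x) :=
  ((h.smooth.contDiffAt ((isOpen_cyl T).mem_nhds ⟨ht, trivial⟩)).differentiableAt
    (by simp)).hasFDerivAt

theorem perCont_fderiv (h : SmoothPer T v) :
    PerCont (Set.Ioo 0 T) fun t x => fderiv ℝ (fun p : ℝ × R3 => v p.1 p.2) (t, x) := by
  refine ⟨?_, fun t ht k x => ?_⟩
  · exact h.smooth.continuousOn_fderiv_of_isOpen (isOpen_cyl T) (by simp)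
  · have e : (fun p : ℝ × R3 => v (p + (0, latticeVec k)).1 (p + (0, latticeVec k)).2) =ᶠ[𝓝 (t, x)]
        fun p => v p.1 p.2 := by
      filter_upwards [(isOpen_cyl T).mem_nhds (⟨ht, trivial⟩ : (t, x) ∈ Set.Ioo 0 T ×ˢ Set.univ)]
        with p hp
      simpa using h.per p.1 hp.1 k p.2
    have e2 := e.fderiv_eq (𝕜 := ℝ)
    rw [fderiv_comp_add_right (f := fun p : ℝ × R3 => v p.1 p.2) (0, latticeVec k)] at e2
    simpa using e2

theorem contDiff (h : SmoothPer T v) {t : ℝ} (ht : t ∈ Set.Ioo 0 T) : ContDiff ℝ ∞ (v t) :=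
  contDiffOn_univ.1 (h.smooth.comp (f := fun x : R3 => (t, x)) (by fun_prop)
    fun x _ => ⟨ht, trivial⟩)

theorem hasFDerivAt_space (h : SmoothPer T v) {t : ℝ} (ht : t ∈ Set.Ioo 0 T) (x : R3) :
    HasFDerivAt (v t) (fderiv ℝ (v t) x) x :=
  ((h.contDiff ht).differentiable (by simp) x).hasFDerivAt

theorem perCont_fderiv_space (h : SmoothPer T v) :
    PerCont (Set.Ioo 0 T) fun t => fderiv ℝ (v t) := by
  refine (h.perCont_fderiv.comp (g := fun A : ℝ × R3 →L[ℝ] W =>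
    A.comp (ContinuousLinearMap.inr ℝ ℝ R3)) (by fun_prop)).congr fun t ht x => ?_
  have h1 : HasFDerivAt (fun y : R3 => (t, y)) (ContinuousLinearMap.inr ℝ ℝ R3) x :=
    hasFDerivAt_prodMk_right t x
  exact ((h.hasFDerivAt ht x).comp x h1).fderiv

/-- The fundamental theorem of calculus for r ↦ P_{t-r} v_r, whose derivative is P_{t-r}(∂_r v - Δv)
= P_{t-r} g_r. -/
theorem duhamel [CompleteSpace W] (h : SmoothPer T v) {g : ℝ → R3 → W}
    (hg : PerCont (Set.Ioo 0 T) g)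
    (heq : ∀ t ∈ Set.Ioo 0 T, ∀ x, HasDerivAt (fun s => v s x)
      (traceL (fderiv ℝ (fderiv ℝ (v t)) x) + g t x) t) {s t : ℝ} (hs0 : 0 < s) (hst : s < t)
    (htT : t < T) (x : R3) :
    v t x = hs (t - s) (v s) x + ∫ r in s..t, hs (t - r) (g r) x := by
  have hsub : Set.Icc s t ⊆ Set.Ioo 0 T := fun r hr => ⟨by linarith [hr.1], by linarith [hr.2]⟩
  have hcv : ContinuousOn (fun r => hs (t - r) (v r) x) (Set.Icc s t) :=
    h.perCont.continuousOn_hs (τ := fun r => t - r) (σ := fun r => r) (ξ := fun _ => x)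
      (by fun_prop) (by fun_prop) (fun r hr => hsub hr) (by fun_prop)
  have hcg : ContinuousOn (fun r => hs (t - r) (g r) x) (Set.Icc s t) :=
    hg.continuousOn_hs (τ := fun r => t - r) (σ := fun r => r) (ξ := fun _ => x)
      (by fun_prop) (by fun_prop) (fun r hr => hsub hr) (by fun_prop)
  have key := intervalIntegral.integral_eq_sub_of_hasDerivAt_of_le hst.le hcv
    (f' := fun r => hs (t - r) (g r) x) (fun r hr => ?_)
    (ContinuousOn.intervalIntegrable (by rwa [Set.uIcc_of_le hst.le]))
  · rw [key, sub_self, hs_zero]; abel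
  have hr' : r ∈ Set.Ioo 0 T := hsub ⟨hr.1.le, hr.2.le⟩
  have hI : Set.Icc s t ∈ 𝓝 r := Icc_mem_nhds hr.1 hr.2
  obtain ⟨M, -, hM⟩ := h.perCont.bound hr'
  obtain ⟨K, -, hK⟩ := h.perCont_fderiv.exists_bound isCompact_Icc hsub
  have hcd := h.contDiff hr'
  have h2 : ContDiff ℝ ∞ (fderiv ℝ (v r)) := hcd.fderiv_right (by simp)
  have hp2 : Periodic (fderiv ℝ (fderiv ℝ (v r))) := (h.per r hr').fderiv.fderiv
  have hpd : ∀ j y, HasFDerivAt (pd j (v r)) ((ContinuousLinearMap.apply ℝ W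
      (EuclideanSpace.single j (1 : ℝ))).comp (fderiv ℝ (fderiv ℝ (v r)) y)) y := fun j y =>
    (ContinuousLinearMap.apply ℝ W (EuclideanSpace.single j (1 : ℝ))).hasFDerivAt.comp y
      (h2.differentiable (by simp) y).hasFDerivAt
  have hc2 : ∀ j : Fin 3, Continuous fun y => (ContinuousLinearMap.apply ℝ W
      (EuclideanSpace.single j (1 : ℝ))).comp (fderiv ℝ (fderiv ℝ (v r)) y) := fun j => by
    have := h2.continuous_fderiv (by simp)
    fun_prop
  have hb2 : ∃ K', ∀ (j : Fin 3) y, ‖(ContinuousLinearMap.apply ℝ W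
      (EuclideanSpace.single j (1 : ℝ))).comp (fderiv ℝ (fderiv ℝ (v r)) y)‖ ≤ K' := by
    have : ∀ j : Fin 3, ∃ K', 0 ≤ K' ∧ ∀ y, ‖(ContinuousLinearMap.apply ℝ W
      (EuclideanSpace.single j (1 : ℝ))).comp (fderiv ℝ (fderiv ℝ (v r)) y)‖ ≤ K' := fun j =>
      Periodic.exists_bound (fun k y => by simp only [hp2 k y]) (hc2 j)
    choose K' hK0 hK' using this
    exact ⟨∑ j, K' j, fun j y => (hK' j y).trans
      (Finset.single_le_sum (fun i _ => hK0 i) (Finset.mem_univ j))⟩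
  obtain ⟨K', hK'⟩ := hb2
  have hd := hasDerivAt_hs_sub (u := v)
    (u' := fun r y => fderiv ℝ (fun p : ℝ × R3 => v p.1 p.2) (r, y)) x hI hr.2
    (fun r hr y => h.hasFDerivAt (hsub hr) y) (h.perCont_fderiv.continuous hr') hM hK hpd hc2 hK'
  have e : (fun y => fderiv ℝ (fun p : ℝ × R3 => v p.1 p.2) (r, y) (1, 0) -
      ∑ j, pd j (pd j (v r)) y) = g r := by
    ext1 y
    have h3 : HasDerivAt (fun s => v s y)
        (fderiv ℝ (fun p : ℝ × R3 => v p.1 p.2) (r, y) (1, 0)) r := by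
      have h4 : HasFDerivAt (fun s : ℝ => (s, y)) (ContinuousLinearMap.inl ℝ ℝ R3) r :=
        hasFDerivAt_prodMk_left r y
      exact ((h.hasFDerivAt hr' y).comp r h4).hasDerivAt
    have h5 : ∑ j, pd j (pd j (v r)) y = traceL (fderiv ℝ (fderiv ℝ (v r)) y) := by
      rw [traceL_apply]
      exact Finset.sum_congr rfl fun j _ => by rw [pd, (hpd j y).fderiv]; rfl
    rw [h3.unique (heq r hr' y), h5]
    abel
  rw [e] at hd
  exact hd

end SmoothPer

end

variable {W : Type*} [NormedAddCommGroup W] [InnerProductSpace ℝ W] [FiniteDimensional ℝ W]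
  {Q : W → (R3 →L[ℝ] W) → W} {C : W → W} {q K η β δ b γ κ : ℝ}

/-- Duhamel's formula between `s` and `t`, minus the heat flow of `X`, in the limit s → 0. The
forces are integrable up to time zero by the weighted bounds, and the boundary term vanishes by the
initial condition. -/
theorem Setup.fixed_of_classical (h : Setup Q C q K η β δ b γ κ) {X : Dist W} {P T T₀ m : ℝ}
    (hP : 0 ≤ P) (hX : fancy β δ X 0 ≤ ENNReal.ofReal P) (hT : T ≤ 1) (hT₀ : T₀ < T) (hm : 1 ≤ m)
    (hZ : Ctl T₀ η m (heatP X)) {v : ℝ → R3 → W} (hv : SmoothPer T v)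
    (heq : ∀ t ∈ Set.Ioo 0 T, ∀ x, HasDerivAt (fun s => v s x)
      (traceL (fderiv ℝ (fderiv ℝ (v t)) x) + (Q (v t x) (fderiv ℝ (v t) x) + C (v t x))) t)
    (hb : ∀ t ∈ Set.Ioo 0 T, ∀ x,
      WB b t m (v t x - heat t X x, fderiv ℝ (v t) x - fderiv ℝ (heat t X) x))
    (h0 : Tendsto (fun s : ℝ => holderNorm b (ofFun fun x => v s x - heat s X x)) (𝓝[>] 0) (𝓝 0)) :
    Fixed Q C T₀ b m (duhP (heatQ Q X)) (heatP X)
      fun t x => (v t x - heat t X x, fderiv ℝ (v t) x - fderiv ℝ (heat t X) x) := by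
  have := FiniteDimensional.complete ℝ W
  have hsub : Set.Ioc 0 T₀ ⊆ Set.Ioo 0 T := fun t ht => ⟨ht.1, ht.2.trans_lt hT₀⟩
  have hsub' : Set.Ioo 0 T ⊆ Set.Ioi 0 := fun t ht => ht.1
  have hT₀1 : T₀ ≤ 1 := hT₀.le.trans hT
  have hγ := h.exps.lt_one
  set U : ℝ → R3 → W × (R3 →L[ℝ] W) := fun t x =>
    (v t x - heat t X x, fderiv ℝ (v t) x - fderiv ℝ (heat t X) x) with hUdef
  have hr : PerCont (Set.Ioo 0 T) fun t x => v t x - heat t X x :=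
    hv.perCont.sub ((perCont_heat X).mono hsub')
  have hU : Ctl T₀ b m U :=
    ⟨(hr.prodMk (hv.perCont_fderiv_space.sub ((perCont_fderiv_heat X).mono hsub'))).mono hsub,
      fun t ht x => hb t (hsub ht) x⟩
  have hFX := h.force_heatQ hP hX hT₀1
  have hR := hU.force_rest h.quad h.cub h.exps hT₀1 hm hZ
  set f : ℝ → R3 → W := fun s y => restN Q C (U s y) (heatP X s y) with hf
  have hval : ∀ t ∈ Set.Ioc 0 T₀, ∀ x, v t x - heat t X x = duh (heatQ Q X) t x + duh f t x := by
    intro t ht x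
    have hN : PerCont (Set.Ioo 0 T) fun t x => Q (v t x) (fderiv ℝ (v t) x) + C (v t x) :=
      ((hv.perCont.prodMk hv.perCont_fderiv_space).comp h.quad.smooth.continuous).add
        (hv.perCont.comp h.cub.smooth.continuous)
    have hint := (hFX.intervalIntegrable hT₀1 h.half_lt h.delta_lt ht x).add
      (hR.intervalIntegrable hT₀1 (by norm_num) hγ ht x)
    set k : ℝ → W := fun r => hs (t - r) (heatQ Q X r) x + hs (t - r) (f r) x with hk
    have hduh : ∀ s ∈ Set.Ioo 0 t, v t x - heat t X x =
        hs (t - s) (fun y => v s y - heat s X y) x + ∫ r in s..t, k r := by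
      intro s hs
      have hsI : s ∈ Set.Ioo 0 T := ⟨hs.1, hs.2.trans (hsub ht).2⟩
      obtain ⟨B1, -, hB1⟩ := hv.perCont.bound hsI
      obtain ⟨B2, hB2⟩ := exists_bound_heat X hs.1
      rw [hv.duhamel hN heq hs.1 hs.2 (hsub ht).2 x, hs_sub (hv.perCont.continuous hsI) hB1
        (continuous_heat X hs.1) hB2, hs_heat X (by linarith [hs.2]) hs.1, sub_add_cancel]
      have e : ∫ r in s..t, YMH.hs (t - r)
          (fun y => Q (v r y) (fderiv ℝ (v r) y) + C (v r y)) x = ∫ r in s..t, k r := by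
        refine intervalIntegral.integral_congr fun r hr => ?_
        rw [Set.uIcc_of_le hs.2.le] at hr
        have hr' : r ∈ Set.Ioc 0 T₀ := ⟨by linarith [hr.1, hs.1], hr.2.trans ht.2⟩
        obtain ⟨A1, -, hA1⟩ := hFX.toPerCont.bound hr'
        obtain ⟨A2, -, hA2⟩ := hR.toPerCont.bound hr'
        simp only [hk]
        rw [← hs_add (hFX.toPerCont.continuous hr') hA1 (hR.toPerCont.continuous hr') hA2]
        congr 1
        ext1 y
        refine Eq.trans ?_ (restN_add_eq (C := C) h.quad (U r y) (heatP X r y))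
        simp [hUdef, heatP]
      rw [e]
      abel
    have hlim1 : Tendsto (fun s => ∫ r in s..t, k r) (𝓝[>] 0) (𝓝 (∫ r in (0 : ℝ)..t, k r)) := by
      have h1 := intervalIntegral.continuousOn_primitive_interval' hint (a := t)
        (Set.right_mem_uIcc)
      rw [Set.uIcc_of_le ht.1.le] at h1
      have h2 := (h1 0 ⟨le_rfl, ht.1.le⟩).mono_left
        (nhdsWithin_le_of_mem (mem_of_superset (Ioc_mem_nhdsGT ht.1) Set.Ioc_subset_Icc_self) :
          𝓝[>] (0 : ℝ) ≤ 𝓝[Set.Icc 0 t] 0)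
      have h3 := h2.neg
      simp only [← intervalIntegral.integral_symm] at h3
      exact h3
    -- For s ≤ t/2 there remains a heating time of at least t/2, over which C^b is mapped to L^∞
    -- with a bound independent of `s`.
    have hlim2 : Tendsto (fun s => hs (t - s) (fun y => v s y - heat s X y) x) (𝓝[>] 0) (𝓝 0) := by
      have h1 : Tendsto (fun s : ℝ => heatConst b *
          (holderNorm b (ofFun fun x => v s x - heat s X x)).toReal * (t / 2) ^ (b / 2))
          (𝓝[>] 0) (𝓝 0) := by
        have h2 := (ENNReal.tendsto_toReal ENNReal.zero_ne_top).comp h0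
        simpa using (h2.const_mul (heatConst b)).mul_const ((t / 2) ^ (b / 2))
      have hlt : ∀ᶠ s in 𝓝[>] (0 : ℝ), holderNorm b (ofFun fun x => v s x - heat s X x) < ⊤ :=
        h0.eventually_lt_const (by simp)
      refine squeeze_zero_norm' ?_ h1
      filter_upwards [hlt, Ioc_mem_nhdsGT (half_pos ht.1)] with s hs hs'
      have hsI : s ∈ Set.Ioo 0 T := ⟨hs'.1, by linarith [hs'.2, (hsub ht).2, ht.1]⟩
      obtain ⟨B, -, hB⟩ := hr.bound hsI
      have hHB := HB_of_holderNorm_le (hr.continuous hsI) (hr.per s hsI) h.exps.b_le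
        ENNReal.toReal_nonneg (ENNReal.ofReal_toReal hs.ne).ge
      refine (norm_hs_le_of_HB (hr.continuous hsI) hB ENNReal.toReal_nonneg hHB
        ⟨by linarith [hs'.2, ht.1], by linarith [hs'.1, ht.2]⟩ x).trans ?_
      refine mul_le_mul_of_nonneg_left (Real.rpow_le_rpow_of_nonpos (half_pos ht.1)
        (by linarith [hs'.2]) (by linarith [h.exps.b_le])) (mul_nonneg (heatConst_nonneg b)
          ENNReal.toReal_nonneg)
    have hlim := hlim2.add hlim1
    rw [zero_add] at hlim
    have hev : (fun s => hs (t - s) (fun y => v s y - heat s X y) x + ∫ r in s..t, k r) =ᶠ[𝓝[>] 0]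
        fun _ => v t x - heat t X x := by
      filter_upwards [Ioo_mem_nhdsGT ht.1] with s hs using (hduh s hs).symm
    rw [tendsto_nhds_unique (tendsto_const_nhds.congr' hev.symm) hlim, duh_eq, duh_eq,
      ← intervalIntegral.integral_add (hFX.intervalIntegrable hT₀1 h.half_lt h.delta_lt ht x)
        (hR.intervalIntegrable hT₀1 (by norm_num) hγ ht x)]
  refine ⟨hU, fun t ht x => Prod.ext (hval t ht x) ?_⟩
  have e : (fun y => v t y - heat t X y) = duh (heatQ Q X) t + duh f t := funext (hval t ht)
  have h1 : HasFDerivAt (fun y => v t y - heat t X y) (U t x).2 x :=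
    (hv.hasFDerivAt_space (hsub ht) x).sub (hasFDerivAt_heat_fderiv X ht.1 x)
  have h2 := (hFX.hasFDerivAt_duh hT₀1 h.half_lt h.delta_lt ht x).add
    (hR.hasFDerivAt_duh hT₀1 (by norm_num) hγ ht x)
  rw [← e] at h2
  exact h1.unique h2

end YMH

namespace YMH

/-! ### Remainders -/

theorem exists_bound_test (φ : Test) (r : ℕ) : ∃ B, 0 < B ∧
    ∀ j ≤ r, ∀ x, ‖iteratedFDeriv ℝ j (φ : R3 → ℝ) x‖ ≤ B := by
  have h : ∀ j : ℕ, ∃ B, 0 ≤ B ∧ ∀ x, ‖iteratedFDeriv ℝ j (φ : R3 → ℝ) x‖ ≤ B := fun j => by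
    refine Periodic.exists_bound (fun k x => ?_) ((contDiff_infty.1 φ.2.1 j).continuous_iteratedFDeriv le_rfl)
    rw [← iteratedFDeriv_comp_add_right]
    congr 1
    exact funext fun y => φ.2.2 k y
  choose B hB0 hB using h
  refine ⟨1 + ∑ j ∈ Finset.range (r + 1), B j, ?_, fun j hj x => (hB j x).trans ?_⟩
  · have := Finset.sum_nonneg fun j (_ : j ∈ Finset.range (r + 1)) => hB0 j
    linarith
  · have := Finset.single_le_sum (fun i _ => hB0 i) (Finset.mem_range.2 (Nat.lt_succ_of_le hj))
    linarith

theorem eq_zero_of_holderNorm {W : Type*} [NormedAddCommGroup W] [NormedSpace ℝ W] {b : ℝ}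
    (hb : b ≤ 0) {X : Dist W} (h : holderNorm b X = 0) : X = 0 := by
  refine Subtype.ext (LinearMap.ext fun φ => ?_)
  obtain ⟨B, hB0, hB⟩ := exists_bound_test φ (rIdx b)
  have := norm_apply_le_of_holderNorm (M := 0) (X := X) hb le_rfl (by simp [h]) hB0 hB
  rw [mul_zero] at this
  exact norm_le_zero_iff.1 this

section

variable {F : Type*} [NormedAddCommGroup F] [InnerProductSpace ℝ F] [FiniteDimensional ℝ F]
  {G : Type*} [Group G] [TopologicalSpace G] [ChartedSpace F G]
  {V : Type*} [NormedAddCommGroup V] [InnerProductSpace ℝ V] [FiniteDimensional ℝ V]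
  {ρ : G →* (V ≃ₗᵢ[ℝ] V)}
  {Q : Fields F V → (R3 →L[ℝ] Fields F V) → Fields F V} {C : Fields F V → Fields F V}
  {q K η β δ b γ κ : ℝ}

/-- The mild solution lives beyond `T`, so smoothness and the equation hold up to and including `T`.
-/
theorem isFlow_of_mild {T T' : ℝ} {u : ℝ → R3 → Fields F V} {u' : ℝ → R3 → R3 →L[ℝ] Fields F V}
    (hQ : IsQuadratic Q q) (hC : IsCubic C K)
    (hflow : ∀ X : R3 → Fields F V, ContDiff ℝ 2 X → ∀ x, flowRHS ρ X x =
      traceL (fderiv ℝ (fderiv ℝ X) x) + (Q (X x) (fderiv ℝ X x) + C (X x)))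
    (hT' : T' ≤ 1) (hTT : T < T') (h : Mild (fun p => Q p.1 p.2 + C p.1) T' u u') :
    IsFlow ρ T u := by
  have hN : ContDiff ℝ ∞ fun p : Fields F V × (R3 →L[ℝ] Fields F V) => Q p.1 p.2 + C p.1 :=
    hQ.smooth.add (hC.smooth.comp contDiff_fst)
  obtain ⟨h1, h2⟩ := h.classical hN hT'
  have hsub : Set.Ioc 0 T ⊆ Set.Ioo 0 T' := fun t ht => ⟨ht.1, ht.2.trans_lt hTT⟩
  refine ⟨h1.mono (Set.prod_mono hsub le_rfl), fun t ht => h.pc.per t (hsub ht), fun t ht x => ?_⟩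
  obtain ⟨h3, h4⟩ := h2 t (hsub ht)
  rw [hflow (u t) (contDiff_infty.1 h3 2) x]
  exact (h4 x).hasDerivWithinAt

/-- The converse of `bNorm_le_of_wb`: the weights are divided out, and the Lipschitz constant bounds
the gradient. -/
theorem exists_wb_of_bNorm {W : Type*} [NormedAddCommGroup W] [NormedSpace ℝ W] [CompleteSpace W]
    {T : ℝ} {R : Set.Icc (0 : ℝ) T → Dist W} (hR : bNorm b R < ⊤) {r : ℝ → R3 → W}
    {r' : ℝ → R3 → R3 →L[ℝ] W} (hr : PerCont (Set.Ioo 0 T) r)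
    (hr' : ∀ t ∈ Set.Ioo 0 T, ∀ x, HasFDerivAt (r t) (r' t x) x)
    (hRr : ∀ t : Set.Icc (0 : ℝ) T, (t : ℝ) ∈ Set.Ioo 0 T → R t = ofFun (r t)) :
    ∃ N, ∀ t ∈ Set.Ioo 0 T, ∀ x, WB b t N (r t x, r' t x) := by
  set N := (bNorm b R).toReal with hN
  have hN0 : 0 ≤ N := ENNReal.toReal_nonneg
  -- A bound strictly above the norm is needed to extract a representative from the infimum in the
  -- C¹ norm.
  refine ⟨N + 1, fun t ht x => ?_⟩
  have htT : t ∈ Set.Icc 0 T := ⟨ht.1.le, ht.2.le⟩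
  have hc := hr.continuous ht
  have hp := hr.per t ht
  have hle : holderNorm b (R ⟨t, htT⟩) + ENNReal.ofReal (t ^ (-b / 2)) * holderNorm 0 (R ⟨t, htT⟩)
      + ENNReal.ofReal (t ^ (1 / 2 - b / 2)) * holderNorm 1 (R ⟨t, htT⟩) ≤ ENNReal.ofReal N := by
    rw [hN, ENNReal.ofReal_toReal hR.ne]
    exact le_iSup₂ (f := fun (t : Set.Icc (0 : ℝ) T) (_ : (t : ℝ) ∈ Set.Ioo 0 T) =>
      (holderNorm b (R t) + ENNReal.ofReal ((t : ℝ) ^ (-b / 2)) * holderNorm 0 (R t)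
      + ENNReal.ofReal ((t : ℝ) ^ (1 / 2 - b / 2)) * holderNorm 1 (R t))) ⟨t, htT⟩ ht
  have div : ∀ {e : ℝ} {Y : ℝ≥0∞}, ENNReal.ofReal (t ^ e) * Y ≤ ENNReal.ofReal N →
      Y ≤ ENNReal.ofReal (N * t ^ (-e)) := by
    intro e Y h
    have hs0 : 0 < t ^ e := Real.rpow_pos_of_pos ht.1 _
    rw [mul_comm, ← ENNReal.le_div_iff_mul_le (by simp [hs0]) (by simp),
      ← ENNReal.ofReal_div_of_pos hs0] at h
    rwa [Real.rpow_neg ht.1.le, ← div_eq_mul_inv]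
  have h0 := div ((le_add_self.trans le_self_add).trans hle)
  have h1 := div (le_add_self.trans hle)
  rw [hRr ⟨t, htT⟩ ht] at h0 h1
  simp only [holderNorm, lt_irrefl, if_false, if_true] at h0
  rw [holderNorm, if_neg (by norm_num), if_neg (by norm_num)] at h1
  have p0 : 0 < t ^ (b / 2) := Real.rpow_pos_of_pos ht.1 _
  have p1 : 0 < t ^ (b / 2 - 1 / 2) := Real.rpow_pos_of_pos ht.1 _
  rw [show -(-b / 2) = b / 2 by ring] at h0
  rw [show -(1 / 2 - b / 2) = b / 2 - 1 / 2 by ring] at h1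
  have k0 := (supNorm_ofFun_le_iff hc hp (by positivity)).1 h0 x
  have k1 := (bounds_of_posHolderNorm_one_lt hc hp (M := (N + 1) * t ^ (b / 2 - 1 / 2))
    (h1.trans_lt ((ENNReal.ofReal_lt_ofReal_iff (by positivity)).2
      (mul_lt_mul_of_pos_right (by linarith) p1)))).2
  refine ⟨k0.trans (mul_le_mul_of_nonneg_right (by linarith) p0.le), ?_⟩
  exact (hr' t ht x).le_of_lip' (by positivity) (Eventually.of_forall fun y => k1 y x)

/-- Any competitor is a fixed point on each (0, T₀] with T₀ < T, of a size dictated by its own norm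
in B; `Fixed.unique` with the larger of the two sizes identifies it there. The times T and 0 are
added by continuity. -/
theorem Setup.eq_remOf (h : Setup Q C q K η β δ b γ κ)
    (hflow : ∀ X : R3 → Fields F V, ContDiff ℝ 2 X → ∀ x, flowRHS ρ X x =
      traceL (fderiv ℝ (fderiv ℝ X) x) + (Q (X x) (fderiv ℝ X x) + C (X x)))
    {X : Dist (Fields F V)} {P T T' m : ℝ} (hP : 0 ≤ P) (hX : fancy β δ X 0 ≤ ENNReal.ofReal P)
    (hT0 : 0 < T) (hTT : T < T') (hT' : T' ≤ 1) (hm : 1 ≤ m) (hZ : Ctl T' η m (heatP X))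
    {U : ℝ → R3 → Fields F V × (R3 →L[ℝ] Fields F V)}
    (hU : Fixed Q C T' b m (duhP (heatQ Q X)) (heatP X) U)
    {R : Set.Icc (0 : ℝ) T → Dist (Fields F V)} (hR : IsRemainder ρ b X R) : R = remOf T U := by
  have : CompleteSpace (Fields F V) := FiniteDimensional.complete ℝ _
  have hT1 : T ≤ 1 := hTT.le.trans hT'
  obtain ⟨v, hv, hRv⟩ := hR.flow
  have hvs : SmoothPer T v := ⟨hv.smooth.mono (Set.prod_mono Set.Ioo_subset_Ioc_self le_rfl),
    fun t ht => hv.periodic t (Set.Ioo_subset_Ioc_self ht)⟩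
  have hvc : PerCont (Set.Ioc 0 T) v := ⟨hv.smooth.continuousOn, hv.periodic⟩
  set r : ℝ → R3 → Fields F V := fun t x => v t x - heat t X x with hrdef
  set r' : ℝ → R3 → R3 →L[ℝ] Fields F V := fun t x =>
    fderiv ℝ (v t) x - fderiv ℝ (heat t X) x with hr'def
  have hrc : PerCont (Set.Ioc 0 T) r := hvc.sub ((perCont_heat X).mono fun t ht => ht.1)
  have hRr : ∀ t : Set.Icc (0 : ℝ) T, 0 < (t : ℝ) → R t = ofFun (r t) := fun t ht => by
    rw [hrdef, ofFun_sub (integrableOn_cube (hvc.continuous ⟨ht, t.2.2⟩))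
      (integrableOn_cube (continuous_heat X ht)), ← hRv t ht, add_sub_cancel_right]
  obtain ⟨N, hN⟩ := exists_wb_of_bNorm (r' := r') hR.memB.norm_lt_top
    (hrc.mono Set.Ioo_subset_Ioc_self) (fun t ht x =>
      (hvs.hasFDerivAt_space ht x).sub (hasFDerivAt_heat_fderiv X ht.1 x)) fun t ht => hRr t ht.1
  have heq : ∀ t ∈ Set.Ioo 0 T, ∀ x, HasDerivAt (fun s => v s x)
      (traceL (fderiv ℝ (fderiv ℝ (v t)) x) + (Q (v t x) (fderiv ℝ (v t) x) + C (v t x))) t := by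
    intro t ht x
    rw [← hflow (v t) (contDiff_infty.1 (hvs.contDiff ht) 2) x]
    exact (hv.eqn t (Set.Ioo_subset_Ioc_self ht) x).hasDerivAt (Ioc_mem_nhds ht.1 ht.2)
  have hL : Tendsto (fun s : ℝ => holderNorm b (ofFun fun x => v s x - heat s X x)) (𝓝[>] 0)
      (𝓝 0) := by
    have h1 := hR.init
    rw [ENNReal.tendsto_nhds_zero] at h1 ⊢
    intro ε hε
    have h2 := h1 ε hε
    rw [eventually_comap] at h2
    filter_upwards [h2, Ioc_mem_nhdsGT hT0] with s hs hsT
    have h3 := hs ⟨s, hsT.1.le, hsT.2⟩ rfl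
    rwa [hRr ⟨s, hsT.1.le, hsT.2⟩ hsT.1] at h3
  set m' := max m N
  have hin : ∀ t ∈ Set.Ioo 0 T, ∀ x, r t x = (U t x).1 := by
    intro t ht x
    obtain ⟨T₀, ht0, hT₀⟩ := exists_between ht.2
    have hm' : m ≤ m' := le_max_left _ _
    have hZ' : Ctl T₀ η m' (heatP X) := hZ.mono (hT₀.le.trans hTT.le) hm'
    have hfix := h.fixed_of_classical hP hX hT1 hT₀ (hm.trans hm') hZ' hvs heq
      (fun t ht x => (hN t ht x).mono ht.1 (le_max_right _ _)) hL
    exact congrArg Prod.fst (Fixed.unique h.quad h.cub h.exps (hT₀.le.trans hT1) (hm.trans hm') hZ'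
      hfix (hU.mono (hT₀.le.trans hTT.le) hm') t ⟨ht.1, ht0.le⟩ x)
  -- The norm of B says nothing at the final time, where the two functions agree because both are
  -- continuous up to it.
  have hend : ∀ x, r T x = (U T x).1 := by
    intro x
    have hTm : T ∈ Set.Ioc 0 T := ⟨hT0, le_rfl⟩
    have hUc : PerCont (Set.Ioc 0 T) fun t x => (U t x).1 :=
      (hU.pc.mono (Set.Ioc_subset_Ioc_right hTT.le)).comp continuous_fst
    have lim : ∀ {f : ℝ → R3 → Fields F V}, PerCont (Set.Ioc 0 T) f →
        Tendsto (fun s => f s x) (𝓝[Set.Ioo 0 T] T) (𝓝 (f T x)) := fun {f} hf => by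
      have h1 : ContinuousOn (fun s => f s x) (Set.Ioc 0 T) :=
        hf.cont.comp (f := fun s => (s, x)) (by fun_prop) fun s hs => ⟨hs, trivial⟩
      exact (h1 T hTm).mono_left (nhdsWithin_mono _ Set.Ioo_subset_Ioc_self)
    have : (𝓝[Set.Ioo 0 T] T).NeBot := by
      rw [nhdsWithin_Ioo_eq_nhdsLT hT0]; infer_instance
    refine tendsto_nhds_unique (lim hrc) ((lim hUc).congr' ?_)
    filter_upwards [self_mem_nhdsWithin] with s hs using (hin s hs x).symm
  ext1 t
  rcases t.2.1.eq_or_lt with ht | ht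
  -- At time zero, continuity in C^b and the initial condition force the value of the competitor to
  -- have norm zero, and the norm separates distributions.
  · have e : remOf T U t = 0 := if_neg (by rw [← ht]; exact lt_irrefl _)
    rw [e]
    refine eq_zero_of_holderNorm h.exps.b_le (le_antisymm ?_ zero_le)
    have hle : comap (Subtype.val : Set.Icc (0 : ℝ) T → ℝ) (𝓝[>] (0 : ℝ)) ≤ 𝓝 t := by
      rw [nhds_subtype, ← ht]
      exact comap_mono nhdsWithin_le_nhds
    have hne : (comap (Subtype.val : Set.Icc (0 : ℝ) T → ℝ) (𝓝[>] (0 : ℝ))).NeBot := by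
      refine comap_neBot fun s hs => ?_
      obtain ⟨y, hy1, hy2⟩ := Filter.nonempty_of_mem (inter_mem hs (Ioc_mem_nhdsGT hT0))
      exact ⟨⟨y, hy2.1.le, hy2.2⟩, hy1⟩
    have h1 := (hR.init).add ((hR.memB.continuous t).mono_left hle)
    rw [add_zero] at h1
    refine ge_of_tendsto' h1 fun s => ?_
    calc holderNorm b (R t) = holderNorm b (R s - (R s - R t)) := by rw [sub_sub_cancel]
      _ ≤ _ := holderNorm_sub_le h.exps.b_le _ _
  · rw [hRr t ht, remOf_of_pos ht]
    congr 1
    ext1 x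
    rcases t.2.2.eq_or_lt with htT | htT
    · rw [htT]; exact hend x
    · exact hin t ⟨ht, htT⟩ x

theorem Setup.isRemainder (h : Setup Q C q K η β δ b γ κ)
    (hflow : ∀ X : R3 → Fields F V, ContDiff ℝ 2 X → ∀ x, flowRHS ρ X x =
      traceL (fderiv ℝ (fderiv ℝ X) x) + (Q (X x) (fderiv ℝ X x) + C (X x)))
    {X : Dist (Fields F V)} (hXI : X ∈ initSpace η β δ) {P T T' m : ℝ} (hP : 0 ≤ P)
    (hX : fancy β δ X 0 ≤ ENNReal.ofReal P) (hT0 : 0 < T) (hTT : T < T') (hT' : T' ≤ 1)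
    (hm : 1 ≤ m) (hZ : Ctl T' η m (heatP X))
    (hs : duhConst γ * ((6 * q + 32 * K) * m ^ 3) * T' ^ (1 - γ) ≤ 1 / 2)
    {U : ℝ → R3 → Fields F V × (R3 →L[ℝ] Fields F V)}
    (hU : Fixed Q C T' b m (duhP (heatQ Q X)) (heatP X) U)
    (hU' : Ctl T' b (baseConst β δ * (κ * P) + 1) U) : IsRemainder ρ b X (remOf T U) := by
  have : CompleteSpace (Fields F V) := FiniteDimensional.complete ℝ _
  obtain ⟨hb1, hb2⟩ := h.bNorm_remOf_le hP hX hT' hm hZ hs hU hU' hTT.le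
  have h0 := h.tendsto_holderNorm_fixed (hT0.trans hTT) hXI hT' hm hZ hU
  have hUc : PerCont (Set.Ioc 0 T') fun t x => (U t x).1 := hU.pc.comp continuous_fst
  refine ⟨⟨fun t => ?_, tendsto_remOf h.exps.b_le hTT.le hU.pc h0,
    hb2.trans_lt ENNReal.ofReal_lt_top⟩, ⟨fun t x => heat t X x + (U t x).1, ?_, fun t ht => ?_⟩, ?_⟩
  · rcases t.2.1.eq_or_lt with ht | ht
    · rw [remOf, if_neg (by rw [← ht]; exact lt_irrefl _), holderNorm_zero h.exps.b_le]
      exact ENNReal.zero_lt_top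
    · rw [remOf_of_pos ht]
      exact (hb1 t ⟨ht, t.2.2.trans hTT.le⟩).trans_lt ENNReal.ofReal_lt_top
  · exact isFlow_of_mild h.quad h.cub hflow hT' hTT (Fixed.mild h.quad h.cub h.exps hT' hm X
      (h.force_heatQ hP hX hT') h.half_lt h.delta_lt hZ hU)
  · rw [remOf_of_pos ht, ofFun_add (integrableOn_cube (continuous_heat X ht))
      (integrableOn_cube (hUc.continuous ⟨ht, t.2.2.trans hTT.le⟩)), add_comm]
  · refine (h0.comp tendsto_comap).congr' ?_
    have : ∀ᶠ t : Set.Icc (0 : ℝ) T in comap Subtype.val (𝓝[>] (0 : ℝ)), 0 < (t : ℝ) :=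
      tendsto_comap.eventually self_mem_nhdsWithin
    filter_upwards [this] with t ht
    rw [Function.comp_apply, remOf_of_pos ht]

end

end YMH

/-! ### The existence time and the constants of the theorem. -/

namespace YMH

/-- The contraction condition is cubic in 1 + θ and of order 1 - γ in the time, so solving for the
time gives the power -3/(1 - γ). It is imposed at 2T because the fixed point is constructed on twice
the interval. -/
theorem exists_time_threshold {γ k D : ℝ} (hγ : γ < 1) (hk : 0 ≤ k) (hD : 0 ≤ D) :
    ∃ c q : ℝ, 0 < c ∧ q ≤ 0 ∧ ∀ T θ : ℝ, 0 < T → 0 ≤ θ → T < c * (θ + 1) ^ q →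
      2 * T ≤ 1 ∧ k * (D * (1 + θ)) ^ 3 * (2 * T) ^ (1 - γ) ≤ 1 / 2 := by
  have he : 0 < 1 - γ := by linarith
  have hkD : 0 ≤ k * D ^ 3 := by positivity
  set ε : ℝ := 1 / (2 * (k * D ^ 3 + 1)) with hε
  have hε0 : 0 < ε := by positivity
  have hε1 : ε ≤ 1 := by
    rw [hε, div_le_one (by positivity)]; linarith
  refine ⟨1 / 2 * ε ^ (1 / (1 - γ)), -3 / (1 - γ), by positivity,
    div_nonpos_of_nonpos_of_nonneg (by norm_num) he.le, fun T θ hT hθ h => ?_⟩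
  have hθ1 : 0 < θ + 1 := by linarith
  have hy0 : 0 < (θ + 1) ^ (-3 : ℝ) := Real.rpow_pos_of_pos hθ1 _
  have hy1 : (θ + 1) ^ (-3 : ℝ) ≤ 1 := Real.rpow_le_one_of_one_le_of_nonpos (by linarith) (by norm_num)
  have h1 : 2 * T ≤ (ε * (θ + 1) ^ (-3 : ℝ)) ^ (1 / (1 - γ)) := by
    rw [Real.mul_rpow hε0.le hy0.le, ← Real.rpow_mul hθ1.le, mul_one_div]
    linarith
  refine ⟨h1.trans (Real.rpow_le_one (by positivity) (mul_le_one₀ hε1 hy0.le hy1)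
    (by positivity)), ?_⟩
  have h2 : (2 * T) ^ (1 - γ) ≤ ε * (θ + 1) ^ (-3 : ℝ) := by
    refine (Real.rpow_le_rpow (by positivity) h1 he.le).trans_eq ?_
    rw [← Real.rpow_mul (by positivity), one_div_mul_cancel he.ne', Real.rpow_one]
  have h3 : (θ + 1) ^ (-3 : ℝ) = ((θ + 1) ^ 3)⁻¹ := by
    rw [Real.rpow_neg hθ1.le]; norm_cast
  calc k * (D * (1 + θ)) ^ 3 * (2 * T) ^ (1 - γ)
      ≤ k * (D * (1 + θ)) ^ 3 * (ε * (θ + 1) ^ (-3 : ℝ)) := by gcongr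
    _ = k * D ^ 3 * ε := by rw [h3]; field_simp; ring
    _ ≤ 1 / 2 := by
      rw [hε, mul_one_div, div_le_div_iff₀ (by positivity) (by norm_num)]
      linarith

section

variable {W : Type*} [NormedAddCommGroup W] [InnerProductSpace ℝ W] [FiniteDimensional ℝ W]
  {Q : W → (R3 →L[ℝ] W) → W} {C : W → W} {q K η β δ b γ κ : ℝ}

/-- The size of the data, relative to the initial condition, in the fixed point problem. -/
noncomputable def dataConst (η β δ κ : ℝ) : ℝ := 1 + heatPConst η + baseConst β δ * κ

theorem dataConst_nonneg (hκ : 0 ≤ κ) : 0 ≤ dataConst η β δ κ := by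
  have h1 := heatPConst_nonneg η
  have h2 := baseConst_nonneg β δ
  unfold dataConst
  positivity

theorem fancy_le_of_theta_le {X Y : Dist W} {M : ℝ≥0∞} (h : theta η β δ X Y ≤ M) :
    fancy β δ X Y ≤ M := le_add_self.trans h

theorem Setup.ctl_heatP_data (h : Setup Q C q K η β δ b γ κ) {X : Dist W} (hX : Approx η X)
    {θ T : ℝ} (hθ : 0 ≤ θ) (hXθ : theta η β δ X 0 ≤ ENNReal.ofReal θ) (hT : T ≤ 1) :
    Ctl T η (dataConst η β δ κ * (1 + θ)) (heatP X) := by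
  have := FiniteDimensional.complete ℝ W
  have h1 : holderNorm η X ≤ ENNReal.ofReal θ := by
    have : holderNorm η (X - 0) ≤ ENNReal.ofReal θ := le_self_add.trans hXθ
    rwa [sub_zero] at this
  refine (ctl_heatP h.exps.eta_le hX hθ h1 hT).mono le_rfl ?_
  have h2 := heatPConst_nonneg η
  have h3 := mul_nonneg (baseConst_nonneg β δ) h.kappa_nonneg
  unfold dataConst
  nlinarith [mul_nonneg h3 hθ]

/-- The size allowed in the contraction condition involves Θ(X), whereas the resulting bound on the
solution involves only ⦀X⦀. -/
theorem Setup.exists_fixed (h : Setup Q C q K η β δ b γ κ) {X : Dist W} (hX : Approx η X)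
    {θ P T : ℝ} (hθ : 0 ≤ θ) (hXθ : theta η β δ X 0 ≤ ENNReal.ofReal θ) (hP : 0 ≤ P) (hPθ : P ≤ θ)
    (hXP : fancy β δ X 0 ≤ ENNReal.ofReal P) (hT : T ≤ 1)
    (hs : duhConst γ * ((6 * q + 32 * K) * (dataConst η β δ κ * (1 + θ)) ^ 3) * T ^ (1 - γ) ≤
      1 / 2) :
    ∃ U, Fixed Q C T b (dataConst η β δ κ * (1 + θ)) (duhP (heatQ Q X)) (heatP X) U ∧
      Ctl T b (baseConst β δ * (κ * P) + 1) U := by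
  have := FiniteDimensional.complete ℝ W
  have h2 := heatPConst_nonneg η
  have h3 := mul_nonneg (baseConst_nonneg β δ) h.kappa_nonneg
  have hA : baseConst β δ * (κ * P) + 1 ≤ dataConst η β δ κ * (1 + θ) := by
    unfold dataConst
    nlinarith [mul_nonneg h3 hθ, mul_nonneg h2 hθ, mul_le_mul_of_nonneg_left hPθ h3]
  have hm : 1 ≤ dataConst η β δ κ * (1 + θ) := by
    have := mul_nonneg h3 hP
    linarith
  obtain ⟨U, hU⟩ := YMH.exists_fixed h.quad h.cub h.exps hT hm hA hs (h.ctl_base hP hXP hT)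
    (h.ctl_heatP_data hX hθ hXθ hT)
  exact ⟨U, hU.mono le_rfl hA, hU.toCtl⟩

end

end YMH

/-! ### The main theorem. -/

open YMH in
theorem proposition2p6
    {F : Type*} [NormedAddCommGroup F] [InnerProductSpace ℝ F] [FiniteDimensional ℝ F]
    {G : Type*} [Group G] [TopologicalSpace G] [ChartedSpace F G] [LieGroup 𝓘(ℝ, F) ∞ G]
    [CompactSpace G]
    (hAd : ∀ (g : G) (x y : F), inner ℝ (YMH.Ad g x) (YMH.Ad g y) = inner ℝ x y)
    {V : Type*} [NormedAddCommGroup V] [InnerProductSpace ℝ V] [FiniteDimensional ℝ V]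
    (ρ : G →* (V ≃ₗᵢ[ℝ] V)) (hρ : ∀ v : V, ContMDiff 𝓘(ℝ, F) 𝓘(ℝ, V) ∞ fun g : G => ρ g v)
    (η β δ : ℝ) (hparam : YMH.Admissible η β δ) :
    ∃ (c q C : ℝ), 0 < c ∧ 0 < C ∧ ∀ T : ℝ, 0 < T →
      ∃ Rem : YMH.Dist (YMH.Fields F V) → Set.Icc (0 : ℝ) T → YMH.Dist (YMH.Fields F V),
        (∀ X ∈ YMH.initSpace η β δ, T < c * ((YMH.theta η β δ X 0).toReal + 1) ^ q →
          YMH.IsRemainder ρ (YMH.betaHat β δ) X (Rem X) ∧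
          (∀ R : Set.Icc (0 : ℝ) T → YMH.Dist (YMH.Fields F V),
            YMH.IsRemainder ρ (YMH.betaHat β δ) X R → R = Rem X) ∧
          YMH.bNorm (YMH.betaHat β δ) (Rem X) ≤ ENNReal.ofReal C * (YMH.fancy β δ X 0 + 1)) ∧
        (∀ X₀ ∈ YMH.initSpace η β δ, T < c * ((YMH.theta η β δ X₀ 0).toReal + 1) ^ q →
          ∃ (ε : ℝ≥0∞) (L : ℝ≥0), 0 < ε ∧
            ∀ X ∈ YMH.initSpace η β δ, ∀ Y ∈ YMH.initSpace η β δ,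
              YMH.theta η β δ X X₀ < ε → YMH.theta η β δ Y X₀ < ε →
              YMH.bNorm (YMH.betaHat β δ) (Rem X - Rem Y) ≤ L * YMH.theta η β δ X Y) := by
  obtain ⟨γ, hγ⟩ := exps_of_admissible hparam
  obtain ⟨Q, N, q, K, hQ, hN, hflow⟩ := exists_semilinear_form (F := F) ρ hρ
  obtain ⟨κ, hκ, hκQ⟩ := exists_HB_heatQ (δ := δ) hQ hparam.beta_mem.2
  have h : Setup Q N q K η β δ (betaHat β δ) γ κ := ⟨hQ, hN, hγ, hparam.beta_mem.1,
    hparam.beta_mem.2, hparam.delta_mem.1.le, hparam.delta_mem.2, rfl, hκ, hκQ⟩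
  have : CompleteSpace (Fields F V) := FiniteDimensional.complete ℝ _
  have hbase := mul_nonneg (baseConst_nonneg β δ) hκ
  have hD := dataConst_nonneg (η := η) (β := β) (δ := δ) hκ
  have hD1 : 1 ≤ dataConst η β δ κ := by
    have := heatPConst_nonneg η
    unfold dataConst
    linarith
  have hk : 0 ≤ duhConst γ * (6 * q + 32 * K) :=
    mul_nonneg (duhConst_nonneg γ) (by linarith [hQ.nonneg, hN.nonneg])
  obtain ⟨c, p, hc, hp, hsmall⟩ := exists_time_threshold hγ.lt_one hk hD
  have hm1 : ∀ θ : ℝ, 0 ≤ θ → 1 ≤ dataConst η β δ κ * (1 + θ) := fun θ hθ => by nlinarith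
  have hθle : ∀ X ∈ initSpace (W := Fields F V) η β δ,
      theta η β δ X 0 ≤ ENNReal.ofReal (theta η β δ X 0).toReal := fun X hX => by
    rw [ENNReal.ofReal_toReal (theta_lt_top hγ.eta_le h.beta_le h.delta_nonneg hX).ne]
  have hfin : ∀ X ∈ initSpace (W := Fields F V) η β δ, fancy β δ X 0 ≠ ⊤ := fun X hX =>
    ((fancy_le_of_theta_le le_rfl).trans_lt
      (theta_lt_top hγ.eta_le h.beta_le h.delta_nonneg hX)).ne
  have hPle : ∀ X ∈ initSpace (W := Fields F V) η β δ,
      fancy β δ X 0 ≤ ENNReal.ofReal (fancy β δ X 0).toReal := fun X hX => by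
    rw [ENNReal.ofReal_toReal (hfin X hX)]
  refine ⟨c, p, 4 * (baseConst β δ * κ + 1), hc, by positivity, fun T hT => ?_⟩
  have hs : ∀ θ : ℝ, 0 ≤ θ → T < c * (θ + 1) ^ p → 2 * T ≤ 1 ∧ duhConst γ * ((6 * q + 32 * K) *
      (dataConst η β δ κ * (1 + θ)) ^ 3) * (2 * T) ^ (1 - γ) ≤ 1 / 2 := fun θ hθ hlt => by
    rw [← mul_assoc (duhConst γ)]
    exact hsmall T θ hT hθ hlt
  have hTT : T < 2 * T := by linarith
  -- One fixed point is selected for each initial condition, with an arbitrary value where the time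
  -- condition fails, so that the solution map is a function.
  have key : ∀ X : YMH.Dist (Fields F V), ∃ U, X ∈ initSpace η β δ →
      T < c * ((theta η β δ X 0).toReal + 1) ^ p →
      Fixed Q N (2 * T) (betaHat β δ) (dataConst η β δ κ * (1 + (theta η β δ X 0).toReal))
        (duhP (heatQ Q X)) (heatP X) U ∧
      Ctl (2 * T) (betaHat β δ) (baseConst β δ * (κ * (fancy β δ X 0).toReal) + 1) U := by
    intro X
    by_cases hX : X ∈ initSpace η β δ ∧ T < c * ((theta η β δ X 0).toReal + 1) ^ p
    · obtain ⟨hX, hXT⟩ := hX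
      obtain ⟨h1, h2⟩ := hs _ ENNReal.toReal_nonneg hXT
      obtain ⟨U, hU⟩ := h.exists_fixed (approx_of_mem hX) ENNReal.toReal_nonneg (hθle X hX)
        ENNReal.toReal_nonneg (ENNReal.toReal_mono
          (theta_lt_top hγ.eta_le h.beta_le h.delta_nonneg hX).ne (fancy_le_of_theta_le le_rfl))
        (hPle X hX) h1 h2
      exact ⟨U, fun _ _ => hU⟩
    · exact ⟨0, fun h1 h2 => absurd ⟨h1, h2⟩ hX⟩
  choose U hU using key
  refine ⟨fun X => remOf T (U X), fun X hX hXT => ?_, fun X₀ hX₀ hXT₀ => ?_⟩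
  · obtain ⟨h1, h2⟩ := hs _ ENNReal.toReal_nonneg hXT
    obtain ⟨hU1, hU2⟩ := hU X hX hXT
    have hZ := h.ctl_heatP_data (approx_of_mem hX) ENNReal.toReal_nonneg (hθle X hX) h1
    have hm := hm1 _ (ENNReal.toReal_nonneg (a := theta η β δ X 0))
    refine ⟨h.isRemainder hflow hX ENNReal.toReal_nonneg (hPle X hX) hT hTT h1 hm hZ h2 hU1 hU2,
      fun R hR => h.eq_remOf hflow ENNReal.toReal_nonneg (hPle X hX) hT hTT h1 hm hZ hU1 hR, ?_⟩
    refine (h.bNorm_remOf_le ENNReal.toReal_nonneg (hPle X hX) h1 hm hZ h2 hU1 hU2 hTT.le).2.trans ?_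
    set P := (fancy β δ X 0).toReal with hP
    have hP0 : 0 ≤ P := ENNReal.toReal_nonneg
    rw [← ENNReal.ofReal_toReal (hfin X hX), ← hP, ← ENNReal.ofReal_one,
      ← ENNReal.ofReal_add hP0 zero_le_one, ← ENNReal.ofReal_mul (by positivity)]
    refine ENNReal.ofReal_le_ofReal ?_
    nlinarith
  · set θ₀ := (theta η β δ X₀ 0).toReal with hθ₀
    have hθ₀0 : 0 ≤ θ₀ := ENNReal.toReal_nonneg
    -- The time condition is open: it persists when Θ(X₀) is increased by some `e`. Since the
    -- threshold decreases in Θ, it then holds on the whole ball of radius `e`, with the common size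
    -- θ₀ + e.
    obtain ⟨e, he, he0⟩ : ∃ e : ℝ, T < c * (θ₀ + e + 1) ^ p ∧ 0 < e := by
      have h1 : ContinuousAt (fun e : ℝ => c * (θ₀ + e + 1) ^ p) 0 := by
        refine continuousAt_const.mul (ContinuousAt.rpow_const (by fun_prop) (Or.inl ?_))
        linarith
      have h2 : ∀ᶠ e in 𝓝 (0 : ℝ), T < c * (θ₀ + e + 1) ^ p :=
        h1.eventually_const_lt (by simpa using hXT₀)
      exact ((h2.filter_mono (nhdsWithin_le_nhds (s := Set.Ioi 0))).and self_mem_nhdsWithin).exists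
    have hθe : 0 ≤ θ₀ + e := by linarith
    obtain ⟨h1, h2⟩ := hs _ hθe he
    have hm := hm1 _ hθe
    have near : ∀ X ∈ initSpace (W := Fields F V) η β δ, theta η β δ X X₀ < ENNReal.ofReal e →
        theta η β δ X 0 ≤ ENNReal.ofReal (θ₀ + e) ∧ Fixed Q N (2 * T) (betaHat β δ)
          (dataConst η β δ κ * (1 + (θ₀ + e))) (duhP (heatQ Q X)) (heatP X) (U X) := by
      intro X hX hXe
      have h3 : theta η β δ X 0 ≤ ENNReal.ofReal (θ₀ + e) := by
        rw [add_comm, ENNReal.ofReal_add he0.le hθ₀0]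
        exact (theta_triangle hγ.eta_le h.beta_le X X₀ 0).trans
          (add_le_add hXe.le (hθle X₀ hX₀))
      have h4 : (theta η β δ X 0).toReal ≤ θ₀ + e := ENNReal.toReal_le_of_le_ofReal hθe h3
      have h5 : T < c * ((theta η β δ X 0).toReal + 1) ^ p := by
        refine he.trans_le (mul_le_mul_of_nonneg_left (Real.rpow_le_rpow_of_nonpos ?_
          (by linarith) hp) hc.le)
        have := ENNReal.toReal_nonneg (a := theta η β δ X 0)
        linarith
      exact ⟨h3, (hU X hX h5).1.mono le_rfl (mul_le_mul_of_nonneg_left (by linarith) hD)⟩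
    refine ⟨ENNReal.ofReal e, (12 * dataConst η β δ κ).toNNReal, ENNReal.ofReal_pos.2 he0,
      fun X hX Y hY hXe hYe => ?_⟩
    obtain ⟨hXθ, hXU⟩ := near X hX hXe
    obtain ⟨hYθ, hYU⟩ := near Y hY hYe
    have hXY : theta η β δ X Y ≠ ⊤ := by
      refine ((theta_triangle hγ.eta_le h.beta_le X X₀ Y).trans_lt
        (ENNReal.add_lt_top.2 ⟨hXe.trans ENNReal.ofReal_lt_top, ?_⟩)).ne
      rw [theta_comm hγ.eta_le h.beta_le]
      exact hYe.trans ENNReal.ofReal_lt_top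
    set d := (theta η β δ X Y).toReal with hd
    have hd0 : 0 ≤ d := ENNReal.toReal_nonneg
    have hXYd : theta η β δ X Y = ENNReal.ofReal d := (ENNReal.ofReal_toReal hXY).symm
    have hp0 := heatPConst_nonneg η
    have hdiff : ∀ t ∈ Set.Ioc 0 (2 * T), ∀ x,
        WB η t (dataConst η β δ κ * d) (heatP X t x - heatP Y t x) := fun t ht x => by
      rw [← heatP_sub X Y ht.1]
      -- The heat flow is linear, so the difference is the heat flow of X - Y, which is again a
      -- limit of smooth functions in C^η.
      refine (wb_heatP hγ.eta_le (Approx.sub hγ.eta_le (approx_of_mem hX) (approx_of_mem hY)) hd0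
        (le_self_add.trans hXYd.le) ⟨ht.1, ht.2.trans h1⟩ x).mono ht.1
        (mul_le_mul_of_nonneg_right ?_ hd0)
      unfold dataConst
      linarith
    have hdP : baseConst β δ * (κ * d) ≤ dataConst η β δ κ * d := by
      rw [← mul_assoc]
      refine mul_le_mul_of_nonneg_right ?_ hd0
      unfold dataConst
      linarith
    have hZX := h.ctl_heatP_data (approx_of_mem hX) hθe hXθ h1
    have hZY := h.ctl_heatP_data (approx_of_mem hY) hθe hYθ h1
    have hdd := mul_nonneg hD hd0
    have hlip := h.bNorm_remOf_sub_le hθe hd0 (fancy_le_of_theta_le hXθ) (fancy_le_of_theta_le hYθ)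
      (fancy_le_of_theta_le hXYd.le) h1 hm hZX hZY hdiff hdd hdP h2 hXU hYU hTT.le
    rw [← mul_assoc, ENNReal.ofReal_mul (mul_nonneg (by norm_num) hD), ← hXYd] at hlip
    exact hlip
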